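/- **Discrete adjoint and discretely exact gradients for the coupled elastic-acoustic wave equation.** *Setting.* A bounded domain $\Omega\subset\mathbb R^3$ with boundary $\Gamma$ is divided into finitely many open elements $\Omega^e$; on a face, superscripts $-$ and $+$ denote values from the element under consideration and from its neighbour, $n^-$ is the outward unit normal and $n^+=-n^-$. For tensors $[\![S]\!]=S^-n^-+S^+n^+$, for vectors $[\![v]\!]=v^-\cdot n^-+v^+\cdot n^+$ and $[v]=v^--v^+$; $\{\!\{\cdot\}\!\}$ is the mean and $A:B=\sum_{ij}A_{ij}B_{ij}$. Integrals over elements and faces are exact or replaced by quadrature (finite nonnegative measures on closed elements and on faces, the same on both sides of a face; integration by parts in space is never assumed exact); time integrals are exact. $P^h$ (symmetric tensors) and $Q^h$ (vectors) are element-wise finite-dimensional spaces whose components lie in given local spaces of $C^1$ functions, on which the element quadrature is definite (nonsingular mass matrices). The density $\rho>0$ and the wave speeds $c_p>0$, $c_s\ge 0$ are $C^1$ on each closed element and may be discontinuous across elements; $\mu=\rho c_s^2$, $\lambda=\rho(c_p^2-2c_s^2)$, $\mathsf C E=\lambda\,\mathrm{tr}(E)I+2\mu E$. Each element is acoustic ($c_s\equiv0$)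 or elastic ($c_s>0$ and $3\lambda+2\mu>0$). Put $k_0=1/(\rho^-c_p^-+\rho^+c_p^+)$, and $k_1=1/(\rho^-c_s^-+\rho^+c_s^+)$ if $\mu^-\ne0$, $k_1=0$ if $\mu^-=0$. *State equation.* Find $C^1$ curves $(E_h,v_h):[0,T]\to P^h\times Q^h$ with given initial values in $P^h\times Q^h$ such that for all $t\in(0,T)$ and all $(H,w)\in P^h\times Q^h$ $$\int_\Omega E_{h,t}:\mathsf CH+\rho v_{h,t}\cdot w-\mathrm{sym}(\nabla v_h):\mathsf CH-(\nabla\cdot(\mathsf CE_h)+f)\cdot w\,dx=\sum_e\int_{\partial\Omega^e}\mathrm{sym}(n^-\otimes(v_h^\dagger-v_h^-)):\mathsf CH^-+\big(((\mathsf CE_h)^\dagger-(\mathsf CE_h)^-)n^-\big)\cdot w^-\,dx ,$$ where, with $a=n^-\cdot[\![\mathsf CE_h]\!]+\rho^+c_p^+[\![v_h]\!]$, $$\mathrm{sym}(n^-\otimes(v_h^\dagger-v_h^-))=-k_0a\,n^-\otimes n^-+k_1\mathrm{sym}\big(n^-\otimes(n^-\times(n^-\times([\![\mathsf CE_h]\!]+\rho^+c_s^+[v_h])))\big),$$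 $$((\mathsf CE_h)^\dagger-(\mathsf CE_h)^-)n^-=-k_0a\rho^-c_p^-n^-+k_1\rho^-c_s^-\,n^-\times(n^-\times([\![\mathsf CE_h]\!]+\rho^+c_s^+[v_h])).$$ On $\Gamma$: material parameters are extended continuously, $v_h^+=v_h^-$, and $\mathsf C^+E_h^+n^+$ equals $-2t^{bc}+\mathsf C^-E_h^-n^-$ if $\mu^-\neq0$, and $-2(n^-\cdot(t^{bc}-\mathsf C^-E_h^-n^-))n^--\mathsf C^-E_h^-n^-$ if $\mu^-=0$. The force $f$ and traction $t^{bc}$ are continuous in time and space (element-wise, face-wise) and do not depend on the wave speeds. *Cost.* $\mathcal J(c_p,c_s)=\int_0^T\!\int_\Omega j_\Omega(v_h)\,dx\,dt+\int_\Omega r_p(c_p)\,dx+\int_\Omega r_s(c_s)\,dx$ with $C^1$ functions $j_\Omega,r_p,r_s$, where in the first term $dx$ may be replaced by any finite measure on the closed elements (e.g. point masses at receivers). *Claims.* 1. The state equation has a solution, and $v_h$ and $\mathsf CE_h$ are unique, so $\mathcal J$ is well defined. 2. (Adjoint.) Let $E_h,v_h,H_h,w_h$ be $C^1$ curves in the discrete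 spaces. The Lagrangian (cost plus time integral of the residual of the state equation tested with $(H_h,w_h)$) has vanishing variations with respect to $(E_h,v_h)$ in all directions that vanish at $t=0$ if and only if $w_h(T)=0$, $\mathsf CH_h(T)=0$ and for all $t\in(0,T)$ and all $(\tilde E,\tilde v)\in P^h\times Q^h$ $$\int_\Omega-H_{h,t}:\mathsf C\tilde E-\rho w_{h,t}\cdot\tilde v-\mathsf CH_h:\mathrm{sym}(\nabla\tilde v)-w_h\cdot\nabla\cdot(\mathsf C\tilde E)\,dx=-\sum_e\int_{\partial\Omega^e}\mathrm{sym}(n^-\otimes w_h^\dagger):\mathsf C\tilde E^-+((\mathsf CH_h)^\dagger n^-)\cdot\tilde v^-\,dx-\int_\Omega j_\Omega'(v_h)\cdot\tilde v\,dx$$ with the adjoint fluxes $$\mathrm{sym}(n^-\otimes w_h^\dagger)=k_0\big(n^-\cdot[\![\mathsf CH_h]\!]+n^-\cdot2\{\!\{\rho c_pw_h\}\!\}\big)n^-\otimes n^--k_1\mathrm{sym}\big(n^-\otimes(n^-\times(n^-\times([\![\mathsf CH_h]\!]+2\{\!\{\rho c_sw_h\}\!\})))\big),$$ $$(\mathsf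 CH_h)^\dagger n^-=k_0\big(n^-\cdot(\rho^+c_p^+\mathsf C^-H_h^-+\rho^-c_p^-\mathsf C^+H_h^+)n^-+\rho^-c_p^-\rho^+c_p^+[\![w_h]\!]\big)n^--k_1n^-\times\big(n^-\times((\rho^+c_s^+\mathsf C^-H_h^-+\rho^-c_s^-\mathsf C^+H_h^+)n^-+\rho^-c_s^-\rho^+c_s^+[w_h])\big),$$ where on $\Gamma$ $w_h^+=w_h^-$ and $\mathsf C^+H_h^+n^+$ equals $\mathsf C^-H_h^-n^-$ if $\mu^-\ne0$, and $-\mathsf C^-H_h^-n^-+2(n^-\cdot(\mathsf C^-H_h^-n^-))n^-$ if $\mu^-=0$. For every $C^1$ curve $v_h$ this scheme with final values $w_h(T)=0$, $H_h(T)=0$ has a solution, and $w_h$ and $\mathsf CH_h$ are unique. Moreover $$((\mathsf CH_h)^\dagger-(\mathsf CH_h)^-)n^-=k_0(-n^-\cdot[\![\mathsf CH_h]\!]+\rho^+c_p^+[\![w_h]\!])\rho^-c_p^-n^-+k_1\rho^-c_s^-\,n^-\times(n^-\times([\![\mathsf CH_h]\!]-\rho^+c_s^+[w_h])),$$ $$\mathrm{sym}(n^-\otimes(w_h^\dagger-w_h^-))=k_0(n^-\cdot[\![\mathsf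 CH_h]\!]-\rho^+c_p^+[\![w_h]\!])n^-\otimes n^--k_1\mathrm{sym}\big(n^-\otimes(n^-\times(n^-\times([\![\mathsf CH_h]\!]-\rho^+c_s^+[w_h])))\big),$$ the last identity where $\mu^-\ne0$, and where $\mu^-=0$ after contraction with $\mathsf C^-A$ for symmetric $A$. 3. (Gradients.) Let $(E_h,v_h)$ solve the state equation and $(H_h,w_h)$ the adjoint scheme. Consider perturbations $\tilde c_p$ (resp. $\tilde c_s$) from the span of finitely many element-wise $C^1$ functions such that, for every $t\in(0,T)$ and each of these functions, $2\rho c_p\tilde c_p\,\mathrm{tr}(H_h)I$ (resp. $4\rho c_s\tilde c_s(H_h-\mathrm{tr}(H_h)I)$) coincides at the integration points of elements and faces with $\mathsf CK$ for some $K\in P^h$ (so that the state equation can be used to simplify the gradient); the functions $\tilde c_s$ vanish where $c_s=0$. Then $\mathcal J$ is Fréchet differentiable on this space of perturbations of $c_p$ (resp. $c_s$) at $0$, with $$\mathcal J_{c_p}(\tilde c_p)=\int_\Omega r_p'(c_p)\tilde c_p\,dx+\int_0^T\!\!\int_\Omega G_p\tilde c_p\,dx\,dt+\sum_e\int_0^T\!\!\int_{\partial\Omega^e}g_p\tilde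 c_p^-\,dx\,dt,$$ $$\mathcal J_{c_s}(\tilde c_s)=\int_\Omega r_s'(c_s)\tilde c_s\,dx+\int_0^T\!\!\int_\Omega G_s\tilde c_s\,dx\,dt+\sum_e\int_0^T\!\!\int_{\partial\Omega^e}g_s\tilde c_s^-\,dx\,dt,$$ where $G_p\tilde c_p=-2\nabla(\rho c_p\tilde c_p\mathrm{tr}(E_h))\cdot w_h$, $\;G_s\tilde c_s=-4\,\nabla\cdot\big(\rho c_s\tilde c_s(E_h-\mathrm{tr}(E_h)I)\big)\cdot w_h$, $$\begin{aligned}g_p={}&-k_0^2\rho^-\,n^-\cdot[\![\mathsf CE_h]\!]\;n^-\cdot[\![\mathsf CH_h]\!]+k_0^2\rho^-(\rho^+c_p^+)^2[\![v_h]\!][\![w_h]\!]+k_0^2\rho^-\rho^+c_p^+\big(n^-\cdot[\![\mathsf CE_h]\!][\![w_h]\!]-[\![v_h]\!]\,n^-\cdot[\![\mathsf CH_h]\!]\big)\\&+2k_0\rho^-c_p^-\mathrm{tr}(E_h^-)\big(n^-\cdot[\![\mathsf CH_h]\!]-\rho^+c_p^+[\![w_h]\!]\big)+2\rho^-c_p^-\mathrm{tr}(E_h^-)\,w_h^-\cdot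 n^-,\end{aligned}$$ and, with $\tau a:=n^-\times(n^-\times a)$ and $z:=[\![\mathsf CH_h]\!]-\rho^+c_s^+[w_h]$, $$\begin{aligned}g_s={}&-k_1^2\rho^-\,\tau[\![\mathsf CE_h]\!]\cdot\tau z-k_1^2\rho^-\rho^+c_s^+\,\tau[v_h]\cdot\tau z+4k_0\rho^-c_s^-\big(n^-\cdot E_h^-n^--\mathrm{tr}(E_h^-)\big)\,n^-\cdot\big([\![\mathsf CH_h]\!]-\rho^+c_p^+[w_h]\big)\\&+4k_1\rho^-c_s^-\,\tau(E_h^-n^-)\cdot\tau z+4\rho^-c_s^-\big((E_h^--\mathrm{tr}(E_h^-)I)n^-\big)\cdot w_h^-.\end{aligned}$$ 4. (Continuous parameters, acoustic medium.) In the situation of 3, let $c_s\equiv0$ and let $\rho$ and $c_p=:c$ be continuous across interior faces. With $e=\mathrm{tr}E_h$ and $h=\mathrm{tr}H_h$, the two contributions $g_p$ from the two sides of every interior face add up to the acoustic face term $$g=\tfrac12\rho c^2[e][h]+\tfrac12\rho[\![v_h]\!][\![w_h]\!]+2\rho c[\![e]\!]\cdot\{\!\{w_h\}\!\},\qquad [e]=e^--e^+,\quad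 [\![e]\!]=e^-n^-+e^+n^+,$$ so that, for every element-wise $C^1$ direction $\tilde c$ continuous across interior faces, the $c_p$-gradient expression of 3 equals $\int_\Omega r_p'(c)\tilde c\,dx-2\int_0^T\!\int_\Omega\nabla(\rho c\tilde ce)\cdot w_h\,dx\,dt+\sum_{\mathsf f}\int_0^T\!\int_{\mathsf f}g\tilde c\,dx\,dt+\int_0^T\!\int_\Gamma g_p\tilde c\,dx\,dt$, the sum being over interior faces. -/

import Mathlib

open MeasureTheory Set Filter Topology Matrix
open scoped ContDiff

namespace DGAE

noncomputable section

universe u₁ u₂ u₃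

/-! ### Vectors, tensors and differential operators in three space dimensions -/

/-- Points and vectors of three-dimensional space. -/
abbrev V3 := Fin 3 → ℝ

/-- Second-order tensors. -/
abbrev M3 := Matrix (Fin 3) (Fin 3) ℝ

/-- The gradient of a scalar function. -/
def grad (u : V3 → ℝ) (x : V3) : V3 := fun i => fderiv ℝ u x (Pi.single i 1)

/-- The gradient `(∇v) i j = ∂ v i / ∂ x j` of a vector function. -/
def gradVec (v : V3 → V3) (x : V3) : M3 :=
  Matrix.of fun i j => fderiv ℝ (fun y => v y i) x (Pi.single j 1)

/-- The row-wise divergence of a tensor function. -/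
def divTensor (S : V3 → M3) (x : V3) : V3 :=
  fun i => ∑ j, fderiv ℝ (fun y => S y i j) x (Pi.single j 1)

/-- The symmetric part of a tensor. -/
def symPart (A : M3) : M3 := (1 / 2 : ℝ) • (A + Aᵀ)

/-- The double contraction `A : B`. -/
def ddot (A B : M3) : ℝ := ∑ i, ∑ j, A i j * B i j

/-- The double vector product `n × (n × a)`. -/
def dcross (n a : V3) : V3 := n ⨯₃ (n ⨯₃ a)

/-- `n` is the outward unit normal of the open set `K` at `x`: near `x` the set `K` is the
sublevel set `φ < 0` of a continuously differentiable function with `φ x = 0`, `∇φ x = n`. -/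
def IsOutwardUnitNormal (K : Set V3) (x n : V3) : Prop :=
  n ⬝ᵥ n = 1 ∧ ∃ φ : V3 → ℝ, ContDiffAt ℝ 1 φ x ∧ φ x = 0 ∧ grad φ x = n ∧
    ∀ᶠ y in 𝓝 x, (y ∈ K ↔ φ y < 0)

/-! ### Meshes -/

/-- A mesh of a bounded domain. `El` indexes the elements, `IF` the faces shared by two elements,
`BF` the faces on the boundary of the domain. The normal of an interior face points from
the element `left` to the element `right`; at edges and corners it is the continuous
extension of the normal from the smooth part of the face. -/
structure Mesh (El : Type u₁) (IF : Type u₂) (BF : Type u₃) where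
  dom : Set V3
  dom_open : IsOpen dom
  dom_bounded : Bornology.IsBounded dom
  cell : El → Set V3
  cell_open : ∀ e, IsOpen (cell e)
  cell_nonempty : ∀ e, (cell e).Nonempty
  cell_subset : ∀ e, cell e ⊆ dom
  cell_disjoint : Pairwise fun e e' => Disjoint (cell e) (cell e')
  cell_cover : closure dom = ⋃ e, closure (cell e)
  left : IF → El
  right : IF → El
  left_ne_right : ∀ f, left f ≠ right f
  own : BF → El
  face : IF ⊕ BF → Set V3
  face_closed : ∀ f, IsClosed (face f)
  face_overlap : Pairwise fun f f' => Measure.hausdorffMeasure 2 (face f ∩ face f') = 0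
  frontier_cell : ∀ e, frontier (cell e) =
    (⋃ f ∈ {f | left f = e ∨ right f = e}, face (Sum.inl f)) ∪
      ⋃ b ∈ {b | own b = e}, face (Sum.inr b)
  frontier_dom : frontier dom = ⋃ b, face (Sum.inr b)
  normal : IF ⊕ BF → V3 → V3
  normal_cont : ∀ f, ContinuousOn (normal f) (face f)
  normal_unit : ∀ f, ∀ x ∈ face f, normal f x ⬝ᵥ normal f x = 1
  normal_interior : ∀ f, face (Sum.inl f) ⊆ closure {x ∈ face (Sum.inl f) |
    IsOutwardUnitNormal (cell (left f)) x (normal (Sum.inl f) x) ∧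
    IsOutwardUnitNormal (cell (right f)) x (-normal (Sum.inl f) x)}
  normal_boundary : ∀ b, face (Sum.inr b) ⊆ closure {x ∈ face (Sum.inr b) |
    IsOutwardUnitNormal (cell (own b)) x (normal (Sum.inr b) x)}

/-- The sides of the faces: an interior face `f` has the side `(f, true)`, which is part of the
boundary of `left f`, and the side `(f, false)`, which is part of the boundary of `right f`;
a boundary face has one side. Thus the sum over all sides is the sum over all
elements `e` of the parts of the boundary of `e`. -/
abbrev Side (IF : Type u₂) (BF : Type u₃) := (IF × Bool) ⊕ BF

section

variable {El : Type u₁} {IF : Type u₂} {BF : Type u₃}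

namespace Mesh

/-- The face to which a side belongs. -/
def faceOf : Side IF BF → IF ⊕ BF
  | Sum.inl (f, _) => Sum.inl f
  | Sum.inr b => Sum.inr b

/-- The element whose boundary contains the side (superscript minus). -/
def inner (M : Mesh El IF BF) : Side IF BF → El
  | Sum.inl (f, true) => M.left f
  | Sum.inl (f, false) => M.right f
  | Sum.inr b => M.own b

/-- The element that supplies the exterior values (superscript plus) of the material parameters
and of the velocities: the adjacent element, and on the boundary of the domain, where these are
extended continuously, the element itself. -/
def outer (M : Mesh El IF BF) : Side IF BF → El
  | Sum.inl (f, true) => M.right f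
  | Sum.inl (f, false) => M.left f
  | Sum.inr b => M.own b

/-- The unit normal that points out of the element `inner s`. -/
def outNormal (M : Mesh El IF BF) : Side IF BF → V3 → V3
  | Sum.inl (f, true) => M.normal (Sum.inl f)
  | Sum.inl (f, false) => fun x => -M.normal (Sum.inl f) x
  | Sum.inr b => M.normal (Sum.inr b)

end Mesh

/-- A discontinuous Galerkin discretization in space: a mesh, integration rules on elements and
faces, and finite-dimensional spaces of scalar functions on the elements (`VP` for the components
of the strain, `VQ` for those of the velocity). The integration rules are finite measures
on the closed elements and on the faces: Lebesgue and surface measure for exact integration, sums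
of point masses for numerical quadrature. They have to be definite on the local spaces, that is,
mass matrices are nonsingular. A function on an element is given on the whole space, but only
its values near the closed element matter. -/
structure Discretization (El : Type u₁) (IF : Type u₂) (BF : Type u₃) extends Mesh El IF BF where
  vol : El → Measure V3
  vol_finite : ∀ e, IsFiniteMeasure (vol e)
  vol_supp : ∀ e, vol e (closure (cell e))ᶜ = 0
  surf : IF ⊕ BF → Measure V3
  surf_finite : ∀ f, IsFiniteMeasure (surf f)
  surf_supp : ∀ f, surf f (face f)ᶜ = 0
  VP : El → Submodule ℝ (V3 → ℝ)
  VQ : El → Submodule ℝ (V3 → ℝ)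
  VP_finite : ∀ e, FiniteDimensional ℝ (VP e)
  VQ_finite : ∀ e, FiniteDimensional ℝ (VQ e)
  VP_smooth : ∀ e, ∀ u ∈ VP e, ∀ x ∈ closure (cell e), ContDiffAt ℝ 1 u x
  VQ_smooth : ∀ e, ∀ u ∈ VQ e, ∀ x ∈ closure (cell e), ContDiffAt ℝ 1 u x
  VP_definite : ∀ e, ∀ u ∈ VP e, (∀ᵐ x ∂vol e, u x = 0) → ∀ x ∈ closure (cell e), u x = 0
  VQ_definite : ∀ e, ∀ u ∈ VQ e, (∀ᵐ x ∂vol e, u x = 0) → ∀ x ∈ closure (cell e), u x = 0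

/-- Element-wise scalar, vector and tensor fields; the traces from the two sides of a
face are unrelated. -/
abbrev SField (El : Type u₁) := El → V3 → ℝ
abbrev VField (El : Type u₁) := El → V3 → V3
abbrev TField (El : Type u₁) := El → V3 → M3

namespace Discretization

/-- The space of the discrete strains: symmetric tensors with components in `VP`. -/
def Ph (D : Discretization El IF BF) : Submodule ℝ (TField El) where
  carrier := {A | ∀ e, (∀ i j, (fun x => A e x i j) ∈ D.VP e) ∧ ∀ x, (A e x).IsSymm}
  add_mem' := by
    intro A B hA hB e
    refine ⟨fun i j => ?_, fun x => ?_⟩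
    · exact (D.VP e).add_mem ((hA e).1 i j) ((hB e).1 i j)
    · exact ((hA e).2 x).add ((hB e).2 x)
  zero_mem' := by
    intro e
    refine ⟨fun i j => (D.VP e).zero_mem, fun x => ?_⟩
    exact Matrix.isSymm_zero
  smul_mem' := by
    intro c A hA e
    refine ⟨fun i j => ?_, fun x => ?_⟩
    · exact (D.VP e).smul_mem c ((hA e).1 i j)
    · exact ((hA e).2 x).smul c

/-- The space of the discrete velocities: vectors with components in `VQ`. -/
def Qh (D : Discretization El IF BF) : Submodule ℝ (VField El) where
  carrier := {v | ∀ e, ∀ i, (fun x => v e x i) ∈ D.VQ e}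
  add_mem' := by
    intro v w hv hw e i
    exact (D.VQ e).add_mem (hv e i) (hw e i)
  zero_mem' := by
    intro e i
    exact (D.VQ e).zero_mem
  smul_mem' := by
    intro c v hv e i
    exact (D.VQ e).smul_mem c (hv e i)

/-- The integration rule on the face of a side. -/
def surfOf (D : Discretization El IF BF) (s : Side IF BF) : Measure V3 :=
  D.surf (Mesh.faceOf s)

/-- The sum of the integrals over all elements. -/
def intVol [Fintype El] (D : Discretization El IF BF) (u : SField El) : ℝ :=
  ∑ e, ∫ x, u e x ∂D.vol e

/-- The sum over all elements of the integrals over their boundaries. -/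
def intSides [Fintype IF] [Fintype BF] (D : Discretization El IF BF)
    (u : Side IF BF → V3 → ℝ) : ℝ :=
  ∑ s, ∫ x, u s x ∂D.surfOf s

end Discretization

/-- `u` is on `[0, T]` a continuously differentiable curve in a finite-dimensional subspace
of `S`. -/
def IsC1Curve {F : Type*} [AddCommGroup F] [Module ℝ F] (T : ℝ) (S : Submodule ℝ F)
    (u : ℝ → F) : Prop :=
  ∃ (N : ℕ) (φ : Fin N → F) (a : Fin N → ℝ → ℝ), (∀ k, φ k ∈ S) ∧
    (∀ k, ContDiffOn ℝ 1 (a k) (Icc 0 T)) ∧ ∀ t ∈ Icc 0 T, u t = ∑ k, a k t • φ k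

/-- Time derivatives of tensor and vector fields. -/
def dtT (A : ℝ → TField El) (t : ℝ) : TField El :=
  fun e x => Matrix.of fun i j => deriv (fun s => A s e x i j) t

def dtV (v : ℝ → VField El) (t : ℝ) : VField El :=
  fun e x i => deriv (fun s => v s e x i) t

/-! ### The medium -/

/-- Mass density, primary and secondary wave speed. -/
structure Medium (El : Type u₁) where
  ρ : SField El
  cp : SField El
  cs : SField El

namespace Medium

/-- The Lamé parameters, so that `cp = √((lam + 2 mu) / ρ)` and `cs = √(mu / ρ)`. -/
def lam (m : Medium El) : SField El := fun e x => m.ρ e x * (m.cp e x ^ 2 - 2 * m.cs e x ^ 2)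

def mu (m : Medium El) : SField El := fun e x => m.ρ e x * m.cs e x ^ 2

/-- The constitutive tensor: `C A = lam tr(A) I + 2 mu A`. -/
def C (m : Medium El) (e : El) (x : V3) (A : M3) : M3 :=
  (m.lam e x * A.trace) • (1 : M3) + (2 * m.mu e x) • A

/-- The derivative of `C A` with respect to `cp` in the direction `c`. -/
def Cp (m : Medium El) (c : SField El) (e : El) (x : V3) (A : M3) : M3 :=
  (2 * m.ρ e x * m.cp e x * c e x * A.trace) • (1 : M3)

/-- The derivative of `C A` with respect to `cs` in the direction `c`. -/
def Cs (m : Medium El) (c : SField El) (e : El) (x : V3) (A : M3) : M3 :=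
  (4 * m.ρ e x * m.cs e x * c e x) • (A - A.trace • (1 : M3))

/-- Parameters perturbed in finitely many directions. -/
def perturbCp (m : Medium El) {N : ℕ} (φ : Fin N → SField El) (θ : Fin N → ℝ) : Medium El :=
  { m with cp := m.cp + ∑ i, θ i • φ i }

def perturbCs (m : Medium El) {N : ℕ} (φ : Fin N → SField El) (θ : Fin N → ℝ) : Medium El :=
  { m with cs := m.cs + ∑ i, θ i • φ i }

end Medium

/-- Continuously differentiable on every closed element, with arbitrary discontinuities across the
element boundaries. -/
def PiecewiseC1 (M : Mesh El IF BF) (c : SField El) : Prop :=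
  ∀ e, ∀ x ∈ closure (M.cell e), ContDiffAt ℝ 1 (c e) x

/-- Admissible media: positive density and primary wave speed; every element is either acoustic
(`cs = 0`) or elastic (`cs > 0`, and the constitutive tensor is positive definite on symmetric
tensors, that is, `3 lam + 2 mu > 0`). -/
structure Admissible (M : Mesh El IF BF) (m : Medium El) : Prop where
  smooth_ρ : PiecewiseC1 M m.ρ
  smooth_cp : PiecewiseC1 M m.cp
  smooth_cs : PiecewiseC1 M m.cs
  ρ_pos : ∀ e, ∀ x ∈ closure (M.cell e), 0 < m.ρ e x
  cp_pos : ∀ e, ∀ x ∈ closure (M.cell e), 0 < m.cp e x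
  acoustic_or_elastic : ∀ e, (∀ x ∈ closure (M.cell e), m.cs e x = 0) ∨
    ∀ x ∈ closure (M.cell e), 0 < m.cs e x ∧ 0 < 3 * m.lam e x + 2 * m.mu e x

/-! ### Numerical fluxes at a point of a face -/

/-- Normal and material parameters at a point of a side of a face; `M` stands for the superscript
minus (interior values), `P` for the superscript plus (exterior values). -/
structure Interface where
  n : V3
  ρM : ℝ
  ρP : ℝ
  cpM : ℝ
  cpP : ℝ
  csM : ℝ
  csP : ℝ

/-- Traces of a stress and a velocity at such a point: the tractions
`tM = S⁻ n⁻` and `tP = S⁺ n⁺`, where `n⁺ = -n⁻`, and the velocities. -/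
structure Trace where
  tM : V3
  tP : V3
  vM : V3
  vP : V3

namespace Trace

/-- The jump `S⁻ n⁻ + S⁺ n⁺` of the stress. -/
def jumpS (q : Trace) : V3 := q.tM + q.tP

/-- The jump `v⁻ · n⁻ + v⁺ · n⁺` of the velocity. -/
def jumpV (q : Trace) (n : V3) : ℝ := q.vM ⬝ᵥ n + q.vP ⬝ᵥ (-n)

/-- The difference `v⁻ - v⁺` of the velocity. -/
def diffV (q : Trace) : V3 := q.vM - q.vP

end Trace

namespace Interface

def k0 (F : Interface) : ℝ := 1 / (F.ρM * F.cpM + F.ρP * F.cpP)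

open Classical in
def k1 (F : Interface) : ℝ :=
  if F.ρM * F.csM ^ 2 ≠ 0 then 1 / (F.ρM * F.csM + F.ρP * F.csP) else 0

/-- The upwind flux difference `sym(n⁻ ⊗ (v† - v⁻))` of the state equation. -/
def fluxV (F : Interface) (q : Trace) : M3 :=
  (-(F.k0 * (F.n ⬝ᵥ q.jumpS + F.ρP * F.cpP * q.jumpV F.n))) • vecMulVec F.n F.n
    + F.k1 • symPart (vecMulVec F.n (dcross F.n q.jumpS))
    + (F.k1 * (F.ρP * F.csP)) • symPart (vecMulVec F.n (dcross F.n q.diffV))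

/-- The upwind flux difference `((C E)† - (C E)⁻) n⁻` of the state equation. -/
def fluxS (F : Interface) (q : Trace) : V3 :=
  (-(F.k0 * (F.n ⬝ᵥ q.jumpS + F.ρP * F.cpP * q.jumpV F.n)) * (F.ρM * F.cpM)) • F.n
    + (F.k1 * (F.ρM * F.csM)) • dcross F.n q.jumpS
    + (F.k1 * (F.ρP * F.csP) * (F.ρM * F.csM)) • dcross F.n q.diffV

/-- The adjoint flux `sym(n⁻ ⊗ w†)`. -/
def adjFluxV (F : Interface) (p : Trace) : M3 :=
  (F.k0 * (F.n ⬝ᵥ p.jumpS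
      + F.n ⬝ᵥ ((F.ρM * F.cpM) • p.vM + (F.ρP * F.cpP) • p.vP))) • vecMulVec F.n F.n
    - F.k1 • symPart (vecMulVec F.n (dcross F.n p.jumpS))
    - F.k1 • symPart (vecMulVec F.n
        (dcross F.n ((F.ρM * F.csM) • p.vM + (F.ρP * F.csP) • p.vP)))

/-- The adjoint flux `(C H)† n⁻`. Note that `C⁺ H⁺ n⁻ = -C⁺ H⁺ n⁺`. -/
def adjFluxS (F : Interface) (p : Trace) : V3 :=
  (F.k0 * (F.n ⬝ᵥ ((F.ρP * F.cpP) • p.tM + (F.ρM * F.cpM) • (-p.tP))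
      + F.ρM * F.cpM * (F.ρP * F.cpP) * p.jumpV F.n)) • F.n
    - F.k1 • dcross F.n ((F.ρP * F.csP) • p.tM + (F.ρM * F.csM) • (-p.tP))
    - (F.k1 * (F.ρM * F.csM) * (F.ρP * F.csP)) • dcross F.n p.diffV

/-- The adjoint flux difference `sym(n⁻ ⊗ (w† - w⁻))` in terms of jumps. -/
def adjFluxDiffV (F : Interface) (p : Trace) : M3 :=
  (F.k0 * (F.n ⬝ᵥ p.jumpS - F.ρP * F.cpP * p.jumpV F.n)) • vecMulVec F.n F.n
    - F.k1 • symPart (vecMulVec F.n (dcross F.n p.jumpS))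
    + (F.k1 * (F.ρP * F.csP)) • symPart (vecMulVec F.n (dcross F.n p.diffV))

/-- The adjoint flux difference `((C H)† - (C H)⁻) n⁻` in terms of jumps. -/
def adjFluxDiffS (F : Interface) (p : Trace) : V3 :=
  (F.k0 * (-(F.n ⬝ᵥ p.jumpS) + F.ρP * F.cpP * p.jumpV F.n) * (F.ρM * F.cpM)) • F.n
    + (F.k1 * (F.ρM * F.csM)) • dcross F.n p.jumpS
    - (F.k1 * (F.ρM * F.csM) * (F.ρP * F.csP)) • dcross F.n p.diffV

/-- The boundary term `g_p`; `q` are the traces of the state, `p` those of the adjoint, `EM` is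
the interior strain. -/
def gp (F : Interface) (q p : Trace) (EM : M3) : ℝ :=
  -(F.k0 ^ 2 * F.ρM * (F.n ⬝ᵥ q.jumpS) * (F.n ⬝ᵥ p.jumpS))
    + F.k0 ^ 2 * F.ρM * (F.ρP * F.cpP) ^ 2 * q.jumpV F.n * p.jumpV F.n
    + F.k0 ^ 2 * F.ρM * F.ρP * F.cpP *
        ((F.n ⬝ᵥ q.jumpS) * p.jumpV F.n - q.jumpV F.n * (F.n ⬝ᵥ p.jumpS))
    + 2 * F.k0 * F.ρM * F.cpM * EM.trace * (F.n ⬝ᵥ p.jumpS - F.ρP * F.cpP * p.jumpV F.n)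
    + 2 * F.ρM * F.cpM * EM.trace * (p.vM ⬝ᵥ F.n)

/-- The boundary term `g_s`. -/
def gs (F : Interface) (q p : Trace) (EM : M3) : ℝ :=
  -(F.k1 ^ 2 * F.ρM *
      (dcross F.n q.jumpS ⬝ᵥ dcross F.n (p.jumpS - (F.ρP * F.csP) • p.diffV)))
    - F.k1 ^ 2 * F.ρM * F.ρP * F.csP *
      (dcross F.n q.diffV ⬝ᵥ dcross F.n (p.jumpS - (F.ρP * F.csP) • p.diffV))
    + 4 * F.k0 * F.ρM * F.csM * (F.n ⬝ᵥ (EM *ᵥ F.n) - EM.trace) *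
      (F.n ⬝ᵥ (p.jumpS - (F.ρP * F.cpP) • p.diffV))
    + 4 * F.k1 * F.ρM * F.csM *
      (dcross F.n (EM *ᵥ F.n) ⬝ᵥ dcross F.n (p.jumpS - (F.ρP * F.csP) • p.diffV))
    + 4 * F.ρM * F.csM * (((EM - EM.trace • (1 : M3)) *ᵥ F.n) ⬝ᵥ p.vM)

end Interface

/-- The face term of the wave-speed gradient of the acoustic wave equation with continuous
parameters `ρ`, `c`: with dilatation `e`, velocity `v` and adjoint variables `h`, `w` it is
`½ ρ c² [e] [h] + ½ ρ ⟦v⟧ ⟦w⟧ + 2 ρ c ⟦e⟧ · {w}`. -/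
def acousticFaceTerm (n : V3) (ρ c eM eP hM hP : ℝ) (vM vP wM wP : V3) : ℝ :=
  1 / 2 * ρ * c ^ 2 * (eM - eP) * (hM - hP)
    + 1 / 2 * ρ * (vM ⬝ᵥ n + vP ⬝ᵥ (-n)) * (wM ⬝ᵥ n + wP ⬝ᵥ (-n))
    + 2 * ρ * c * ((eM • n + eP • (-n)) ⬝ᵥ ((1 / 2 : ℝ) • (wM + wP)))

/-- Normal and material parameters at the point `x` of the side `s`. -/
def Medium.interface (m : Medium El) (M : Mesh El IF BF) (s : Side IF BF) (x : V3) : Interface where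
  n := M.outNormal s x
  ρM := m.ρ (M.inner s) x
  ρP := m.ρ (M.outer s) x
  cpM := m.cp (M.inner s) x
  cpP := m.cp (M.outer s) x
  csM := m.cs (M.inner s) x
  csP := m.cs (M.outer s) x

/-- The traction of the stress `C A` at the side `s`, with the interior value of `C A`. -/
def Medium.traction (m : Medium El) (M : Mesh El IF BF) (A : TField El)
    (s : Side IF BF) (x : V3) : V3 :=
  m.C (M.inner s) x (A (M.inner s) x) *ᵥ M.outNormal s x

open Classical in
/-- The exterior traction `C⁺ E⁺ n⁺` of the state; on the boundary of the domain it imposes the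
traction `τ`. -/
def Medium.outerTraction (m : Medium El) (M : Mesh El IF BF) (τ : BF → V3 → V3) (E : TField El) :
    Side IF BF → V3 → V3
  | Sum.inl fb, x => m.C (M.outer (Sum.inl fb)) x (E (M.outer (Sum.inl fb)) x) *ᵥ
      (-M.outNormal (Sum.inl fb) x)
  | Sum.inr b, x =>
      if m.mu (M.own b) x ≠ 0 then
        (-2 : ℝ) • τ b x + m.traction M E (Sum.inr b) x
      else
        (-2 * (M.outNormal (Sum.inr b) x ⬝ᵥ (τ b x - m.traction M E (Sum.inr b) x))) •
          M.outNormal (Sum.inr b) x - m.traction M E (Sum.inr b) x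

open Classical in
/-- The exterior traction `C⁺ H⁺ n⁺` of the adjoint. -/
def Medium.adjOuterTraction (m : Medium El) (M : Mesh El IF BF) (H : TField El) :
    Side IF BF → V3 → V3
  | Sum.inl fb, x => m.C (M.outer (Sum.inl fb)) x (H (M.outer (Sum.inl fb)) x) *ᵥ
      (-M.outNormal (Sum.inl fb) x)
  | Sum.inr b, x =>
      if m.mu (M.own b) x ≠ 0 then
        m.traction M H (Sum.inr b) x
      else
        -m.traction M H (Sum.inr b) x +
          (2 * (M.outNormal (Sum.inr b) x ⬝ᵥ m.traction M H (Sum.inr b) x)) •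
            M.outNormal (Sum.inr b) x

/-- The traces of the state; on the boundary of the domain `v⁺ = v⁻`. -/
def Medium.stateTrace (m : Medium El) (M : Mesh El IF BF) (τ : BF → V3 → V3)
    (E : TField El) (v : VField El) (s : Side IF BF) (x : V3) : Trace where
  tM := m.traction M E s x
  tP := m.outerTraction M τ E s x
  vM := v (M.inner s) x
  vP := v (M.outer s) x

/-- The traces of the adjoint; on the boundary of the domain `w⁺ = w⁻`. -/
def Medium.adjTrace (m : Medium El) (M : Mesh El IF BF)
    (H : TField El) (w : VField El) (s : Side IF BF) (x : V3) : Trace where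
  tM := m.traction M H s x
  tP := m.adjOuterTraction M H s x
  vM := w (M.inner s) x
  vP := w (M.outer s) x

/-! ### State equation, cost functional and adjoint equation -/

/-- The data that do not depend on the wave speeds: final time, volume force, boundary traction,
discrete initial values, and the functions `jΩ`, `rp`, `rs` of the cost functional. The measure
`obs` against which `jΩ(v)` is integrated is the integration rule `vol`, or for instance a sum of
point masses at receivers. -/
structure ProblemData (D : Discretization El IF BF) where
  T : ℝ
  T_pos : 0 < T
  force : ℝ → VField El
  force_cont : ∀ e, ContinuousOn (fun z : ℝ × V3 => force z.1 e z.2)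
    (Icc 0 T ×ˢ closure (D.cell e))
  trac : ℝ → BF → V3 → V3
  trac_cont : ∀ b, ContinuousOn (fun z : ℝ × V3 => trac z.1 b z.2)
    (Icc 0 T ×ˢ D.face (Sum.inr b))
  E0 : TField El
  E0_mem : E0 ∈ D.Ph
  v0 : VField El
  v0_mem : v0 ∈ D.Qh
  jΩ : V3 → ℝ
  jΩ_smooth : ContDiff ℝ 1 jΩ
  obs : El → Measure V3
  obs_finite : ∀ e, IsFiniteMeasure (obs e)
  obs_supp : ∀ e, obs e (closure (D.cell e))ᶜ = 0
  rp : ℝ → ℝ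
  rp_smooth : ContDiff ℝ 1 rp
  rs : ℝ → ℝ
  rs_smooth : ContDiff ℝ 1 rs

/-- The left minus the right side of the strong form of the discontinuous Galerkin discretization,
with force `f`, boundary traction `τ`, time derivatives `Et`, `vt`, and test functions `H`, `w`. -/
def stateResidual [Fintype El] [Fintype IF] [Fintype BF] (D : Discretization El IF BF)
    (m : Medium El) (f : VField El) (τ : BF → V3 → V3) (Et E : TField El) (vt v : VField El)
    (H : TField El) (w : VField El) : ℝ :=
  D.intVol (fun e x =>
      ddot (Et e x) (m.C e x (H e x)) + m.ρ e x * (vt e x ⬝ᵥ w e x)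
      - ddot (symPart (gradVec (v e) x)) (m.C e x (H e x))
      - (divTensor (fun y => m.C e y (E e y)) x + f e x) ⬝ᵥ w e x)
  - D.intSides (fun s x =>
      ddot ((m.interface D.toMesh s x).fluxV (m.stateTrace D.toMesh τ E v s x))
        (m.C (D.inner s) x (H (D.inner s) x)))
  - D.intSides (fun s x =>
      (m.interface D.toMesh s x).fluxS (m.stateTrace D.toMesh τ E v s x) ⬝ᵥ w (D.inner s) x)

/-- `(E, v)` solves the semidiscrete state equation for the medium `m`. -/
structure IsState [Fintype El] [Fintype IF] [Fintype BF] (D : Discretization El IF BF)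
    (P : ProblemData D) (m : Medium El) (E : ℝ → TField El) (v : ℝ → VField El) : Prop where
  curve_E : IsC1Curve P.T D.Ph E
  curve_v : IsC1Curve P.T D.Qh v
  init_E : ∀ e, ∀ x ∈ closure (D.cell e), E 0 e x = P.E0 e x
  init_v : ∀ e, ∀ x ∈ closure (D.cell e), v 0 e x = P.v0 e x
  equation : ∀ t ∈ Ioo 0 P.T, ∀ H ∈ D.Ph, ∀ w ∈ D.Qh,
    stateResidual D m (P.force t) (P.trac t) (dtT E t) (E t) (dtV v t) (v t) H w = 0

/-- The cost of a velocity history. -/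
def cost [Fintype El] (D : Discretization El IF BF) (P : ProblemData D) (m : Medium El)
    (v : ℝ → VField El) : ℝ :=
  (∫ t in (0 : ℝ)..P.T, ∑ e, ∫ x, P.jΩ (v t e x) ∂P.obs e)
    + D.intVol (fun e x => P.rp (m.cp e x)) + D.intVol (fun e x => P.rs (m.cs e x))

open Classical in
/-- The cost as a function of the medium, through the velocity of the solution of the state
equation. -/
def reducedCost [Fintype El] [Fintype IF] [Fintype BF] (D : Discretization El IF BF)
    (P : ProblemData D) (m : Medium El) : ℝ :=
  if h : ∃ v : ℝ → VField El, ∃ E : ℝ → TField El, IsState D P m E v then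
    cost D P m h.choose
  else 0

/-- The Lagrangian function: cost plus time integral of the state equation tested with `(H, w)`. -/
def lagrangian [Fintype El] [Fintype IF] [Fintype BF] (D : Discretization El IF BF)
    (P : ProblemData D) (m : Medium El) (E : ℝ → TField El) (v : ℝ → VField El)
    (H : ℝ → TField El) (w : ℝ → VField El) : ℝ :=
  cost D P m v + ∫ t in (0 : ℝ)..P.T,
    stateResidual D m (P.force t) (P.trac t) (dtT E t) (E t) (dtV v t) (v t) (H t) (w t)

/-- All variations of the Lagrangian with respect to the state, in directions that vanish
at the initial time, are zero: the discrete adjoint condition. -/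
def IsStationary [Fintype El] [Fintype IF] [Fintype BF] (D : Discretization El IF BF)
    (P : ProblemData D) (m : Medium El) (E : ℝ → TField El) (v : ℝ → VField El)
    (H : ℝ → TField El) (w : ℝ → VField El) : Prop :=
  ∀ (E' : ℝ → TField El) (v' : ℝ → VField El), IsC1Curve P.T D.Ph E' → IsC1Curve P.T D.Qh v' →
    E' 0 = 0 → v' 0 = 0 →
    HasDerivAt (fun ε : ℝ => lagrangian D P m (E + ε • E') (v + ε • v') H w) 0 0

/-- The adjoint discontinuous Galerkin scheme in weak form for `(H, w)`, tested at time `t` with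
`(E', v')`. -/
def AdjointEquation [Fintype El] [Fintype IF] [Fintype BF] (D : Discretization El IF BF)
    (P : ProblemData D) (m : Medium El) (v : ℝ → VField El) (H : ℝ → TField El)
    (w : ℝ → VField El) (t : ℝ) (E' : TField El) (v' : VField El) : Prop :=
  D.intVol (fun e x =>
      -ddot (dtT H t e x) (m.C e x (E' e x)) - m.ρ e x * (dtV w t e x ⬝ᵥ v' e x)
      - ddot (m.C e x (H t e x)) (symPart (gradVec (v' e) x))
      - w t e x ⬝ᵥ divTensor (fun y => m.C e y (E' e y)) x)
  = -D.intSides (fun s x =>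
      ddot ((m.interface D.toMesh s x).adjFluxV (m.adjTrace D.toMesh (H t) (w t) s x))
        (m.C (D.inner s) x (E' (D.inner s) x)))
    - D.intSides (fun s x =>
      (m.interface D.toMesh s x).adjFluxS (m.adjTrace D.toMesh (H t) (w t) s x) ⬝ᵥ
        v' (D.inner s) x)
    - ∑ e, ∫ x, fderiv ℝ P.jΩ (v t e x) (v' e x) ∂P.obs e

/-- `(H, w)` solves the adjoint equation, backward in time from zero final values. -/
structure IsAdjoint [Fintype El] [Fintype IF] [Fintype BF] (D : Discretization El IF BF)
    (P : ProblemData D) (m : Medium El) (v : ℝ → VField El)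
    (H : ℝ → TField El) (w : ℝ → VField El) : Prop where
  curve_H : IsC1Curve P.T D.Ph H
  curve_w : IsC1Curve P.T D.Qh w
  final_H : ∀ e, ∀ x ∈ closure (D.cell e), H P.T e x = 0
  final_w : ∀ e, ∀ x ∈ closure (D.cell e), w P.T e x = 0
  equation : ∀ t ∈ Ioo 0 P.T, ∀ E' ∈ D.Ph, ∀ v' ∈ D.Qh, AdjointEquation D P m v H w t E' v'

/-! ### The discrete gradients -/

/-- `A` coincides at the integration points of all elements and of their boundaries with `C K`
for some test function `K` in the strain space: then the state equation can be tested with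
`(K, 0)`, which amounts to replacing `C H` in it by `A`. -/
def IsTestStress (D : Discretization El IF BF) (m : Medium El) (A : TField El) : Prop :=
  ∃ K ∈ D.Ph, (∀ e, ∀ᵐ x ∂D.vol e, m.C e x (K e x) = A e x) ∧
    ∀ s, ∀ᵐ x ∂D.surfOf s, m.C (D.inner s) x (K (D.inner s) x) = A (D.inner s) x

/-- The element term `G_p c = -2 ∇(ρ cp c tr E) · w`. -/
def elementTermP (m : Medium El) (E : TField El) (w : VField El) (c : SField El) : SField El :=
  fun e x => -2 * (grad (fun y => m.ρ e y * m.cp e y * c e y * (E e y).trace) x ⬝ᵥ w e x)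

/-- The element term `G_s c = -4 ∇·(ρ cs c (E - tr(E) I)) · w`. -/
def elementTermS (m : Medium El) (E : TField El) (w : VField El) (c : SField El) : SField El :=
  fun e x => -4 * (divTensor (fun y =>
    (m.ρ e y * m.cs e y * c e y) • (E e y - (E e y).trace • (1 : M3))) x ⬝ᵥ w e x)

/-- The boundary terms `g_p` and `g_s` at time `t`. -/
def sideTermP {D : Discretization El IF BF} (P : ProblemData D) (m : Medium El)
    (E : ℝ → TField El) (v : ℝ → VField El) (H : ℝ → TField El) (w : ℝ → VField El)
    (t : ℝ) (s : Side IF BF) (x : V3) : ℝ :=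
  (m.interface D.toMesh s x).gp (m.stateTrace D.toMesh (P.trac t) (E t) (v t) s x)
    (m.adjTrace D.toMesh (H t) (w t) s x) (E t (D.inner s) x)

def sideTermS {D : Discretization El IF BF} (P : ProblemData D) (m : Medium El)
    (E : ℝ → TField El) (v : ℝ → VField El) (H : ℝ → TField El) (w : ℝ → VField El)
    (t : ℝ) (s : Side IF BF) (x : V3) : ℝ :=
  (m.interface D.toMesh s x).gs (m.stateTrace D.toMesh (P.trac t) (E t) (v t) s x)
    (m.adjTrace D.toMesh (H t) (w t) s x) (E t (D.inner s) x)

/-- The discrete gradient with respect to `cp`, applied to the direction `c`. -/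
def gradientP [Fintype El] [Fintype IF] [Fintype BF] (D : Discretization El IF BF)
    (P : ProblemData D) (m : Medium El) (E : ℝ → TField El) (v : ℝ → VField El)
    (H : ℝ → TField El) (w : ℝ → VField El) (c : SField El) : ℝ :=
  D.intVol (fun e x => deriv P.rp (m.cp e x) * c e x)
    + (∫ t in (0 : ℝ)..P.T, D.intVol (elementTermP m (E t) (w t) c))
    + ∑ s, ∫ t in (0 : ℝ)..P.T,
        ∫ x, sideTermP P m E v H w t s x * c (D.inner s) x ∂D.surfOf s

/-- The discrete gradient with respect to `cs`, applied to the direction `c`. -/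
def gradientS [Fintype El] [Fintype IF] [Fintype BF] (D : Discretization El IF BF)
    (P : ProblemData D) (m : Medium El) (E : ℝ → TField El) (v : ℝ → VField El)
    (H : ℝ → TField El) (w : ℝ → VField El) (c : SField El) : ℝ :=
  D.intVol (fun e x => deriv P.rs (m.cs e x) * c e x)
    + (∫ t in (0 : ℝ)..P.T, D.intVol (elementTermS m (E t) (w t) c))
    + ∑ s, ∫ t in (0 : ℝ)..P.T,
        ∫ x, sideTermS P m E v H w t s x * c (D.inner s) x ∂D.surfOf s

/-- The field `u` is continuous across the interior faces. -/
def ContinuousAcross (M : Mesh El IF BF) (u : SField El) : Prop :=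
  ∀ f, ∀ x ∈ M.face (Sum.inl f), u (M.left f) x = u (M.right f) x

/-- The face term of the acoustic gradient on an interior face, for the dilatations `tr E`
and `tr H`. -/
def acousticTerm (M : Mesh El IF BF) (m : Medium El) (E : TField El) (v : VField El)
    (H : TField El) (w : VField El) (f : IF) (x : V3) : ℝ :=
  acousticFaceTerm (M.normal (Sum.inl f) x) (m.ρ (M.left f) x) (m.cp (M.left f) x)
    (E (M.left f) x).trace (E (M.right f) x).trace (H (M.left f) x).trace (H (M.right f) x).trace
    (v (M.left f) x) (v (M.right f) x) (w (M.left f) x) (w (M.right f) x)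

end

end

end DGAE

open DGAE

/-!
The semidiscrete state equation is a linear system of ordinary differential equations, and all
claims follow from three facts about it: its mass matrix is symmetric and nonsingular, its adjoint
is the scheme with the adjoint fluxes, and it depends on the wave speeds differentiably.

*Coordinates.* In acoustic elements only the trace of a strain produces stress, so strains are not
determined by the equations. The fields without stress and velocity form the subspace `nullSpace`;
the residual vanishes if such fields are inserted for the state or for the test functions, and the
subspace does not change under small perturbations of the wave speeds. In `Coordinates` modulo this
subspace the residual reads `h ⬝ᵥ (A *ᵥ c' - B *ᵥ c - F)` (`stateResidual_coord`). The matrix `A`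
is symmetric, and it is nonsingular because the elastic energy controls the stress pointwise and the
element quadrature is definite on the local spaces (`massMat_injective`). This gives solutions, and
uniqueness of stress and velocity.

*Duality.* No integration by parts in space is needed: the weak form of the adjoint scheme is the
transpose of that of the state equation term by term in the elements, and for the fluxes it is a
pointwise algebraic identity. At each point of an interior face the upwind fluxes of the state
equation from both sides, as bilinear forms in state and test functions, are the transposes of the
adjoint fluxes (`Interface.pairing_add_swap`); on the boundary the same holds for the homogeneous
boundary conditions (`Interface.pairing_boundary`). Since both sides of a face carry the same
quadrature, the identity survives integration (`intSides_duality`), and the adjoint scheme is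
`A *ᵥ h' = -Bᵀ *ᵥ h + G` with `G` the derivative of the cost (`adjointEquation_iff`). Testing the
variation of the Lagrangian with suitable directions identifies this system and its final condition
as the stationarity condition (`ode_of_forall_integral_eq_zero`, `isStationary_iff`). The final
condition takes the form `A *ᵥ h T = 0`, so it concerns the stress and velocity only.

*Gradients.* Volume integrands and fluxes have first-order expansions in the wave speeds, uniform in
space and time (`UExp`, `uexp_residual`). Gronwall's inequality then bounds the change of the state
linearly in the perturbation (`exists_state_bound`), and representing the derivative of the cost by
the adjoint (`adjoint_representation`) shows that the reduced cost is differentiable, its derivative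
being the variation of the residual at fixed state and adjoint (`hasFDerivAt_reducedCost`). In that
variation the test stress varies too. By hypothesis its variation is the stress of an element of
the discrete space, so that part vanishes by the state equation (`residualVar_eq`). The rest
consists of the element terms and of flux terms which, added over the two sides of a face, are the
terms `g_p` and `g_s`; this is again an identity at each point (`Interface.pairingVar_add_swap`,
`Interface.pairingVar_boundary`). The acoustic face term results from adding `g_p` from both sides
when the material parameters agree (`Interface.gp_add_swap`).
-/


namespace DGAE

noncomputable section

/-! ### Algebra of the numerical fluxes at a point -/

/-- The Euclidean product of the components of `y` and `z` tangential to the unit vector `n`. -/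
def tang (n y z : V3) : ℝ := y ⬝ᵥ z - (n ⬝ᵥ y) * (n ⬝ᵥ z)

section tang

variable (n x y z : V3) (c : ℝ)

lemma tang_add_left : tang n (x + y) z = tang n x z + tang n y z := by
  simp only [tang, add_dotProduct, dotProduct_add]; ring

lemma tang_add_right : tang n x (y + z) = tang n x y + tang n x z := by
  simp only [tang, dotProduct_add]; ring

lemma tang_sub_left : tang n (x - y) z = tang n x z - tang n y z := by
  simp only [tang, sub_dotProduct, dotProduct_sub]; ring

lemma tang_sub_right : tang n x (y - z) = tang n x y - tang n x z := by
  simp only [tang, dotProduct_sub]; ring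

lemma tang_smul_left : tang n (c • x) z = c * tang n x z := by
  simp only [tang, smul_dotProduct, dotProduct_smul, smul_eq_mul]; ring

lemma tang_smul_right : tang n x (c • z) = c * tang n x z := by
  simp only [tang, dotProduct_smul, smul_eq_mul]; ring

lemma tang_neg_left : tang n (-x) z = -tang n x z := by
  simp only [tang, neg_dotProduct, dotProduct_neg]; ring

lemma tang_neg_normal : tang (-n) x z = tang n x z := by
  simp only [tang, neg_dotProduct]; ring

lemma tang_comm : tang n x y = tang n y x := by
  simp only [tang, dotProduct_comm x y]; ring

lemma tang_zero_left : tang n 0 z = 0 := by simp [tang]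

lemma tang_zero_right : tang n z 0 = 0 := by simp [tang]

variable {n}

lemma tang_normal_left (hn : n ⬝ᵥ n = 1) : tang n n z = 0 := by
  simp only [tang, hn]; ring

lemma tang_normal_right (hn : n ⬝ᵥ n = 1) : tang n z n = 0 := by
  rw [tang_comm, tang_normal_left z hn]

end tang

lemma dcross_eq (n a : V3) : dcross n a = (n ⬝ᵥ a) • n - (n ⬝ᵥ n) • a := by
  ext i
  fin_cases i <;> simp [dcross, cross_apply, dotProduct, Fin.sum_univ_three] <;> ring

lemma dcross_dotProduct {n : V3} (hn : n ⬝ᵥ n = 1) (a z : V3) :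
    dcross n a ⬝ᵥ z = -tang n a z := by
  rw [dcross_eq, hn]
  simp only [tang, sub_dotProduct, smul_dotProduct, smul_eq_mul]; ring

lemma dcross_dotProduct_dcross {n : V3} (hn : n ⬝ᵥ n = 1) (a z : V3) :
    dcross n a ⬝ᵥ dcross n z = tang n a z := by
  rw [dcross_dotProduct hn, dcross_eq, hn, tang_sub_right, tang_smul_right, tang_smul_right,
    tang_normal_right _ hn]
  ring

/-- A vector whose tangential products vanish is normal. -/
lemma dcross_eq_zero_of_tang {n : V3} (hn : n ⬝ᵥ n = 1) {a : V3} (h : ∀ z, tang n a z = 0) :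
    dcross n a = 0 :=
  dotProduct_eq_zero _ fun z => by rw [dcross_dotProduct hn, h, neg_zero]

section ddot

lemma ddot_add_left (A B S : M3) : ddot (A + B) S = ddot A S + ddot B S := by
  simp only [ddot, Matrix.add_apply, add_mul, Finset.sum_add_distrib]

lemma ddot_sub_left (A B S : M3) : ddot (A - B) S = ddot A S - ddot B S := by
  simp only [ddot, Matrix.sub_apply, sub_mul, Finset.sum_sub_distrib]

lemma ddot_smul_left (c : ℝ) (A S : M3) : ddot (c • A) S = c * ddot A S := by
  simp only [ddot, Matrix.smul_apply, smul_eq_mul, mul_assoc, Finset.mul_sum]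

lemma ddot_comm (A B : M3) : ddot A B = ddot B A := by
  simp only [ddot, mul_comm]

lemma ddot_add_right (A B S : M3) : ddot S (A + B) = ddot S A + ddot S B := by
  rw [ddot_comm, ddot_add_left, ddot_comm A, ddot_comm B]

lemma ddot_smul_right (c : ℝ) (A S : M3) : ddot S (c • A) = c * ddot S A := by
  rw [ddot_comm, ddot_smul_left, ddot_comm A]

lemma ddot_one_right (A : M3) : ddot A 1 = A.trace := by
  simp [ddot, Matrix.trace, Matrix.one_apply]

lemma ddot_zero_left (A : M3) : ddot 0 A = 0 := by simp [ddot]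

lemma ddot_zero_right (A : M3) : ddot A 0 = 0 := by simp [ddot]

lemma ddot_symPart_vecMulVec (n y : V3) {S : M3} (hS : S.IsSymm) :
    ddot (symPart (vecMulVec n y)) S = y ⬝ᵥ (S *ᵥ n) := by
  have h := fun i j => congrFun (congrFun hS.eq i) j
  simp only [Matrix.transpose_apply] at h
  simp only [ddot, symPart, vecMulVec, Matrix.smul_apply, Matrix.add_apply, Matrix.transpose_apply,
    Matrix.of_apply, smul_eq_mul, dotProduct, Matrix.mulVec, Fin.sum_univ_three]
  rw [h 0 1, h 0 2, h 1 2]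
  ring

lemma ddot_vecMulVec (n : V3) (S : M3) : ddot (vecMulVec n n) S = n ⬝ᵥ (S *ᵥ n) := by
  simp only [ddot, vecMulVec, Matrix.of_apply, dotProduct, Matrix.mulVec, Fin.sum_univ_three]
  ring

end ddot

lemma Trace.jumpV_eq (q : Trace) (n : V3) : q.jumpV n = n ⬝ᵥ q.vM - n ⬝ᵥ q.vP := by
  rw [Trace.jumpV, dotProduct_neg, dotProduct_comm, dotProduct_comm q.vP]; ring

/-- The traces at the same point of a face, seen from the other side. -/
def Trace.swap (q : Trace) : Trace := ⟨q.tP, q.tM, q.vP, q.vM⟩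

namespace Interface

/-- The interface seen from the other side. -/
def swap (F : Interface) : Interface := ⟨-F.n, F.ρP, F.ρM, F.cpP, F.cpM, F.csP, F.csM⟩

/-- The conditions on the normal and the material parameters at a point of a face that an
admissible medium guarantees. -/
structure Regular (F : Interface) : Prop where
  unit : F.n ⬝ᵥ F.n = 1
  ρM_pos : 0 < F.ρM
  ρP_pos : 0 < F.ρP
  cpM_pos : 0 < F.cpM
  cpP_pos : 0 < F.cpP
  csM_nonneg : 0 ≤ F.csM
  csP_nonneg : 0 ≤ F.csP

/-- Tractions have no tangential component on an acoustic side of the interface. -/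
structure AcousticTangential (F : Interface) (q : Trace) : Prop where
  minus : F.csM = 0 → ∀ z, tang F.n q.tM z = 0
  plus : F.csP = 0 → ∀ z, tang F.n q.tP z = 0

namespace Regular

variable {F : Interface} (hF : F.Regular)
include hF

lemma swap : F.swap.Regular :=
  ⟨by simpa [Interface.swap] using hF.unit, hF.ρP_pos, hF.ρM_pos, hF.cpP_pos, hF.cpM_pos,
    hF.csP_nonneg, hF.csM_nonneg⟩

lemma k0_denom_pos : 0 < F.ρM * F.cpM + F.ρP * F.cpP :=
  add_pos (mul_pos hF.ρM_pos hF.cpM_pos) (mul_pos hF.ρP_pos hF.cpP_pos)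

lemma k0_mul : F.k0 * (F.ρM * F.cpM + F.ρP * F.cpP) = 1 := by
  rw [k0, one_div, inv_mul_cancel₀ hF.k0_denom_pos.ne']

omit hF in
lemma k1_of_zero (h : F.csM = 0) : F.k1 = 0 := by
  simp [k1, h]

lemma k1_of_ne (h : F.csM ≠ 0) : F.k1 = 1 / (F.ρM * F.csM + F.ρP * F.csP) := by
  rw [k1, if_pos (mul_ne_zero hF.ρM_pos.ne' (pow_ne_zero 2 h))]

lemma k1_mul (h : F.csM ≠ 0) : F.k1 * (F.ρM * F.csM + F.ρP * F.csP) = 1 := by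
  have h1 : 0 < F.ρM * F.csM :=
    mul_pos hF.ρM_pos (lt_of_le_of_ne hF.csM_nonneg (Ne.symm h))
  have h2 : 0 ≤ F.ρP * F.csP := mul_nonneg hF.ρP_pos.le hF.csP_nonneg
  rw [hF.k1_of_ne h, one_div, inv_mul_cancel₀ (by positivity)]

end Regular

lemma swap_k0 (F : Interface) : F.swap.k0 = F.k0 := by
  simp only [k0, swap]; rw [add_comm]

/-- The contribution of a side of a face to the state equation, in terms of the traction `t`
and the velocity `w` of the test functions. -/
def pairing (F : Interface) (q : Trace) (t w : V3) : ℝ :=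
  -(F.k0 * (F.n ⬝ᵥ q.jumpS + F.ρP * F.cpP * q.jumpV F.n)
      * (F.n ⬝ᵥ t + F.ρM * F.cpM * (F.n ⬝ᵥ w)))
    - F.k1 * tang F.n (q.jumpS + (F.ρP * F.csP) • q.diffV) (t + (F.ρM * F.csM) • w)

/-- The contribution of a side of a face to the adjoint equation, in terms of the traction `t`
and the velocity `v` of the test functions. -/
def adjPairing (F : Interface) (p : Trace) (t v : V3) : ℝ :=
  F.k0 * ((F.n ⬝ᵥ p.jumpS + F.n ⬝ᵥ ((F.ρM * F.cpM) • p.vM + (F.ρP * F.cpP) • p.vP)) * (F.n ⬝ᵥ t)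
      + (F.n ⬝ᵥ ((F.ρP * F.cpP) • p.tM + (F.ρM * F.cpM) • (-p.tP))
          + F.ρM * F.cpM * (F.ρP * F.cpP) * p.jumpV F.n) * (F.n ⬝ᵥ v))
    + F.k1 * (tang F.n (p.jumpS + ((F.ρM * F.csM) • p.vM + (F.ρP * F.csP) • p.vP)) t
      + tang F.n ((F.ρP * F.csP) • p.tM + (F.ρM * F.csM) • (-p.tP)
          + (F.ρM * F.csM * (F.ρP * F.csP)) • p.diffV) v)

lemma flux_eq_pairing {F : Interface} (hn : F.n ⬝ᵥ F.n = 1) (q : Trace) {S : M3} (hS : S.IsSymm)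
    (w : V3) : ddot (F.fluxV q) S + F.fluxS q ⬝ᵥ w = F.pairing q (S *ᵥ F.n) w := by
  simp only [fluxV, fluxS, pairing, ddot_add_left, ddot_smul_left, ddot_vecMulVec,
    ddot_symPart_vecMulVec _ _ hS, add_dotProduct, smul_dotProduct, dcross_dotProduct hn,
    smul_eq_mul, tang_add_left, tang_add_right, tang_smul_left, tang_smul_right]
  ring

lemma adjFlux_eq_pairing {F : Interface} (hn : F.n ⬝ᵥ F.n = 1) (p : Trace) {S : M3}
    (hS : S.IsSymm) (v : V3) :
    ddot (F.adjFluxV p) S + F.adjFluxS p ⬝ᵥ v = F.adjPairing p (S *ᵥ F.n) v := by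
  simp only [adjFluxV, adjFluxS, adjPairing, ddot_sub_left, ddot_smul_left, ddot_vecMulVec,
    ddot_symPart_vecMulVec _ _ hS, sub_dotProduct, smul_dotProduct, dcross_dotProduct hn,
    smul_eq_mul, tang_add_left, tang_smul_left]
  ring

/-- Duality of the fluxes on an interior face: the upwind terms of the state equation from both
sides, as a form in the state, are minus the terms of the adjoint fluxes. This is a regrouping of
terms, as `k0` is the same from both sides, and so is `k1` between elastic sides. Between an
acoustic and an elastic side only the `k1` of the latter is nonzero; the tangential traction from
the acoustic side vanishes, and `k1 * (ρM * csM + ρP * csP) = 1`. -/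
lemma pairing_add_swap {F : Interface} (hF : F.Regular) {q p : Trace}
    (hq : F.AcousticTangential q) (hp : F.AcousticTangential p) :
    F.pairing q p.tM p.vM + F.swap.pairing q.swap p.tP p.vP =
      -(F.adjPairing p q.tM q.vM + F.swap.adjPairing p.swap q.tP q.vP) := by
  simp only [pairing, adjPairing, swap_k0]
  simp only [swap, Trace.swap, Trace.jumpS, Trace.jumpV_eq, Trace.diffV, neg_dotProduct,
    tang_neg_normal, tang_add_left, tang_add_right, tang_sub_left, tang_smul_left,
    tang_smul_right, tang_neg_left, dotProduct_add, dotProduct_neg,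
    dotProduct_smul, smul_eq_mul]
  simp only [tang_comm F.n p.tM, tang_comm F.n p.vM, tang_comm F.n p.tP, tang_comm F.n p.vP]
  by_cases hM : F.csM = 0 <;> by_cases hP : F.csP = 0
  · have h1 := Regular.k1_of_zero hM
    have h2 := Regular.k1_of_zero (F := F.swap) hP
    simp only [swap] at h2
    simp only [h1, h2]
    ring
  · have h1 := Regular.k1_of_zero hM
    have h2 := hF.swap.k1_mul hP
    simp only [swap] at h2 ⊢
    simp only [h1, hM, hq.minus hM, tang_comm F.n _ p.tM, hp.minus hM]
    ring
  · simp only [hP, hq.plus hP, tang_comm F.n _ p.tP, hp.plus hP]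
    ring
  · have h2 : F.swap.k1 = F.k1 := by
      rw [hF.k1_of_ne hM, hF.swap.k1_of_ne hP]; simp only [swap]; rw [add_comm]
    simp only [swap] at h2
    simp only [h2]
    ring

/-- The two sides of a boundary face carry the same material parameters. -/
structure SameParameters (F : Interface) : Prop where
  ρ : F.ρP = F.ρM
  cp : F.cpP = F.cpM
  cs : F.csP = F.csM

/-- Traces on a boundary face with homogeneous boundary condition. -/
structure FreeTrace (F : Interface) (q : Trace) : Prop where
  vel : q.vP = q.vM
  elastic : F.csM ≠ 0 → q.tP = q.tM
  acoustic : F.csM = 0 → q.tP = (2 * (F.n ⬝ᵥ q.tM)) • F.n - q.tM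

/-- Duality of the fluxes on a boundary face. -/
lemma pairing_boundary {F : Interface} (hF : F.Regular) (hc : F.SameParameters) {q p : Trace}
    (hq : F.FreeTrace q) (hp : F.FreeTrace p) :
    F.pairing q p.tM p.vM = -F.adjPairing p q.tM q.vM := by
  simp only [pairing, adjPairing]
  simp only [Trace.jumpS, Trace.jumpV_eq, Trace.diffV, hq.vel, hp.vel, hc.ρ, hc.cp, hc.cs]
  by_cases hM : F.csM = 0
  · rw [Regular.k1_of_zero hM, hq.acoustic hM, hp.acoustic hM]
    simp only [dotProduct_add, dotProduct_sub, dotProduct_neg, dotProduct_smul, smul_eq_mul,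
      hF.unit]
    ring
  · rw [hq.elastic hM, hp.elastic hM]
    simp only [tang_add_left, tang_add_right, tang_sub_left, tang_smul_left,
      tang_smul_right, tang_neg_left, dotProduct_add, dotProduct_neg,
      dotProduct_smul, smul_eq_mul, tang_comm F.n p.tM, tang_comm F.n p.vM]
    ring

/-! ### First variations of the flux terms with respect to the wave speeds -/

/-- Variations of the wave speeds on both sides of an interface and of the tractions. -/
structure Variation where
  pM : ℝ
  pP : ℝ
  sM : ℝ
  sP : ℝ
  tM : V3
  tP : V3

/-- The variation seen from the other side. -/
def Variation.swap (d : Variation) : Variation := ⟨d.pP, d.pM, d.sP, d.sM, d.tP, d.tM⟩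

/-- The first variation of `pairing`, where `t'` is the variation of the traction `t` of the
test function. -/
def pairingVar (F : Interface) (d : Variation) (q : Trace) (t t' w : V3) : ℝ :=
  F.k0 ^ 2 * (F.ρM * d.pM + F.ρP * d.pP) * (F.n ⬝ᵥ q.jumpS + F.ρP * F.cpP * q.jumpV F.n)
      * (F.n ⬝ᵥ t + F.ρM * F.cpM * (F.n ⬝ᵥ w))
    - F.k0 * (F.n ⬝ᵥ (d.tM + d.tP) + F.ρP * d.pP * q.jumpV F.n)
      * (F.n ⬝ᵥ t + F.ρM * F.cpM * (F.n ⬝ᵥ w))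
    - F.k0 * (F.n ⬝ᵥ q.jumpS + F.ρP * F.cpP * q.jumpV F.n)
      * (F.n ⬝ᵥ t' + F.ρM * d.pM * (F.n ⬝ᵥ w))
    + F.k1 ^ 2 * (F.ρM * d.sM + F.ρP * d.sP)
      * tang F.n (q.jumpS + (F.ρP * F.csP) • q.diffV) (t + (F.ρM * F.csM) • w)
    - F.k1 * tang F.n (d.tM + d.tP + (F.ρP * d.sP) • q.diffV) (t + (F.ρM * F.csM) • w)
    - F.k1 * tang F.n (q.jumpS + (F.ρP * F.csP) • q.diffV) (t' + (F.ρM * d.sM) • w)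

lemma pairingVar_eq (F : Interface) (d : Variation) (q : Trace) (t t' w : V3) :
    F.pairingVar d q t t' w = F.pairing q t' 0 + F.pairingVar d q t 0 w := by
  simp only [pairingVar, pairing, dotProduct_zero, tang_add_right, tang_smul_right,
    tang_zero_right]
  ring

/-- The variation of the traction `(C E) n` of a strain `E`. -/
def varTraction (ρ cp cs dp ds : ℝ) (n : V3) (E : M3) : V3 :=
  (2 * ρ * cp * dp * E.trace) • n + (4 * ρ * cs * ds) • (E *ᵥ n - E.trace • n)

/-- Hypotheses on the variation at an interior face: the tractions vary as those of
strains `EM`, `EP`, and the secondary wave speed is not varied where it vanishes. -/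
structure Variation.IsInterior (d : Variation) (F : Interface) (EM EP : M3) : Prop where
  tM : d.tM = varTraction F.ρM F.cpM F.csM d.pM d.sM F.n EM
  tP : d.tP = varTraction F.ρP F.cpP F.csP d.pP d.sP (-F.n) EP
  sM : F.csM = 0 → d.sM = 0
  sP : F.csP = 0 → d.sP = 0

/-- The sum of the boundary terms `g_p` and `g_s` times the variations of the wave speeds. -/
def gpair (F : Interface) (q p : Trace) (EM : M3) (dp ds : ℝ) : ℝ :=
  F.gp q p EM * dp + F.gs q p EM * ds

lemma gs_eq {F : Interface} (hn : F.n ⬝ᵥ F.n = 1) (q p : Trace) (EM : M3) :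
    F.gs q p EM =
      -(F.k1 ^ 2 * F.ρM * tang F.n q.jumpS (p.jumpS - (F.ρP * F.csP) • p.diffV))
    - F.k1 ^ 2 * F.ρM * F.ρP * F.csP * tang F.n q.diffV (p.jumpS - (F.ρP * F.csP) • p.diffV)
    + 4 * F.k0 * F.ρM * F.csM * (F.n ⬝ᵥ (EM *ᵥ F.n) - EM.trace) *
      (F.n ⬝ᵥ (p.jumpS - (F.ρP * F.cpP) • p.diffV))
    + 4 * F.k1 * F.ρM * F.csM *
      tang F.n (EM *ᵥ F.n) (p.jumpS - (F.ρP * F.csP) • p.diffV)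
    + 4 * F.ρM * F.csM * (tang F.n (EM *ᵥ F.n) p.vM
        + (F.n ⬝ᵥ (EM *ᵥ F.n) - EM.trace) * (F.n ⬝ᵥ p.vM)) := by
  simp only [gs, dcross_dotProduct_dcross hn, Matrix.sub_mulVec, Matrix.smul_mulVec,
    Matrix.one_mulVec, sub_dotProduct, smul_dotProduct, smul_eq_mul]
  simp only [tang]
  ring

/-- On an interior face the first variations of the flux terms of the state equation from both
sides add up to minus the gradient terms `g_p`, `g_s` of both sides, apart from the variation of
the test function. -/
lemma pairingVar_add_swap {F : Interface} (hF : F.Regular) {q p : Trace} {d : Variation}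
    {EM EP : M3} (hd : d.IsInterior F EM EP)
    (hq : F.AcousticTangential q) (hp : F.AcousticTangential p) :
    F.pairingVar d q p.tM 0 p.vM + F.swap.pairingVar d.swap q.swap p.tP 0 p.vP =
      -(F.gpair q p EM d.pM d.sM + F.swap.gpair q.swap p.swap EP d.pP d.sP) := by
  have hk := hF.k0_mul
  simp only [gpair, gs_eq hF.unit, gs_eq hF.swap.unit, gp, pairingVar, swap_k0]
  simp only [swap, Trace.swap, Variation.swap, Trace.jumpS, Trace.jumpV_eq, Trace.diffV,
    hd.tM, hd.tP, varTraction,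
    neg_dotProduct, dotProduct_comm p.vM, dotProduct_comm p.vP,
    tang_neg_normal, tang_add_left, tang_add_right, tang_sub_left, tang_sub_right, tang_smul_left,
    tang_smul_right, tang_neg_left, dotProduct_add, dotProduct_neg,
    dotProduct_sub, neg_neg, tang_normal_left _ hF.unit, tang_zero_right, dotProduct_zero,
    dotProduct_smul, smul_eq_mul, Matrix.mulVec_neg, hF.unit]
  generalize F.k0 = k at *
  -- the normal components give a multiple of `k (ρ⁻ cp⁻ + ρ⁺ cp⁺) - 1`; this is its cofactor
  obtain ⟨N, hN⟩ : ∃ N : ℝ, N = k * (((F.n ⬝ᵥ q.tM + F.n ⬝ᵥ q.tP) * (F.n ⬝ᵥ p.vM)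
        + (F.n ⬝ᵥ q.vM - F.n ⬝ᵥ q.vP) * (-(F.n ⬝ᵥ p.tP)
          + F.ρP * F.cpP * (F.n ⬝ᵥ p.vM - F.n ⬝ᵥ p.vP))) * (F.ρM * d.pM)
      + ((F.n ⬝ᵥ q.tM + F.n ⬝ᵥ q.tP) * (F.n ⬝ᵥ p.vP)
        + (F.n ⬝ᵥ q.vM - F.n ⬝ᵥ q.vP) * (F.n ⬝ᵥ p.tM
          + F.ρM * F.cpM * (F.n ⬝ᵥ p.vM - F.n ⬝ᵥ p.vP))) * (F.ρP * d.pP))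
    - (2 * F.ρM * F.cpM * d.pM * EM.trace
        + 4 * F.ρM * F.csM * d.sM * (F.n ⬝ᵥ EM *ᵥ F.n - EM.trace)) * (F.n ⬝ᵥ p.vM)
    + (2 * F.ρP * F.cpP * d.pP * EP.trace
        + 4 * F.ρP * F.csP * d.sP * (F.n ⬝ᵥ EP *ᵥ F.n - EP.trace)) * (F.n ⬝ᵥ p.vP) := ⟨_, rfl⟩
  by_cases hM : F.csM = 0 <;> by_cases hP : F.csP = 0
  · have h1 := Regular.k1_of_zero hM
    simp only [hM, hd.sM hM, hP, hd.sP hP] at hN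
    simp only [h1, hM, hP, hd.sM hM, hd.sP hP]
    replace hk := congrArg (N * ·) hk
    simp only [mul_one, hN] at hk
    linear_combination hk
  · have h1 := Regular.k1_of_zero hM
    have h2 := hF.swap.k1_mul hP
    simp only [swap] at h2
    generalize Interface.k1 ⟨-F.n, F.ρP, F.ρM, F.cpP, F.cpM, F.csP, F.csM⟩ = κ at *
    simp only [hM, hd.sM hM] at hN
    simp only [h1, hM, hd.sM hM, hq.minus hM, tang_comm F.n _ p.tM, hp.minus hM]
    simp only [hM] at h2
    replace hk := congrArg (N * ·) hk
    simp only [mul_one, hN] at hk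
    linear_combination hk + (κ * (tang F.n q.tP p.vP * (F.ρP * d.sP))
      + 4 * F.ρP * F.csP * d.sP * tang F.n (EP *ᵥ F.n) p.vP) * h2
  · have h1 := hF.k1_mul hM
    simp only [hP, hd.sP hP] at hN
    simp only [hP, hd.sP hP, hq.plus hP, tang_comm F.n _ p.tP, hp.plus hP]
    simp only [hP] at h1
    generalize F.k1 = κ at *
    replace hk := congrArg (N * ·) hk
    simp only [mul_one, hN] at hk
    linear_combination hk + (κ * (tang F.n q.tM p.vM * (F.ρM * d.sM))
      - 4 * F.ρM * F.csM * d.sM * tang F.n (EM *ᵥ F.n) p.vM) * h1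
  · have h1 := hF.k1_mul hM
    have h2 : F.swap.k1 = F.k1 := by
      rw [hF.k1_of_ne hM, hF.swap.k1_of_ne hP]; simp only [swap]; rw [add_comm]
    simp only [swap] at h2
    simp only [h2]
    generalize F.k1 = κ at *
    replace hk := congrArg (N * ·) hk
    simp only [mul_one, hN] at hk
    linear_combination hk + (κ * ((tang F.n q.tM p.vM + tang F.n q.tP p.vM
        - tang F.n q.vM p.tP + tang F.n q.vP p.tP + F.ρP * F.csP * (tang F.n q.vM p.vM
          - tang F.n q.vP p.vM - tang F.n q.vM p.vP + tang F.n q.vP p.vP)) * (F.ρM * d.sM)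
        + (tang F.n q.tM p.vP + tang F.n q.tP p.vP + tang F.n q.vM p.tM - tang F.n q.vP p.tM
          + F.ρM * F.csM * (tang F.n q.vM p.vM
          - tang F.n q.vP p.vM - tang F.n q.vM p.vP + tang F.n q.vP p.vP)) * (F.ρP * d.sP))
      - 4 * F.ρM * F.csM * d.sM * tang F.n (EM *ᵥ F.n) p.vM
      + 4 * F.ρP * F.csP * d.sP * tang F.n (EP *ᵥ F.n) p.vP) * h1

/-- Hypotheses on the variation at a boundary face. -/
structure Variation.IsBoundary (d : Variation) (F : Interface) (EM : M3) : Prop where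
  tM : d.tM = varTraction F.ρM F.cpM F.csM d.pM d.sM F.n EM
  elastic : F.csM ≠ 0 → d.tP = d.tM
  acoustic : F.csM = 0 → d.tP = (2 * (F.n ⬝ᵥ d.tM)) • F.n - d.tM
  pP : d.pP = d.pM
  sP : d.sP = d.sM
  sM : F.csM = 0 → d.sM = 0

/-- On a boundary face the first variation of the flux terms of the state equation is minus the
gradient terms, apart from the variation of the test function. -/
lemma pairingVar_boundary {F : Interface} (hF : F.Regular) (hc : F.SameParameters) {q p : Trace}
    {d : Variation} {EM : M3} (hd : d.IsBoundary F EM) (hqv : q.vP = q.vM)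
    (hp : F.FreeTrace p) :
    F.pairingVar d q p.tM 0 p.vM = -F.gpair q p EM d.pM d.sM := by
  have hk := hF.k0_mul
  simp only [hc.ρ, hc.cp] at hk
  simp only [gpair, gs_eq hF.unit, gp, pairingVar]
  simp only [Trace.jumpS, Trace.jumpV_eq, Trace.diffV, hqv, hp.vel, hc.ρ, hc.cp, hc.cs, hd.pP,
    hd.sP, dotProduct_comm p.vM, sub_self, smul_zero, add_zero, mul_zero, sub_zero]
  by_cases hM : F.csM = 0
  · rw [Regular.k1_of_zero hM, hp.acoustic hM, hd.acoustic hM, hd.tM, hd.sM hM, hM]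
    simp only [varTraction, dotProduct_add, dotProduct_sub, dotProduct_smul, smul_eq_mul,
      hF.unit, dotProduct_zero]
    generalize F.k0 = k at *
    linear_combination (k * (F.n ⬝ᵥ q.tM + F.n ⬝ᵥ q.tP) * (F.n ⬝ᵥ p.vM) * F.ρM * d.pM
      - 2 * F.ρM * F.cpM * d.pM * EM.trace * (F.n ⬝ᵥ p.vM)) * hk
  · have h1 := hF.k1_mul hM
    simp only [hc.ρ, hc.cs] at h1
    rw [hp.elastic hM, hd.elastic hM, hd.tM]
    simp only [varTraction, dotProduct_add, dotProduct_sub, dotProduct_smul, smul_eq_mul,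
      hF.unit, tang_zero_left, dotProduct_zero, zero_add, tang_add_left, tang_add_right,
      tang_sub_left,
      tang_smul_left, tang_smul_right, tang_normal_left _ hF.unit]
    generalize F.k0 = k at *
    generalize F.k1 = κ at *
    linear_combination (k * (F.n ⬝ᵥ q.tM + F.n ⬝ᵥ q.tP) * (F.n ⬝ᵥ p.vM) * F.ρM * d.pM
      - (2 * F.ρM * F.cpM * d.pM * EM.trace
        + 4 * F.ρM * F.csM * d.sM * (F.n ⬝ᵥ EM *ᵥ F.n - EM.trace)) * (F.n ⬝ᵥ p.vM)) * hk
      + (κ * (tang F.n q.tM p.vM + tang F.n q.tP p.vM) * F.ρM * d.sM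
        - 4 * F.ρM * F.csM * d.sM * tang F.n (EM *ᵥ F.n) p.vM) * h1

/-! ### Flux differences, and the acoustic face term -/

section fluxDiff

lemma dcross_add (n a b : V3) : dcross n (a + b) = dcross n a + dcross n b := by
  simp only [dcross_eq, dotProduct_add]; module

lemma dcross_smul (n a : V3) (c : ℝ) : dcross n (c • a) = c • dcross n a := by
  simp only [dcross_eq, dotProduct_smul, smul_eq_mul]; module

lemma dcross_neg (n a : V3) : dcross n (-a) = -dcross n a := by
  simp only [dcross_eq, dotProduct_neg]; module

lemma dcross_sub (n a b : V3) : dcross n (a - b) = dcross n a - dcross n b := by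
  simp only [dcross_eq, dotProduct_sub]; module

lemma eq_normal_sub_dcross {n : V3} (hn : n ⬝ᵥ n = 1) (a : V3) :
    a = (n ⬝ᵥ a) • n - dcross n a := by
  rw [dcross_eq, hn]; module

lemma symPart_add (A B : M3) : symPart (A + B) = symPart A + symPart B := by
  simp only [symPart, Matrix.transpose_add]; module

lemma symPart_smul (c : ℝ) (A : M3) : symPart (c • A) = c • symPart A := by
  simp only [symPart, Matrix.transpose_smul]; module

lemma symPart_sub (A B : M3) : symPart (A - B) = symPart A - symPart B := by
  simp only [symPart, Matrix.transpose_sub]; module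

lemma symPart_vecMulVec_self (n : V3) : symPart (vecMulVec n n) = vecMulVec n n := by
  simp only [symPart, Matrix.transpose_vecMulVec]; module

variable {F : Interface} (hF : F.Regular) (p : Trace)
include hF

lemma adjFluxS_sub (hp : F.csM = 0 → ∀ z, tang F.n p.tM z = 0) :
    F.adjFluxS p - p.tM = F.adjFluxDiffS p := by
  have hk := hF.k0_mul
  rw [eq_normal_sub_dcross hF.unit p.tM]
  simp only [adjFluxS, adjFluxDiffS, Trace.jumpS, Trace.diffV, Trace.jumpV_eq, dcross_add,
    dcross_smul, dcross_neg, dotProduct_add, dotProduct_smul, dotProduct_neg, smul_eq_mul]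
  have hN : (F.k0 * (F.ρP * F.cpP * (F.n ⬝ᵥ p.tM) + F.ρM * F.cpM * -(F.n ⬝ᵥ p.tP) +
      F.ρM * F.cpM * (F.ρP * F.cpP) * (F.n ⬝ᵥ p.vM - F.n ⬝ᵥ p.vP))) • F.n
      - (F.n ⬝ᵥ p.tM) • F.n = (F.k0 * (-(F.n ⬝ᵥ p.tM + F.n ⬝ᵥ p.tP)
        + F.ρP * F.cpP * (F.n ⬝ᵥ p.vM - F.n ⬝ᵥ p.vP)) * (F.ρM * F.cpM)) • F.n := by
    rw [← sub_smul]
    congr 1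
    linear_combination (F.n ⬝ᵥ p.tM) * hk
  rw [← hN]
  by_cases hM : F.csM = 0
  · rw [Regular.k1_of_zero hM, dcross_eq_zero_of_tang hF.unit (hp hM)]
    module
  · have hT : F.k1 * (F.ρP * F.csP) = 1 - F.k1 * (F.ρM * F.csM) := by
      linear_combination hF.k1_mul hM
    have hT' : F.k1 * (F.ρM * F.csM) * (F.ρP * F.csP)
      = (1 - F.k1 * (F.ρM * F.csM)) * (F.ρM * F.csM) := by rw [← hT]; ring
    simp only [smul_add, smul_smul, smul_neg, hT, hT']
    module

lemma adjFluxV_sub (hM : F.csM ≠ 0) :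
    F.adjFluxV p - symPart (vecMulVec F.n p.vM) = F.adjFluxDiffV p := by
  have hk := hF.k0_mul
  have h1 := hF.k1_mul hM
  rw [eq_normal_sub_dcross hF.unit p.vM]
  simp only [adjFluxV, adjFluxDiffV, Trace.jumpS, Trace.diffV, Trace.jumpV_eq, dcross_add,
    dcross_smul, dcross_sub, dotProduct_add, dotProduct_smul, smul_eq_mul, vecMulVec_add,
    vecMulVec_sub, vecMulVec_smul, symPart_add, symPart_smul, symPart_sub, symPart_vecMulVec_self]
  have hN : F.k0 * (F.n ⬝ᵥ p.tM + F.n ⬝ᵥ p.tP + (F.ρM * F.cpM * (F.n ⬝ᵥ p.vM)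
        + F.ρP * F.cpP * (F.n ⬝ᵥ p.vP))) = F.k0 * (F.n ⬝ᵥ p.tM + F.n ⬝ᵥ p.tP
        - F.ρP * F.cpP * (F.n ⬝ᵥ p.vM - F.n ⬝ᵥ p.vP)) + F.n ⬝ᵥ p.vM := by
    linear_combination (F.n ⬝ᵥ p.vM) * hk
  have hT : F.k1 * (F.ρM * F.csM) = 1 - F.k1 * (F.ρP * F.csP) := by linear_combination h1
  rw [hN]
  simp only [smul_add, smul_smul, hT]
  module

lemma ddot_adjFluxV_sub {S : M3} (hS : S.IsSymm)
    (hp : F.csM = 0 → ∀ z, tang F.n (S *ᵥ F.n) z = 0) :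
    ddot (F.adjFluxV p - symPart (vecMulVec F.n p.vM)) S = ddot (F.adjFluxDiffV p) S := by
  by_cases hM : F.csM = 0
  · have hk := hF.k0_mul
    have ht := hp hM p.vM
    rw [tang] at ht
    simp only [adjFluxV, adjFluxDiffV, Regular.k1_of_zero hM, ddot_sub_left, ddot_add_left,
      ddot_smul_left, ddot_vecMulVec, ddot_symPart_vecMulVec _ _ hS, Trace.jumpV_eq,
      dotProduct_add, dotProduct_smul, smul_eq_mul]
    rw [dotProduct_comm p.vM]
    linear_combination (F.n ⬝ᵥ p.vM) * (F.n ⬝ᵥ S *ᵥ F.n) * hk - ht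
  · rw [adjFluxV_sub hF p hM]

/-- Between acoustic elements with equal parameters the gradient terms of the two sides of a face
add up to the acoustic face term. -/
lemma gp_add_swap (hc : F.SameParameters) {q : Trace} {EM EP HM HP : M3}
    (hq : q.tM = (F.ρM * F.cpM ^ 2 * EM.trace) • F.n)
    (hq' : q.tP = (F.ρM * F.cpM ^ 2 * EP.trace) • (-F.n))
    (hp : p.tM = (F.ρM * F.cpM ^ 2 * HM.trace) • F.n)
    (hp' : p.tP = (F.ρM * F.cpM ^ 2 * HP.trace) • (-F.n)) :
    F.gp q p EM + F.swap.gp q.swap p.swap EP =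
      acousticFaceTerm F.n F.ρM F.cpM EM.trace EP.trace HM.trace HP.trace q.vM q.vP p.vM p.vP := by
  have hk := hF.k0_mul
  have hρ := hF.ρM_pos.ne'
  have hcp := hF.cpM_pos.ne'
  simp only [hc.ρ, hc.cp] at hk
  have hk' : F.k0 = 1 / (2 * F.ρM * F.cpM) := by
    rw [eq_div_iff (by positivity)]; linear_combination hk
  simp only [gp, swap_k0]
  simp only [swap, Trace.swap, Trace.jumpS, Trace.jumpV_eq, hq, hq', hp, hp', hc.ρ, hc.cp,
    acousticFaceTerm, neg_dotProduct, dotProduct_neg, dotProduct_add, add_dotProduct,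
    smul_dotProduct, dotProduct_smul, smul_eq_mul, hF.unit, hk', dotProduct_comm p.vM,
    dotProduct_comm p.vP, dotProduct_comm q.vM, dotProduct_comm q.vP]
  field_simp
  ring

end fluxDiff

end Interface

end

end DGAE

namespace DGAE

noncomputable section

/-! ### Integrals of continuous functions over compact supports -/

section integrals

variable {μ : Measure V3} [IsFiniteMeasure μ] {K : Set V3}

omit [IsFiniteMeasure μ] in
lemma ae_mem_of_null_compl (hμ : μ Kᶜ = 0) : ∀ᵐ x ∂μ, x ∈ K := by
  rw [ae_iff]; exact hμ

lemma integrable_of_continuousOn (hK : IsCompact K) (hμ : μ Kᶜ = 0) {g : V3 → ℝ}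
    (hg : ContinuousOn g K) : Integrable g μ := by
  have h := hg.integrableOn_compact (μ := μ) hK
  rwa [IntegrableOn, Measure.restrict_eq_self_of_ae_mem (ae_mem_of_null_compl hμ)] at h

omit [IsFiniteMeasure μ] in
lemma integral_congr_on (hμ : μ Kᶜ = 0) {g g' : V3 → ℝ} (h : ∀ x ∈ K, g x = g' x) :
    ∫ x, g x ∂μ = ∫ x, g' x ∂μ :=
  integral_congr_ae ((ae_mem_of_null_compl hμ).mono h)

/-- Integrals of a jointly continuous function depend continuously on the parameter. -/
lemma continuousOn_integral_param (hK : IsCompact K) (hμ : μ Kᶜ = 0) {I : Set ℝ}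
    (hI : IsCompact I) {g : ℝ × V3 → ℝ} (hg : ContinuousOn g (I ×ˢ K)) :
    ContinuousOn (fun t => ∫ x, g (t, x) ∂μ) I := by
  obtain ⟨C, hC⟩ := (hI.prod hK).exists_bound_of_continuousOn hg
  have hslice : ∀ t ∈ I, ContinuousOn (fun x => g (t, x)) K := fun t ht =>
    hg.comp (by fun_prop) fun x hx => ⟨ht, hx⟩
  refine continuousOn_of_dominated (bound := fun _ => C) ?_ ?_ (integrable_const _) ?_
  · exact fun t ht => (integrable_of_continuousOn hK hμ (hslice t ht)).aestronglyMeasurable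
  · exact fun t ht => (ae_mem_of_null_compl hμ).mono fun x hx => hC _ ⟨ht, hx⟩
  · exact (ae_mem_of_null_compl hμ).mono fun x hx =>
      hg.comp (by fun_prop) fun t ht => ⟨ht, hx⟩

lemma abs_integral_le_of_forall_abs_le (hμ : μ Kᶜ = 0) {g : V3 → ℝ} {C : ℝ}
    (h : ∀ x ∈ K, |g x| ≤ C) : |∫ x, g x ∂μ| ≤ C * μ.real univ := by
  rw [← Real.norm_eq_abs]
  exact norm_integral_le_of_norm_le_const ((ae_mem_of_null_compl hμ).mono h)

end integrals

/-! ### Uniform first-order expansions -/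

/-- On `S` the functions `f θ` have at `θ = 0` the first-order expansion
`f θ = f0 + f1 θ + o(θ)`, uniformly on `S`; `f0` is bounded, `f1` is linear in `θ`, and all
functions are continuous on `S`. -/
structure UExp {Θ Z : Type*} [NormedAddCommGroup Θ] [NormedSpace ℝ Θ] [TopologicalSpace Z]
    (S : Set Z) (f : Θ → Z → ℝ) (f0 : Z → ℝ) (f1 : Θ → Z → ℝ) : Prop where
  cont : ∀ᶠ θ in 𝓝 0, ContinuousOn (f θ) S
  cont0 : ContinuousOn f0 S
  cont1 : ∀ θ, ContinuousOn (f1 θ) S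
  map_add : ∀ θ θ', ∀ z ∈ S, f1 (θ + θ') z = f1 θ z + f1 θ' z
  map_smul : ∀ (c : ℝ) θ, ∀ z ∈ S, f1 (c • θ) z = c * f1 θ z
  bdd0 : (fun p : Θ × Z => f0 p.2) =O[𝓝 0 ×ˢ 𝓟 S] fun _ => (1 : ℝ)
  bdd1 : (fun p : Θ × Z => f1 p.1 p.2) =O[𝓝 0 ×ˢ 𝓟 S] fun p => ‖p.1‖
  rem : (fun p : Θ × Z => f p.1 p.2 - f0 p.2 - f1 p.1 p.2) =o[𝓝 0 ×ˢ 𝓟 S] fun p => ‖p.1‖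

namespace UExp

variable {Θ Z : Type*} [NormedAddCommGroup Θ] [NormedSpace ℝ Θ] [TopologicalSpace Z]
  {S : Set Z} {f g : Θ → Z → ℝ} {f0 g0 : Z → ℝ} {f1 g1 : Θ → Z → ℝ}

omit [NormedSpace ℝ Θ] [TopologicalSpace Z] in
lemma norm_isLittleO_one : (fun p : Θ × Z => ‖p.1‖) =o[𝓝 0 ×ˢ 𝓟 S] fun _ => (1 : ℝ) := by
  rw [Asymptotics.isLittleO_one_iff]
  have : Tendsto (fun p : Θ × Z => p.1) (𝓝 0 ×ˢ 𝓟 S) (𝓝 0) := tendsto_fst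
  simpa using this.norm

lemma sub_isBigO (h : UExp S f f0 f1) :
    (fun p : Θ × Z => f p.1 p.2 - f0 p.2) =O[𝓝 0 ×ˢ 𝓟 S] fun p => ‖p.1‖ := by
  simpa using h.rem.isBigO.add h.bdd1

lemma isBigO_one (h : UExp S f f0 f1) :
    (fun p : Θ × Z => f p.1 p.2) =O[𝓝 0 ×ˢ 𝓟 S] fun _ => (1 : ℝ) := by
  simpa using (h.sub_isBigO.trans norm_isLittleO_one.isBigO).add h.bdd0

lemma congr (h : UExp S f f0 f1) (hf : ∀ᶠ θ in 𝓝 0, ∀ z ∈ S, f θ z = g θ z)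
    (h0 : ∀ z ∈ S, f0 z = g0 z) (h1 : ∀ θ, ∀ z ∈ S, f1 θ z = g1 θ z) : UExp S g g0 g1 where
  cont := by
    filter_upwards [h.cont, hf] with θ hθ hθ'
    exact hθ.congr fun z hz => (hθ' z hz).symm
  cont0 := h.cont0.congr fun z hz => (h0 z hz).symm
  cont1 θ := (h.cont1 θ).congr fun z hz => (h1 θ z hz).symm
  map_add θ θ' z hz := by simpa only [← h1 _ z hz] using h.map_add θ θ' z hz
  map_smul c θ z hz := by simpa only [← h1 _ z hz] using h.map_smul c θ z hz
  bdd0 := h.bdd0.congr' (eventually_prod_principal_iff.2 <| .of_forall fun _ => h0) .rfl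
  bdd1 := h.bdd1.congr' (eventually_prod_principal_iff.2 <| .of_forall fun θ => h1 θ) .rfl
  rem := h.rem.congr' (eventually_prod_principal_iff.2 <| by
    filter_upwards [hf] with θ hθ z hz
    simp only [hθ z hz, h0 z hz, h1 θ z hz]) .rfl

lemma const (hS : IsCompact S) (hg : ContinuousOn g0 S) :
    UExp (Θ := Θ) S (fun _ => g0) g0 (fun _ _ => 0) where
  cont := .of_forall fun _ => hg
  cont0 := hg
  cont1 _ := continuousOn_const
  map_add := by simp
  map_smul := by simp
  bdd0 := by
    obtain ⟨C, hC⟩ := hS.exists_bound_of_continuousOn hg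
    refine Asymptotics.IsBigO.of_bound C (eventually_prod_principal_iff.2 <| .of_forall ?_)
    intro _ z hz
    simpa using hC z hz
  bdd1 := Asymptotics.isBigO_zero _ _
  rem := by simp

lemma add (hf : UExp S f f0 f1) (hg : UExp S g g0 g1) :
    UExp S (fun θ z => f θ z + g θ z) (fun z => f0 z + g0 z) (fun θ z => f1 θ z + g1 θ z) where
  cont := by filter_upwards [hf.cont, hg.cont] with θ h h' using h.add h'
  cont0 := hf.cont0.add hg.cont0
  cont1 θ := (hf.cont1 θ).add (hg.cont1 θ)
  map_add θ θ' z hz := by rw [hf.map_add _ _ z hz, hg.map_add _ _ z hz]; ring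
  map_smul c θ z hz := by rw [hf.map_smul _ _ z hz, hg.map_smul _ _ z hz]; ring
  bdd0 := hf.bdd0.add hg.bdd0
  bdd1 := hf.bdd1.add hg.bdd1
  rem := (hf.rem.add hg.rem).congr_left fun p => by ring

lemma neg (hf : UExp S f f0 f1) :
    UExp S (fun θ z => -f θ z) (fun z => -f0 z) (fun θ z => -f1 θ z) where
  cont := by filter_upwards [hf.cont] with θ h using h.neg
  cont0 := hf.cont0.neg
  cont1 θ := (hf.cont1 θ).neg
  map_add θ θ' z hz := by rw [hf.map_add _ _ z hz]; ring
  map_smul c θ z hz := by rw [hf.map_smul _ _ z hz]; ring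
  bdd0 := hf.bdd0.neg_left
  bdd1 := hf.bdd1.neg_left
  rem := hf.rem.neg_left.congr_left fun p => by ring

lemma sub (hf : UExp S f f0 f1) (hg : UExp S g g0 g1) :
    UExp S (fun θ z => f θ z - g θ z) (fun z => f0 z - g0 z) (fun θ z => f1 θ z - g1 θ z) := by
  simpa only [sub_eq_add_neg] using hf.add hg.neg

lemma mul (hf : UExp S f f0 f1) (hg : UExp S g g0 g1) :
    UExp S (fun θ z => f θ z * g θ z) (fun z => f0 z * g0 z)
      (fun θ z => f1 θ z * g0 z + f0 z * g1 θ z) where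
  cont := by filter_upwards [hf.cont, hg.cont] with θ h h' using h.mul h'
  cont0 := hf.cont0.mul hg.cont0
  cont1 θ := ((hf.cont1 θ).mul hg.cont0).add (hf.cont0.mul (hg.cont1 θ))
  map_add θ θ' z hz := by rw [hf.map_add _ _ z hz, hg.map_add _ _ z hz]; ring
  map_smul c θ z hz := by rw [hf.map_smul _ _ z hz, hg.map_smul _ _ z hz]; ring
  bdd0 := by simpa using hf.bdd0.mul hg.bdd0
  bdd1 := by
    have h1 := hf.bdd1.mul hg.bdd0
    have h2 := hf.bdd0.mul hg.bdd1
    simp only [mul_one, one_mul] at h1 h2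
    exact h1.add h2
  rem := by
    have h1 := hf.rem.mul_isBigO hg.isBigO_one
    have h2 := hf.bdd0.mul_isLittleO hg.rem
    have h3 := hf.bdd1.mul_isLittleO (hg.sub_isBigO.trans_isLittleO norm_isLittleO_one)
    simp only [mul_one, one_mul] at h1 h2 h3
    exact ((h1.add h2).add h3).congr_left fun p => by ring

lemma sum {ι : Type*} (s : Finset ι) {f : ι → Θ → Z → ℝ} {f0 : ι → Z → ℝ} {f1 : ι → Θ → Z → ℝ}
    (h : ∀ i ∈ s, UExp S (f i) (f0 i) (f1 i)) :
    UExp S (fun θ z => ∑ i ∈ s, f i θ z) (fun z => ∑ i ∈ s, f0 i z)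
      (fun θ z => ∑ i ∈ s, f1 i θ z) where
  cont := by
    have := (Filter.eventually_all_finset s).2 fun i hi => (h i hi).cont
    filter_upwards [this] with θ hθ using continuousOn_finsetSum _ hθ
  cont0 := continuousOn_finsetSum _ fun i hi => (h i hi).cont0
  cont1 θ := continuousOn_finsetSum _ fun i hi => (h i hi).cont1 θ
  map_add θ θ' z hz := by
    rw [← Finset.sum_add_distrib]
    exact Finset.sum_congr rfl fun i hi => (h i hi).map_add _ _ z hz
  map_smul c θ z hz := by
    rw [Finset.mul_sum]
    exact Finset.sum_congr rfl fun i hi => (h i hi).map_smul _ _ z hz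
  bdd0 := Asymptotics.IsBigO.fun_sum fun i hi => (h i hi).bdd0
  bdd1 := Asymptotics.IsBigO.fun_sum fun i hi => (h i hi).bdd1
  rem := (Asymptotics.IsLittleO.fun_sum fun i hi => (h i hi).rem).congr_left fun p => by
    simp only [Finset.sum_sub_distrib]

lemma eventually_lower_bound (hf : UExp S f f0 f1) {κ : ℝ} (hκ : 0 < κ)
    (h : ∀ z ∈ S, κ ≤ f0 z) : ∀ᶠ θ in 𝓝 0, ∀ z ∈ S, κ / 2 ≤ f θ z := by
  have h1 := (hf.sub_isBigO.trans_isLittleO norm_isLittleO_one).bound (half_pos hκ)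
  rw [eventually_prod_principal_iff] at h1
  filter_upwards [h1] with θ hθ z hz
  have h2 := hθ z hz
  simp only [Real.norm_eq_abs, norm_one, mul_one] at h2
  linarith [(abs_le.1 h2).1, h z hz]

/-- Reciprocals of positive functions. On the compact set `S` the function `f0` is bounded below by
a positive constant, hence so is `f θ` for small `θ`. -/
lemma inv (hS : IsCompact S) (hf : UExp S f f0 f1) (h : ∀ z ∈ S, 0 < f0 z) :
    UExp S (fun θ z => 1 / f θ z) (fun z => 1 / f0 z)
      (fun θ z => -((1 / f0 z) ^ 2 * f1 θ z)) := by
  obtain ⟨κ, hκ, hκ'⟩ : ∃ κ > 0, ∀ z ∈ S, κ ≤ f0 z := by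
    rcases S.eq_empty_or_nonempty with rfl | hne
    · exact ⟨1, one_pos, by simp⟩
    · obtain ⟨z0, hz0, hmin⟩ := hS.exists_isMinOn hne hf.cont0
      exact ⟨f0 z0, h z0 hz0, fun z hz => hmin hz⟩
  have hlow := hf.eventually_lower_bound hκ hκ'
  have hc0 : ContinuousOn (fun z => 1 / f0 z) S :=
    continuousOn_const.div hf.cont0 fun z hz => (h z hz).ne'
  have hb0 := (UExp.const (Θ := Θ) hS hc0).bdd0
  have hb : (fun p : Θ × Z => 1 / f p.1 p.2) =O[𝓝 0 ×ˢ 𝓟 S] fun _ => (1 : ℝ) := by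
    refine Asymptotics.IsBigO.of_bound (2 / κ) (eventually_prod_principal_iff.2 ?_)
    filter_upwards [hlow] with θ hθ z hz
    have h1 := hθ z hz
    have h2 : 0 < f θ z := by linarith
    rw [Real.norm_eq_abs, abs_of_pos (by positivity), norm_one, mul_one,
      div_le_div_iff₀ h2 hκ]
    linarith
  refine ⟨?_, hc0, fun θ => ((hc0.pow 2).mul (hf.cont1 θ)).neg, ?_, ?_, hb0, ?_, ?_⟩
  · filter_upwards [hf.cont, hlow] with θ h1 h2
    exact continuousOn_const.div h1 fun z hz => by linarith [h2 z hz]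
  · intro θ θ' z hz
    simp only [hf.map_add _ _ z hz]; ring
  · intro c θ z hz
    simp only [hf.map_smul _ _ z hz]; ring
  · have := ((hb0.pow 2).mul hf.bdd1).neg_left
    simpa using this
  · -- `1/f - 1/f0 + f1/f0² = -(1/f0)(1/f)(f - f0 - f1) + (1/f0)²(1/f) f1 (f - f0)`
    have h1 := ((hb0.mul hb).mul_isLittleO hf.rem).neg_left
    have h2 := (((hb0.pow 2).mul hb).mul hf.bdd1).mul_isLittleO
      (hf.sub_isBigO.trans_isLittleO norm_isLittleO_one)
    simp only [one_pow, mul_one, one_mul] at h1 h2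
    refine (h1.add h2).congr' (eventually_prod_principal_iff.2 ?_) .rfl
    filter_upwards [hlow] with θ hθ z hz
    have h3 : f θ z ≠ 0 := by linarith [hθ z hz]
    have h4 := (h z hz).ne'
    field_simp
    ring

/-- Composition with a continuously differentiable function. -/
lemma comp_contDiff (hS : IsCompact S) (hf : UExp S f f0 f1) {r : ℝ → ℝ} (hr : ContDiff ℝ 1 r) :
    UExp S (fun θ z => r (f θ z)) (fun z => r (f0 z)) (fun θ z => deriv r (f0 z) * f1 θ z) := by
  have hr' : Continuous (deriv r) := hr.continuous_deriv le_rfl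
  have hc' : ContinuousOn (fun z => deriv r (f0 z)) S := hr'.comp_continuousOn hf.cont0
  have hb' := (UExp.const (Θ := Θ) hS hc').bdd0
  have hc0 : ContinuousOn (fun z => r (f0 z)) S := hr.continuous.comp_continuousOn hf.cont0
  refine ⟨?_, hc0, fun θ => hc'.mul (hf.cont1 θ), ?_, ?_, (UExp.const hS hc0).bdd0, ?_, ?_⟩
  · filter_upwards [hf.cont] with θ h using hr.continuous.comp_continuousOn h
  · intro θ θ' z hz
    simp only [hf.map_add _ _ z hz]; ring
  · intro c θ z hz
    simp only [hf.map_smul _ _ z hz]; ring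
  · have := hb'.mul hf.bdd1
    simpa using this
  · have h1 := hb'.mul_isLittleO hf.rem
    simp only [one_mul] at h1
    obtain ⟨C, hC⟩ := hS.exists_bound_of_continuousOn hf.cont0
    have huc : UniformContinuousOn (deriv r) (Icc (-(C + 1)) (C + 1)) :=
      isCompact_Icc.uniformContinuousOn_of_continuous hr'.continuousOn
    obtain ⟨B, hB, hB'⟩ := hf.sub_isBigO.exists_pos
    -- mean value inequality on the segment from `f0 z` to `f θ z`, of length at most `B ‖θ‖`
    have h2 : (fun p : Θ × Z => r (f p.1 p.2) - r (f0 p.2) - deriv r (f0 p.2)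
        * (f p.1 p.2 - f0 p.2)) =o[𝓝 0 ×ˢ 𝓟 S] fun p => ‖p.1‖ := by
      refine Asymptotics.isLittleO_iff.2 fun ε hε => ?_
      obtain ⟨δ, hδ, hδ'⟩ := Metric.uniformContinuousOn_iff.1 huc (ε / B) (by positivity)
      have h3 := (hf.sub_isBigO.trans_isLittleO norm_isLittleO_one).bound
        (lt_min (half_pos hδ) one_pos)
      have hmem : ∀ᶠ p in 𝓝 (0 : Θ) ×ˢ 𝓟 S, p.2 ∈ S :=
        eventually_prod_principal_iff.2 (.of_forall fun _ _ hz => hz)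
      filter_upwards [h3, hB'.bound, hmem] with p hp hpB hz
      obtain ⟨θ, z⟩ := p
      simp only [norm_one, mul_one, Real.norm_eq_abs, abs_norm] at hp hpB hz ⊢
      have hz0 := hC z hz
      rw [Real.norm_eq_abs, abs_le] at hz0
      have hp1 := abs_le.1 (hp.trans (min_le_right _ _))
      have hp2 := hp.trans (min_le_left _ _)
      have hmv : ‖r (f θ z) - r (f0 z) - deriv r (f0 z) * (f θ z - f0 z)‖
          ≤ ε / B * ‖f θ z - f0 z‖ := by
        have hd : ∀ y ∈ uIcc (f0 z) (f θ z), HasDerivWithinAt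
            (fun y => r y - deriv r (f0 z) * y) (deriv r y - deriv r (f0 z)) (uIcc (f0 z) (f θ z))
            y := fun y _ => by
          have := ((hr.differentiable one_ne_zero y).hasDerivAt.fun_sub
            ((hasDerivAt_id y).const_mul (deriv r (f0 z)))).hasDerivWithinAt
              (s := uIcc (f0 z) (f θ z))
          simpa using this
        have := (convex_uIcc (f0 z) (f θ z)).norm_image_sub_le_of_norm_hasDerivWithin_le
          (C := ε / B) hd (fun y hy => ?_) left_mem_uIcc right_mem_uIcc
        · rw [show r (f θ z) - r (f0 z) - deriv r (f0 z) * (f θ z - f0 z) =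
            r (f θ z) - deriv r (f0 z) * f θ z - (r (f0 z) - deriv r (f0 z) * f0 z) by ring]
          exact this
        · have hy1 : |y - f0 z| ≤ |f θ z - f0 z| := abs_sub_left_of_mem_uIcc hy
          have hy2 := abs_le.1 (hy1.trans (hp.trans (min_le_right _ _)))
          rw [← dist_eq_norm]
          refine (hδ' y ⟨by linarith, by linarith⟩ (f0 z) ⟨by linarith, by linarith⟩ ?_).le
          rw [Real.dist_eq]; linarith
      rw [Real.norm_eq_abs, Real.norm_eq_abs] at hmv
      calc _ ≤ ε / B * |f θ z - f0 z| := hmv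
        _ ≤ ε / B * (B * ‖θ‖) := by gcongr
        _ = ε * ‖θ‖ := by field_simp
    exact (h2.add h1).congr_left fun p => by ring

end UExp

/-- Uniform expansions may be integrated over the space variable. -/
lemma UExp.integral {Θ : Type*} [NormedAddCommGroup Θ] [NormedSpace ℝ Θ] {μ : Measure V3}
    [IsFiniteMeasure μ] {K : Set V3} {I : Set ℝ} (hK : IsCompact K) (hμ : μ Kᶜ = 0)
    (hI : IsCompact I) {f : Θ → ℝ × V3 → ℝ} {f0 : ℝ × V3 → ℝ} {f1 : Θ → ℝ × V3 → ℝ}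
    (h : UExp (I ×ˢ K) f f0 f1) :
    UExp I (fun θ t => ∫ x, f θ (t, x) ∂μ) (fun t => ∫ x, f0 (t, x) ∂μ)
      (fun θ t => ∫ x, f1 θ (t, x) ∂μ) := by
  have hint : ∀ {g : ℝ × V3 → ℝ}, ContinuousOn g (I ×ˢ K) → ∀ t ∈ I,
      Integrable (fun x => g (t, x)) μ := fun hg t ht =>
    integrable_of_continuousOn hK hμ (hg.comp (by fun_prop) fun x hx => ⟨ht, hx⟩)
  have hc0 := continuousOn_integral_param hK hμ hI h.cont0
  refine ⟨?_, hc0, fun θ => continuousOn_integral_param hK hμ hI (h.cont1 θ), ?_, ?_,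
    (UExp.const hI hc0).bdd0, ?_, ?_⟩
  · filter_upwards [h.cont] with θ hθ using continuousOn_integral_param hK hμ hI hθ
  · intro θ θ' t ht
    rw [← integral_add (hint (h.cont1 θ) t ht) (hint (h.cont1 θ') t ht)]
    exact integral_congr_on hμ fun x hx => h.map_add θ θ' _ ⟨ht, hx⟩
  · intro c θ t ht
    rw [← integral_const_mul]
    exact integral_congr_on hμ fun x hx => h.map_smul c θ _ ⟨ht, hx⟩
  · obtain ⟨C, hC⟩ := h.bdd1.bound
    refine Asymptotics.IsBigO.of_bound (C * μ.real univ) (eventually_prod_principal_iff.2 ?_)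
    rw [eventually_prod_principal_iff] at hC
    filter_upwards [hC] with θ hθ t ht
    have := abs_integral_le_of_forall_abs_le hμ (g := fun x => f1 θ (t, x)) (C := C * ‖‖θ‖‖)
      fun x hx => hθ (t, x) ⟨ht, hx⟩
    rw [Real.norm_eq_abs]; linarith
  · refine Asymptotics.isLittleO_iff.2 fun ε hε => eventually_prod_principal_iff.2 ?_
    have hpos : 0 < μ.real univ + 1 := by positivity
    have h1 := h.rem.bound (div_pos hε hpos)
    rw [eventually_prod_principal_iff] at h1
    filter_upwards [h1, h.cont] with θ hθ hcθ t ht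
    have := abs_integral_le_of_forall_abs_le hμ
      (g := fun x => f θ (t, x) - f0 (t, x) - f1 θ (t, x))
      (C := ε / (μ.real univ + 1) * ‖‖θ‖‖) fun x hx => hθ (t, x) ⟨ht, hx⟩
    rw [integral_sub (f := fun x => f θ (t, x) - f0 (t, x))
      ((hint hcθ t ht).sub (hint h.cont0 t ht)) (hint (h.cont1 θ) t ht), integral_sub (hint hcθ t ht) (hint h.cont0 t ht)] at this
    rw [Real.norm_eq_abs]
    refine this.trans ?_
    have h2 : μ.real univ / (μ.real univ + 1) ≤ 1 := by
      rw [div_le_one hpos]; linarith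
    calc ε / (μ.real univ + 1) * ‖‖θ‖‖ * μ.real univ
        = ε * ‖‖θ‖‖ * (μ.real univ / (μ.real univ + 1)) := by ring
      _ ≤ ε * ‖‖θ‖‖ * 1 := by gcongr
      _ = _ := by ring

end

end DGAE

namespace DGAE

noncomputable section

/-! ### Partial derivatives and regular families of functions -/

/-- The `k`-th partial derivative. -/
def pd (k : Fin 3) (u : V3 → ℝ) (x : V3) : ℝ := fderiv ℝ u x (Pi.single k 1)

section pd

variable {u v : V3 → ℝ} {x : V3} (k : Fin 3)

lemma pd_add (hu : DifferentiableAt ℝ u x) (hv : DifferentiableAt ℝ v x) :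
    pd k (fun y => u y + v y) x = pd k u x + pd k v x := by
  simp only [pd, fderiv_fun_add hu hv, _root_.add_apply]

lemma pd_sub (hu : DifferentiableAt ℝ u x) (hv : DifferentiableAt ℝ v x) :
    pd k (fun y => u y - v y) x = pd k u x - pd k v x := by
  simp only [pd, fderiv_fun_sub hu hv, _root_.sub_apply]

lemma pd_mul (hu : DifferentiableAt ℝ u x) (hv : DifferentiableAt ℝ v x) :
    pd k (fun y => u y * v y) x = pd k u x * v x + u x * pd k v x := by
  simp only [pd, fderiv_fun_mul hu hv, _root_.add_apply,
    _root_.smul_apply, smul_eq_mul]; ring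

lemma pd_const_mul (hu : DifferentiableAt ℝ u x) (c : ℝ) :
    pd k (fun y => c * u y) x = c * pd k u x := by
  simp only [pd, fderiv_const_mul hu, _root_.smul_apply, smul_eq_mul]

lemma pd_sum {ι : Type*} (s : Finset ι) {u : ι → V3 → ℝ}
    (hu : ∀ i ∈ s, DifferentiableAt ℝ (u i) x) :
    pd k (fun y => ∑ i ∈ s, u i y) x = ∑ i ∈ s, pd k (u i) x := by
  simp only [pd, fderiv_fun_sum hu, _root_.sum_apply]

lemma continuousOn_pd {K : Set V3} (hu : ∀ x ∈ K, ContDiffAt ℝ 1 u x) :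
    ContinuousOn (pd k u) K := fun x hx => by
  have h : ContDiffAt ℝ 0 (fderiv ℝ u) x := (hu x hx).fderiv_right (by norm_num)
  exact (h.continuousAt.clm_apply continuousAt_const).continuousWithinAt

/-- The derivatives of a continuously differentiable function that vanishes on an open set vanish
on the closure. -/
lemma pd_eq_zero_of_eqOn_zero {U : Set V3} (hU : IsOpen U)
    (hu : ∀ x ∈ closure U, ContDiffAt ℝ 1 u x) (h : ∀ x ∈ U, u x = 0) (hx : x ∈ closure U) :
    pd k u x = 0 := by
  have h1 : EqOn (pd k u) (fun _ => 0) U := fun y hy => by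
    have : u =ᶠ[𝓝 y] fun _ => 0 := by
      filter_upwards [hU.mem_nhds hy] with z hz using h z hz
    simp only [pd, this.fderiv_eq]
    simp
  exact h1.of_subset_closure (continuousOn_pd k hu) continuousOn_const subset_closure
    subset_rfl hx

end pd

/-- The functions `u t`, `t ∈ I`, are continuously differentiable near the points of `K`,
and they and their derivatives are jointly continuous on `I × K`. -/
structure RegOn (I : Set ℝ) (K : Set V3) (u : ℝ → V3 → ℝ) : Prop where
  smooth : ∀ t ∈ I, ∀ x ∈ K, ContDiffAt ℝ 1 (u t) x
  cont : ContinuousOn (fun z : ℝ × V3 => u z.1 z.2) (I ×ˢ K)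
  cont_pd : ∀ k, ContinuousOn (fun z : ℝ × V3 => pd k (u z.1) z.2) (I ×ˢ K)

namespace RegOn

variable {I : Set ℝ} {K : Set V3} {u : ℝ → V3 → ℝ}

lemma diff (h : RegOn I K u) {t : ℝ} (ht : t ∈ I) {x : V3} (hx : x ∈ K) :
    DifferentiableAt ℝ (u t) x := (h.smooth t ht x hx).differentiableAt one_ne_zero

/-- Linear combinations of fixed functions with continuous coefficients. -/
lemma of_sum {N : ℕ} {a : Fin N → ℝ → ℝ} {φ : Fin N → V3 → ℝ}
    (ha : ∀ k, ContinuousOn (a k) I) (hφ : ∀ k, ∀ x ∈ K, ContDiffAt ℝ 1 (φ k) x)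
    (h : ∀ t ∈ I, u t = fun x => ∑ k, a k t * φ k x) : RegOn I K u where
  smooth t ht x hx := by
    rw [h t ht]
    exact ContDiffAt.sum fun k _ => contDiffAt_const.mul (hφ k x hx)
  cont := by
    have : ContinuousOn (fun z : ℝ × V3 => ∑ k, a k z.1 * φ k z.2) (I ×ˢ K) :=
      continuousOn_finsetSum _ fun k _ =>
        ((ha k).comp continuousOn_fst fun z hz => hz.1).mul
          (ContinuousOn.comp (fun x hx => (hφ k x hx).continuousAt.continuousWithinAt)
            continuousOn_snd fun z hz => hz.2)
    exact this.congr fun z hz => by simp only [h z.1 hz.1]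
  cont_pd j := by
    have : ContinuousOn (fun z : ℝ × V3 => ∑ k, a k z.1 * pd j (φ k) z.2) (I ×ˢ K) :=
      continuousOn_finsetSum _ fun k _ =>
        ((ha k).comp continuousOn_fst fun z hz => hz.1).mul
          ((continuousOn_pd j (hφ k)).comp continuousOn_snd fun z hz => hz.2)
    refine this.congr fun z hz => ?_
    have hd : ∀ k, DifferentiableAt ℝ (φ k) z.2 := fun k =>
      (hφ k _ hz.2).differentiableAt one_ne_zero
    simp only [h z.1 hz.1]
    rw [pd_sum _ _ fun k _ => (hd k).const_mul _]
    exact Finset.sum_congr rfl fun k _ => pd_const_mul _ (hd k) _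

lemma static {φ : V3 → ℝ} (hφ : ∀ x ∈ K, ContDiffAt ℝ 1 φ x) : RegOn I K fun _ => φ :=
  of_sum (N := 1) (a := fun _ _ => 1) (φ := fun _ => φ) (fun _ => continuousOn_const)
    (fun _ => hφ) fun t _ => by simp

end RegOn

section mesh

variable {El IF BF : Type*} (D : Discretization El IF BF)

namespace Discretization

lemma isCompact_cell (e : El) : IsCompact (closure (D.cell e)) :=
  (D.dom_bounded.subset (D.cell_subset e)).isCompact_closure

lemma face_subset_inner (s : Side IF BF) :
    D.face (Mesh.faceOf s) ⊆ closure (D.cell (D.inner s)) := by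
  refine Subset.trans ?_ frontier_subset_closure
  rw [D.frontier_cell]
  rcases s with ⟨f, _ | _⟩ | b
  · exact subset_union_of_subset_left (subset_biUnion_of_mem (u := fun f => D.face (Sum.inl f))
      (show f ∈ {g | D.left g = D.right f ∨ D.right g = D.right f} from Or.inr rfl)) _
  · exact subset_union_of_subset_left (subset_biUnion_of_mem (u := fun f => D.face (Sum.inl f))
      (show f ∈ {g | D.left g = D.left f ∨ D.right g = D.left f} from Or.inl rfl)) _
  · exact subset_union_of_subset_right (subset_biUnion_of_mem (u := fun b => D.face (Sum.inr b))
      (show b ∈ {c | D.own c = D.own b} from rfl)) _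

lemma face_subset_outer (s : Side IF BF) :
    D.face (Mesh.faceOf s) ⊆ closure (D.cell (D.outer s)) := by
  rcases s with ⟨f, _ | _⟩ | b
  · exact D.face_subset_inner (Sum.inl (f, true))
  · exact D.face_subset_inner (Sum.inl (f, false))
  · exact D.face_subset_inner (Sum.inr b)

lemma isCompact_face (s : Side IF BF) : IsCompact (D.face (Mesh.faceOf s)) :=
  (D.isCompact_cell _).of_isClosed_subset (D.face_closed _) (D.face_subset_inner s)

lemma continuousOn_outNormal (s : Side IF BF) :
    ContinuousOn (D.outNormal s) (D.face (Mesh.faceOf s)) := by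
  rcases s with ⟨f, _ | _⟩ | b
  · exact (D.normal_cont (Sum.inl f)).neg
  · exact D.normal_cont (Sum.inl f)
  · exact D.normal_cont (Sum.inr b)

lemma outNormal_unit (s : Side IF BF) {x : V3} (hx : x ∈ D.face (Mesh.faceOf s)) :
    D.outNormal s x ⬝ᵥ D.outNormal s x = 1 := by
  rcases s with ⟨f, _ | _⟩ | b
  · have := D.normal_unit (Sum.inl f) x hx
    simpa [Mesh.outNormal] using this
  · exact D.normal_unit (Sum.inl f) x hx
  · exact D.normal_unit (Sum.inr b) x hx

instance (e : El) : IsFiniteMeasure (D.vol e) := D.vol_finite e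

instance (s : Side IF BF) : IsFiniteMeasure (D.surfOf s) := D.surf_finite _

lemma surfOf_supp (s : Side IF BF) : D.surfOf s (D.face (Mesh.faceOf s))ᶜ = 0 := D.surf_supp _

end Discretization

/-- Families of discrete strains that are jointly continuous in time and space, with their
derivatives. -/
structure RegT (I : Set ℝ) (E : ℝ → TField El) : Prop where
  mem : ∀ t ∈ I, E t ∈ D.Ph
  reg : ∀ e i j, RegOn I (closure (D.cell e)) fun t x => E t e x i j

/-- Families of discrete velocities that are jointly continuous in time and space, with their
derivatives. -/
structure RegV (I : Set ℝ) (v : ℝ → VField El) : Prop where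
  mem : ∀ t ∈ I, v t ∈ D.Qh
  reg : ∀ e i, RegOn I (closure (D.cell e)) fun t x => v t e x i

variable {D}

lemma Ph_smooth {E : TField El} (hE : E ∈ D.Ph) (e : El) (i j : Fin 3) :
    ∀ x ∈ closure (D.cell e), ContDiffAt ℝ 1 (fun x => E e x i j) x :=
  D.VP_smooth e _ ((hE e).1 i j)

lemma Qh_smooth {v : VField El} (hv : v ∈ D.Qh) (e : El) (i : Fin 3) :
    ∀ x ∈ closure (D.cell e), ContDiffAt ℝ 1 (fun x => v e x i) x :=
  D.VQ_smooth e _ (hv e i)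

lemma RegT.static {I : Set ℝ} {E : TField El} (hE : E ∈ D.Ph) : RegT D I fun _ => E :=
  ⟨fun _ _ => hE, fun e i j => RegOn.static (Ph_smooth hE e i j)⟩

lemma RegV.static {I : Set ℝ} {v : VField El} (hv : v ∈ D.Qh) : RegV D I fun _ => v :=
  ⟨fun _ _ => hv, fun e i => RegOn.static (Qh_smooth hv e i)⟩

lemma RegT.of_sum {I : Set ℝ} {N : ℕ} {a : Fin N → ℝ → ℝ} {φ : Fin N → TField El}
    (hφ : ∀ k, φ k ∈ D.Ph) (ha : ∀ k, ContinuousOn (a k) I) {E : ℝ → TField El}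
    (h : ∀ t ∈ I, E t = ∑ k, a k t • φ k) : RegT D I E where
  mem t ht := by
    rw [h t ht]; exact Submodule.sum_mem _ fun k _ => Submodule.smul_mem _ _ (hφ k)
  reg e i j := RegOn.of_sum ha (fun k => Ph_smooth (hφ k) e i j) fun t ht => by
    ext x
    simp only [h t ht, Finset.sum_apply, Pi.smul_apply, Matrix.sum_apply, Matrix.smul_apply,
      smul_eq_mul]

lemma RegV.of_sum {I : Set ℝ} {N : ℕ} {a : Fin N → ℝ → ℝ} {φ : Fin N → VField El}
    (hφ : ∀ k, φ k ∈ D.Qh) (ha : ∀ k, ContinuousOn (a k) I) {v : ℝ → VField El}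
    (h : ∀ t ∈ I, v t = ∑ k, a k t • φ k) : RegV D I v where
  mem t ht := by
    rw [h t ht]; exact Submodule.sum_mem _ fun k _ => Submodule.smul_mem _ _ (hφ k)
  reg e i := RegOn.of_sum ha (fun k => Qh_smooth (hφ k) e i) fun t ht => by
    ext x
    simp only [h t ht, Finset.sum_apply, Pi.smul_apply, smul_eq_mul]

/-- The time derivative of a continuously differentiable curve, as a continuous curve on the
closed time interval. -/
structure HasDt {F : Type*} [AddCommGroup F] [Module ℝ F] (T : ℝ) (u u' : ℝ → F) : Prop where
  hasDeriv : ∀ {V : Type} [NormedAddCommGroup V] [NormedSpace ℝ V] (L : F →ₗ[ℝ] V),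
    ∀ t ∈ Icc 0 T, HasDerivWithinAt (fun s => L (u s)) (L (u' t)) (Icc 0 T) t
  cont : ∀ {V : Type} [NormedAddCommGroup V] [NormedSpace ℝ V] (L : F →ₗ[ℝ] V),
    ContinuousOn (fun s => L (u' s)) (Icc 0 T)

lemma IsC1Curve.exists_sum {F : Type*} [AddCommGroup F] [Module ℝ F] {T : ℝ} (hT : 0 < T)
    {S : Submodule ℝ F} {u : ℝ → F} (h : IsC1Curve T S u) :
    ∃ (N : ℕ) (φ : Fin N → F) (a a' : Fin N → ℝ → ℝ), (∀ k, φ k ∈ S) ∧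
      (∀ k, ContinuousOn (a k) (Icc 0 T)) ∧ (∀ k, ContinuousOn (a' k) (Icc 0 T)) ∧
      (∀ t ∈ Icc 0 T, u t = ∑ k, a k t • φ k) ∧
      (∀ k, ∀ t ∈ Ioo 0 T, HasDerivAt (a k) (a' k t) t) ∧
      HasDt T u fun t => ∑ k, a' k t • φ k := by
  obtain ⟨N, φ, a, hφ, ha, hu⟩ := h
  have hd : ∀ k, ∀ t ∈ Icc 0 T, HasDerivWithinAt (a k) (derivWithin (a k) (Icc 0 T) t) (Icc 0 T) t :=
    fun k t ht => ((ha k).differentiableOn one_ne_zero t ht).hasDerivWithinAt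
  have hc : ∀ k, ContinuousOn (fun t => derivWithin (a k) (Icc 0 T) t) (Icc 0 T) := fun k =>
    (ha k).continuousOn_derivWithin (uniqueDiffOn_Icc hT) le_rfl
  refine ⟨N, φ, a, fun k t => derivWithin (a k) (Icc 0 T) t, hφ, fun k => (ha k).continuousOn, hc,
    hu, fun k t ht => (hd k t (Ioo_subset_Icc_self ht)).hasDerivAt (Icc_mem_nhds ht.1 ht.2), ?_, ?_⟩
  · intro V _ _ L t ht
    have h1 : HasDerivWithinAt (fun s => ∑ k, a k s • L (φ k))
        (∑ k, derivWithin (a k) (Icc 0 T) t • L (φ k)) (Icc 0 T) t :=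
      HasDerivWithinAt.fun_sum fun k _ => (hd k t ht).smul_const _
    simp only [map_sum, map_smul]
    exact h1.congr (fun s hs => by simp [hu s hs]) (by simp [hu t ht])
  · intro V _ _ L
    simp only [map_sum, map_smul]
    exact continuousOn_finsetSum _ fun k _ => (hc k).smul continuousOn_const

lemma IsC1Curve.regT {T : ℝ} (hT : 0 < T) {E : ℝ → TField El} (h : IsC1Curve T D.Ph E) :
    RegT D (Icc 0 T) E ∧ ∃ E', RegT D (Icc 0 T) E' ∧ HasDt T E E' ∧
      ∀ t ∈ Ioo 0 T, dtT E t = E' t := by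
  obtain ⟨N, φ, a, a', hφ, ha, ha', hu, hd, hdt⟩ := h.exists_sum hT
  refine ⟨RegT.of_sum hφ ha hu, _, RegT.of_sum hφ ha' fun t _ => rfl, hdt, fun t ht => ?_⟩
  ext e x i j
  simp only [dtT, Matrix.of_apply, Finset.sum_apply, Pi.smul_apply, Matrix.sum_apply,
    Matrix.smul_apply, smul_eq_mul]
  have h1 : HasDerivAt (fun s => ∑ k, a k s * φ k e x i j) (∑ k, a' k t * φ k e x i j) t :=
    HasDerivAt.fun_sum fun k _ => (hd k t ht).mul_const _
  refine (h1.congr_of_eventuallyEq ?_).deriv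
  filter_upwards [Icc_mem_nhds ht.1 ht.2] with s hs
  simp only [hu s hs, Finset.sum_apply, Pi.smul_apply, Matrix.sum_apply, Matrix.smul_apply,
    smul_eq_mul]

lemma IsC1Curve.regV {T : ℝ} (hT : 0 < T) {v : ℝ → VField El} (h : IsC1Curve T D.Qh v) :
    RegV D (Icc 0 T) v ∧ ∃ v', RegV D (Icc 0 T) v' ∧ HasDt T v v' ∧
      ∀ t ∈ Ioo 0 T, dtV v t = v' t := by
  obtain ⟨N, φ, a, a', hφ, ha, ha', hu, hd, hdt⟩ := h.exists_sum hT
  refine ⟨RegV.of_sum hφ ha hu, _, RegV.of_sum hφ ha' fun t _ => rfl, hdt, fun t ht => ?_⟩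
  ext e x i
  simp only [dtV, Finset.sum_apply, Pi.smul_apply, smul_eq_mul]
  have h1 : HasDerivAt (fun s => ∑ k, a k s * φ k e x i) (∑ k, a' k t * φ k e x i) t :=
    HasDerivAt.fun_sum fun k _ => (hd k t ht).mul_const _
  refine (h1.congr_of_eventuallyEq ?_).deriv
  filter_upwards [Icc_mem_nhds ht.1 ht.2] with s hs
  simp only [hu s hs, Finset.sum_apply, Pi.smul_apply, smul_eq_mul]

end mesh

end

end DGAE

namespace DGAE

noncomputable section

/-! ### Perturbed media -/

/-- An affine function of finitely many parameters. -/
lemma UExp.affine {Z : Type*} [TopologicalSpace Z] {S : Set Z} (hS : IsCompact S) {N : ℕ}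
    {c : Z → ℝ} {φ : Fin N → Z → ℝ} (hc : ContinuousOn c S) (hφ : ∀ i, ContinuousOn (φ i) S) :
    UExp (Θ := Fin N → ℝ) S (fun θ z => c z + ∑ i, θ i * φ i z) c
      (fun θ z => ∑ i, θ i * φ i z) := by
  have h : ∀ i, UExp (Θ := Fin N → ℝ) S (fun θ z => θ i * φ i z) (fun _ => 0)
      (fun θ z => θ i * φ i z) := fun i => by
    refine ⟨.of_forall fun θ => continuousOn_const.mul (hφ i), continuousOn_const,
      fun θ => continuousOn_const.mul (hφ i), fun θ θ' z _ => ?_, fun c θ z _ => ?_, ?_, ?_, ?_⟩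
    · simp only [Pi.add_apply]; ring
    · simp only [Pi.smul_apply, smul_eq_mul]; ring
    · exact Asymptotics.isBigO_zero _ _
    · obtain ⟨C, hC⟩ := hS.exists_bound_of_continuousOn (hφ i)
      refine Asymptotics.IsBigO.of_bound C (eventually_prod_principal_iff.2 (.of_forall ?_))
      intro θ z hz
      rw [norm_mul, norm_norm, mul_comm]
      exact mul_le_mul (hC z hz) (norm_le_pi_norm θ i) (norm_nonneg _)
        ((norm_nonneg _).trans (hC z hz))
    · simp
  refine ((UExp.const hS hc).add (UExp.sum Finset.univ fun i _ => h i)).congr ?_ ?_ ?_ <;> simp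

section media

variable {El IF BF : Type*} {D : Discretization El IF BF} {N : ℕ}

/-- Simultaneous perturbation of both wave speeds. -/
def Medium.perturb (m : Medium El) (φ χ : Fin N → SField El) (θ : Fin N → ℝ) : Medium El :=
  { m with cp := m.cp + ∑ i, θ i • φ i, cs := m.cs + ∑ i, θ i • χ i }

/-- The first variation of `lam` in the directions `c` of `cp` and `c'` of `cs`. -/
def Medium.lamVar (m : Medium El) (c c' : SField El) : SField El := fun e x =>
  2 * (m.ρ e x * m.cp e x * c e x) - 4 * (m.ρ e x * m.cs e x * c' e x)

/-- The first variation of `mu` in the direction `c'` of `cs`. -/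
def Medium.muVar (m : Medium El) (c' : SField El) : SField El := fun e x =>
  2 * (m.ρ e x * m.cs e x * c' e x)

lemma Medium.C_apply (m : Medium El) (e : El) (x : V3) (A : M3) (i j : Fin 3) :
    m.C e x A i j = m.lam e x * A.trace * (1 : M3) i j + 2 * m.mu e x * A i j := by
  simp only [Medium.C, Matrix.add_apply, Matrix.smul_apply, smul_eq_mul]

lemma Medium.C_isSymm (m : Medium El) (e : El) (x : V3) {A : M3} (hA : A.IsSymm) :
    (m.C e x A).IsSymm := (Matrix.isSymm_one.smul _).add (hA.smul _)

lemma Medium.ddot_C (m : Medium El) (e : El) (x : V3) (A B : M3) :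
    ddot A (m.C e x B) = m.lam e x * (A.trace * B.trace) + m.mu e x * (2 * ddot A B) := by
  simp only [Medium.C, ddot_add_right, ddot_smul_right, ddot_one_right]; ring

lemma Medium.Cp_add_Cs (m : Medium El) (c c' : SField El) (e : El) (x : V3) (A : M3) :
    m.Cp c e x A + m.Cs c' e x A =
      (m.lamVar c c' e x * A.trace) • (1 : M3) + (2 * m.muVar c' e x) • A := by
  simp only [Medium.Cp, Medium.Cs, Medium.lamVar, Medium.muVar]; module

lemma Medium.ddot_Cp_add_Cs (m : Medium El) (c c' : SField El) (e : El) (x : V3) (A B : M3) :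
    ddot A (m.Cp c e x B + m.Cs c' e x B) =
      m.lamVar c c' e x * (A.trace * B.trace) + m.muVar c' e x * (2 * ddot A B) := by
  rw [Medium.Cp_add_Cs]
  simp only [ddot_add_right, ddot_smul_right, ddot_one_right]; ring

lemma sum_dir_apply (φ : Fin N → SField El) (θ : Fin N → ℝ) (e : El) (x : V3) :
    (∑ i, θ i • φ i) e x = ∑ i, θ i * φ i e x := by
  simp only [Finset.sum_apply, Pi.smul_apply, smul_eq_mul]

lemma PiecewiseC1.sum {φ : Fin N → SField El} (hφ : ∀ i, PiecewiseC1 D.toMesh (φ i))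
    (θ : Fin N → ℝ) : PiecewiseC1 D.toMesh (∑ i, θ i • φ i) := fun e x hx => by
  have : (∑ i, θ i • φ i) e = fun y => ∑ i, θ i * φ i e y := by
    ext y; exact sum_dir_apply φ θ e y
  rw [this]
  exact ContDiffAt.sum fun i _ => contDiffAt_const.mul (hφ i e x hx)

lemma PiecewiseC1.diff {c : SField El} (hc : PiecewiseC1 D.toMesh c) {e : El} {x : V3}
    (hx : x ∈ closure (D.cell e)) : DifferentiableAt ℝ (c e) x :=
  (hc e x hx).differentiableAt one_ne_zero

lemma PiecewiseC1.continuousOn {c : SField El} (hc : PiecewiseC1 D.toMesh c) (e : El) :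
    ContinuousOn (c e) (closure (D.cell e)) :=
  fun x hx => (hc e x hx).continuousAt.continuousWithinAt

/-- Admissible directions of perturbation: `φ` for the primary wave speed, `χ` for the secondary
wave speed, which is perturbed in elastic elements only. -/
structure IsDirection (D : Discretization El IF BF) (m : Medium El) (φ χ : Fin N → SField El) :
    Prop where
  smooth_p : ∀ i, PiecewiseC1 D.toMesh (φ i)
  smooth_s : ∀ i, PiecewiseC1 D.toMesh (χ i)
  vanish : ∀ i e, ∀ x ∈ closure (D.cell e), m.cs e x = 0 → χ i e x = 0

/-- The smoothness part of admissibility. -/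
structure Medium.IsC1 (D : Discretization El IF BF) (m : Medium El) : Prop where
  ρ : PiecewiseC1 D.toMesh m.ρ
  cp : PiecewiseC1 D.toMesh m.cp
  cs : PiecewiseC1 D.toMesh m.cs

lemma _root_.DGAE.Admissible.isC1 {m : Medium El} (hm : Admissible D.toMesh m) : m.IsC1 D :=
  ⟨hm.smooth_ρ, hm.smooth_cp, hm.smooth_cs⟩

namespace Medium.IsC1

variable {m : Medium El} (hm : m.IsC1 D)
include hm

lemma perturb {φ χ : Fin N → SField El} (hφ : ∀ i, PiecewiseC1 D.toMesh (φ i))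
    (hχ : ∀ i, PiecewiseC1 D.toMesh (χ i)) (θ : Fin N → ℝ) : (m.perturb φ χ θ).IsC1 D :=
  ⟨hm.ρ, fun e x hx => (hm.cp e x hx).add (PiecewiseC1.sum hφ θ e x hx),
    fun e x hx => (hm.cs e x hx).add (PiecewiseC1.sum hχ θ e x hx)⟩

lemma lam : PiecewiseC1 D.toMesh m.lam := fun e x hx =>
  (hm.ρ e x hx).mul (((hm.cp e x hx).pow 2).sub (contDiffAt_const.mul ((hm.cs e x hx).pow 2)))

lemma mu : PiecewiseC1 D.toMesh m.mu := fun e x hx => (hm.ρ e x hx).mul ((hm.cs e x hx).pow 2)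

variable {e : El} {x : V3} (hx : x ∈ closure (D.cell e)) (k : Fin 3)
include hx

lemma pd_mu : pd k (m.mu e) x = pd k (m.ρ e) x * (m.cs e x * m.cs e x)
    + m.ρ e x * (2 * (m.cs e x * pd k (m.cs e) x)) := by
  have h : m.mu e = fun y => m.ρ e y * (m.cs e y * m.cs e y) := by
    ext y; simp only [Medium.mu, sq]
  rw [h, pd_mul k (hm.ρ.diff hx) ((hm.cs.diff hx).fun_mul (hm.cs.diff hx)),
    pd_mul k (hm.cs.diff hx) (hm.cs.diff hx)]
  ring

lemma pd_lam : pd k (m.lam e) x = pd k (m.ρ e) x *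
      (m.cp e x * m.cp e x - 2 * (m.cs e x * m.cs e x))
    + m.ρ e x * (2 * (m.cp e x * pd k (m.cp e) x) - 4 * (m.cs e x * pd k (m.cs e) x)) := by
  have h : m.lam e = fun y => m.ρ e y * (m.cp e y * m.cp e y - 2 * (m.cs e y * m.cs e y)) := by
    ext y; simp only [Medium.lam, sq]
  have hs := (hm.cs.diff hx).fun_mul (hm.cs.diff hx)
  have hp := (hm.cp.diff hx).fun_mul (hm.cp.diff hx)
  rw [h, pd_mul k (hm.ρ.diff hx) (hp.fun_sub (hs.const_mul 2)), pd_sub k hp (hs.const_mul 2),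
    pd_const_mul k hs, pd_mul k (hm.cp.diff hx) (hm.cp.diff hx),
    pd_mul k (hm.cs.diff hx) (hm.cs.diff hx)]
  ring

lemma pd_mul₃ {b c : SField El} (hb : PiecewiseC1 D.toMesh b) (hc : PiecewiseC1 D.toMesh c) :
    pd k (fun y => m.ρ e y * b e y * c e y) x = pd k (m.ρ e) x * (b e x * c e x)
      + m.ρ e x * (pd k (b e) x * c e x + b e x * pd k (c e) x) := by
  rw [pd_mul k ((hm.ρ.diff hx).fun_mul (hb.diff hx)) (hc.diff hx),
    pd_mul k (hm.ρ.diff hx) (hb.diff hx)]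
  ring

omit k in
lemma diff_mul₃ {b c : SField El} (hb : PiecewiseC1 D.toMesh b) (hc : PiecewiseC1 D.toMesh c) :
    DifferentiableAt ℝ (fun y => m.ρ e y * b e y * c e y) x :=
  ((hm.ρ.diff hx).fun_mul (hb.diff hx)).fun_mul (hc.diff hx)

lemma pd_muVar {c' : SField El} (hc' : PiecewiseC1 D.toMesh c') :
    pd k (m.muVar c' e) x = 2 * pd k (fun y => m.ρ e y * m.cs e y * c' e y) x :=
  pd_const_mul k (hm.diff_mul₃ hx hm.cs hc') 2

lemma pd_lamVar {c c' : SField El} (hc : PiecewiseC1 D.toMesh c)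
    (hc' : PiecewiseC1 D.toMesh c') :
    pd k (m.lamVar c c' e) x = 2 * pd k (fun y => m.ρ e y * m.cp e y * c e y) x
      - 4 * pd k (fun y => m.ρ e y * m.cs e y * c' e y) x := by
  have h1 := hm.diff_mul₃ hx hm.cp hc
  have h2 := hm.diff_mul₃ hx hm.cs hc'
  rw [← pd_const_mul k h1, ← pd_const_mul k h2, ← pd_sub k (h1.const_mul 2) (h2.const_mul 4)]
  rfl

end Medium.IsC1

section expansions

variable {m : Medium El} (hm : m.IsC1 D) {φ χ : Fin N → SField El} (e : El) {I : Set ℝ}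
  {K : Set V3}

lemma continuousOn_comp_snd {Y : Type*} [TopologicalSpace Y] {u : V3 → Y} (hu : ContinuousOn u K) :
    ContinuousOn (fun z : ℝ × V3 => u z.2) (I ×ˢ K) :=
  hu.comp continuousOn_snd fun _ hz => hz.2

/-- Expansion of a perturbed wave speed and of its derivatives. -/
lemma uexp_speed (hI : IsCompact I) (hK : IsCompact K) (hKe : K ⊆ closure (D.cell e))
    {c : SField El} (hc : PiecewiseC1 D.toMesh c) (hφ : ∀ i, PiecewiseC1 D.toMesh (φ i)) :
    UExp (I ×ˢ K) (fun (θ : Fin N → ℝ) z => (c + ∑ i, θ i • φ i) e z.2) (fun z => c e z.2)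
      (fun θ z => (∑ i, θ i • φ i) e z.2) := by
  refine (UExp.affine (hI.prod hK) (continuousOn_comp_snd ((hc.continuousOn e).mono hKe))
    fun i => continuousOn_comp_snd (((hφ i).continuousOn e).mono hKe)).congr ?_ ?_ ?_
  · refine .of_forall fun θ z _ => ?_
    simp only [Pi.add_apply, sum_dir_apply]
  · intro z _; rfl
  · intro θ z _
    simp only [sum_dir_apply]

lemma pd_sum_dir (hφ : ∀ i, PiecewiseC1 D.toMesh (φ i)) (θ : Fin N → ℝ) {x : V3}
    (hx : x ∈ closure (D.cell e)) (k : Fin 3) :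
    pd k ((∑ i, θ i • φ i) e) x = ∑ i, θ i * pd k (φ i e) x := by
  have : (∑ i, θ i • φ i) e = fun y => ∑ i, θ i * φ i e y := by
    ext y; exact sum_dir_apply φ θ e y
  rw [this, pd_sum k _ fun i _ => ((hφ i).diff hx).const_mul _]
  exact Finset.sum_congr rfl fun i _ => pd_const_mul k ((hφ i).diff hx) _

lemma uexp_pd_speed (hI : IsCompact I) (hK : IsCompact K) (hKe : K ⊆ closure (D.cell e))
    {c : SField El} (hc : PiecewiseC1 D.toMesh c) (hφ : ∀ i, PiecewiseC1 D.toMesh (φ i))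
    (k : Fin 3) :
    UExp (I ×ˢ K) (fun (θ : Fin N → ℝ) z => pd k ((c + ∑ i, θ i • φ i) e) z.2)
      (fun z => pd k (c e) z.2) (fun θ z => pd k ((∑ i, θ i • φ i) e) z.2) := by
  have hpd : ∀ {b : SField El}, PiecewiseC1 D.toMesh b →
      ContinuousOn (fun z : ℝ × V3 => pd k (b e) z.2) (I ×ˢ K) := fun hb =>
    continuousOn_comp_snd ((continuousOn_pd k (hb e)).mono hKe)
  refine (UExp.affine (hI.prod hK) (hpd hc) fun i => hpd (hφ i)).congr ?_ ?_ ?_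
  · refine .of_forall fun θ z hz => ?_
    rw [← pd_sum_dir e hφ θ (hKe hz.2)]
    exact (pd_add k (hc.diff (hKe hz.2)) ((PiecewiseC1.sum hφ θ).diff (hKe hz.2))).symm
  · intro z _; rfl
  · intro θ z hz
    exact (pd_sum_dir e hφ θ (hKe hz.2) k).symm

variable (hI : IsCompact I) (hK : IsCompact K) (hKe : K ⊆ closure (D.cell e))
  (hφ : ∀ i, PiecewiseC1 D.toMesh (φ i)) (hχ : ∀ i, PiecewiseC1 D.toMesh (χ i))
include hm hI hK hKe hφ hχ

omit hφ in
lemma uexp_mu : UExp (I ×ˢ K) (fun θ z => (m.perturb φ χ θ).mu e z.2) (fun z => m.mu e z.2)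
    (fun θ z => m.muVar (∑ i, θ i • χ i) e z.2) := by
  have hs := uexp_speed e hI hK hKe hm.cs hχ
  have hρ := UExp.const (Θ := Fin N → ℝ) (hI.prod hK)
    (continuousOn_comp_snd ((hm.ρ.continuousOn e).mono hKe))
  refine (hρ.mul (hs.mul hs)).congr ?_ ?_ ?_
  · refine .of_forall fun θ z _ => ?_
    simp only [Medium.mu, Medium.perturb]; ring
  · intro z _
    simp only [Medium.mu]; ring
  · intro θ z _
    simp only [Medium.muVar]; ring

lemma uexp_lam : UExp (I ×ˢ K) (fun θ z => (m.perturb φ χ θ).lam e z.2) (fun z => m.lam e z.2)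
    (fun θ z => m.lamVar (∑ i, θ i • φ i) (∑ i, θ i • χ i) e z.2) := by
  have hp := uexp_speed e hI hK hKe hm.cp hφ
  have hs := uexp_speed e hI hK hKe hm.cs hχ
  have hρ := UExp.const (Θ := Fin N → ℝ) (hI.prod hK)
    (continuousOn_comp_snd ((hm.ρ.continuousOn e).mono hKe))
  refine (hρ.mul ((hp.mul hp).sub ((hs.mul hs).add (hs.mul hs)))).congr ?_ ?_ ?_
  · refine .of_forall fun θ z _ => ?_
    simp only [Medium.lam, Medium.perturb]; ring
  · intro z _
    simp only [Medium.lam]; ring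
  · intro θ z _
    simp only [Medium.lamVar]; ring

lemma uexp_pd_mu (k : Fin 3) : UExp (I ×ˢ K) (fun θ z => pd k ((m.perturb φ χ θ).mu e) z.2)
    (fun z => pd k (m.mu e) z.2) (fun θ z => pd k (m.muVar (∑ i, θ i • χ i) e) z.2) := by
  have hs := uexp_speed e hI hK hKe hm.cs hχ
  have hs' := uexp_pd_speed e hI hK hKe hm.cs hχ k
  have hρ := UExp.const (Θ := Fin N → ℝ) (hI.prod hK)
    (continuousOn_comp_snd ((hm.ρ.continuousOn e).mono hKe))
  have hρ' := UExp.const (Θ := Fin N → ℝ) (hI.prod hK)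
    (continuousOn_comp_snd ((continuousOn_pd k (hm.ρ e)).mono hKe))
  refine ((hρ'.mul (hs.mul hs)).add (hρ.mul ((hs.mul hs').add (hs.mul hs')))).congr ?_ ?_ ?_
  · refine .of_forall fun θ z hz => ?_
    rw [(hm.perturb hφ hχ θ).pd_mu (hKe hz.2) k]
    simp only [Medium.perturb]; ring
  · intro z hz
    rw [hm.pd_mu (hKe hz.2) k]; ring
  · intro θ z hz
    rw [hm.pd_muVar (hKe hz.2) k (PiecewiseC1.sum hχ θ),
      hm.pd_mul₃ (hKe hz.2) k hm.cs (PiecewiseC1.sum hχ θ)]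
    ring

lemma uexp_pd_lam (k : Fin 3) : UExp (I ×ˢ K) (fun θ z => pd k ((m.perturb φ χ θ).lam e) z.2)
    (fun z => pd k (m.lam e) z.2)
    (fun θ z => pd k (m.lamVar (∑ i, θ i • φ i) (∑ i, θ i • χ i) e) z.2) := by
  have hp := uexp_speed e hI hK hKe hm.cp hφ
  have hp' := uexp_pd_speed e hI hK hKe hm.cp hφ k
  have hs := uexp_speed e hI hK hKe hm.cs hχ
  have hs' := uexp_pd_speed e hI hK hKe hm.cs hχ k
  have hρ := UExp.const (Θ := Fin N → ℝ) (hI.prod hK)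
    (continuousOn_comp_snd ((hm.ρ.continuousOn e).mono hKe))
  have hρ' := UExp.const (Θ := Fin N → ℝ) (hI.prod hK)
    (continuousOn_comp_snd ((continuousOn_pd k (hm.ρ e)).mono hKe))
  have h2 := UExp.const (Θ := Fin N → ℝ) (hI.prod hK)
    (continuousOn_const (c := (2 : ℝ)) (s := I ×ˢ K))
  refine ((hρ'.mul ((hp.mul hp).sub (h2.mul (hs.mul hs)))).add
    (h2.mul (hρ.mul ((hp.mul hp').sub (h2.mul (hs.mul hs')))))).congr ?_ ?_ ?_
  · refine .of_forall fun θ z hz => ?_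
    rw [(hm.perturb hφ hχ θ).pd_lam (hKe hz.2) k]
    simp only [Medium.perturb]; ring
  · intro z hz
    rw [hm.pd_lam (hKe hz.2) k]; ring
  · intro θ z hz
    rw [hm.pd_lamVar (hKe hz.2) k (PiecewiseC1.sum hφ θ) (PiecewiseC1.sum hχ θ),
      hm.pd_mul₃ (hKe hz.2) k hm.cp (PiecewiseC1.sum hφ θ),
      hm.pd_mul₃ (hKe hz.2) k hm.cs (PiecewiseC1.sum hχ θ)]
    ring

end expansions

end media

end

end DGAE

namespace DGAE

noncomputable section

/-! ### The volume terms -/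

section volume

variable {El IF BF : Type*} {D : Discretization El IF BF} {N : ℕ}

/-- The volume integrand of the state equation. -/
def volTerm (m : Medium El) (f : VField El) (Et E : TField El) (vt v : VField El)
    (H : TField El) (w : VField El) : SField El := fun e x =>
  ddot (Et e x) (m.C e x (H e x)) + m.ρ e x * (vt e x ⬝ᵥ w e x)
    - ddot (symPart (gradVec (v e) x)) (m.C e x (H e x))
    - (divTensor (fun y => m.C e y (E e y)) x + f e x) ⬝ᵥ w e x

/-- The part of the first variation of `volTerm` with respect to the wave speeds in which the
stress of the test strain is varied. -/
def volVarTest (m : Medium El) (c c' : SField El) (Et : TField El) (v : VField El)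
    (H : TField El) : SField El := fun e x =>
  ddot (Et e x) (m.Cp c e x (H e x) + m.Cs c' e x (H e x))
    - ddot (symPart (gradVec (v e) x)) (m.Cp c e x (H e x) + m.Cs c' e x (H e x))

/-- The remaining part of the first variation of `volTerm`: the element terms of the gradients. -/
def volVarMain (m : Medium El) (c c' : SField El) (E : TField El) (w : VField El) : SField El :=
  fun e x => elementTermP m E w c e x + elementTermS m E w c' e x

lemma trace_symPart_gradVec (v : V3 → V3) (x : V3) :
    (symPart (gradVec v x)).trace = ∑ p, pd p (fun y => v y p) x := by
  simp only [symPart, gradVec, Matrix.trace, Matrix.diag, Matrix.smul_apply, Matrix.add_apply,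
    Matrix.transpose_apply, Matrix.of_apply, smul_eq_mul, pd]
  exact Finset.sum_congr rfl fun p _ => by ring

lemma divTensor_isotropic {l μ : V3 → ℝ} {A : V3 → M3} {x : V3} (hl : DifferentiableAt ℝ l x)
    (hμ : DifferentiableAt ℝ μ x) (hA : ∀ i j, DifferentiableAt ℝ (fun y => A y i j) x)
    (i : Fin 3) :
    divTensor (fun y => (l y * (A y).trace) • (1 : M3) + (2 * μ y) • A y) x i =
      pd i l x * (A x).trace + l x * ∑ p, pd i (fun y => A y p p) x
        + ∑ j, 2 * (pd j μ x * A x i j + μ x * pd j (fun y => A y i j) x) := by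
  have htr : DifferentiableAt ℝ (fun y => ∑ p, A y p p) x :=
    DifferentiableAt.fun_sum fun p _ => hA p p
  have h : ∀ j, pd j (fun y => ((l y * (A y).trace) • (1 : M3) + (2 * μ y) • A y) i j) x =
      (1 : M3) i j * (pd j l x * (A x).trace + l x * ∑ p, pd j (fun y => A y p p) x)
        + 2 * (pd j μ x * A x i j + μ x * pd j (fun y => A y i j) x) := fun j => by
    have h1 : (fun y => ((l y * (A y).trace) • (1 : M3) + (2 * μ y) • A y) i j) =
        fun y => (1 : M3) i j * (l y * ∑ p, A y p p) + 2 * (μ y * A y i j) := by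
      ext y
      simp only [Matrix.add_apply, Matrix.smul_apply, smul_eq_mul, Matrix.trace, Matrix.diag]
      ring
    rw [h1, pd_add j ((hl.fun_mul htr).const_mul _) ((hμ.fun_mul (hA i j)).const_mul 2),
      pd_const_mul j (hl.fun_mul htr), pd_const_mul j (hμ.fun_mul (hA i j)),
      pd_mul j hl htr, pd_mul j hμ (hA i j), pd_sum j _ fun p _ => hA p p]
    rfl
  change ∑ j, pd j (fun y => ((l y * (A y).trace) • (1 : M3) + (2 * μ y) • A y) i j) x = _
  simp only [h, Finset.sum_add_distrib, Matrix.one_apply, ite_mul, one_mul, zero_mul,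
    Finset.sum_ite_eq, Finset.mem_univ, if_true]

/-- The coefficient of `lam` in the volume terms. -/
def coeffLam (Et E H : TField El) (v w : VField El) : SField El := fun e x =>
  (Et e x).trace * (H e x).trace - (∑ p, pd p (fun y => v e y p) x) * (H e x).trace
    - ∑ i, (∑ p, pd i (fun y => E e y p p) x) * w e x i

/-- The coefficient of `mu` in the volume terms. -/
def coeffMu (Et E H : TField El) (v w : VField El) : SField El := fun e x =>
  2 * ddot (Et e x) (H e x) - 2 * ddot (symPart (gradVec (v e) x)) (H e x)
    - ∑ i, (∑ j, 2 * pd j (fun y => E e y i j) x) * w e x i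

/-- The coefficient of the `i`-th partial derivative of `lam` in the volume terms. -/
def coeffGradLam (E : TField El) (w : VField El) (i : Fin 3) : SField El := fun e x =>
  -((E e x).trace * w e x i)

/-- The coefficient of the `j`-th partial derivative of `mu` in the volume terms. -/
def coeffGradMu (E : TField El) (w : VField El) (j : Fin 3) : SField El := fun e x =>
  -∑ i, 2 * E e x i j * w e x i

/-- The volume integrand depends on the wave speeds through `lam`, `mu` and their first
derivatives, and is affine in these. -/
lemma volTerm_eq {m : Medium El} (hm : m.IsC1 D) {E : TField El} (hE : E ∈ D.Ph) (f : VField El)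
    (Et : TField El) (vt v : VField El) (H : TField El) (w : VField El) {e : El} {x : V3}
    (hx : x ∈ closure (D.cell e)) :
    volTerm m f Et E vt v H w e x = m.lam e x * coeffLam Et E H v w e x
      + m.mu e x * coeffMu Et E H v w e x + ∑ i, pd i (m.lam e) x * coeffGradLam E w i e x
      + ∑ j, pd j (m.mu e) x * coeffGradMu E w j e x
      + (m.ρ e x * ∑ i, vt e x i * w e x i - ∑ i, f e x i * w e x i) := by
  have hd : ∀ i, divTensor (fun y => m.C e y (E e y)) x i = _ :=
    divTensor_isotropic (hm.lam.diff hx) (hm.mu.diff hx)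
      fun i j => (Ph_smooth hE e i j x hx).differentiableAt one_ne_zero
  simp only [volTerm, Medium.ddot_C, trace_symPart_gradVec, dotProduct, Pi.add_apply, hd,
    coeffLam, coeffMu, coeffGradLam, coeffGradMu, Fin.sum_univ_three]
  simp only [Matrix.trace, Matrix.diag, Fin.sum_univ_three]
  ring

lemma volVar_eq {m : Medium El} (hm : m.IsC1 D) {c c' : SField El} (hc : PiecewiseC1 D.toMesh c)
    (hc' : PiecewiseC1 D.toMesh c') {E : TField El} (hE : E ∈ D.Ph)
    (Et : TField El) (v : VField El) (H : TField El) (w : VField El) {e : El} {x : V3}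
    (hx : x ∈ closure (D.cell e)) :
    volVarTest m c c' Et v H e x + volVarMain m c c' E w e x =
      m.lamVar c c' e x * coeffLam Et E H v w e x
      + m.muVar c' e x * coeffMu Et E H v w e x
      + ∑ i, pd i (m.lamVar c c' e) x * coeffGradLam E w i e x
      + ∑ j, pd j (m.muVar c' e) x * coeffGradMu E w j e x := by
  have hEd := fun i j => (Ph_smooth hE e i j x hx).differentiableAt one_ne_zero
  have hP := hm.diff_mul₃ hx hm.cp hc
  have hQ := hm.diff_mul₃ hx hm.cs hc'
  have htr : DifferentiableAt ℝ (fun y => ∑ p, E e y p p) x :=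
    DifferentiableAt.fun_sum fun p _ => hEd p p
  have h1 : ∀ i, grad (fun y => m.ρ e y * m.cp e y * c e y * (E e y).trace) x i =
      pd i (fun y => m.ρ e y * m.cp e y * c e y) x * (E e x).trace
        + m.ρ e x * m.cp e x * c e x * ∑ p, pd i (fun y => E e y p p) x := fun i => by
    change pd i (fun y => m.ρ e y * m.cp e y * c e y * (∑ p, E e y p p)) x = _
    rw [pd_mul i hP htr, pd_sum i _ fun p _ => hEd p p]
    rfl
  have h2 : (fun y => (m.ρ e y * m.cs e y * c' e y) • (E e y - (E e y).trace • (1 : M3))) =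
      fun y => ((-1 * (m.ρ e y * m.cs e y * c' e y)) * (E e y).trace) • (1 : M3)
        + (2 * (1 / 2 * (m.ρ e y * m.cs e y * c' e y))) • E e y := by
    ext1 y; module
  have h3 := divTensor_isotropic (hQ.const_mul (-1)) (hQ.const_mul (1 / 2)) hEd
  simp only [pd_const_mul _ hQ] at h3
  simp only [volVarTest, volVarMain, elementTermP, elementTermS, h2, dotProduct, h3, h1,
    hm.pd_lamVar hx _ hc hc', hm.pd_muVar hx _ hc', Medium.ddot_Cp_add_Cs, trace_symPart_gradVec,
    coeffLam, coeffMu, coeffGradLam, coeffGradMu, Fin.sum_univ_three, Medium.lamVar,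
    Medium.muVar]
  simp only [Matrix.trace, Matrix.diag, Fin.sum_univ_three]
  ring

/-- First-order expansion of the volume integrand under perturbations of the wave speeds. -/
lemma uexp_volTerm {m : Medium El} (hm : m.IsC1 D) {φ χ : Fin N → SField El}
    (hφ : ∀ i, PiecewiseC1 D.toMesh (φ i)) (hχ : ∀ i, PiecewiseC1 D.toMesh (χ i)) (e : El)
    {I : Set ℝ} (hI : IsCompact I) {f : ℝ → VField El}
    (hf : ContinuousOn (fun z : ℝ × V3 => f z.1 e z.2) (I ×ˢ closure (D.cell e)))
    {Et E H : ℝ → TField El} (hEt : RegT D I Et) (hE : RegT D I E) (hH : RegT D I H)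
    {vt v w : ℝ → VField El} (hvt : RegV D I vt) (hv : RegV D I v) (hw : RegV D I w) :
    UExp (I ×ˢ closure (D.cell e))
      (fun (θ : Fin N → ℝ) z => volTerm (m.perturb φ χ θ) (f z.1) (Et z.1) (E z.1) (vt z.1) (v z.1)
        (H z.1) (w z.1) e z.2)
      (fun z => volTerm m (f z.1) (Et z.1) (E z.1) (vt z.1) (v z.1) (H z.1) (w z.1) e z.2)
      (fun θ z => volVarTest m (∑ i, θ i • φ i) (∑ i, θ i • χ i) (Et z.1) (v z.1) (H z.1) e z.2
        + volVarMain m (∑ i, θ i • φ i) (∑ i, θ i • χ i) (E z.1) (w z.1) e z.2) := by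
  have hK := D.isCompact_cell e
  have hS := hI.prod hK
  have cEt := fun i j => (hEt.reg e i j).cont
  have cE := fun i j => (hE.reg e i j).cont
  have cH := fun i j => (hH.reg e i j).cont
  have cvt := fun i => (hvt.reg e i).cont
  have cw := fun i => (hw.reg e i).cont
  have dE := fun i j => (hE.reg e i j).cont_pd
  have dv := fun i => (hv.reg e i).cont_pd
  have cf : ∀ i, ContinuousOn (fun z : ℝ × V3 => f z.1 e z.2 i) (I ×ˢ closure (D.cell e)) :=
    fun i => (continuous_apply i).comp_continuousOn hf
  have cρ : ContinuousOn (fun z : ℝ × V3 => m.ρ e z.2) (I ×ˢ closure (D.cell e)) :=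
    continuousOn_comp_snd (hm.ρ.continuousOn e)
  have k1 : ContinuousOn (fun z : ℝ × V3 => coeffLam (Et z.1) (E z.1) (H z.1) (v z.1) (w z.1) e z.2)
      (I ×ˢ closure (D.cell e)) := by
    simp only [coeffLam, Matrix.trace, Matrix.diag]
    fun_prop
  have k2 : ContinuousOn (fun z : ℝ × V3 => coeffMu (Et z.1) (E z.1) (H z.1) (v z.1) (w z.1) e z.2)
      (I ×ˢ closure (D.cell e)) := by
    have : ∀ i j, ContinuousOn (fun z : ℝ × V3 => symPart (gradVec (v z.1 e) z.2) i j)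
        (I ×ˢ closure (D.cell e)) := fun i j =>
      continuousOn_const.mul ((dv i j).add (dv j i))
    simp only [coeffMu, ddot]
    fun_prop
  have k3 : ∀ i, ContinuousOn (fun z : ℝ × V3 => coeffGradLam (E z.1) (w z.1) i e z.2)
      (I ×ˢ closure (D.cell e)) := fun i => by
    simp only [coeffGradLam, Matrix.trace, Matrix.diag]
    fun_prop
  have k4 : ∀ i, ContinuousOn (fun z : ℝ × V3 => coeffGradMu (E z.1) (w z.1) i e z.2)
      (I ×ˢ closure (D.cell e)) := fun i => by
    simp only [coeffGradMu]
    fun_prop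
  have k5 : ContinuousOn (fun z : ℝ × V3 => m.ρ e z.2 * ∑ i, vt z.1 e z.2 i * w z.1 e z.2 i
      - ∑ i, f z.1 e z.2 i * w z.1 e z.2 i) (I ×ˢ closure (D.cell e)) := by
    fun_prop
  have c := fun {g : ℝ × V3 → ℝ} (hg : ContinuousOn g (I ×ˢ closure (D.cell e))) =>
    UExp.const (Θ := Fin N → ℝ) hS hg
  refine ((((((uexp_lam hm e hI hK subset_rfl hφ hχ).mul (c k1)).add
    ((uexp_mu (φ := φ) hm e hI hK subset_rfl hχ).mul (c k2))).add
    (UExp.sum Finset.univ fun i _ => (uexp_pd_lam hm e hI hK subset_rfl hφ hχ i).mul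
      (c (k3 i)))).add (UExp.sum Finset.univ fun i _ =>
        (uexp_pd_mu hm e hI hK subset_rfl hφ hχ i).mul (c (k4 i)))).add (c k5)).congr ?_ ?_ ?_
  · refine .of_forall fun θ z hz => ?_
    rw [volTerm_eq (hm.perturb hφ hχ θ) (hE.mem _ hz.1) _ _ _ _ _ _ hz.2]
    rfl
  · intro z hz
    rw [volTerm_eq hm (hE.mem _ hz.1) _ _ _ _ _ _ hz.2]
  · intro θ z hz
    rw [volVar_eq hm (PiecewiseC1.sum hφ θ) (PiecewiseC1.sum hχ θ) (hE.mem _ hz.1) _ _ _ _ hz.2]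
    simp only [mul_zero, add_zero]

end volume

end

end DGAE

namespace DGAE

noncomputable section

/-! ### Flux terms of perturbed media -/

lemma UExp.eventually_pos {Θ Z : Type*} [NormedAddCommGroup Θ] [NormedSpace ℝ Θ]
    [TopologicalSpace Z] {S : Set Z} {f : Θ → Z → ℝ} {f0 : Z → ℝ} {f1 : Θ → Z → ℝ}
    (hS : IsCompact S) (hf : UExp S f f0 f1) (h : ∀ z ∈ S, 0 < f0 z) :
    ∀ᶠ θ in 𝓝 0, ∀ z ∈ S, 0 < f θ z := by
  rcases S.eq_empty_or_nonempty with rfl | hne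
  · simp
  · obtain ⟨z0, hz0, hmin⟩ := hS.exists_isMinOn hne hf.cont0
    filter_upwards [hf.eventually_lower_bound (h z0 hz0) fun z hz => hmin hz] with θ hθ z hz
    linarith [hθ z hz, h z0 hz0]

/-- Componentwise uniform first-order expansion of vector functions. -/
def UExpV {Θ Z : Type*} [NormedAddCommGroup Θ] [NormedSpace ℝ Θ] [TopologicalSpace Z]
    (S : Set Z) (f : Θ → Z → V3) (f0 : Z → V3) (f1 : Θ → Z → V3) : Prop :=
  ∀ i, UExp S (fun θ z => f θ z i) (fun z => f0 z i) (fun θ z => f1 θ z i)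

namespace UExpV

variable {Θ Z : Type*} [NormedAddCommGroup Θ] [NormedSpace ℝ Θ] [TopologicalSpace Z]
  {S : Set Z} {f g : Θ → Z → V3} {f0 g0 : Z → V3} {f1 g1 : Θ → Z → V3}

lemma const (hS : IsCompact S) (hg : ContinuousOn g0 S) :
    UExpV (Θ := Θ) S (fun _ => g0) g0 (fun _ _ => 0) := fun i =>
  UExp.const hS ((continuous_apply i).comp_continuousOn hg)

lemma add (hf : UExpV S f f0 f1) (hg : UExpV S g g0 g1) :
    UExpV S (fun θ z => f θ z + g θ z) (fun z => f0 z + g0 z) (fun θ z => f1 θ z + g1 θ z) :=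
  fun i => (hf i).add (hg i)

lemma sub (hf : UExpV S f f0 f1) (hg : UExpV S g g0 g1) :
    UExpV S (fun θ z => f θ z - g θ z) (fun z => f0 z - g0 z) (fun θ z => f1 θ z - g1 θ z) :=
  fun i => (hf i).sub (hg i)

lemma smul {a : Θ → Z → ℝ} {a0 : Z → ℝ} {a1 : Θ → Z → ℝ} (ha : UExp S a a0 a1)
    (hg : UExpV S g g0 g1) :
    UExpV S (fun θ z => a θ z • g θ z) (fun z => a0 z • g0 z)
      (fun θ z => a1 θ z • g0 z + a0 z • g1 θ z) :=
  fun i => ha.mul (hg i)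

lemma dot (hf : UExpV S f f0 f1) (hg : UExpV S g g0 g1) :
    UExp S (fun θ z => f θ z ⬝ᵥ g θ z) (fun z => f0 z ⬝ᵥ g0 z)
      (fun θ z => f1 θ z ⬝ᵥ g0 z + f0 z ⬝ᵥ g1 θ z) := by
  refine (UExp.sum Finset.univ fun i _ => (hf i).mul (hg i)).congr ?_ ?_ ?_
  · exact .of_forall fun θ z _ => rfl
  · exact fun z _ => rfl
  · exact fun θ z _ => by simp only [dotProduct, Finset.sum_add_distrib]

lemma congr (h : UExpV S f f0 f1) (hf : ∀ᶠ θ in 𝓝 0, ∀ z ∈ S, f θ z = g θ z)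
    (h0 : ∀ z ∈ S, f0 z = g0 z) (h1 : ∀ θ, ∀ z ∈ S, f1 θ z = g1 θ z) : UExpV S g g0 g1 := fun i =>
  (h i).congr (by filter_upwards [hf] with θ hθ z hz; rw [hθ z hz])
    (fun z hz => by rw [h0 z hz]) (fun θ z hz => by rw [h1 θ z hz])

end UExpV

/-- Expansion of the flux terms at interfaces that depend on a parameter through the wave speeds
and the tractions. -/
lemma UExp.pairing {Θ Z : Type*} [NormedAddCommGroup Θ] [NormedSpace ℝ Θ] [TopologicalSpace Z]
    {S : Set Z} (hS : IsCompact S) {F : Θ → Z → Interface} {F0 : Z → Interface}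
    {d : Θ → Z → Interface.Variation} {q : Θ → Z → Trace} {q0 : Z → Trace}
    {t : Θ → Z → V3} {t0 : Z → V3} {t1 : Θ → Z → V3} {w : Z → V3}
    (hn : ∀ θ z, (F θ z).n = (F0 z).n) (hρM : ∀ θ z, (F θ z).ρM = (F0 z).ρM)
    (hρP : ∀ θ z, (F θ z).ρP = (F0 z).ρP) (cn : ContinuousOn (fun z => (F0 z).n) S)
    (cρM : ContinuousOn (fun z => (F0 z).ρM) S) (cρP : ContinuousOn (fun z => (F0 z).ρP) S)
    (hpM : UExp S (fun θ z => (F θ z).cpM) (fun z => (F0 z).cpM) (fun θ z => (d θ z).pM))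
    (hpP : UExp S (fun θ z => (F θ z).cpP) (fun z => (F0 z).cpP) (fun θ z => (d θ z).pP))
    (hsM : UExp S (fun θ z => (F θ z).csM) (fun z => (F0 z).csM) (fun θ z => (d θ z).sM))
    (hsP : UExp S (fun θ z => (F θ z).csP) (fun z => (F0 z).csP) (fun θ z => (d θ z).sP))
    (hk0 : UExp S (fun θ z => (F θ z).k0) (fun z => (F0 z).k0)
      (fun θ z => -((F0 z).k0 ^ 2 * ((F0 z).ρM * (d θ z).pM + (F0 z).ρP * (d θ z).pP))))
    (hk1 : UExp S (fun θ z => (F θ z).k1) (fun z => (F0 z).k1)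
      (fun θ z => -((F0 z).k1 ^ 2 * ((F0 z).ρM * (d θ z).sM + (F0 z).ρP * (d θ z).sP))))
    (htM : UExpV S (fun θ z => (q θ z).tM) (fun z => (q0 z).tM) (fun θ z => (d θ z).tM))
    (htP : UExpV S (fun θ z => (q θ z).tP) (fun z => (q0 z).tP) (fun θ z => (d θ z).tP))
    (hvM : ∀ θ z, (q θ z).vM = (q0 z).vM) (hvP : ∀ θ z, (q θ z).vP = (q0 z).vP)
    (cvM : ContinuousOn (fun z => (q0 z).vM) S) (cvP : ContinuousOn (fun z => (q0 z).vP) S)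
    (ht : UExpV S t t0 t1) (cw : ContinuousOn w S) :
    UExp S (fun θ z => (F θ z).pairing (q θ z) (t θ z) (w z))
      (fun z => (F0 z).pairing (q0 z) (t0 z) (w z))
      (fun θ z => (F0 z).pairingVar (d θ z) (q0 z) (t0 z) (t1 θ z) (w z)) := by
  have c := fun {g : Z → ℝ} (hg : ContinuousOn g S) => UExp.const (Θ := Θ) hS hg
  have cV := fun {g : Z → V3} (hg : ContinuousOn g S) => UExpV.const (Θ := Θ) hS hg
  have hJ := htM.add htP
  have hD := (cV cvM).sub (cV cvP)
  have hX := ((cV cn).dot hJ).add (((c cρP).mul hpP).mul ((cV cn).dot hD))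
  have hY := ((cV cn).dot ht).add (((c cρM).mul hpM).mul ((cV cn).dot (cV cw)))
  have hZ := hJ.add (UExpV.smul ((c cρP).mul hsP) hD)
  have hQ := ht.add (UExpV.smul ((c cρM).mul hsM) (cV cw))
  have hT := (hZ.dot hQ).sub (((cV cn).dot hZ).mul ((cV cn).dot hQ))
  refine (((hk0.mul hX).mul hY).neg.sub (hk1.mul hT)).congr ?_ ?_ ?_
  · refine .of_forall fun θ z _ => ?_
    simp only [Interface.pairing, tang, Trace.jumpS, Trace.jumpV_eq, Trace.diffV, hn, hρM, hρP,
      hvM, hvP, dotProduct_sub]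
  · intro z _
    simp only [Interface.pairing, tang, Trace.jumpS, Trace.jumpV_eq, Trace.diffV, dotProduct_sub]
  · intro θ z _
    simp only [Interface.pairingVar, tang, Trace.jumpS, Trace.jumpV_eq, Trace.diffV, sub_self,
      smul_zero, add_zero, zero_dotProduct, dotProduct_zero, zero_mul, mul_zero, zero_add,
      dotProduct_sub, dotProduct_add, add_dotProduct, smul_dotProduct, dotProduct_smul,
      sub_dotProduct, smul_eq_mul]
    ring

section sides

variable {El IF BF : Type*} {D : Discretization El IF BF} {N : ℕ}

lemma Admissible.cs_nonneg {m : Medium El} (hm : Admissible D.toMesh m) {e : El} {x : V3}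
    (hx : x ∈ closure (D.cell e)) : 0 ≤ m.cs e x := by
  rcases hm.acoustic_or_elastic e with h | h
  · exact (h x hx).ge
  · exact (h x hx).1.le

lemma Admissible.mu_ne_zero_iff {m : Medium El} (hm : Admissible D.toMesh m) {e : El} {x : V3}
    (hx : x ∈ closure (D.cell e)) : m.mu e x ≠ 0 ↔ m.cs e x ≠ 0 := by
  simp [Medium.mu, (hm.ρ_pos e x hx).ne']

lemma Admissible.regular {m : Medium El} (hm : Admissible D.toMesh m) (s : Side IF BF) {x : V3}
    (hx : x ∈ D.face (Mesh.faceOf s)) : (m.interface D.toMesh s x).Regular :=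
  have hM := D.face_subset_inner s hx
  have hP := D.face_subset_outer s hx
  ⟨D.outNormal_unit s hx, hm.ρ_pos _ _ hM, hm.ρ_pos _ _ hP, hm.cp_pos _ _ hM, hm.cp_pos _ _ hP,
    hm.cs_nonneg hM, hm.cs_nonneg hP⟩

lemma varTraction_eq (m : Medium El) (c c' : SField El) (e : El) (x n : V3) (A : M3) :
    Interface.varTraction (m.ρ e x) (m.cp e x) (m.cs e x) (c e x) (c' e x) n A =
      (m.lamVar c c' e x * A.trace) • n + (2 * m.muVar c' e x) • (A *ᵥ n) := by
  simp only [Interface.varTraction, Medium.lamVar, Medium.muVar]; module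

lemma Cp_add_Cs_mulVec (m : Medium El) (c c' : SField El) (e : El) (x n : V3) (A : M3) :
    (m.Cp c e x A + m.Cs c' e x A) *ᵥ n =
      Interface.varTraction (m.ρ e x) (m.cp e x) (m.cs e x) (c e x) (c' e x) n A := by
  rw [varTraction_eq, Medium.Cp_add_Cs]
  simp only [Matrix.add_mulVec, Matrix.smul_mulVec, Matrix.one_mulVec]

open Classical in
/-- The variation of the exterior traction of the state. -/
def varOuter (M : Mesh El IF BF) (m : Medium El) (c c' : SField El) (E : TField El) :
    Side IF BF → V3 → V3
  | Sum.inl fb, x => Interface.varTraction (m.ρ (M.outer (Sum.inl fb)) x)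
      (m.cp (M.outer (Sum.inl fb)) x) (m.cs (M.outer (Sum.inl fb)) x)
      (c (M.outer (Sum.inl fb)) x) (c' (M.outer (Sum.inl fb)) x) (-M.outNormal (Sum.inl fb) x)
      (E (M.outer (Sum.inl fb)) x)
  | Sum.inr b, x =>
      if m.mu (M.own b) x ≠ 0 then
        Interface.varTraction (m.ρ (M.own b) x) (m.cp (M.own b) x) (m.cs (M.own b) x)
          (c (M.own b) x) (c' (M.own b) x) (M.outNormal (Sum.inr b) x) (E (M.own b) x)
      else
        (2 * (M.outNormal (Sum.inr b) x ⬝ᵥ Interface.varTraction (m.ρ (M.own b) x)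
          (m.cp (M.own b) x) (m.cs (M.own b) x)
          (c (M.own b) x) (c' (M.own b) x) (M.outNormal (Sum.inr b) x) (E (M.own b) x))) •
            M.outNormal (Sum.inr b) x
          - Interface.varTraction (m.ρ (M.own b) x) (m.cp (M.own b) x) (m.cs (M.own b) x)
          (c (M.own b) x) (c' (M.own b) x) (M.outNormal (Sum.inr b) x) (E (M.own b) x)

/-- The variation of the wave speeds and of the tractions of the state at a side. -/
def sideVariation (M : Mesh El IF BF) (m : Medium El) (c c' : SField El) (E : TField El)
    (s : Side IF BF) (x : V3) : Interface.Variation where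
  pM := c (M.inner s) x
  pP := c (M.outer s) x
  sM := c' (M.inner s) x
  sP := c' (M.outer s) x
  tM := Interface.varTraction (m.ρ (M.inner s) x) (m.cp (M.inner s) x) (m.cs (M.inner s) x)
    (c (M.inner s) x) (c' (M.inner s) x) (M.outNormal s x) (E (M.inner s) x)
  tP := varOuter M m c c' E s x

section expansions

variable {m : Medium El} (hm : Admissible D.toMesh m) {φ χ : Fin N → SField El}
  (hd : IsDirection D m φ χ)
include hm hd

/-- Small perturbations of an admissible medium are admissible, and do not change the type of
the elements. -/
lemma eventually_admissible [Fintype El] : ∀ᶠ θ in 𝓝 (0 : Fin N → ℝ),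
    Admissible D.toMesh (m.perturb φ χ θ) ∧
      ∀ e, ∀ x ∈ closure (D.cell e), ((m.perturb φ χ θ).cs e x = 0 ↔ m.cs e x = 0) := by
  have hI : IsCompact ({0} : Set ℝ) := isCompact_singleton
  have hpos : ∀ e, ∀ᶠ θ in 𝓝 (0 : Fin N → ℝ),
      (∀ x ∈ closure (D.cell e), 0 < (m.perturb φ χ θ).cp e x) ∧
      ((∀ x ∈ closure (D.cell e), m.cs e x = 0 ∧ (m.perturb φ χ θ).cs e x = 0) ∨
        ∀ x ∈ closure (D.cell e), 0 < m.cs e x ∧ 0 < (m.perturb φ χ θ).cs e x ∧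
          0 < 3 * (m.perturb φ χ θ).lam e x + 2 * (m.perturb φ χ θ).mu e x) := fun e => by
    have hK := D.isCompact_cell e
    have h1 := (uexp_speed e hI hK subset_rfl hm.smooth_cp hd.smooth_p).eventually_pos
      (hI.prod hK) fun z hz => hm.cp_pos e z.2 hz.2
    rcases hm.acoustic_or_elastic e with h | h
    · filter_upwards [h1] with θ hθ
      refine ⟨fun x hx => hθ (0, x) ⟨rfl, hx⟩, Or.inl fun x hx => ⟨h x hx, ?_⟩⟩
      simp only [Medium.perturb, Pi.add_apply, sum_dir_apply, h x hx, zero_add]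
      exact Finset.sum_eq_zero fun i _ => by rw [hd.vanish i e x hx (h x hx), mul_zero]
    · have h2 := (uexp_speed e hI hK subset_rfl hm.smooth_cs hd.smooth_s).eventually_pos
        (hI.prod hK) fun z hz => (h z.2 hz.2).1
      have c := fun a : ℝ => UExp.const (Θ := Fin N → ℝ) (hI.prod hK)
        (continuousOn_const (c := a) (s := ({0} : Set ℝ) ×ˢ closure (D.cell e)))
      have h3 := (((c 3).mul (uexp_lam hm.isC1 e hI hK subset_rfl hd.smooth_p hd.smooth_s)).add
        ((c 2).mul (uexp_mu (φ := φ) hm.isC1 e hI hK subset_rfl hd.smooth_s))).eventually_pos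
          (hI.prod hK) fun z hz => (h z.2 hz.2).2
      filter_upwards [h1, h2, h3] with θ g1 g2 g3
      exact ⟨fun x hx => g1 (0, x) ⟨rfl, hx⟩, Or.inr fun x hx => ⟨(h x hx).1, g2 (0, x) ⟨rfl, hx⟩,
        g3 (0, x) ⟨rfl, hx⟩⟩⟩
  filter_upwards [eventually_all.2 hpos] with θ hθ
  have hC := hm.isC1.perturb hd.smooth_p hd.smooth_s θ
  refine ⟨⟨hC.ρ, hC.cp, hC.cs, hm.ρ_pos, fun e => (hθ e).1, fun e => ?_⟩, fun e x hx => ?_⟩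
  · rcases (hθ e).2 with h | h
    · exact Or.inl fun x hx => (h x hx).2
    · exact Or.inr fun x hx => (h x hx).2
  · rcases (hθ e).2 with h | h
    · simp only [(h x hx).1, (h x hx).2]
    · simp only [(h x hx).1.ne', (h x hx).2.1.ne']

variable (s : Side IF BF) {I : Set ℝ} (hI : IsCompact I)
include hI

lemma uexp_k0 : UExp (I ×ˢ D.face (Mesh.faceOf s))
    (fun θ z => ((m.perturb φ χ θ).interface D.toMesh s z.2).k0)
    (fun z => (m.interface D.toMesh s z.2).k0)
    (fun θ z => -((m.interface D.toMesh s z.2).k0 ^ 2 *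
      (m.ρ (D.inner s) z.2 * (∑ i, θ i • φ i) (D.inner s) z.2 +
        m.ρ (D.outer s) z.2 * (∑ i, θ i • φ i) (D.outer s) z.2))) := by
  have hK := D.isCompact_face s
  have hS := hI.prod hK
  have cM := UExp.const (Θ := Fin N → ℝ) hS (continuousOn_comp_snd
    ((hm.smooth_ρ.continuousOn (D.inner s)).mono (D.face_subset_inner s)))
  have cP := UExp.const (Θ := Fin N → ℝ) hS (continuousOn_comp_snd
    ((hm.smooth_ρ.continuousOn (D.outer s)).mono (D.face_subset_outer s)))
  have pM := uexp_speed (D.inner s) hI hK (D.face_subset_inner s) hm.smooth_cp hd.smooth_p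
  have pP := uexp_speed (D.outer s) hI hK (D.face_subset_outer s) hm.smooth_cp hd.smooth_p
  refine (((cM.mul pM).add (cP.mul pP)).inv hS
    fun z hz => (hm.regular s hz.2).k0_denom_pos).congr ?_ ?_ ?_
  · exact .of_forall fun θ z _ => rfl
  · exact fun z _ => rfl
  · intro θ z _
    simp only [zero_mul, zero_add]
    rfl

/-- The case distinction in `k1` is harmless: an element is acoustic or elastic as a whole, and
perturbations do not change its type. -/
lemma uexp_k1 [Fintype El] : UExp (I ×ˢ D.face (Mesh.faceOf s))
    (fun θ z => ((m.perturb φ χ θ).interface D.toMesh s z.2).k1)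
    (fun z => (m.interface D.toMesh s z.2).k1)
    (fun θ z => -((m.interface D.toMesh s z.2).k1 ^ 2 *
      (m.ρ (D.inner s) z.2 * (∑ i, θ i • χ i) (D.inner s) z.2 +
        m.ρ (D.outer s) z.2 * (∑ i, θ i • χ i) (D.outer s) z.2))) := by
  have hK := D.isCompact_face s
  have hS := hI.prod hK
  have hev := eventually_admissible hm hd
  rcases hm.acoustic_or_elastic (D.inner s) with h | h
  · have h0 : ∀ z ∈ I ×ˢ D.face (Mesh.faceOf s), (m.interface D.toMesh s z.2).k1 = 0 :=
      fun z hz => Interface.Regular.k1_of_zero (h _ (D.face_subset_inner s hz.2))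
    refine (UExp.const hS (continuousOn_const (c := (0 : ℝ)))).congr ?_ ?_ ?_
    · filter_upwards [hev] with θ hθ z hz
      exact (Interface.Regular.k1_of_zero ((hθ.2 _ _ (D.face_subset_inner s hz.2)).2
        (h _ (D.face_subset_inner s hz.2)))).symm
    · exact fun z hz => (h0 z hz).symm
    · intro θ z hz
      rw [h0 z hz]; ring
  · have cM := UExp.const (Θ := Fin N → ℝ) hS (continuousOn_comp_snd
      ((hm.smooth_ρ.continuousOn (D.inner s)).mono (D.face_subset_inner s)))
    have cP := UExp.const (Θ := Fin N → ℝ) hS (continuousOn_comp_snd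
      ((hm.smooth_ρ.continuousOn (D.outer s)).mono (D.face_subset_outer s)))
    have sM := uexp_speed (D.inner s) hI hK (D.face_subset_inner s) hm.smooth_cs hd.smooth_s
    have sP := uexp_speed (D.outer s) hI hK (D.face_subset_outer s) hm.smooth_cs hd.smooth_s
    have h0 : ∀ z ∈ I ×ˢ D.face (Mesh.faceOf s), (m.interface D.toMesh s z.2).k1 =
        1 / (m.ρ (D.inner s) z.2 * m.cs (D.inner s) z.2
          + m.ρ (D.outer s) z.2 * m.cs (D.outer s) z.2) := fun z hz =>
      (hm.regular s hz.2).k1_of_ne (h _ (D.face_subset_inner s hz.2)).1.ne'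
    refine (((cM.mul sM).add (cP.mul sP)).inv hS fun z hz => ?_).congr ?_ ?_ ?_
    · exact add_pos_of_pos_of_nonneg (mul_pos (hm.ρ_pos _ _ (D.face_subset_inner s hz.2))
        (h _ (D.face_subset_inner s hz.2)).1) (mul_nonneg
          (hm.ρ_pos _ _ (D.face_subset_outer s hz.2)).le
          (hm.cs_nonneg (D.face_subset_outer s hz.2)))
    · filter_upwards [hev] with θ hθ z hz
      refine ((hθ.1.regular s hz.2).k1_of_ne fun hz0 => ?_).symm
      exact (h _ (D.face_subset_inner s hz.2)).1.ne'
        ((hθ.2 _ _ (D.face_subset_inner s hz.2)).1 hz0)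
    · exact fun z hz => (h0 z hz).symm
    · intro θ z hz
      rw [h0 z hz]
      simp only [zero_mul, zero_add]

omit hm hd hI in
lemma RegT.continuousOn_face {A : ℝ → TField El} (hA : RegT D I A) {e : El} {K : Set V3}
    (hKe : K ⊆ closure (D.cell e)) (i j : Fin 3) :
    ContinuousOn (fun z : ℝ × V3 => A z.1 e z.2 i j) (I ×ˢ K) :=
  (hA.reg e i j).cont.mono (prod_mono subset_rfl hKe)

omit hm hd hI in
lemma RegV.continuousOn_face {v : ℝ → VField El} (hv : RegV D I v) {e : El} {K : Set V3}
    (hKe : K ⊆ closure (D.cell e)) : ContinuousOn (fun z : ℝ × V3 => v z.1 e z.2) (I ×ˢ K) :=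
  continuousOn_pi.2 fun i => (hv.reg e i).cont.mono (prod_mono subset_rfl hKe)

omit hI in
/-- Expansion of the traction of the stress in an element with respect to a continuous
normal. -/
lemma uexp_stress_mulVec {K : Set V3} (hI : IsCompact I) (hK : IsCompact K) (e : El)
    (hKe : K ⊆ closure (D.cell e)) {A : ℝ → TField El} (hA : RegT D I A)
    {n : V3 → V3} (hn : ContinuousOn n K) :
    UExpV (I ×ˢ K) (fun (θ : Fin N → ℝ) z => (m.perturb φ χ θ).C e z.2 (A z.1 e z.2) *ᵥ n z.2)
      (fun z => m.C e z.2 (A z.1 e z.2) *ᵥ n z.2)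
      (fun θ z => Interface.varTraction (m.ρ e z.2) (m.cp e z.2) (m.cs e z.2)
        ((∑ i, θ i • φ i) e z.2) ((∑ i, θ i • χ i) e z.2) (n z.2) (A z.1 e z.2)) := by
  have hS := hI.prod hK
  have cA := fun i j => hA.continuousOn_face hKe i j
  have cn : ∀ i, ContinuousOn (fun z : ℝ × V3 => n z.2 i) (I ×ˢ K) := fun i =>
    continuousOn_comp_snd ((continuous_apply i).comp_continuousOn hn)
  intro k
  have h1 : ContinuousOn (fun z : ℝ × V3 => (A z.1 e z.2).trace * n z.2 k) (I ×ˢ K) := by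
    exact (continuousOn_finsetSum _ fun j _ => cA j j).mul (cn k)
  have h2 : ContinuousOn (fun z : ℝ × V3 => 2 * (A z.1 e z.2 *ᵥ n z.2) k) (I ×ˢ K) := by
    exact continuousOn_const.mul (continuousOn_finsetSum Finset.univ fun j _ =>
      (cA k j).mul (cn j) : ContinuousOn (fun z : ℝ × V3 => ∑ j, A z.1 e z.2 k j * n z.2 j) _)
  have hl0 := uexp_lam hm.isC1 e hI hK hKe hd.smooth_p hd.smooth_s
  have hl := hl0.mul (UExp.const (Θ := Fin N → ℝ) hS h1)
  have hμ0 := uexp_mu (φ := φ) hm.isC1 e hI hK hKe hd.smooth_s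
  have hμ := hμ0.mul (UExp.const (Θ := Fin N → ℝ) hS h2)
  refine (hl.add hμ).congr ?_ ?_ ?_
  · refine .of_forall fun θ z _ => ?_
    simp only [Medium.C, Matrix.add_mulVec, Matrix.smul_mulVec, Matrix.one_mulVec, Pi.add_apply,
      Pi.smul_apply, smul_eq_mul]
    ring
  · intro z _
    simp only [Medium.C, Matrix.add_mulVec, Matrix.smul_mulVec, Matrix.one_mulVec, Pi.add_apply,
      Pi.smul_apply, smul_eq_mul]
    ring
  · intro θ z _
    simp only [varTraction_eq, Pi.add_apply, Pi.smul_apply, smul_eq_mul]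
    ring

lemma uexp_traction {A : ℝ → TField El} (hA : RegT D I A) :
    UExpV (I ×ˢ D.face (Mesh.faceOf s))
      (fun (θ : Fin N → ℝ) z => (m.perturb φ χ θ).traction D.toMesh (A z.1) s z.2)
      (fun z => m.traction D.toMesh (A z.1) s z.2)
      (fun θ z => (sideVariation D.toMesh m (∑ i, θ i • φ i) (∑ i, θ i • χ i) (A z.1) s z.2).tM) :=
  uexp_stress_mulVec hm hd hI (D.isCompact_face s) (D.inner s) (D.face_subset_inner s) hA
    (D.continuousOn_outNormal s)

lemma uexp_outerTraction [Fintype El] {A : ℝ → TField El} (hA : RegT D I A)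
    {τ : ℝ → BF → V3 → V3}
    (hτ : ∀ b, ContinuousOn (fun z : ℝ × V3 => τ z.1 b z.2) (I ×ˢ D.face (Sum.inr b))) :
    UExpV (I ×ˢ D.face (Mesh.faceOf s))
      (fun (θ : Fin N → ℝ) z => (m.perturb φ χ θ).outerTraction D.toMesh (τ z.1) (A z.1) s z.2)
      (fun z => m.outerTraction D.toMesh (τ z.1) (A z.1) s z.2)
      (fun θ z => (sideVariation D.toMesh m (∑ i, θ i • φ i) (∑ i, θ i • χ i) (A z.1) s z.2).tP) := by
  have hK := D.isCompact_face s
  have hS := hI.prod hK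
  rcases s with fb | b
  · exact uexp_stress_mulVec hm hd hI hK (D.outer (Sum.inl fb)) (D.face_subset_outer _) hA
      (D.continuousOn_outNormal (Sum.inl fb)).neg
  · have ht := uexp_traction hm hd (Sum.inr b) hI hA
    have cτ := UExpV.const (Θ := Fin N → ℝ) hS (hτ b)
    have c := fun a : ℝ => UExp.const (Θ := Fin N → ℝ) hS
        (continuousOn_const (c := a) (s := I ×ˢ D.face (Mesh.faceOf (Sum.inr b))))
    have cn := UExpV.const (Θ := Fin N → ℝ) hS
      (continuousOn_comp_snd (I := I) (D.continuousOn_outNormal (Sum.inr b)))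
    have hev := eventually_admissible hm hd
    have hsub : ∀ z ∈ I ×ˢ D.face (Mesh.faceOf (Sum.inr b)), z.2 ∈ closure (D.cell (D.own b)) :=
      fun z hz => D.face_subset_inner (Sum.inr b) hz.2
    rcases hm.acoustic_or_elastic (D.own b) with h | h
    · have h0 : ∀ z ∈ I ×ˢ D.face (Mesh.faceOf (Sum.inr b)), ¬ (m.mu (D.own b) z.2 ≠ 0) :=
        fun z hz => by
          rw [hm.mu_ne_zero_iff (hsub z hz)]; exact not_not.2 (h _ (hsub z hz))
      refine ((UExpV.smul ((c (-2)).mul (cn.dot (cτ.sub ht))) cn).sub ht).congr ?_ ?_ ?_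
      · filter_upwards [hev] with θ hθ z hz
        have : ¬ ((m.perturb φ χ θ).mu (D.own b) z.2 ≠ 0) := by
          rw [hθ.1.mu_ne_zero_iff (hsub z hz), Ne, hθ.2 _ _ (hsub z hz)]
          simpa using h _ (hsub z hz)
        simp only [Medium.outerTraction, if_neg this]
      · intro z hz
        simp only [Medium.outerTraction, if_neg (h0 z hz)]
      · intro θ z hz
        simp only [sideVariation, varOuter, if_neg (h0 z hz), zero_dotProduct, dotProduct_sub,
          zero_mul, zero_add, smul_zero, add_zero, zero_sub]
        simp only [Mesh.inner]
        congr 2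
        rw [dotProduct_neg]; ring
    · have h0 : ∀ z ∈ I ×ˢ D.face (Mesh.faceOf (Sum.inr b)), m.mu (D.own b) z.2 ≠ 0 :=
        fun z hz => (hm.mu_ne_zero_iff (hsub z hz)).2 (h _ (hsub z hz)).1.ne'
      refine ((UExpV.smul (c (-2)) cτ).add ht).congr ?_ ?_ ?_
      · filter_upwards [hev] with θ hθ z hz
        have : (m.perturb φ χ θ).mu (D.own b) z.2 ≠ 0 := by
          rw [hθ.1.mu_ne_zero_iff (hsub z hz), Ne, hθ.2 _ _ (hsub z hz)]
          exact (h _ (hsub z hz)).1.ne'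
        simp only [Medium.outerTraction, if_pos this]
      · intro z hz
        simp only [Medium.outerTraction, if_pos (h0 z hz)]
      · intro θ z hz
        simp only [sideVariation, varOuter, if_pos (h0 z hz), zero_smul, smul_zero, add_zero,
          zero_add]
        rfl

/-- First-order expansion of the flux terms under perturbations of the wave speeds. -/
lemma uexp_side [Fintype El] {E H : ℝ → TField El} (hE : RegT D I E) (hH : RegT D I H)
    {v w : ℝ → VField El} (hv : RegV D I v) (hw : RegV D I w) {τ : ℝ → BF → V3 → V3}
    (hτ : ∀ b, ContinuousOn (fun z : ℝ × V3 => τ z.1 b z.2) (I ×ˢ D.face (Sum.inr b))) :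
    UExp (I ×ˢ D.face (Mesh.faceOf s))
      (fun (θ : Fin N → ℝ) z => ((m.perturb φ χ θ).interface D.toMesh s z.2).pairing
        ((m.perturb φ χ θ).stateTrace D.toMesh (τ z.1) (E z.1) (v z.1) s z.2)
        ((m.perturb φ χ θ).traction D.toMesh (H z.1) s z.2) (w z.1 (D.inner s) z.2))
      (fun z => (m.interface D.toMesh s z.2).pairing
        (m.stateTrace D.toMesh (τ z.1) (E z.1) (v z.1) s z.2)
        (m.traction D.toMesh (H z.1) s z.2) (w z.1 (D.inner s) z.2))
      (fun θ z => (m.interface D.toMesh s z.2).pairingVar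
        (sideVariation D.toMesh m (∑ i, θ i • φ i) (∑ i, θ i • χ i) (E z.1) s z.2)
        (m.stateTrace D.toMesh (τ z.1) (E z.1) (v z.1) s z.2)
        (m.traction D.toMesh (H z.1) s z.2)
        (sideVariation D.toMesh m (∑ i, θ i • φ i) (∑ i, θ i • χ i) (H z.1) s z.2).tM
        (w z.1 (D.inner s) z.2)) := by
  have hK := D.isCompact_face s
  have hS := hI.prod hK
  have hMs := D.face_subset_inner s
  have hPs := D.face_subset_outer s
  exact UExp.pairing hS (fun _ _ => rfl) (fun _ _ => rfl) (fun _ _ => rfl)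
    (continuousOn_comp_snd (D.continuousOn_outNormal s))
    (continuousOn_comp_snd ((hm.smooth_ρ.continuousOn (D.inner s)).mono hMs))
    (continuousOn_comp_snd ((hm.smooth_ρ.continuousOn (D.outer s)).mono hPs))
    (uexp_speed (D.inner s) hI hK hMs hm.smooth_cp hd.smooth_p)
    (uexp_speed (D.outer s) hI hK hPs hm.smooth_cp hd.smooth_p)
    (uexp_speed (D.inner s) hI hK hMs hm.smooth_cs hd.smooth_s)
    (uexp_speed (D.outer s) hI hK hPs hm.smooth_cs hd.smooth_s)
    (uexp_k0 hm hd s hI) (uexp_k1 hm hd s hI) (uexp_traction hm hd s hI hE)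
    (uexp_outerTraction hm hd s hI hE hτ) (fun _ _ => rfl) (fun _ _ => rfl)
    (hv.continuousOn_face hMs) (hv.continuousOn_face hPs) (uexp_traction hm hd s hI hH)
    (hw.continuousOn_face hMs)

end expansions

end sides

end

end DGAE

namespace DGAE

noncomputable section

/-! ### The residual of the state equation -/

section sums

variable {El IF BF : Type*} [Fintype El] [Fintype IF] [Fintype BF] (D : Discretization El IF BF)

omit [Fintype IF] [Fintype BF] in
lemma intVol_congr {u u' : SField El} (h : ∀ e, ∀ x ∈ closure (D.cell e), u e x = u' e x) :
    D.intVol u = D.intVol u' :=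
  Finset.sum_congr rfl fun e _ => integral_congr_on (D.vol_supp e) (h e)

omit [Fintype El] in
lemma intSides_congr {u u' : Side IF BF → V3 → ℝ}
    (h : ∀ s, ∀ x ∈ D.face (Mesh.faceOf s), u s x = u' s x) : D.intSides u = D.intSides u' :=
  Finset.sum_congr rfl fun s _ => integral_congr_on (D.surfOf_supp s) (h s)

omit [Fintype IF] [Fintype BF] in
lemma intVol_add_mul {u u' : SField El} (hu : ∀ e, ContinuousOn (u e) (closure (D.cell e)))
    (hu' : ∀ e, ContinuousOn (u' e) (closure (D.cell e))) (c : ℝ) :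
    D.intVol (fun e x => u e x + c * u' e x) = D.intVol u + c * D.intVol u' := by
  simp only [Discretization.intVol, Finset.mul_sum, ← Finset.sum_add_distrib]
  refine Finset.sum_congr rfl fun e _ => ?_
  rw [integral_add (integrable_of_continuousOn (D.isCompact_cell e) (D.vol_supp e) (hu e))
    ((integrable_of_continuousOn (D.isCompact_cell e) (D.vol_supp e) (hu' e)).const_mul c),
    integral_const_mul]

omit [Fintype El] in
lemma intSides_add_mul {u u' : Side IF BF → V3 → ℝ}
    (hu : ∀ s, ContinuousOn (u s) (D.face (Mesh.faceOf s)))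
    (hu' : ∀ s, ContinuousOn (u' s) (D.face (Mesh.faceOf s))) (c : ℝ) :
    D.intSides (fun s x => u s x + c * u' s x) = D.intSides u + c * D.intSides u' := by
  simp only [Discretization.intSides, Finset.mul_sum, ← Finset.sum_add_distrib]
  refine Finset.sum_congr rfl fun s _ => ?_
  rw [integral_add (integrable_of_continuousOn (D.isCompact_face s) (D.surfOf_supp s) (hu s))
    ((integrable_of_continuousOn (D.isCompact_face s) (D.surfOf_supp s) (hu' s)).const_mul c),
    integral_const_mul]

omit [Fintype El] in
/-- Sum over sides as a sum over faces, with both sides of an interior face. -/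
lemma intSides_eq_faces (u : Side IF BF → V3 → ℝ) :
    D.intSides u = (∑ f, ((∫ x, u (Sum.inl (f, true)) x ∂D.surf (Sum.inl f))
        + ∫ x, u (Sum.inl (f, false)) x ∂D.surf (Sum.inl f)))
      + ∑ b, ∫ x, u (Sum.inr b) x ∂D.surf (Sum.inr b) := by
  rw [Discretization.intSides, Fintype.sum_sum_type, Fintype.sum_prod_type]
  simp only [Fintype.sum_bool]
  rfl

end sums

section residual

variable {El IF BF : Type*} {D : Discretization El IF BF}

/-- The flux term of the state equation at a side. -/
def sideTerm (M : Mesh El IF BF) (m : Medium El) (τ : BF → V3 → V3) (E : TField El)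
    (v : VField El) (H : TField El) (w : VField El) (s : Side IF BF) (x : V3) : ℝ :=
  (m.interface M s x).pairing (m.stateTrace M τ E v s x) (m.traction M H s x) (w (M.inner s) x)

variable (D) in
/-- Regularity of the arguments of the residual, as functions of time and space. -/
structure RegData (I : Set ℝ) (f : ℝ → VField El) (τ : ℝ → BF → V3 → V3) (Et E : ℝ → TField El)
    (vt v : ℝ → VField El) : Prop where
  f : ∀ e, ContinuousOn (fun z : ℝ × V3 => f z.1 e z.2) (I ×ˢ closure (D.cell e))
  τ : ∀ b, ContinuousOn (fun z : ℝ × V3 => τ z.1 b z.2) (I ×ˢ D.face (Sum.inr b))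
  Et : RegT D I Et
  E : RegT D I E
  vt : RegV D I vt
  v : RegV D I v

variable (D) in
/-- Regularity of the arguments of the residual, as functions of space. -/
structure DataMem (f : VField El) (τ : BF → V3 → V3) (Et E : TField El) (vt v : VField El) :
    Prop where
  f : ∀ e, ContinuousOn (f e) (closure (D.cell e))
  τ : ∀ b, ContinuousOn (τ b) (D.face (Sum.inr b))
  Et : Et ∈ D.Ph
  E : E ∈ D.Ph
  vt : vt ∈ D.Qh
  v : v ∈ D.Qh

lemma DataMem.reg {f : VField El} {τ : BF → V3 → V3} {Et E : TField El} {vt v : VField El}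
    (h : DataMem D f τ Et E vt v) (I : Set ℝ) :
    RegData D I (fun _ => f) (fun _ => τ) (fun _ => Et) (fun _ => E) (fun _ => vt) fun _ => v :=
  ⟨fun e => continuousOn_comp_snd (h.f e), fun b => continuousOn_comp_snd (h.τ b),
    .static h.Et, .static h.E, .static h.vt, .static h.v⟩

lemma continuousOn_slice {Y : Type*} [TopologicalSpace Y] {I : Set ℝ} {K : Set V3}
    {g : ℝ × V3 → Y} (hg : ContinuousOn g (I ×ˢ K)) {t : ℝ} (ht : t ∈ I) :
    ContinuousOn (fun x => g (t, x)) K :=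
  hg.comp (by fun_prop) fun _ hx => ⟨ht, hx⟩

lemma RegData.at {I : Set ℝ} {f : ℝ → VField El} {τ : ℝ → BF → V3 → V3} {Et E : ℝ → TField El}
    {vt v : ℝ → VField El} (h : RegData D I f τ Et E vt v) {t : ℝ} (ht : t ∈ I) :
    DataMem D (f t) (τ t) (Et t) (E t) (vt t) (v t) :=
  ⟨fun e => continuousOn_slice (h.f e) ht, fun b => continuousOn_slice (h.τ b) ht, h.Et.mem t ht,
    h.E.mem t ht, h.vt.mem t ht, h.v.mem t ht⟩

lemma DataMem.add_smul {f f' : VField El} {τ τ' : BF → V3 → V3} {Et E Et' E' : TField El}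
    {vt v vt' v' : VField El} (h : DataMem D f τ Et E vt v) (h' : DataMem D f' τ' Et' E' vt' v')
    (c : ℝ) : DataMem D (f + c • f') (τ + c • τ') (Et + c • Et') (E + c • E') (vt + c • vt')
      (v + c • v') :=
  ⟨fun e => (h.f e).add ((h'.f e).const_smul c), fun b => (h.τ b).add ((h'.τ b).const_smul c),
    D.Ph.add_mem h.Et (D.Ph.smul_mem c h'.Et), D.Ph.add_mem h.E (D.Ph.smul_mem c h'.E),
    D.Qh.add_mem h.vt (D.Qh.smul_mem c h'.vt), D.Qh.add_mem h.v (D.Qh.smul_mem c h'.v)⟩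

section continuity

variable {m : Medium El} (hm : Admissible D.toMesh m) {I : Set ℝ} (hI : IsCompact I)
  {f : ℝ → VField El} {τ : ℝ → BF → V3 → V3} {Et E H : ℝ → TField El} {vt v w : ℝ → VField El}
  (hY : RegData D I f τ Et E vt v) (hH : RegT D I H) (hw : RegV D I w)
include hm hI hY hH hw

/-- Joint continuity in time and space is part of the first-order expansion, here in the trivial
case of no directions. -/
lemma continuousOn_volTerm (e : El) : ContinuousOn (fun z : ℝ × V3 =>
    volTerm m (f z.1) (Et z.1) (E z.1) (vt z.1) (v z.1) (H z.1) (w z.1) e z.2)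
    (I ×ˢ closure (D.cell e)) :=
  (uexp_volTerm (N := 0) (φ := fun _ => 0) (χ := fun _ => 0) hm.isC1 (fun i => i.elim0)
    (fun i => i.elim0) e hI (hY.f e) hY.Et hY.E hH hY.vt hY.v hw).cont0

omit hm hI hY hH hw in
lemma isDirection_empty (m : Medium El) :
    IsDirection (N := 0) D m (fun _ => 0) (fun _ => 0) :=
  ⟨fun i => i.elim0, fun i => i.elim0, fun i => i.elim0⟩

lemma continuousOn_sideTerm [Fintype El] (s : Side IF BF) : ContinuousOn (fun z : ℝ × V3 =>
    sideTerm D.toMesh m (τ z.1) (E z.1) (v z.1) (H z.1) (w z.1) s z.2)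
    (I ×ˢ D.face (Mesh.faceOf s)) :=
  (uexp_side hm (isDirection_empty m) s hI hY.E hH hY.v hw hY.τ).cont0

end continuity

section static

variable [Fintype El] {m : Medium El} (hm : Admissible D.toMesh m)
  {f : VField El} {τ : BF → V3 → V3} {Et E H : TField El} {vt v w : VField El}
  (hY : DataMem D f τ Et E vt v) (hH : H ∈ D.Ph) (hw : w ∈ D.Qh)
include hm hY hH hw

omit [Fintype El] in
lemma continuousOn_volTerm_static (e : El) :
    ContinuousOn (volTerm m f Et E vt v H w e) (closure (D.cell e)) :=
  continuousOn_slice (continuousOn_volTerm hm (isCompact_singleton (x := (0 : ℝ))) (hY.reg {0})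
    (.static hH) (.static hw) e) (mem_singleton 0)

lemma continuousOn_sideTerm_static (s : Side IF BF) :
    ContinuousOn (sideTerm D.toMesh m τ E v H w s) (D.face (Mesh.faceOf s)) :=
  continuousOn_slice (continuousOn_sideTerm hm (isCompact_singleton (x := (0 : ℝ))) (hY.reg {0})
    (.static hH) (.static hw) s) (mem_singleton 0)

variable [Fintype IF] [Fintype BF]

/-- The residual in terms of the volume and flux integrands. -/
lemma stateResidual_eq : stateResidual D m f τ Et E vt v H w =
    D.intVol (volTerm m f Et E vt v H w) - D.intSides (sideTerm D.toMesh m τ E v H w) := by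
  have hflux : ∀ {H w}, H ∈ D.Ph → ∀ s, ∀ x ∈ D.face (Mesh.faceOf s),
      sideTerm D.toMesh m τ E v H w s x =
      ddot ((m.interface D.toMesh s x).fluxV (m.stateTrace D.toMesh τ E v s x))
        (m.C (D.inner s) x (H (D.inner s) x)) +
      (m.interface D.toMesh s x).fluxS (m.stateTrace D.toMesh τ E v s x) ⬝ᵥ w (D.inner s) x :=
    fun hH s x hx => (Interface.flux_eq_pairing (hm.regular s hx).unit _
      (m.C_isSymm _ x ((hH _).2 x)) _).symm
  have h1 : ∀ s, ContinuousOn (fun x =>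
      ddot ((m.interface D.toMesh s x).fluxV (m.stateTrace D.toMesh τ E v s x))
        (m.C (D.inner s) x (H (D.inner s) x))) (D.face (Mesh.faceOf s)) := fun s =>
    (continuousOn_sideTerm_static hm hY hH D.Qh.zero_mem s).congr fun x hx => by
      rw [hflux hH s x hx]; simp
  have h2 : ∀ s, ContinuousOn (fun x =>
      (m.interface D.toMesh s x).fluxS (m.stateTrace D.toMesh τ E v s x) ⬝ᵥ w (D.inner s) x)
        (D.face (Mesh.faceOf s)) := fun s =>
    (continuousOn_sideTerm_static hm hY D.Ph.zero_mem hw s).congr fun x hx => by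
      rw [hflux D.Ph.zero_mem s x hx]; simp [Medium.C, ddot_zero_right]
  rw [stateResidual, sub_sub]
  congr 1
  have := intSides_add_mul D h1 h2 1
  rw [one_mul] at this
  rw [← this]
  exact intSides_congr D fun s x hx => by rw [hflux hH s x hx, one_mul]

end static

/-! ### Linearity of the residual -/

lemma pd_add_mul {u u' : V3 → ℝ} {x : V3} (k : Fin 3) (hu : DifferentiableAt ℝ u x)
    (hu' : DifferentiableAt ℝ u' x) (c : ℝ) :
    pd k (fun y => u y + c * u' y) x = pd k u x + c * pd k u' x := by
  rw [pd_add k hu (hu'.const_mul c), pd_const_mul k hu']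

lemma differentiableAt_C {m : Medium El} (hm : m.IsC1 D) {E : TField El} (hE : E ∈ D.Ph) {e : El}
    {x : V3} (hx : x ∈ closure (D.cell e)) (i j : Fin 3) :
    ContDiffAt ℝ 1 (fun y => m.C e y (E e y) i j) x := by
  simp only [Medium.C_apply, Matrix.trace, Matrix.diag]
  have hEd := fun i j => Ph_smooth hE e i j x hx
  exact (((hm.lam e x hx).mul (ContDiffAt.sum fun p _ => hEd p p)).mul contDiffAt_const).add
    ((contDiffAt_const.mul (hm.mu e x hx)).mul (hEd i j))

lemma Medium.C_add_smul (m : Medium El) (e : El) (x : V3) (A B : M3) (c : ℝ) :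
    m.C e x (A + c • B) = m.C e x A + c • m.C e x B := by
  simp only [Medium.C, Matrix.trace_add, Matrix.trace_smul, smul_eq_mul]; module

lemma divTensor_C_add_smul {m : Medium El} (hm : m.IsC1 D) {E E' : TField El} (hE : E ∈ D.Ph)
    (hE' : E' ∈ D.Ph) (c : ℝ) {e : El} {x : V3} (hx : x ∈ closure (D.cell e)) :
    divTensor (fun y => m.C e y ((E + c • E') e y)) x =
      divTensor (fun y => m.C e y (E e y)) x + c • divTensor (fun y => m.C e y (E' e y)) x := by
  ext i
  have h : ∀ j, pd j (fun y => m.C e y ((E + c • E') e y) i j) x =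
      pd j (fun y => m.C e y (E e y) i j) x + c * pd j (fun y => m.C e y (E' e y) i j) x :=
    fun j => by
      rw [← pd_add_mul j ((differentiableAt_C hm hE hx i j).differentiableAt one_ne_zero)
        ((differentiableAt_C hm hE' hx i j).differentiableAt one_ne_zero)]
      congr 1
      ext y
      exact congrFun (congrFun (m.C_add_smul e y (E e y) (E' e y) c) i) j
  change ∑ j, pd j (fun y => m.C e y ((E + c • E') e y) i j) x =
    ∑ j, pd j (fun y => m.C e y (E e y) i j) x
      + c * ∑ j, pd j (fun y => m.C e y (E' e y) i j) x
  simp only [h, Finset.sum_add_distrib, Finset.mul_sum]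

lemma gradVec_add_smul {v v' : VField El} (hv : v ∈ D.Qh) (hv' : v' ∈ D.Qh) (c : ℝ) {e : El}
    {x : V3} (hx : x ∈ closure (D.cell e)) :
    gradVec ((v + c • v') e) x = gradVec (v e) x + c • gradVec (v' e) x := by
  ext i j
  exact pd_add_mul j ((Qh_smooth hv e i x hx).differentiableAt one_ne_zero)
    ((Qh_smooth hv' e i x hx).differentiableAt one_ne_zero) c

lemma volTerm_add_left {m : Medium El} (hm : m.IsC1 D) {f f' : VField El} {τ τ' : BF → V3 → V3}
    {Et E Et' E' : TField El} {vt v vt' v' : VField El} (h : DataMem D f τ Et E vt v)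
    (h' : DataMem D f' τ' Et' E' vt' v') (c : ℝ) (H : TField El) (w : VField El) {e : El} {x : V3}
    (hx : x ∈ closure (D.cell e)) :
    volTerm m (f + c • f') (Et + c • Et') (E + c • E') (vt + c • vt') (v + c • v') H w e x =
      volTerm m f Et E vt v H w e x + c * volTerm m f' Et' E' vt' v' H w e x := by
  rw [volTerm, divTensor_C_add_smul hm h.E h'.E c hx, gradVec_add_smul h.v h'.v c hx]
  simp only [volTerm, Interface.symPart_add, Interface.symPart_smul, Pi.add_apply, Pi.smul_apply, ddot_add_left, ddot_smul_left,
    add_dotProduct, smul_dotProduct, smul_eq_mul]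
  ring

lemma volTerm_add_right (m : Medium El) (f : VField El) (Et E : TField El) (vt v : VField El)
    (H H' : TField El) (w w' : VField El) (c : ℝ) (e : El) (x : V3) :
    volTerm m f Et E vt v (H + c • H') (w + c • w') e x =
      volTerm m f Et E vt v H w e x + c * volTerm m f Et E vt v H' w' e x := by
  simp only [volTerm, Pi.add_apply, Pi.smul_apply, Medium.C_add_smul, ddot_add_right,
    ddot_smul_right, dotProduct_add, dotProduct_smul, smul_eq_mul]
  ring

lemma traction_add_smul (M : Mesh El IF BF) (m : Medium El) (A B : TField El) (c : ℝ)
    (s : Side IF BF) (x : V3) :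
    m.traction M (A + c • B) s x = m.traction M A s x + c • m.traction M B s x := by
  simp only [Medium.traction, Pi.add_apply, Pi.smul_apply, Medium.C_add_smul, Matrix.add_mulVec,
    Matrix.smul_mulVec]

lemma outerTraction_add_smul (M : Mesh El IF BF) (m : Medium El) (τ τ' : BF → V3 → V3)
    (A B : TField El) (c : ℝ) (s : Side IF BF) (x : V3) :
    m.outerTraction M (τ + c • τ') (A + c • B) s x =
      m.outerTraction M τ A s x + c • m.outerTraction M τ' B s x := by
  rcases s with fb | b
  · simp only [Medium.outerTraction, Pi.add_apply, Pi.smul_apply, Medium.C_add_smul,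
      Matrix.add_mulVec, Matrix.smul_mulVec]
  · simp only [Medium.outerTraction, traction_add_smul]
    split_ifs
    · simp only [Pi.add_apply, Pi.smul_apply]; module
    · simp only [Pi.add_apply, Pi.smul_apply, dotProduct_add, dotProduct_sub, dotProduct_smul,
        smul_eq_mul]
      module

lemma sideTerm_add_left (M : Mesh El IF BF) (m : Medium El) (τ τ' : BF → V3 → V3)
    (E E' : TField El) (v v' : VField El) (c : ℝ) (H : TField El) (w : VField El) (s : Side IF BF)
    (x : V3) :
    sideTerm M m (τ + c • τ') (E + c • E') (v + c • v') H w s x =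
      sideTerm M m τ E v H w s x + c * sideTerm M m τ' E' v' H w s x := by
  simp only [sideTerm, Interface.pairing, Medium.stateTrace, Trace.jumpS, Trace.jumpV_eq,
    Trace.diffV, traction_add_smul, outerTraction_add_smul, Pi.add_apply, Pi.smul_apply,
    dotProduct_add, dotProduct_smul, smul_eq_mul, tang_add_left, tang_smul_left, tang_sub_left]
  ring

lemma sideTerm_add_right (M : Mesh El IF BF) (m : Medium El) (τ : BF → V3 → V3)
    (E : TField El) (v : VField El) (H H' : TField El) (w w' : VField El) (c : ℝ) (s : Side IF BF)
    (x : V3) :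
    sideTerm M m τ E v (H + c • H') (w + c • w') s x =
      sideTerm M m τ E v H w s x + c * sideTerm M m τ E v H' w' s x := by
  simp only [sideTerm, Interface.pairing, traction_add_smul, Pi.add_apply, Pi.smul_apply,
    dotProduct_add, dotProduct_smul, smul_eq_mul, tang_add_right, tang_smul_right]
  ring

section linear

variable [Fintype El] [Fintype IF] [Fintype BF] {m : Medium El} (hm : Admissible D.toMesh m)
  {f f' : VField El} {τ τ' : BF → V3 → V3} {Et E Et' E' H H' : TField El}
  {vt v vt' v' w w' : VField El}
  (hY : DataMem D f τ Et E vt v) (hH : H ∈ D.Ph) (hw : w ∈ D.Qh)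
include hm hY hH hw

lemma stateResidual_add_left (hY' : DataMem D f' τ' Et' E' vt' v') (c : ℝ) :
    stateResidual D m (f + c • f') (τ + c • τ') (Et + c • Et') (E + c • E') (vt + c • vt')
      (v + c • v') H w =
    stateResidual D m f τ Et E vt v H w + c * stateResidual D m f' τ' Et' E' vt' v' H w := by
  rw [stateResidual_eq hm (hY.add_smul hY' c) hH hw, stateResidual_eq hm hY hH hw,
    stateResidual_eq hm hY' hH hw,
    intVol_congr D fun e x hx => volTerm_add_left hm.isC1 hY hY' c H w hx,
    intSides_congr D fun s x _ => sideTerm_add_left D.toMesh m τ τ' E E' v v' c H w s x,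
    intVol_add_mul D (continuousOn_volTerm_static hm hY hH hw)
      (continuousOn_volTerm_static hm hY' hH hw),
    intSides_add_mul D (continuousOn_sideTerm_static hm hY hH hw)
      (continuousOn_sideTerm_static hm hY' hH hw)]
  ring

lemma stateResidual_add_right (hH' : H' ∈ D.Ph) (hw' : w' ∈ D.Qh) (c : ℝ) :
    stateResidual D m f τ Et E vt v (H + c • H') (w + c • w') =
    stateResidual D m f τ Et E vt v H w + c * stateResidual D m f τ Et E vt v H' w' := by
  rw [stateResidual_eq hm hY (D.Ph.add_mem hH (D.Ph.smul_mem c hH'))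
      (D.Qh.add_mem hw (D.Qh.smul_mem c hw')), stateResidual_eq hm hY hH hw,
    stateResidual_eq hm hY hH' hw',
    intVol_congr D fun e x _ => volTerm_add_right m f Et E vt v H H' w w' c e x,
    intSides_congr D fun s x _ => sideTerm_add_right D.toMesh m τ E v H H' w w' c s x,
    intVol_add_mul D (continuousOn_volTerm_static hm hY hH hw)
      (continuousOn_volTerm_static hm hY hH' hw'),
    intSides_add_mul D (continuousOn_sideTerm_static hm hY hH hw)
      (continuousOn_sideTerm_static hm hY hH' hw')]
  ring

end linear

/-! ### Expansion of the residual -/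

variable {N : ℕ}

/-- First-order expansion of the residual under perturbations of the wave speeds, uniformly in
time. -/
lemma uexp_residual [Fintype El] [Fintype IF] [Fintype BF] {m : Medium El}
    (hm : Admissible D.toMesh m) {φ χ : Fin N → SField El} (hd : IsDirection D m φ χ) {I : Set ℝ}
    (hI : IsCompact I) {f : ℝ → VField El} {τ : ℝ → BF → V3 → V3} {Et E H : ℝ → TField El}
    {vt v w : ℝ → VField El} (hY : RegData D I f τ Et E vt v) (hH : RegT D I H)
    (hw : RegV D I w) :
    UExp I (fun (θ : Fin N → ℝ) t => stateResidual D (m.perturb φ χ θ) (f t) (τ t) (Et t) (E t)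
        (vt t) (v t) (H t) (w t))
      (fun t => stateResidual D m (f t) (τ t) (Et t) (E t) (vt t) (v t) (H t) (w t))
      (fun θ t => D.intVol (fun e x =>
          volVarTest m (∑ i, θ i • φ i) (∑ i, θ i • χ i) (Et t) (v t) (H t) e x
          + volVarMain m (∑ i, θ i • φ i) (∑ i, θ i • χ i) (E t) (w t) e x)
        - D.intSides fun s x => (m.interface D.toMesh s x).pairingVar
          (sideVariation D.toMesh m (∑ i, θ i • φ i) (∑ i, θ i • χ i) (E t) s x)
          (m.stateTrace D.toMesh (τ t) (E t) (v t) s x) (m.traction D.toMesh (H t) s x)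
          (sideVariation D.toMesh m (∑ i, θ i • φ i) (∑ i, θ i • χ i) (H t) s x).tM
          (w t (D.inner s) x)) := by
  have h1 := UExp.sum Finset.univ fun e (_ : e ∈ Finset.univ) =>
    (uexp_volTerm hm.isC1 hd.smooth_p hd.smooth_s e hI (hY.f e) hY.Et hY.E hH hY.vt hY.v
      hw).integral (D.isCompact_cell e) (D.vol_supp e) hI
  have h2 := UExp.sum Finset.univ fun s (_ : s ∈ Finset.univ) =>
    (uexp_side hm hd s hI hY.E hH hY.v hw hY.τ).integral (D.isCompact_face s) (D.surfOf_supp s) hI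
  refine (h1.sub h2).congr ?_ ?_ ?_
  · filter_upwards [eventually_admissible hm hd] with θ hθ t ht
    rw [stateResidual_eq hθ.1 (hY.at ht) (hH.mem t ht) (hw.mem t ht)]
    rfl
  · intro t ht
    rw [stateResidual_eq hm (hY.at ht) (hH.mem t ht) (hw.mem t ht)]
    rfl
  · intro θ t _
    rfl

end residual

end

end DGAE

namespace DGAE

noncomputable section

/-! ### Fields without stress and velocity, and definiteness of the mass matrix -/

section null

variable {El IF BF : Type*} {D : Discretization El IF BF}

variable (D) in
/-- The pairs of strains and velocities whose stress and velocity vanish on all elements. They are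
not determined by the equations: in acoustic elements, where only the trace of the strain produces
stress, there are nonzero ones. -/
def nullSpace (m : Medium El) : Submodule ℝ (TField El × VField El) where
  carrier := {U | ∀ e, ∀ x ∈ closure (D.cell e), m.C e x (U.1 e x) = 0 ∧ U.2 e x = 0}
  add_mem' {U V} hU hV e x hx := by
    have := m.C_add_smul e x (U.1 e x) (V.1 e x) 1
    simp only [one_smul] at this
    refine ⟨?_, ?_⟩
    · rw [Prod.fst_add, Pi.add_apply, Pi.add_apply, this, (hU e x hx).1, (hV e x hx).1, add_zero]
    · rw [Prod.snd_add, Pi.add_apply, Pi.add_apply, (hU e x hx).2, (hV e x hx).2, add_zero]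
  zero_mem' e x _ := by simp [Medium.C]
  smul_mem' c U hU e x hx := by
    have := m.C_add_smul e x 0 (U.1 e x) c
    refine ⟨?_, ?_⟩
    · rw [zero_add, (hU e x hx).1, smul_zero, add_zero] at this
      rw [Prod.smul_fst, Pi.smul_apply, Pi.smul_apply, this]
      simp [Medium.C]
    · rw [Prod.smul_snd, Pi.smul_apply, Pi.smul_apply, (hU e x hx).2, smul_zero]

lemma mem_nullSpace {m : Medium El} {U : TField El × VField El} : U ∈ nullSpace D m ↔
    ∀ e, ∀ x ∈ closure (D.cell e), m.C e x (U.1 e x) = 0 ∧ U.2 e x = 0 := Iff.rfl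

lemma sq_trace_le (A : M3) : A.trace ^ 2 ≤ 3 * ddot A A := by
  simp only [Matrix.trace, Matrix.diag, ddot, Fin.sum_univ_three]
  nlinarith [sq_nonneg (A 0 0 - A 1 1), sq_nonneg (A 0 0 - A 2 2), sq_nonneg (A 1 1 - A 2 2),
    sq_nonneg (A 0 1), sq_nonneg (A 0 2), sq_nonneg (A 1 0), sq_nonneg (A 1 2), sq_nonneg (A 2 0),
    sq_nonneg (A 2 1)]

lemma eq_zero_of_ddot_self {A : M3} (h : ddot A A = 0) : A = 0 := by
  have h1 : ∀ i ∈ Finset.univ, 0 ≤ ∑ j, A i j * A i j := fun i _ =>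
    Finset.sum_nonneg fun j _ => mul_self_nonneg _
  ext i j
  have h2 := (Finset.sum_eq_zero_iff_of_nonneg h1).1 h i (Finset.mem_univ i)
  have h3 := (Finset.sum_eq_zero_iff_of_nonneg fun j _ => mul_self_nonneg (A i j)).1 h2 j
    (Finset.mem_univ j)
  exact mul_self_eq_zero.1 h3

variable {m : Medium El} (hm : Admissible D.toMesh m)
include hm

/-- The elastic energy is nonnegative and controls the stress. -/
lemma energy_nonneg {e : El} {x : V3} (hx : x ∈ closure (D.cell e)) (A : M3) :
    0 ≤ ddot A (m.C e x A) ∧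
      (ddot A (m.C e x A) = 0 → A.trace = 0 ∧ (m.cs e x ≠ 0 → A = 0)) := by
  have htr := sq_trace_le A
  rw [m.ddot_C]
  rcases hm.acoustic_or_elastic e with h | h
  · have hs := h x hx
    have hl : 0 < m.lam e x := by
      have := hm.ρ_pos e x hx
      have := hm.cp_pos e x hx
      have h1 : m.lam e x = m.ρ e x * m.cp e x ^ 2 := by simp [Medium.lam, hs]
      rw [h1]; positivity
    have hmu : m.mu e x = 0 := by simp [Medium.mu, hs]
    rw [hmu, zero_mul, add_zero]
    exact ⟨mul_nonneg hl.le (mul_self_nonneg _), fun h0 =>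
      ⟨mul_self_eq_zero.1 ((mul_eq_zero.1 h0).resolve_left hl.ne'), fun h1 => absurd hs h1⟩⟩
  · obtain ⟨hs, hl⟩ := h x hx
    have hmu : 0 < m.mu e x := mul_pos (hm.ρ_pos e x hx) (pow_pos hs 2)
    have hdec : m.lam e x * (A.trace * A.trace) + m.mu e x * (2 * ddot A A) =
        (3 * m.lam e x + 2 * m.mu e x) * (A.trace ^ 2 / 3)
          + m.mu e x * (2 / 3 * (3 * ddot A A - A.trace ^ 2)) := by ring
    have h1 : 0 ≤ (3 * m.lam e x + 2 * m.mu e x) * (A.trace ^ 2 / 3) := by positivity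
    have h2 : 0 ≤ m.mu e x * (2 / 3 * (3 * ddot A A - A.trace ^ 2)) :=
      mul_nonneg hmu.le (by linarith)
    rw [hdec]
    refine ⟨add_nonneg h1 h2, fun h0 => ?_⟩
    have h3 : (3 * m.lam e x + 2 * m.mu e x) * (A.trace ^ 2 / 3) = 0 := by linarith
    have h4 : m.mu e x * (2 / 3 * (3 * ddot A A - A.trace ^ 2)) = 0 := by linarith
    have h5 : A.trace = 0 := by
      have := (mul_eq_zero.1 h3).resolve_left hl.ne'
      exact pow_eq_zero_iff two_ne_zero |>.1 (by linarith)
    refine ⟨h5, fun _ => eq_zero_of_ddot_self ?_⟩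
    have := (mul_eq_zero.1 h4).resolve_left hmu.ne'
    rw [h5] at this
    linarith

lemma C_eq_zero_iff {e : El} {x : V3} (hx : x ∈ closure (D.cell e)) (A : M3) :
    m.C e x A = 0 ↔ A.trace = 0 ∧ (m.cs e x ≠ 0 → A = 0) := by
  refine ⟨fun h => (energy_nonneg hm hx A).2 (by rw [h, ddot_zero_right]), fun ⟨h1, h2⟩ => ?_⟩
  by_cases hs : m.cs e x = 0
  · simp [Medium.C, h1, Medium.mu, hs]
  · simp [Medium.C, h2 hs]

/-- Only the set where `cs` vanishes matters, so the space is unchanged by small perturbations of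
the wave speeds. -/
lemma nullSpace_eq {m' : Medium El} (hm' : Admissible D.toMesh m')
    (h : ∀ e, ∀ x ∈ closure (D.cell e), (m'.cs e x = 0 ↔ m.cs e x = 0)) :
    nullSpace D m' = nullSpace D m := by
  ext U
  simp only [mem_nullSpace]
  refine forall_congr' fun e => forall₂_congr fun x hx => ?_
  rw [C_eq_zero_iff hm hx, C_eq_zero_iff hm' hx, Ne, h e x hx]

omit hm in
lemma gradVec_eq_zero {v : VField El} (hv : v ∈ D.Qh)
    (h : ∀ e, ∀ x ∈ closure (D.cell e), v e x = 0) {e : El} {x : V3}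
    (hx : x ∈ closure (D.cell e)) : gradVec (v e) x = 0 := by
  ext i j
  exact pd_eq_zero_of_eqOn_zero j (D.cell_open e) (Qh_smooth hv e i)
    (fun y hy => congrFun (h e y (subset_closure hy)) i) hx

lemma divTensor_C_eq_zero {E : TField El} (hE : E ∈ D.Ph)
    (h : ∀ e, ∀ x ∈ closure (D.cell e), m.C e x (E e x) = 0) {e : El} {x : V3}
    (hx : x ∈ closure (D.cell e)) : divTensor (fun y => m.C e y (E e y)) x = 0 := by
  ext i
  exact Finset.sum_eq_zero fun j _ => pd_eq_zero_of_eqOn_zero j (D.cell_open e)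
    (fun y hy => differentiableAt_C hm.isC1 hE hy i j)
    (fun y hy => congrFun (congrFun (h e y (subset_closure hy)) i) j) hx

omit hm in
lemma ddot_C_comm (m : Medium El) (e : El) (x : V3) (A B : M3) :
    ddot A (m.C e x B) = ddot (m.C e x A) B := by
  rw [ddot_comm (m.C e x A), m.ddot_C, m.ddot_C, ddot_comm A B, mul_comm A.trace]

/-- The volume terms with derivatives vanish as well, since stress and velocity vanish on open
elements. -/
lemma volTerm_null_left {Et E : TField El} {vt v : VField El} (hE : E ∈ D.Ph) (hv : v ∈ D.Qh)
    (ht : (Et, vt) ∈ nullSpace D m) (h : (E, v) ∈ nullSpace D m) (H : TField El) (w : VField El)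
    {e : El} {x : V3} (hx : x ∈ closure (D.cell e)) : volTerm m 0 Et E vt v H w e x = 0 := by
  have h1 := (ht e x hx).1
  have h2 := (ht e x hx).2
  simp only at h1 h2
  rw [volTerm, ddot_C_comm, h1, h2, gradVec_eq_zero hv (fun e x hx => (h e x hx).2) hx,
    divTensor_C_eq_zero hm hE (fun e x hx => (h e x hx).1) hx]
  simp [symPart, ddot_zero_left]

omit hm in
lemma sideTerm_null_left {E : TField El} {v : VField El} (h : (E, v) ∈ nullSpace D m)
    (H : TField El) (w : VField El) (s : Side IF BF) {x : V3} (hx : x ∈ D.face (Mesh.faceOf s)) :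
    sideTerm D.toMesh m 0 E v H w s x = 0 := by
  have hM := h _ x (D.face_subset_inner s hx)
  have hP := h _ x (D.face_subset_outer s hx)
  simp only at hM hP
  have ht : m.traction D.toMesh E s x = 0 := by
    simp only [Medium.traction, hM.1, Matrix.zero_mulVec]
  have ho : m.outerTraction D.toMesh 0 E s x = 0 := by
    rcases s with fb | b
    · simp only [Medium.outerTraction, hP.1, Matrix.zero_mulVec]
    · simp only [Medium.outerTraction, ht, Pi.zero_apply]
      simp
  simp only [sideTerm, Interface.pairing, Medium.stateTrace, ht, ho, hM.2, hP.2, Trace.jumpS,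
    Trace.jumpV, Trace.diffV]
  simp [tang]

omit hm in
lemma volTerm_null_right {E Et : TField El} {v vt : VField El} {f : VField El} {H : TField El}
    {w : VField El} (h : (H, w) ∈ nullSpace D m) {e : El} {x : V3}
    (hx : x ∈ closure (D.cell e)) : volTerm m f Et E vt v H w e x = 0 := by
  have h1 := h e x hx
  simp only at h1
  rw [volTerm, h1.1, h1.2]
  simp [ddot_zero_right]

omit hm in
lemma sideTerm_null_right {τ : BF → V3 → V3} {E : TField El} {v : VField El} {H : TField El}
    {w : VField El} (h : (H, w) ∈ nullSpace D m) (s : Side IF BF) {x : V3}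
    (hx : x ∈ D.face (Mesh.faceOf s)) : sideTerm D.toMesh m τ E v H w s x = 0 := by
  have hM := h _ x (D.face_subset_inner s hx)
  simp only at hM
  simp only [sideTerm, Interface.pairing, Medium.traction, hM.1, hM.2]
  simp [tang]

variable [Fintype El] [Fintype IF] [Fintype BF]

lemma stateResidual_null_left {Et E : TField El} {vt v : VField El}
    (hY : DataMem D 0 0 Et E vt v) (ht : (Et, vt) ∈ nullSpace D m)
    (h : (E, v) ∈ nullSpace D m) {H : TField El} {w : VField El} (hH : H ∈ D.Ph)
    (hw : w ∈ D.Qh) : stateResidual D m 0 0 Et E vt v H w = 0 := by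
  rw [stateResidual_eq hm hY hH hw, intVol_congr D (u' := fun _ _ => 0)
    fun e x hx => volTerm_null_left hm hY.E hY.v ht h H w hx,
    intSides_congr D (u' := fun _ _ => 0) fun s x hx => sideTerm_null_left h H w s hx]
  simp [Discretization.intVol, Discretization.intSides]

lemma stateResidual_null_right {f : VField El} {τ : BF → V3 → V3} {Et E : TField El}
    {vt v : VField El} (hY : DataMem D f τ Et E vt v) {H : TField El} {w : VField El}
    (hH : H ∈ D.Ph) (hw : w ∈ D.Qh) (h : (H, w) ∈ nullSpace D m) :
    stateResidual D m f τ Et E vt v H w = 0 := by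
  rw [stateResidual_eq hm hY hH hw, intVol_congr D (u' := fun _ _ => 0)
    fun e x hx => volTerm_null_right h hx,
    intSides_congr D (u' := fun _ _ => 0) fun s x hx => sideTerm_null_right h s hx]
  simp [Discretization.intVol, Discretization.intSides]

omit [Fintype El] [Fintype IF] [Fintype BF] in
lemma volTerm_mass {E H : TField El} {v w : VField El} {e : El} {x : V3}
    (hx : x ∈ closure (D.cell e)) :
    volTerm m 0 E 0 v 0 H w e x = ddot (E e x) (m.C e x (H e x)) + m.ρ e x * (v e x ⬝ᵥ w e x) := by
  rw [volTerm, gradVec_eq_zero D.Qh.zero_mem (fun _ _ _ => rfl) hx,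
    divTensor_C_eq_zero hm D.Ph.zero_mem (fun _ _ _ => by simp [Medium.C]) hx]
  simp [symPart, ddot_zero_left]

/-- Definiteness of the mass form up to fields without stress and velocity. The integrand is
nonnegative, hence zero at the integration points; definiteness of the element quadrature on the
local spaces extends this to the whole element, for the trace of the strain in acoustic elements,
and for all components in elastic ones. -/
lemma mem_nullSpace_of_mass {E : TField El} {v : VField El} (hE : E ∈ D.Ph) (hv : v ∈ D.Qh)
    (h : stateResidual D m 0 0 E 0 v 0 E v = 0) : (E, v) ∈ nullSpace D m := by
  have hY : DataMem D 0 0 E 0 v 0 :=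
    ⟨fun _ => continuousOn_const, fun _ => continuousOn_const, hE, D.Ph.zero_mem, hv,
      D.Qh.zero_mem⟩
  have h0 : ((0 : TField El), (0 : VField El)) ∈ nullSpace D m := (nullSpace D m).zero_mem
  rw [stateResidual_eq hm hY hE hv, intSides_congr D (u' := fun _ _ => 0)
    fun s x hx => sideTerm_null_left h0 E v s hx] at h
  have h1 : ∀ e, ∀ x ∈ closure (D.cell e), volTerm m 0 E 0 v 0 E v e x = _ :=
    fun e x hx => volTerm_mass hm hx
  have hnn : ∀ e, 0 ≤ᵐ[D.vol e] volTerm m 0 E 0 v 0 E v e := fun e => by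
    filter_upwards [ae_mem_of_null_compl (D.vol_supp e)] with x hx
    rw [Pi.zero_apply, h1 e x hx]
    exact add_nonneg (energy_nonneg hm hx _).1
      (mul_nonneg (hm.ρ_pos e x hx).le (Finset.sum_nonneg fun i _ => mul_self_nonneg _))
  have h2 : ∑ e, ∫ x, volTerm m 0 E 0 v 0 E v e x ∂D.vol e = 0 := by
    simpa [Discretization.intSides, Discretization.intVol] using h
  have h3 : ∀ e, ∀ᵐ x ∂D.vol e, x ∈ closure (D.cell e) ∧ ddot (E e x) (m.C e x (E e x)) = 0 ∧
      v e x = 0 := fun e => by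
    have h4 := (Finset.sum_eq_zero_iff_of_nonneg
      fun e _ => integral_nonneg_of_ae (hnn e)).1 h2 e (Finset.mem_univ e)
    rw [integral_eq_zero_iff_of_nonneg_ae (hnn e) (integrable_of_continuousOn (D.isCompact_cell e)
      (D.vol_supp e) (continuousOn_volTerm_static hm hY hE hv e))] at h4
    filter_upwards [h4, ae_mem_of_null_compl (D.vol_supp e)] with x hx hxc
    rw [h1 e x hxc, Pi.zero_apply] at hx
    have g1 := (energy_nonneg hm hxc (E e x)).1
    have g2 := hm.ρ_pos e x hxc
    have g3 : 0 ≤ v e x ⬝ᵥ v e x := Finset.sum_nonneg (s := Finset.univ) fun i _ => mul_self_nonneg (v e x i)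
    have g4 : m.ρ e x * (v e x ⬝ᵥ v e x) = 0 := by
      have := mul_nonneg g2.le g3
      linarith
    refine ⟨hxc, by linarith, ?_⟩
    exact dotProduct_self_eq_zero.1 ((mul_eq_zero.1 g4).resolve_left g2.ne')
  intro e x hx
  refine ⟨(C_eq_zero_iff hm hx _).2 ?_, ?_⟩
  · have htr : ∀ y ∈ closure (D.cell e), (E e y).trace = 0 := by
      refine D.VP_definite e (fun y => (E e y).trace) ?_ ?_
      · have : (fun y => (E e y).trace) = ∑ i, fun y => E e y i i := by
          ext y; simp [Matrix.trace]
        rw [this]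
        exact Submodule.sum_mem _ fun i _ => (hE e).1 i i
      · filter_upwards [h3 e] with y hy using ((energy_nonneg hm hy.1 _).2 hy.2.1).1
    refine ⟨htr x hx, fun hs => ?_⟩
    rcases hm.acoustic_or_elastic e with ha | ha
    · exact absurd (ha x hx) hs
    · ext i j
      refine D.VP_definite e (fun y => E e y i j) ((hE e).1 i j) ?_ x hx
      filter_upwards [h3 e] with y hy
      rw [((energy_nonneg hm hy.1 _).2 hy.2.1).2 (ha y hy.1).1.ne']
      rfl
  · ext i
    refine D.VQ_definite e (fun y => v e y i) (hv e i) ?_ x hx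
    filter_upwards [h3 e] with y hy
    rw [hy.2.2]
    rfl

end null

/-! ### Coordinates -/

section coordinates

/-- Coordinates on a subspace `W` modulo a subspace `N`: representatives `u i ∈ W` of a basis
of `W` modulo `N`, and the corresponding coordinate map, extended to the whole space. -/
structure Coordinates {X : Type*} [AddCommGroup X] [Module ℝ X] (W N : Submodule ℝ X) where
  n : ℕ
  u : Fin n → X
  proj : X →ₗ[ℝ] Fin n → ℝ
  u_mem : ∀ i, u i ∈ W
  proj_u : ∀ i, proj (u i) = Pi.single i 1
  sub_mem : ∀ U ∈ W, U - ∑ i, proj U i • u i ∈ N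
  proj_null : ∀ U ∈ W, U ∈ N → proj U = 0

lemma Coordinates.nonempty {X : Type*} [AddCommGroup X] [Module ℝ X] (W N : Submodule ℝ X)
    [FiniteDimensional ℝ W] : Nonempty (Coordinates W N) := by
  let Q := W ⧸ N.submoduleOf W
  let b := Module.finBasis ℝ Q
  have hs : ∀ q : Q, ∃ z : W, (N.submoduleOf W).mkQ z = q := Submodule.mkQ_surjective _
  choose l hl using hs
  obtain ⟨p, hp⟩ := LinearMap.exists_extend
    (b.equivFun.toLinearMap.comp (N.submoduleOf W).mkQ)
  have hp' : ∀ z : W, p z = b.equivFun ((N.submoduleOf W).mkQ z) := fun z =>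
    LinearMap.congr_fun hp z
  refine ⟨⟨_, fun i => (l (b i) : X), p, fun i => (l (b i)).2, fun i => ?_, fun U hU => ?_,
    fun U hU hN => ?_⟩⟩
  · rw [hp', hl]
    ext j
    simp [b.equivFun_self, Pi.single_apply, eq_comm]
  · have h1 : (N.submoduleOf W).mkQ ((⟨U, hU⟩ : W) - ∑ i, p U i • l (b i)) = 0 := by
      simp only [map_sub, map_sum, map_smul, hl]
      have h2 := hp' ⟨U, hU⟩
      simp only at h2
      rw [h2, b.sum_equivFun, sub_self]
    rw [Submodule.mkQ_apply, Submodule.Quotient.mk_eq_zero] at h1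
    have h3 := Submodule.mem_comap.1 h1
    simpa using h3
  · have h1 : (N.submoduleOf W).mkQ (⟨U, hU⟩ : W) = 0 := by
      rw [Submodule.mkQ_apply, Submodule.Quotient.mk_eq_zero]
      exact hN
    have := hp' ⟨U, hU⟩
    rw [h1, map_zero] at this
    exact this

namespace Coordinates

variable {X : Type*} [AddCommGroup X] [Module ℝ X] {W N : Submodule ℝ X} (K : Coordinates W N)

/-- A map that is linear on `W` and vanishes on `W ∩ N` is determined by its values on the
representatives. -/
lemma apply_eq {l : X → ℝ} (hl : ∀ Z ∈ W, ∀ Z' ∈ W, ∀ c : ℝ, l (Z + c • Z') = l Z + c * l Z')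
    (h0 : ∀ Z ∈ W, Z ∈ N → l Z = 0) {Z : X} (hZ : Z ∈ W) :
    l Z = ∑ i, K.proj Z i * l (K.u i) := by
  have hsum : ∀ (c : Fin K.n → ℝ) (s : Finset (Fin K.n)),
      l (∑ i ∈ s, c i • K.u i) = ∑ i ∈ s, c i * l (K.u i) := fun c s => by
    induction s using Finset.induction_on with
    | empty => simpa using h0 0 W.zero_mem N.zero_mem
    | insert i s hi ih =>
      rw [Finset.sum_insert hi, Finset.sum_insert hi, add_comm, hl _ (Submodule.sum_mem _ fun j _ =>
        W.smul_mem _ (K.u_mem j)) _ (K.u_mem i), ih, add_comm]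
  have hS : ∑ i, K.proj Z i • K.u i ∈ W := Submodule.sum_mem _ fun j _ => W.smul_mem _ (K.u_mem j)
  have h1 := hl _ hS _ (W.sub_mem hZ hS) 1
  rw [h0 _ (W.sub_mem hZ hS) (K.sub_mem Z hZ), mul_zero, add_zero, one_smul, add_sub_cancel,
    hsum] at h1
  exact h1

lemma proj_sum (c : Fin K.n → ℝ) : K.proj (∑ i, c i • K.u i) = c := by
  simp only [map_sum, map_smul, K.proj_u]
  ext j
  simp [Finset.sum_apply, Pi.single_apply]

lemma mem_null_of_proj {U : X} (hU : U ∈ W) (h : K.proj U = 0) : U ∈ N := by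
  simpa [h] using K.sub_mem U hU

end Coordinates

end coordinates

section matrices

variable {El IF BF : Type*} [Fintype El] [Fintype IF] [Fintype BF]

variable (D : Discretization El IF BF)

omit [Fintype IF] [Fintype BF] in
lemma finiteDimensional_Ph : FiniteDimensional ℝ D.Ph := by
  have := D.VP_finite
  let g : D.Ph →ₗ[ℝ] (e : El) → Fin 3 → Fin 3 → D.VP e :=
    { toFun := fun A e i j => ⟨fun x => A.1 e x i j, (A.2 e).1 i j⟩
      map_add' := fun _ _ => rfl
      map_smul' := fun _ _ => rfl }
  refine FiniteDimensional.of_injective g fun A B h => ?_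
  ext e x i j
  exact congrFun (congrArg Subtype.val (congrFun (congrFun (congrFun h e) i) j)) x

omit [Fintype IF] [Fintype BF] in
lemma finiteDimensional_Qh : FiniteDimensional ℝ D.Qh := by
  have := D.VQ_finite
  let g : D.Qh →ₗ[ℝ] (e : El) → Fin 3 → D.VQ e :=
    { toFun := fun v e i => ⟨fun x => v.1 e x i, v.2 e i⟩
      map_add' := fun _ _ => rfl
      map_smul' := fun _ _ => rfl }
  refine FiniteDimensional.of_injective g fun A B h => ?_
  ext e x i
  exact congrFun (congrArg Subtype.val (congrFun (congrFun h e) i)) x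

omit [Fintype IF] [Fintype BF] in
lemma exists_coordinates (m : Medium El) :
    Nonempty (Coordinates (D.Ph.prod D.Qh) (nullSpace D m)) := by
  have h : FiniteDimensional ℝ (D.Ph.prod D.Qh) :=
    Module.Finite.iff_fg.2 ((Module.Finite.iff_fg.1 (finiteDimensional_Ph D)).prod
      (Module.Finite.iff_fg.1 (finiteDimensional_Qh D)))
  exact Coordinates.nonempty _ _

end matrices

end

end DGAE

namespace DGAE

noncomputable section

/-! ### Linear systems of ordinary differential equations -/

section ode

lemma exists_hasDerivAt_linear {V : Type*} [NormedAddCommGroup V] [NormedSpace ℝ V]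
    [CompleteSpace V] (M : V →L[ℝ] V) {g : ℝ → V} (hg : Continuous g) (x₀ : V) :
    ∃ x : ℝ → V, x 0 = x₀ ∧ ∀ t, HasDerivAt x (M (x t) + g t) t := by
  -- variation of constants
  let y : ℝ → V := fun t => x₀ + ∫ s in (0 : ℝ)..t, NormedSpace.exp ((-s) • M) (g s)
  have hexp : ∀ t : ℝ, HasDerivAt (fun s : ℝ => NormedSpace.exp (s • M))
      (M * NormedSpace.exp (t • M)) t := fun t => hasDerivAt_exp_smul_const' M t
  have hc : Continuous fun s : ℝ => NormedSpace.exp (s • M) :=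
    continuous_iff_continuousAt.2 fun t => (hexp t).continuousAt
  have hcg : Continuous fun s : ℝ => NormedSpace.exp ((-s) • M) (g s) :=
    (hc.comp continuous_neg).clm_apply hg
  have hy : ∀ t, HasDerivAt y (NormedSpace.exp ((-t) • M) (g t)) t := fun t =>
    (intervalIntegral.integral_hasDerivAt_right (hcg.intervalIntegrable _ _)
      (hcg.stronglyMeasurableAtFilter _ _) hcg.continuousAt).const_add x₀
  refine ⟨fun t => NormedSpace.exp (t • M) (y t), by simp [y], fun t => ?_⟩
  have h := (hexp t).clm_apply (hy t)
  let _ : NormedAlgebra ℚ (V →L[ℝ] V) := NormedAlgebra.restrictScalars ℚ ℝ (V →L[ℝ] V)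
  have hinv : NormedSpace.exp (t • M) * NormedSpace.exp ((-t) • M) = 1 := by
    rw [← NormedSpace.exp_add_of_commute, ← add_smul, add_neg_cancel, zero_smul,
      NormedSpace.exp_zero]
    exact ((Commute.refl M).smul_left t).smul_right (-t)
  have h2 : NormedSpace.exp (t • M) (NormedSpace.exp ((-t) • M) (g t)) = g t := by
    rw [← mul_apply_eq_comp, hinv]; rfl
  rw [h2] at h
  exact h

variable {n : ℕ} {A B : Matrix (Fin n) (Fin n) ℝ}

lemma norm_mulVec_le {a : ℝ} (ha : 0 ≤ a) (h : ∀ i j, |A i j| ≤ a) (y : Fin n → ℝ) :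
    ‖A *ᵥ y‖ ≤ n * a * ‖y‖ := by
  refine (pi_norm_le_iff_of_nonneg (by positivity)).2 fun i => ?_
  calc ‖(A *ᵥ y) i‖ ≤ ∑ j, ‖A i j * y j‖ := norm_sum_le Finset.univ fun j => A i j * y j
    _ ≤ ∑ _j : Fin n, a * ‖y‖ := Finset.sum_le_sum fun j _ => by
        rw [norm_mul]
        exact mul_le_mul (h i j) (norm_le_pi_norm y j) (norm_nonneg _) ha
    _ = _ := by simp [mul_assoc]

lemma abs_dotProduct_le (x y : Fin n → ℝ) : |x ⬝ᵥ y| ≤ n * ‖x‖ * ‖y‖ := by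
  calc |x ⬝ᵥ y| ≤ ∑ j, |x j * y j| := Finset.abs_sum_le_sum_abs _ _
    _ ≤ ∑ _j : Fin n, ‖x‖ * ‖y‖ := Finset.sum_le_sum fun j _ => by
        rw [abs_mul]
        exact mul_le_mul (norm_le_pi_norm x j) (norm_le_pi_norm y j) (abs_nonneg _) (norm_nonneg _)
    _ = _ := by simp [mul_assoc]

lemma exists_lower_bound (hA : ∀ y, A *ᵥ y = 0 → y = 0) :
    ∃ κ > 0, ∀ y, κ * ‖y‖ ≤ ‖A *ᵥ y‖ := by
  obtain ⟨C, hC, hC'⟩ := (Matrix.mulVecLin A).exists_antilipschitzWith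
    (LinearMap.ker_eq_bot'.2 fun y hy => hA y hy)
  refine ⟨(C : ℝ)⁻¹, by positivity, fun y => ?_⟩
  have h := hC'.le_mul_dist y 0
  rw [map_zero, dist_zero_right, dist_zero_right] at h
  rw [inv_mul_le_iff₀ (by positivity)]
  exact h

/-- Solutions exist when the mass matrix is nonsingular. -/
lemma exists_solution (hA : ∀ y, A *ᵥ y = 0 → y = 0) {T : ℝ} (hT : 0 ≤ T) {g : ℝ → Fin n → ℝ}
    (hg : ContinuousOn g (Icc 0 T)) (x₀ : Fin n → ℝ) :
    ∃ x x' : ℝ → Fin n → ℝ, x 0 = x₀ ∧ Continuous x' ∧ (∀ t, HasDerivAt x (x' t) t) ∧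
      ∀ t ∈ Icc 0 T, A *ᵥ x' t = B *ᵥ x t + g t := by
  have hdet : IsUnit A.det := by
    rw [isUnit_iff_ne_zero]
    intro h0
    obtain ⟨y, hy, hy'⟩ := Matrix.exists_mulVec_eq_zero_iff.2 h0
    exact hy (hA y hy')
  let M : (Fin n → ℝ) →L[ℝ] (Fin n → ℝ) := (Matrix.mulVecLin (A⁻¹ * B)).toContinuousLinearMap
  let g' : ℝ → Fin n → ℝ := IccExtend hT ((Icc 0 T).domRestrict g)
  have hg' : Continuous g' := (continuousOn_iff_continuous_domRestrict.1 hg).Icc_extend'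
  have hgc : Continuous fun t => A⁻¹ *ᵥ g' t := continuous_const.matrix_mulVec hg'
  obtain ⟨x, hx0, hx⟩ := exists_hasDerivAt_linear M hgc x₀
  have hxc : Continuous x := continuous_iff_continuousAt.2 fun t => (hx t).continuousAt
  refine ⟨x, fun t => M (x t) + A⁻¹ *ᵥ g' t, hx0, (M.continuous.comp hxc).add hgc, hx,
    fun t ht => ?_⟩
  have h1 : g' t = g t := by simp only [g', IccExtend_of_mem _ _ ht]; rfl
  change A *ᵥ (M (x t) + A⁻¹ *ᵥ g' t) = _
  have h2 : M (x t) = (A⁻¹ * B) *ᵥ x t := rfl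
  rw [h1, h2, Matrix.mulVec_add, Matrix.mulVec_mulVec, Matrix.mulVec_mulVec, ← Matrix.mul_assoc,
    Matrix.mul_nonsing_inv A hdet, Matrix.one_mul, Matrix.one_mulVec]

/-- Gronwall's inequality: solutions that start from zero, and their derivatives, are bounded by
the data, with a constant that depends on the matrices only through the bounds `κ` and `β`. -/
lemma exists_gronwall_bound (n : ℕ) {κ β : ℝ} (T : ℝ) (hκ : 0 < κ) (hβ : 0 ≤ β) :
    ∃ C, 0 ≤ C ∧ ∀ (A B : Matrix (Fin n) (Fin n) ℝ) (x x' r : ℝ → Fin n → ℝ) (ε : ℝ),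
      (∀ y, κ * ‖y‖ ≤ ‖A *ᵥ y‖) → (∀ y, ‖B *ᵥ y‖ ≤ β * ‖y‖) → 0 ≤ ε → x 0 = 0 →
      (∀ t ∈ Icc 0 T, HasDerivWithinAt x (x' t) (Icc 0 T) t) →
      (∀ t ∈ Icc 0 T, A *ᵥ x' t = B *ᵥ x t + r t) → (∀ t ∈ Icc 0 T, ‖r t‖ ≤ ε) →
      ∀ t ∈ Icc 0 T, ‖x t‖ ≤ C * ε ∧ ‖x' t‖ ≤ C * ε := by
  -- the summand `1` excludes the degenerate case `K = 0` of `gronwallBound`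
  set K := β / κ + 1 with hK
  have hKpos : 0 < K := by positivity
  set C₀ := Real.exp (K * T) / (κ * K) with hC₀
  have hC₀pos : 0 ≤ C₀ := by positivity
  refine ⟨C₀ + (β * C₀ + 1) / κ, by positivity, fun A B x x' r ε hA hB hε hx0 hx heq hr => ?_⟩
  have hd : ∀ t ∈ Icc 0 T, ‖x' t‖ ≤ (β * ‖x t‖ + ε) / κ := fun t ht => by
    rw [le_div_iff₀' hκ]
    calc κ * ‖x' t‖ ≤ ‖A *ᵥ x' t‖ := hA _
      _ = ‖B *ᵥ x t + r t‖ := by rw [heq t ht]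
      _ ≤ ‖B *ᵥ x t‖ + ‖r t‖ := norm_add_le _ _
      _ ≤ _ := add_le_add (hB _) (hr t ht)
  have hcont : ContinuousOn x (Icc 0 T) := fun t ht => (hx t ht).continuousWithinAt
  have hgr := norm_le_gronwallBound_of_norm_deriv_right_le (f' := x') (δ := 0) (K := K)
    (ε := ε / κ) hcont (fun t ht => ((hx t (Ico_subset_Icc_self ht)).mono_of_mem_nhdsWithin
      (Icc_mem_nhdsGE_of_mem ht))) (by rw [hx0, norm_zero]) (fun t ht => by
      refine (hd t (Ico_subset_Icc_self ht)).trans ?_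
      rw [hK, add_div, add_mul]
      have : 0 ≤ ‖x t‖ := norm_nonneg _
      have : β * ‖x t‖ / κ = β / κ * ‖x t‖ := by ring
      linarith)
  have hx1 : ∀ t ∈ Icc 0 T, ‖x t‖ ≤ C₀ * ε := fun t ht => by
    refine (hgr t ht).trans ?_
    rw [gronwallBound_of_K_ne_0 hKpos.ne']
    simp only [zero_mul, zero_add, sub_zero]
    rw [hC₀]
    have h1 : Real.exp (K * t) ≤ Real.exp (K * T) := Real.exp_le_exp.2 (by gcongr; exact ht.2)
    calc ε / κ / K * (Real.exp (K * t) - 1) ≤ ε / κ / K * Real.exp (K * T) := by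
          gcongr; linarith
      _ = _ := by field_simp
  intro t ht
  have h1 := hx1 t ht
  have h2 := hd t ht
  constructor
  · have : 0 ≤ (β * C₀ + 1) / κ * ε := by positivity
    rw [add_mul]; linarith
  · refine h2.trans ?_
    rw [add_mul]
    have : 0 ≤ C₀ * ε := by positivity
    have h3 : (β * ‖x t‖ + ε) / κ ≤ (β * C₀ + 1) / κ * ε := by
      rw [div_mul_eq_mul_div]
      gcongr
      have := mul_le_mul_of_nonneg_left h1 hβ
      linarith
    linarith

/-- Uniqueness for the homogeneous system. -/
lemma eq_zero_of_ode (hA : ∀ y, A *ᵥ y = 0 → y = 0) {T : ℝ}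
    {x x' : ℝ → Fin n → ℝ} (h0 : x 0 = 0)
    (hx : ∀ t ∈ Icc 0 T, HasDerivWithinAt x (x' t) (Icc 0 T) t)
    (h : ∀ t ∈ Icc 0 T, A *ᵥ x' t = B *ᵥ x t) : ∀ t ∈ Icc 0 T, x t = 0 := by
  obtain ⟨κ, hκ, hκ'⟩ := exists_lower_bound hA
  obtain ⟨b, hb⟩ := Set.finite_range (fun p : Fin n × Fin n => |B p.1 p.2|) |>.bddAbove
  have hb' : ∀ i j, |B i j| ≤ max b 0 := fun i j =>
    (hb (mem_range_self (i, j))).trans (le_max_left _ _)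
  obtain ⟨C, _, hC⟩ := exists_gronwall_bound n T hκ (β := n * max b 0) (by positivity)
  intro t ht
  have := (hC A B x x' (fun _ => 0) 0 hκ' (norm_mulVec_le (le_max_right _ _) hb') le_rfl h0 hx
    (fun t ht => by rw [h t ht, add_zero]) (fun t _ => by simp) t ht).1
  simpa using this

end ode

end

end DGAE

namespace DGAE

noncomputable section

/-! ### Duality of the fluxes -/

section duality

variable {El IF BF : Type*} {D : Discretization El IF BF}

/-- The boundary conditions of the adjoint are those of the state with zero traction. -/
lemma adjTrace_eq (M : Mesh El IF BF) (m : Medium El) (H : TField El) (w : VField El)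
    (s : Side IF BF) (x : V3) : m.adjTrace M H w s x = m.stateTrace M 0 H w s x := by
  have : m.adjOuterTraction M H s x = m.outerTraction M 0 H s x := by
    rcases s with fb | b
    · rfl
    · simp only [Medium.adjOuterTraction, Medium.outerTraction, Pi.zero_apply]
      split_ifs
      · simp
      · simp only [zero_sub, dotProduct_neg]; module
  simp only [Medium.adjTrace, Medium.stateTrace, this]

lemma interface_swap (M : Mesh El IF BF) (m : Medium El) (f : IF) (x : V3) :
    m.interface M (Sum.inl (f, false)) x = (m.interface M (Sum.inl (f, true)) x).swap := rfl

lemma stateTrace_swap (M : Mesh El IF BF) (m : Medium El) (τ : BF → V3 → V3) (E : TField El)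
    (v : VField El) (f : IF) (x : V3) : m.stateTrace M τ E v (Sum.inl (f, false)) x =
      (m.stateTrace M τ E v (Sum.inl (f, true)) x).swap := by
  simp only [Medium.stateTrace, Trace.swap, Medium.outerTraction, Medium.traction, Mesh.outer,
    Mesh.inner, Mesh.outNormal, neg_neg]

/-- At an acoustic point the stress is isotropic, so that tractions are normal. -/
lemma tang_C_mulVec {m : Medium El} {e : El} {x : V3} (h : m.cs e x = 0) (A : M3) {n n' : V3}
    (hn : n ⬝ᵥ n = 1) (hn' : n' = n ∨ n' = -n) (z : V3) : tang n (m.C e x A *ᵥ n') z = 0 := by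
  have h1 : m.C e x A *ᵥ n' = (m.lam e x * A.trace) • n' := by
    simp [Medium.C, Medium.mu, h, Matrix.smul_mulVec]
  rw [h1]
  rcases hn' with rfl | rfl <;>
  simp only [tang, smul_dotProduct, dotProduct_smul, smul_eq_mul, dotProduct_neg, neg_dotProduct,
    hn] <;> ring

section admissible

variable {m : Medium El} (hm : Admissible D.toMesh m)
include hm

lemma acousticTangential (f : IF) {x : V3} (hx : x ∈ D.face (Sum.inl f)) (τ : BF → V3 → V3)
    (E : TField El) (v : VField El) :
    (m.interface D.toMesh (Sum.inl (f, true)) x).AcousticTangential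
      (m.stateTrace D.toMesh τ E v (Sum.inl (f, true)) x) :=
  have hn := (hm.regular (Sum.inl (f, true)) hx).unit
  ⟨fun h z => tang_C_mulVec h _ hn (Or.inl rfl) z,
    fun h z => tang_C_mulVec (m := m) (e := D.right f) h _ hn (Or.inr rfl) z⟩

omit hm in
lemma sameParameters (M : Mesh El IF BF) (m : Medium El) (b : BF) (x : V3) :
    (m.interface M (Sum.inr b) x).SameParameters := ⟨rfl, rfl, rfl⟩

lemma freeTrace (b : BF) {x : V3} (hx : x ∈ D.face (Sum.inr b)) (E : TField El) (v : VField El) :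
    (m.interface D.toMesh (Sum.inr b) x).FreeTrace
      (m.stateTrace D.toMesh 0 E v (Sum.inr b) x) := by
  have hc : x ∈ closure (D.cell (D.own b)) := D.face_subset_inner (Sum.inr b) hx
  refine ⟨rfl, fun h => ?_, fun h => ?_⟩
  · have h1 : m.mu (D.own b) x ≠ 0 := (hm.mu_ne_zero_iff hc).2 h
    simp [Medium.stateTrace, Medium.outerTraction, h1]
  · have h1 : ¬ m.mu (D.own b) x ≠ 0 := by
      rw [hm.mu_ne_zero_iff hc]; exact not_not.2 h
    simp only [Medium.stateTrace, Medium.outerTraction, if_neg h1, Pi.zero_apply, zero_sub,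
      dotProduct_neg]
    congr 2
    simp [Medium.interface]

end admissible

/-- The flux term of the adjoint equation at a side. -/
def adjSideTerm (M : Mesh El IF BF) (m : Medium El) (H : TField El) (w : VField El)
    (E : TField El) (v : VField El) (s : Side IF BF) (x : V3) : ℝ :=
  (m.interface M s x).adjPairing (m.stateTrace M 0 H w s x) (m.traction M E s x) (v (M.inner s) x)

/-! ### Continuity of traces -/

lemma _root_.ContinuousOn.dot {Z : Type*} [TopologicalSpace Z] {S : Set Z} {f g : Z → V3}
    (hf : ContinuousOn f S) (hg : ContinuousOn g S) : ContinuousOn (fun z => f z ⬝ᵥ g z) S :=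
  continuousOn_finsetSum _ fun i _ => ((continuous_apply i).comp_continuousOn hf).mul
    ((continuous_apply i).comp_continuousOn hg)

lemma _root_.ContinuousOn.tang {Z : Type*} [TopologicalSpace Z] {S : Set Z} {n f g : Z → V3}
    (hn : ContinuousOn n S) (hf : ContinuousOn f S) (hg : ContinuousOn g S) :
    ContinuousOn (fun z => DGAE.tang (n z) (f z) (g z)) S :=
  (hf.dot hg).sub ((hn.dot hf).mul (hn.dot hg))

/-- Continuity of normals and material parameters along a family of interfaces. -/
structure ContInterface {Z : Type*} [TopologicalSpace Z] (S : Set Z) (F : Z → Interface) :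
    Prop where
  n : ContinuousOn (fun z => (F z).n) S
  ρM : ContinuousOn (fun z => (F z).ρM) S
  ρP : ContinuousOn (fun z => (F z).ρP) S
  cpM : ContinuousOn (fun z => (F z).cpM) S
  cpP : ContinuousOn (fun z => (F z).cpP) S
  csM : ContinuousOn (fun z => (F z).csM) S
  csP : ContinuousOn (fun z => (F z).csP) S
  k0 : ContinuousOn (fun z => (F z).k0) S
  k1 : ContinuousOn (fun z => (F z).k1) S

/-- Continuity of a family of traces. -/
structure ContTrace {Z : Type*} [TopologicalSpace Z] (S : Set Z) (q : Z → Trace) : Prop where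
  tM : ContinuousOn (fun z => (q z).tM) S
  tP : ContinuousOn (fun z => (q z).tP) S
  vM : ContinuousOn (fun z => (q z).vM) S
  vP : ContinuousOn (fun z => (q z).vP) S

lemma ContInterface.adjPairing {Z : Type*} [TopologicalSpace Z] {S : Set Z} {F : Z → Interface}
    (hF : ContInterface S F) {p : Z → Trace} (hp : ContTrace S p) {t v : Z → V3}
    (ht : ContinuousOn t S) (hv : ContinuousOn v S) :
    ContinuousOn (fun z => (F z).adjPairing (p z) (t z) (v z)) S := by
  obtain ⟨hn, hρM, hρP, hpM, hpP, hsM, hsP, hk0, hk1⟩ := hF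
  obtain ⟨htM, htP, hvM, hvP⟩ := hp
  have hJ := htM.add htP
  have hD := hvM.sub hvP
  have h1 := (hn.dot hJ).add (hn.dot (((hρM.mul hpM).smul hvM).add ((hρP.mul hpP).smul hvP)))
  have h2 := (hn.dot (((hρP.mul hpP).smul htM).add ((hρM.mul hpM).smul htP.neg))).add
    (((hρM.mul hpM).mul (hρP.mul hpP)).mul ((hvM.dot hn).add (hvP.dot hn.neg)))
  have h3 := hn.tang (hJ.add (((hρM.mul hsM).smul hvM).add ((hρP.mul hsP).smul hvP))) ht
  have h4 := hn.tang ((((hρP.mul hsP).smul htM).add ((hρM.mul hsM).smul htP.neg)).add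
    (((hρM.mul hsM).mul (hρP.mul hsP)).smul hD)) hv
  exact (hk0.mul ((h1.mul (hn.dot ht)).add (h2.mul (hn.dot hv)))).add (hk1.mul (h3.add h4))

section continuity

variable [Fintype El] {m : Medium El} (hm : Admissible D.toMesh m) {I : Set ℝ} (hI : IsCompact I)
include hm hI

lemma contInterface (s : Side IF BF) : ContInterface (I ×ˢ D.face (Mesh.faceOf s))
    fun z => m.interface D.toMesh s z.2 :=
  have hM := D.face_subset_inner s
  have hP := D.face_subset_outer s
  ⟨continuousOn_comp_snd (D.continuousOn_outNormal s),
    continuousOn_comp_snd ((hm.smooth_ρ.continuousOn (D.inner s)).mono hM),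
    continuousOn_comp_snd ((hm.smooth_ρ.continuousOn (D.outer s)).mono hP),
    continuousOn_comp_snd ((hm.smooth_cp.continuousOn (D.inner s)).mono hM),
    continuousOn_comp_snd ((hm.smooth_cp.continuousOn (D.outer s)).mono hP),
    continuousOn_comp_snd ((hm.smooth_cs.continuousOn (D.inner s)).mono hM),
    continuousOn_comp_snd ((hm.smooth_cs.continuousOn (D.outer s)).mono hP),
    (uexp_k0 hm (isDirection_empty m) s hI).cont0, (uexp_k1 hm (isDirection_empty m) s hI).cont0⟩

omit [Fintype El] in
lemma continuousOn_traction {E : ℝ → TField El} (hE : RegT D I E) (s : Side IF BF) :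
    ContinuousOn (fun z : ℝ × V3 => m.traction D.toMesh (E z.1) s z.2)
      (I ×ˢ D.face (Mesh.faceOf s)) :=
  continuousOn_pi.2 fun i => (uexp_traction hm (isDirection_empty m) s hI hE i).cont0

lemma contTrace {τ : ℝ → BF → V3 → V3} {E : ℝ → TField El} {v : ℝ → VField El}
    (hE : RegT D I E) (hv : RegV D I v)
    (hτ : ∀ b, ContinuousOn (fun z : ℝ × V3 => τ z.1 b z.2) (I ×ˢ D.face (Sum.inr b)))
    (s : Side IF BF) : ContTrace (I ×ˢ D.face (Mesh.faceOf s))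
      fun z => m.stateTrace D.toMesh (τ z.1) (E z.1) (v z.1) s z.2 :=
  ⟨continuousOn_traction hm hI hE s,
    continuousOn_pi.2 fun i => (uexp_outerTraction hm (isDirection_empty m) s hI hE hτ i).cont0,
    hv.continuousOn_face (D.face_subset_inner s), hv.continuousOn_face (D.face_subset_outer s)⟩

end continuity

lemma DataMem.main {E : TField El} {v : VField El} (hE : E ∈ D.Ph) (hv : v ∈ D.Qh) :
    DataMem D 0 0 0 E 0 v :=
  ⟨fun _ => continuousOn_const, fun _ => continuousOn_const, D.Ph.zero_mem, hE,
    D.Qh.zero_mem, hv⟩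

lemma DataMem.mass {E : TField El} {v : VField El} (hE : E ∈ D.Ph) (hv : v ∈ D.Qh) :
    DataMem D 0 0 E 0 v 0 :=
  ⟨fun _ => continuousOn_const, fun _ => continuousOn_const, hE, D.Ph.zero_mem, hv,
    D.Qh.zero_mem⟩

lemma DataMem.load {f : VField El} {τ : BF → V3 → V3}
    (hf : ∀ e, ContinuousOn (f e) (closure (D.cell e)))
    (hτ : ∀ b, ContinuousOn (τ b) (D.face (Sum.inr b))) : DataMem D f τ 0 0 0 0 :=
  ⟨hf, hτ, D.Ph.zero_mem, D.Ph.zero_mem, D.Qh.zero_mem, D.Qh.zero_mem⟩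

section adjoint

variable [Fintype El] {m : Medium El} (hm : Admissible D.toMesh m)
  {E H : TField El} {v w : VField El} (hE : E ∈ D.Ph) (hv : v ∈ D.Qh) (hH : H ∈ D.Ph)
  (hw : w ∈ D.Qh)
include hm hE hv hH hw

lemma continuousOn_adjSideTerm (s : Side IF BF) :
    ContinuousOn (adjSideTerm D.toMesh m H w E v s) (D.face (Mesh.faceOf s)) := by
  have hI := isCompact_singleton (x := (0 : ℝ))
  exact continuousOn_slice ((contInterface hm hI s).adjPairing
    (contTrace hm hI (.static hH) (.static hw) (τ := fun _ => 0)
      (fun b => continuousOn_const) s) (continuousOn_traction hm hI (.static hE) s)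
      ((RegV.static hv).continuousOn_face (D.face_subset_inner s))) (mem_singleton 0)

variable [Fintype IF] [Fintype BF]

/-- Discrete integration by parts on the faces: the flux terms of the state equation and of the
adjoint equation are dual to each other. -/
lemma intSides_duality : D.intSides (sideTerm D.toMesh m 0 E v H w) =
    -D.intSides (adjSideTerm D.toMesh m H w E v) := by
  have hY := DataMem.main hE hv
  have c1 := fun s => integrable_of_continuousOn (D.isCompact_face s) (D.surfOf_supp s)
    (continuousOn_sideTerm_static hm hY hH hw s)
  have c2 := fun s => integrable_of_continuousOn (D.isCompact_face s) (D.surfOf_supp s)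
    (continuousOn_adjSideTerm hm hE hv hH hw s)
  rw [intSides_eq_faces, intSides_eq_faces, neg_add, ← Finset.sum_neg_distrib,
    ← Finset.sum_neg_distrib]
  congr 1
  · refine Finset.sum_congr rfl fun f _ => ?_
    have a1 := integral_add (c1 (Sum.inl (f, true))) (c1 (Sum.inl (f, false)))
    have a2 := integral_add (c2 (Sum.inl (f, true))) (c2 (Sum.inl (f, false)))
    refine a1.symm.trans (Eq.trans ?_ (congrArg Neg.neg a2))
    rw [← integral_neg]
    refine integral_congr_on (D.surfOf_supp (Sum.inl (f, true))) fun x hx => ?_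
    have h := Interface.pairing_add_swap (hm.regular (Sum.inl (f, true)) hx)
      (acousticTangential hm f hx 0 E v) (acousticTangential hm f hx 0 H w)
    rw [← interface_swap, ← stateTrace_swap, ← stateTrace_swap] at h
    have e1 := congrArg Trace.tM (stateTrace_swap D.toMesh m 0 H w f x)
    have e2 := congrArg Trace.tM (stateTrace_swap D.toMesh m 0 E v f x)
    simp only [Trace.swap] at e1 e2
    rw [← e1, ← e2] at h
    exact h
  · refine Finset.sum_congr rfl fun b _ => ?_
    rw [← integral_neg]
    refine integral_congr_on (D.surfOf_supp (Sum.inr b)) fun x hx => ?_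
    exact Interface.pairing_boundary (hm.regular (Sum.inr b) hx) (sameParameters D.toMesh m b x)
      (freeTrace hm b hx E v) (freeTrace hm b hx H w)

/-- The adjoint equation states that the residual, tested with the adjoint, and the derivative of
the cost cancel. -/
lemma adjoint_equation_iff {Ht : TField El} {wt : VField El} (hHt : Ht ∈ D.Ph) (hwt : wt ∈ D.Qh)
    (j : ℝ) :
    (D.intVol (fun e x =>
      -ddot (Ht e x) (m.C e x (E e x)) - m.ρ e x * (wt e x ⬝ᵥ v e x)
      - ddot (m.C e x (H e x)) (symPart (gradVec (v e) x))
      - w e x ⬝ᵥ divTensor (fun y => m.C e y (E e y)) x)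
    = -D.intSides (fun s x =>
        ddot ((m.interface D.toMesh s x).adjFluxV (m.adjTrace D.toMesh H w s x))
          (m.C (D.inner s) x (E (D.inner s) x)))
      - D.intSides (fun s x =>
        (m.interface D.toMesh s x).adjFluxS (m.adjTrace D.toMesh H w s x) ⬝ᵥ v (D.inner s) x)
      - j) ↔
    stateResidual D m 0 0 0 E 0 v H w + j = stateResidual D m 0 0 Ht 0 wt 0 E v := by
  have hY := DataMem.main hE hv
  have hYt := DataMem.mass hHt hwt
  have hflux : ∀ {E v}, E ∈ D.Ph → ∀ s, ∀ x ∈ D.face (Mesh.faceOf s),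
      adjSideTerm D.toMesh m H w E v s x =
      ddot ((m.interface D.toMesh s x).adjFluxV (m.adjTrace D.toMesh H w s x))
          (m.C (D.inner s) x (E (D.inner s) x)) +
      (m.interface D.toMesh s x).adjFluxS (m.adjTrace D.toMesh H w s x) ⬝ᵥ v (D.inner s) x :=
    fun hE s x hx => by
      rw [adjTrace_eq]
      exact (Interface.adjFlux_eq_pairing (hm.regular s hx).unit _
        (m.C_isSymm _ x ((hE _).2 x)) _).symm
  have h1 : ∀ s, ContinuousOn (fun x =>
      ddot ((m.interface D.toMesh s x).adjFluxV (m.adjTrace D.toMesh H w s x))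
        (m.C (D.inner s) x (E (D.inner s) x))) (D.face (Mesh.faceOf s)) := fun s =>
    (continuousOn_adjSideTerm hm hE D.Qh.zero_mem hH hw s).congr fun x hx => by
      rw [hflux hE s x hx]; simp
  have h2 : ∀ s, ContinuousOn (fun x =>
      (m.interface D.toMesh s x).adjFluxS (m.adjTrace D.toMesh H w s x) ⬝ᵥ v (D.inner s) x)
        (D.face (Mesh.faceOf s)) := fun s =>
    (continuousOn_adjSideTerm hm D.Ph.zero_mem hv hH hw s).congr fun x hx => by
      rw [hflux D.Ph.zero_mem s x hx]; simp [Medium.C, ddot_zero_right]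
  have h3 := intSides_add_mul D h1 h2 1
  rw [one_mul] at h3
  have h4 : D.intSides (adjSideTerm D.toMesh m H w E v) = _ :=
    (intSides_congr D fun s x hx => by rw [hflux hE s x hx, one_mul]).trans h3
  have h5 := intVol_add_mul D (continuousOn_volTerm_static hm hY hH hw)
    (continuousOn_volTerm_static hm hYt hE hv) (-1)
  have h6 : D.intVol (fun e x =>
      -ddot (Ht e x) (m.C e x (E e x)) - m.ρ e x * (wt e x ⬝ᵥ v e x)
      - ddot (m.C e x (H e x)) (symPart (gradVec (v e) x))
      - w e x ⬝ᵥ divTensor (fun y => m.C e y (E e y)) x) = _ :=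
    (intVol_congr D fun e x hx => by
      rw [volTerm_mass hm hx, volTerm, ddot_comm (m.C e x (H e x)), dotProduct_comm (w e x)]
      simp only [Pi.zero_apply, add_zero, ddot_zero_left, zero_dotProduct, mul_zero]
      ring).trans h5
  have h7 : D.intSides (sideTerm D.toMesh m 0 0 0 E v) = 0 := by
    rw [intSides_congr D (u' := fun _ _ => 0)
      fun s x hx => sideTerm_null_left (nullSpace D m).zero_mem E v s hx]
    simp [Discretization.intSides]
  rw [h6, stateResidual_eq hm hY hH hw, stateResidual_eq hm hYt hE hv, h7,
    intSides_duality hm hE hv hH hw, h4]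
  constructor <;> intro h <;> linarith

end adjoint

end duality

end

end DGAE

namespace DGAE

noncomputable section

/-! ### The semidiscrete equations in coordinates -/

section coordinates

variable {El IF BF : Type*} [Fintype El] [Fintype IF] [Fintype BF] {D : Discretization El IF BF}
  {N : Submodule ℝ (TField El × VField El)} (K : Coordinates (D.Ph.prod D.Qh) N)

/-- The mass matrix. -/
def massMat (m : Medium El) : Matrix (Fin K.n) (Fin K.n) ℝ :=
  .of fun i j => stateResidual D m 0 0 (K.u j).1 0 (K.u j).2 0 (K.u i).1 (K.u i).2

/-- The stiffness matrix, with the volume and flux terms of the state equation. The sign is such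
that the state equation reads `massMat *ᵥ c' = stiffMat *ᵥ c + loadVec`. -/
def stiffMat (m : Medium El) : Matrix (Fin K.n) (Fin K.n) ℝ :=
  .of fun i j => -stateResidual D m 0 0 0 (K.u j).1 0 (K.u j).2 (K.u i).1 (K.u i).2

/-- The load vector. -/
def loadVec (m : Medium El) (f : VField El) (τ : BF → V3 → V3) : Fin K.n → ℝ :=
  fun i => -stateResidual D m f τ 0 0 0 0 (K.u i).1 (K.u i).2

section static

variable {m : Medium El} (hm : Admissible D.toMesh m) (hN : nullSpace D m = N)
include hm hN

lemma mass_coord {E H : TField El} {v w : VField El} (hE : E ∈ D.Ph) (hv : v ∈ D.Qh)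
    (hH : H ∈ D.Ph) (hw : w ∈ D.Qh) :
    stateResidual D m 0 0 E 0 v 0 H w = K.proj (H, w) ⬝ᵥ (massMat K m *ᵥ K.proj (E, v)) := by
  subst hN
  have h1 := K.apply_eq (l := fun Z => stateResidual D m 0 0 E 0 v 0 Z.1 Z.2)
    (fun Z hZ Z' hZ' c =>
      stateResidual_add_right hm (DataMem.mass hE hv) hZ.1 hZ.2 hZ'.1 hZ'.2 c)
    (fun Z hZ hZN => stateResidual_null_right hm (DataMem.mass hE hv) hZ.1 hZ.2 hZN)
    (Z := (H, w)) ⟨hH, hw⟩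
  refine h1.trans (Finset.sum_congr rfl fun i _ => congrArg _ ?_)
  have h2 := K.apply_eq (l := fun Z => stateResidual D m 0 0 Z.1 0 Z.2 0 (K.u i).1 (K.u i).2)
    (fun Z hZ Z' hZ' c => by
      simpa using stateResidual_add_left hm (DataMem.mass hZ.1 hZ.2) (K.u_mem i).1 (K.u_mem i).2
        (DataMem.mass hZ'.1 hZ'.2) c)
    (fun Z hZ hZN => stateResidual_null_left hm (DataMem.mass hZ.1 hZ.2) hZN
      (nullSpace D m).zero_mem (K.u_mem i).1 (K.u_mem i).2)
    (Z := (E, v)) ⟨hE, hv⟩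
  exact h2.trans (Finset.sum_congr rfl fun j _ => mul_comm _ _)

lemma stiff_coord {E H : TField El} {v w : VField El} (hE : E ∈ D.Ph) (hv : v ∈ D.Qh)
    (hH : H ∈ D.Ph) (hw : w ∈ D.Qh) :
    stateResidual D m 0 0 0 E 0 v H w = -(K.proj (H, w) ⬝ᵥ (stiffMat K m *ᵥ K.proj (E, v))) := by
  subst hN
  have h1 := K.apply_eq (l := fun Z => stateResidual D m 0 0 0 E 0 v Z.1 Z.2)
    (fun Z hZ Z' hZ' c =>
      stateResidual_add_right hm (DataMem.main hE hv) hZ.1 hZ.2 hZ'.1 hZ'.2 c)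
    (fun Z hZ hZN => stateResidual_null_right hm (DataMem.main hE hv) hZ.1 hZ.2 hZN)
    (Z := (H, w)) ⟨hH, hw⟩
  rw [← dotProduct_neg]
  refine h1.trans (Finset.sum_congr rfl fun i _ => congrArg _ ?_)
  have h2 := K.apply_eq (l := fun Z => stateResidual D m 0 0 0 Z.1 0 Z.2 (K.u i).1 (K.u i).2)
    (fun Z hZ Z' hZ' c => by
      simpa using stateResidual_add_left hm (DataMem.main hZ.1 hZ.2) (K.u_mem i).1 (K.u_mem i).2
        (DataMem.main hZ'.1 hZ'.2) c)
    (fun Z hZ hZN => stateResidual_null_left hm (DataMem.main hZ.1 hZ.2)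
      (nullSpace D m).zero_mem hZN (K.u_mem i).1 (K.u_mem i).2)
    (Z := (E, v)) ⟨hE, hv⟩
  refine h2.trans ?_
  rw [Pi.neg_apply, Matrix.mulVec, dotProduct, ← Finset.sum_neg_distrib]
  refine Finset.sum_congr rfl fun j _ => ?_
  simp only [stiffMat, Matrix.of_apply]
  ring

/-- The residual in coordinates. -/
lemma stateResidual_coord {f : VField El} {τ : BF → V3 → V3} {Et E H : TField El}
    {vt v w : VField El} (hY : DataMem D f τ Et E vt v) (hH : H ∈ D.Ph) (hw : w ∈ D.Qh) :
    stateResidual D m f τ Et E vt v H w = K.proj (H, w) ⬝ᵥ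
      (massMat K m *ᵥ K.proj (Et, vt) - stiffMat K m *ᵥ K.proj (E, v) - loadVec K m f τ) := by
  have hl := DataMem.load hY.f hY.τ
  have h1 := stateResidual_add_left hm hl hH hw (DataMem.mass hY.Et hY.vt) 1
  have h2 := stateResidual_add_left hm (hl.add_smul (DataMem.mass hY.Et hY.vt) 1) hH hw
    (DataMem.main hY.E hY.v) 1
  simp only [one_smul, add_zero, zero_add, one_mul] at h1 h2
  rw [h2, h1, mass_coord K hm hN hY.Et hY.vt hH hw, stiff_coord K hm hN hY.E hY.v hH hw]
  have h3 : stateResidual D m f τ 0 0 0 0 H w = -(K.proj (H, w) ⬝ᵥ loadVec K m f τ) := by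
    subst hN
    have h4 := K.apply_eq (l := fun Z => stateResidual D m f τ 0 0 0 0 Z.1 Z.2)
      (fun Z hZ Z' hZ' c => stateResidual_add_right hm hl hZ.1 hZ.2 hZ'.1 hZ'.2 c)
      (fun Z hZ hZN => stateResidual_null_right hm hl hZ.1 hZ.2 hZN) (Z := (H, w)) ⟨hH, hw⟩
    refine h4.trans ?_
    rw [← dotProduct_neg]
    refine Finset.sum_congr rfl fun i _ => congrArg _ ?_
    simp only [Pi.neg_apply, loadVec, neg_neg]
  rw [h3]
  simp only [dotProduct_sub]
  ring

/-- The mass matrix is nonsingular, since the coordinates are taken modulo the kernel of the mass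
form. -/
lemma massMat_injective {c : Fin K.n → ℝ} (hc : massMat K m *ᵥ c = 0) : c = 0 := by
  have hU : ∑ i, c i • K.u i ∈ D.Ph.prod D.Qh :=
    Submodule.sum_mem _ fun i _ => Submodule.smul_mem _ _ (K.u_mem i)
  have h := mass_coord K hm hN hU.1 hU.2 hU.1 hU.2
  rw [Prod.mk.eta, K.proj_sum, hc, dotProduct_zero] at h
  have h1 := mem_nullSpace_of_mass hm hU.1 hU.2 h
  rw [hN] at h1
  rw [← K.proj_sum c]
  exact K.proj_null _ hU h1

omit hN in
lemma massMat_transpose : (massMat K m)ᵀ = massMat K m := by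
  have h : ∀ i j, massMat K m i j =
      D.intVol (volTerm m 0 (K.u j).1 0 (K.u j).2 0 (K.u i).1 (K.u i).2) := fun i j => by
    simp only [massMat, Matrix.of_apply]
    rw [stateResidual_eq hm (DataMem.mass (K.u_mem j).1 (K.u_mem j).2) (K.u_mem i).1 (K.u_mem i).2,
      intSides_congr D (u' := fun _ _ => 0) fun s x hx =>
        sideTerm_null_left (nullSpace D m).zero_mem _ _ s hx]
    simp [Discretization.intSides]
  ext i j
  rw [Matrix.transpose_apply, h, h]
  refine intVol_congr D fun e x hx => ?_
  rw [volTerm_mass hm hx, volTerm_mass hm hx, ddot_C_comm, ddot_comm, dotProduct_comm]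

end static

omit [Fintype El] [Fintype IF] [Fintype BF] in
lemma ContinuousOn.of_Ioo {V : Type*} [TopologicalSpace V] [T2Space V] {T : ℝ} (hT : 0 < T)
    {f g : ℝ → V} (hf : ContinuousOn f (Icc 0 T)) (hg : ContinuousOn g (Icc 0 T))
    (h : ∀ t ∈ Ioo 0 T, f t = g t) : ∀ t ∈ Icc 0 T, f t = g t :=
  EqOn.of_subset_closure (s := Ioo 0 T) h hf hg Ioo_subset_Icc_self
    (closure_Ioo hT.ne).ge

lemma continuousOn_loadVec {m : Medium El} (hm : Admissible D.toMesh m) (P : ProblemData D) :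
    ContinuousOn (fun t => loadVec K m (P.force t) (P.trac t)) (Icc 0 P.T) :=
  continuousOn_pi.2 fun i => ((uexp_residual hm (isDirection_empty m) isCompact_Icc
    (Et := fun _ => 0) (E := fun _ => 0) (vt := fun _ => 0) (v := fun _ => 0)
    ⟨P.force_cont, P.trac_cont, .static D.Ph.zero_mem, .static D.Ph.zero_mem,
      .static D.Qh.zero_mem, .static D.Qh.zero_mem⟩ (.static (K.u_mem i).1)
      (.static (K.u_mem i).2)).cont0).neg

/-! ### Curves in coordinates -/

omit [Fintype El] [Fintype IF] [Fintype BF] in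
/-- Coordinates of continuously differentiable curves are continuously differentiable. -/
lemma exists_coord_deriv {T : ℝ} (hT : 0 < T) {E : ℝ → TField El} {v : ℝ → VField El}
    (hE : IsC1Curve T D.Ph E) (hv : IsC1Curve T D.Qh v) :
    RegT D (Icc 0 T) E ∧ RegV D (Icc 0 T) v ∧ ∃ E' v', RegT D (Icc 0 T) E' ∧
      RegV D (Icc 0 T) v' ∧ (∀ t ∈ Ioo 0 T, dtT E t = E' t ∧ dtV v t = v' t) ∧
      (∀ t ∈ Icc 0 T, HasDerivWithinAt (fun t => K.proj (E t, v t)) (K.proj (E' t, v' t))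
        (Icc 0 T) t) ∧ ContinuousOn (fun t => K.proj (E' t, v' t)) (Icc 0 T) := by
  obtain ⟨rE, E', rE', hE', tE⟩ := hE.regT hT
  obtain ⟨rv, v', rv', hv', tv⟩ := hv.regV hT
  have hsplit : ∀ (A : TField El) (b : VField El), K.proj (A, b) =
      (K.proj.comp (LinearMap.inl ℝ _ _)) A + (K.proj.comp (LinearMap.inr ℝ _ _)) b :=
    fun A b => by
      simp only [LinearMap.comp_apply, LinearMap.inl_apply, LinearMap.inr_apply, ← map_add,
        Prod.mk_add_mk, add_zero, zero_add]
  refine ⟨rE, rv, E', v', rE', rv', fun t ht => ⟨tE t ht, tv t ht⟩, fun t ht => ?_, ?_⟩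
  · simp only [hsplit]
    exact (hE'.hasDeriv _ t ht).add (hv'.hasDeriv _ t ht)
  · simp only [hsplit]
    exact (hE'.cont _).add (hv'.cont _)

omit [Fintype El] [Fintype IF] [Fintype BF] in
/-- Curves with given coordinates, through a given point. -/
lemma exists_curve {T : ℝ} {c c' : ℝ → Fin K.n → ℝ} (hc : ∀ t, HasDerivAt c (c' t) t)
    (hc' : Continuous c') {E₀ : TField El} {v₀ : VField El} (hE₀ : E₀ ∈ D.Ph) (hv₀ : v₀ ∈ D.Qh)
    {t₀ : ℝ} (h₀ : c t₀ = K.proj (E₀, v₀)) :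
    ∃ E v, IsC1Curve T D.Ph E ∧ IsC1Curve T D.Qh v ∧ E t₀ = E₀ ∧ v t₀ = v₀ ∧
      ∀ t, K.proj (E t, v t) = c t := by
  have hsm : ∀ i, ContDiffOn ℝ 1 (fun t => c t i - K.proj (E₀, v₀) i) (Icc 0 T) := fun i => by
    have h1 : ∀ t, HasDerivAt (fun t => c t i) (c' t i) t := fun t => hasDerivAt_pi.1 (hc t) i
    have h2 : ContDiff ℝ 1 fun t => c t i := contDiff_one_iff_deriv.2
      ⟨fun t => (h1 t).differentiableAt, by
        rw [show deriv (fun t => c t i) = fun t => c' t i from funext fun t => (h1 t).deriv]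
        exact (continuous_apply i).comp hc'⟩
    exact (h2.sub contDiff_const).contDiffOn
  refine ⟨fun t => E₀ + ∑ i, (c t i - K.proj (E₀, v₀) i) • (K.u i).1,
    fun t => v₀ + ∑ i, (c t i - K.proj (E₀, v₀) i) • (K.u i).2,
    ⟨K.n + 1, Fin.cons E₀ fun i => (K.u i).1, Fin.cons (fun _ => 1)
      fun i t => c t i - K.proj (E₀, v₀) i, ?_, ?_, ?_⟩,
    ⟨K.n + 1, Fin.cons v₀ fun i => (K.u i).2, Fin.cons (fun _ => 1)
      fun i t => c t i - K.proj (E₀, v₀) i, ?_, ?_, ?_⟩, ?_, ?_, ?_⟩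
  · exact fun k => Fin.cases hE₀ (fun i => (K.u_mem i).1) k
  · exact fun k => Fin.cases contDiffOn_const hsm k
  · intro t _
    rw [Fin.sum_univ_succ]
    simp
  · exact fun k => Fin.cases hv₀ (fun i => (K.u_mem i).2) k
  · exact fun k => Fin.cases contDiffOn_const hsm k
  · intro t _
    rw [Fin.sum_univ_succ]
    simp
  · simp [h₀]
  · simp [h₀]
  · intro t
    have h : ((E₀ + ∑ i, (c t i - K.proj (E₀, v₀) i) • (K.u i).1,
        v₀ + ∑ i, (c t i - K.proj (E₀, v₀) i) • (K.u i).2) : TField El × VField El) =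
        (E₀, v₀) + ∑ i, (c t - K.proj (E₀, v₀)) i • K.u i := by
      ext1
      · simp [Prod.fst_sum]
      · simp [Prod.snd_sum]
    rw [h, map_add, K.proj_sum, add_sub_cancel]

end coordinates

end

end DGAE

namespace DGAE

noncomputable section

/-! ### Solvability of the state equation -/

section wellposed

variable {El IF BF : Type*} {D : Discretization El IF BF}

lemma sub_mem_nullSpace {m : Medium El} {U V : TField El × VField El} :
    U - V ∈ nullSpace D m ↔ ∀ e, ∀ x ∈ closure (D.cell e),
      m.C e x (U.1 e x) = m.C e x (V.1 e x) ∧ U.2 e x = V.2 e x := by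
  refine forall_congr' fun e => forall₂_congr fun x _ => ?_
  have h := m.C_add_smul e x (U.1 e x) (V.1 e x) (-1)
  rw [neg_one_smul, neg_one_smul, ← sub_eq_add_neg, ← sub_eq_add_neg] at h
  rw [Prod.fst_sub, Prod.snd_sub, Pi.sub_apply, Pi.sub_apply, Pi.sub_apply, Pi.sub_apply, h,
    sub_eq_zero, sub_eq_zero]

variable [Fintype El] [Fintype IF] [Fintype BF] {m : Medium El} (hm : Admissible D.toMesh m)
  {N : Submodule ℝ (TField El × VField El)} (K : Coordinates (D.Ph.prod D.Qh) N)
  (hN : nullSpace D m = N)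
include hm hN

/-- The state equation at a fixed time, in coordinates. -/
lemma stateResidual_eq_zero_iff {f : VField El} {τ : BF → V3 → V3} {Et E : TField El}
    {vt v : VField El} (hY : DataMem D f τ Et E vt v) :
    (∀ H ∈ D.Ph, ∀ w ∈ D.Qh, stateResidual D m f τ Et E vt v H w = 0) ↔
      massMat K m *ᵥ K.proj (Et, vt) = stiffMat K m *ᵥ K.proj (E, v) + loadVec K m f τ := by
  constructor
  · intro h
    ext i
    have h1 := h (K.u i).1 (K.u_mem i).1 (K.u i).2 (K.u_mem i).2
    rw [stateResidual_coord K hm hN hY (K.u_mem i).1 (K.u_mem i).2, Prod.mk.eta, K.proj_u,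
      single_one_dotProduct] at h1
    simp only [Pi.sub_apply, Pi.add_apply] at h1 ⊢
    linarith
  · intro h H hH w hw
    rw [stateResidual_coord K hm hN hY hH hw, h]
    simp

/-- Solutions of the state equation solve a linear system of ordinary differential equations. -/
lemma IsState.ode {P : ProblemData D} {E E' : ℝ → TField El} {v v' : ℝ → VField El}
    (h : IsState D P m E v) (rE : RegT D (Icc 0 P.T) E) (rv : RegV D (Icc 0 P.T) v)
    (rE' : RegT D (Icc 0 P.T) E') (rv' : RegV D (Icc 0 P.T) v')
    (hdt : ∀ t ∈ Ioo 0 P.T, dtT E t = E' t ∧ dtV v t = v' t)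
    (hder : ∀ t ∈ Icc 0 P.T, HasDerivWithinAt (fun t => K.proj (E t, v t))
      (K.proj (E' t, v' t)) (Icc 0 P.T) t)
    (hcont : ContinuousOn (fun t => K.proj (E' t, v' t)) (Icc 0 P.T)) :
    ∀ t ∈ Icc 0 P.T, massMat K m *ᵥ K.proj (E' t, v' t) =
      stiffMat K m *ᵥ K.proj (E t, v t) + loadVec K m (P.force t) (P.trac t) := by
  have hY : RegData D (Icc 0 P.T) P.force P.trac E' E v' v :=
    ⟨P.force_cont, P.trac_cont, rE', rE, rv', rv⟩
  have hc : ContinuousOn (fun t => K.proj (E t, v t)) (Icc 0 P.T) :=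
    fun t ht => (hder t ht).continuousWithinAt
  refine ContinuousOn.of_Ioo P.T_pos ?_ ?_ fun t ht => ?_
  · exact (continuous_const.matrix_mulVec continuous_id).comp_continuousOn hcont
  · exact ((continuous_const.matrix_mulVec continuous_id).comp_continuousOn hc).add
      (continuousOn_loadVec K hm P)
  · refine (stateResidual_eq_zero_iff hm K hN (hY.at (Ioo_subset_Icc_self ht))).1 fun H hH w hw => ?_
    rw [← (hdt t ht).1, ← (hdt t ht).2]
    exact h.equation t ht H hH w hw

omit K hN in
theorem exists_state (P : ProblemData D) : ∃ E v, IsState D P m E v := by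
  obtain ⟨K⟩ := exists_coordinates D m
  obtain ⟨c, c', h0, hc', hc, hode⟩ := exists_solution (B := stiffMat K m)
    (fun y => massMat_injective K hm rfl) P.T_pos.le (continuousOn_loadVec K hm P)
    (K.proj (P.E0, P.v0))
  obtain ⟨E, v, hE, hv, hE0, hv0, hproj⟩ :=
    exists_curve (T := P.T) K hc hc' P.E0_mem P.v0_mem h0
  obtain ⟨rE, rv, E', v', rE', rv', hdt, hder, -⟩ := exists_coord_deriv K P.T_pos hE hv
  have hY : RegData D (Icc 0 P.T) P.force P.trac E' E v' v :=
    ⟨P.force_cont, P.trac_cont, rE', rE, rv', rv⟩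
  refine ⟨E, v, hE, hv, fun e x _ => by rw [hE0], fun e x _ => by rw [hv0],
    fun t ht H hH w hw => ?_⟩
  rw [(hdt t ht).1, (hdt t ht).2]
  have htI := Ioo_subset_Icc_self ht
  refine (stateResidual_eq_zero_iff hm K rfl (hY.at htI)).2 ?_ H hH w hw
  have hd : K.proj (E' t, v' t) = c' t := by
    have h1 := hder t htI
    simp only [hproj] at h1
    exact (uniqueDiffOn_Icc P.T_pos t htI).eq_deriv _ h1 (hc t).hasDerivWithinAt
  rw [hd, hproj, hode t htI]

omit K hN in
/-- Solutions of the state equation have the same stress and velocity. -/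
theorem state_unique {P : ProblemData D} {E₁ E₂ : ℝ → TField El} {v₁ v₂ : ℝ → VField El}
    (h₁ : IsState D P m E₁ v₁) (h₂ : IsState D P m E₂ v₂) {t : ℝ} (ht : t ∈ Icc 0 P.T) :
    (E₁ t, v₁ t) - (E₂ t, v₂ t) ∈ nullSpace D m := by
  obtain ⟨K⟩ := exists_coordinates D m
  obtain ⟨r₁, s₁, E₁', v₁', r₁', s₁', hdt₁, hder₁, hc₁⟩ :=
    exists_coord_deriv K P.T_pos h₁.curve_E h₁.curve_v
  obtain ⟨r₂, s₂, E₂', v₂', r₂', s₂', hdt₂, hder₂, hc₂⟩ :=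
    exists_coord_deriv K P.T_pos h₂.curve_E h₂.curve_v
  have o₁ := h₁.ode hm K rfl r₁ s₁ r₁' s₁' hdt₁ hder₁ hc₁
  have o₂ := h₂.ode hm K rfl r₂ s₂ r₂' s₂' hdt₂ hder₂ hc₂
  have hmem : ∀ t ∈ Icc 0 P.T, (E₁ t, v₁ t) - (E₂ t, v₂ t) ∈ D.Ph.prod D.Qh := fun t ht =>
    ⟨D.Ph.sub_mem (r₁.mem t ht) (r₂.mem t ht), D.Qh.sub_mem (s₁.mem t ht) (s₂.mem t ht)⟩
  have h0 : (0 : ℝ) ∈ Icc 0 P.T := ⟨le_rfl, P.T_pos.le⟩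
  have hz := eq_zero_of_ode (A := massMat K m) (B := stiffMat K m)
    (x := fun t => K.proj (E₁ t, v₁ t) - K.proj (E₂ t, v₂ t))
    (fun y => massMat_injective K hm rfl) ?_ (fun t ht => (hder₁ t ht).fun_sub (hder₂ t ht))
    (fun t ht => by rw [Matrix.mulVec_sub, Matrix.mulVec_sub, o₁ t ht, o₂ t ht]; abel) t ht
  · refine K.mem_null_of_proj (hmem t ht) ?_
    rw [map_sub]; exact hz
  · rw [← map_sub]
    refine K.proj_null _ (hmem 0 h0) (sub_mem_nullSpace.2 fun e x hx => ⟨?_, ?_⟩)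
    · simp only [h₁.init_E e x hx, h₂.init_E e x hx]
    · simp only [h₁.init_v e x hx, h₂.init_v e x hx]

end wellposed

/-! ### Solvability of the adjoint equation -/

section adjoint

variable {El IF BF : Type*} [Fintype El] {D : Discretization El IF BF}

/-- The derivative of the cost at a fixed time. -/
def costDeriv (P : ProblemData D) (v v' : VField El) : ℝ :=
  ∑ e, ∫ x, fderiv ℝ P.jΩ (v e x) (v' e x) ∂P.obs e

omit [Fintype El] in
instance (P : ProblemData D) (e : El) : IsFiniteMeasure (P.obs e) := P.obs_finite e

omit [Fintype El] in
lemma continuousOn_costDeriv_integrand (P : ProblemData D) {I : Set ℝ} {v v' : ℝ → VField El}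
    (hv : RegV D I v) (hv' : RegV D I v') (e : El) :
    ContinuousOn (fun z : ℝ × V3 => fderiv ℝ P.jΩ (v z.1 e z.2) (v' z.1 e z.2))
      (I ×ˢ closure (D.cell e)) :=
  ((P.jΩ_smooth.continuous_fderiv one_ne_zero).comp_continuousOn
    (hv.continuousOn_face subset_rfl)).clm_apply (hv'.continuousOn_face subset_rfl)

lemma continuousOn_costDeriv (P : ProblemData D) {I : Set ℝ} (hI : IsCompact I)
    {v v' : ℝ → VField El} (hv : RegV D I v) (hv' : RegV D I v') :
    ContinuousOn (fun t => costDeriv P (v t) (v' t)) I :=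
  continuousOn_finsetSum _ fun e _ => continuousOn_integral_param (D.isCompact_cell e)
    (P.obs_supp e) hI (continuousOn_costDeriv_integrand P hv hv' e)

lemma costDeriv_add_mul (P : ProblemData D) {v v' v'' : VField El} (hv : v ∈ D.Qh)
    (hv' : v' ∈ D.Qh) (hv'' : v'' ∈ D.Qh) (c : ℝ) :
    costDeriv P v (v' + c • v'') = costDeriv P v v' + c * costDeriv P v v'' := by
  have hi : ∀ {u}, u ∈ D.Qh → ∀ e,
      Integrable (fun x => fderiv ℝ P.jΩ (v e x) (u e x)) (P.obs e) := fun hu e =>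
    integrable_of_continuousOn (D.isCompact_cell e) (P.obs_supp e)
      (continuousOn_slice (continuousOn_costDeriv_integrand P (I := {0}) (.static hv) (.static hu) e)
        (mem_singleton 0))
  simp only [costDeriv, Finset.mul_sum, ← Finset.sum_add_distrib]
  refine Finset.sum_congr rfl fun e _ => ?_
  rw [← integral_const_mul, ← integral_add (hi hv' e) ((hi hv'' e).const_mul c)]
  simp only [Pi.add_apply, Pi.smul_apply, map_add, map_smul, smul_eq_mul]

lemma costDeriv_congr (P : ProblemData D) {v v' u u' : VField El}
    (h : ∀ e, ∀ x ∈ closure (D.cell e), v e x = u e x)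
    (h' : ∀ e, ∀ x ∈ closure (D.cell e), v' e x = u' e x) :
    costDeriv P v v' = costDeriv P u u' :=
  Finset.sum_congr rfl fun e _ => integral_congr_on (P.obs_supp e) fun x hx => by
    rw [h e x hx, h' e x hx]

variable {N : Submodule ℝ (TField El × VField El)} (K : Coordinates (D.Ph.prod D.Qh) N)

/-- The derivative of the cost in coordinates. -/
def costVec (P : ProblemData D) (v : VField El) : Fin K.n → ℝ :=
  fun i => costDeriv P v (K.u i).2

lemma continuousOn_costVec (P : ProblemData D) {v : ℝ → VField El}
    (hv : RegV D (Icc 0 P.T) v) : ContinuousOn (fun t => costVec K P (v t)) (Icc 0 P.T) :=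
  continuousOn_pi.2 fun i => continuousOn_costDeriv P isCompact_Icc hv (.static (K.u_mem i).2)

lemma costDeriv_coord {m : Medium El} (hN : nullSpace D m = N) (P : ProblemData D)
    {v v' : VField El} {E' : TField El} (hv : v ∈ D.Qh) (hE' : E' ∈ D.Ph) (hv' : v' ∈ D.Qh) :
    costDeriv P v v' = K.proj (E', v') ⬝ᵥ costVec K P v := by
  subst hN
  refine K.apply_eq (l := fun Z => costDeriv P v Z.2)
    (fun Z hZ Z' hZ' c => costDeriv_add_mul P hv hZ.2 hZ'.2 c) (fun Z hZ hZN => ?_)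
    (Z := (E', v')) ⟨hE', hv'⟩
  rw [costDeriv_congr P (u := v) (u' := fun _ _ => 0) (fun _ _ _ => rfl)
    fun e x hx => (hZN e x hx).2]
  simp [costDeriv]

variable [Fintype IF] [Fintype BF] {m : Medium El} (hm : Admissible D.toMesh m)
  (hN : nullSpace D m = N)
include hm hN

/-- The adjoint equation in coordinates. -/
lemma adjointEquation_iff (P : ProblemData D) {v : ℝ → VField El} {H : ℝ → TField El}
    {w : ℝ → VField El} {t : ℝ} {Ht : TField El} {wt : VField El} (hv : v t ∈ D.Qh)
    (hH : H t ∈ D.Ph) (hw : w t ∈ D.Qh) (hHt : Ht ∈ D.Ph) (hwt : wt ∈ D.Qh)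
    (ht : dtT H t = Ht ∧ dtV w t = wt) :
    (∀ E' ∈ D.Ph, ∀ v' ∈ D.Qh, AdjointEquation D P m v H w t E' v') ↔
      massMat K m *ᵥ K.proj (Ht, wt) =
        (-(stiffMat K m)ᵀ) *ᵥ K.proj (H t, w t) + costVec K P (v t) := by
  have key : ∀ E' ∈ D.Ph, ∀ v' ∈ D.Qh, (AdjointEquation D P m v H w t E' v' ↔
      K.proj (E', v') ⬝ᵥ ((-(stiffMat K m)ᵀ) *ᵥ K.proj (H t, w t) + costVec K P (v t)) =
        K.proj (E', v') ⬝ᵥ (massMat K m *ᵥ K.proj (Ht, wt))) := fun E' hE' v' hv' => by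
    have h := adjoint_equation_iff hm hE' hv' hH hw hHt hwt (costDeriv P (v t) v')
    rw [stiff_coord K hm hN hE' hv' hH hw, mass_coord K hm hN hHt hwt hE' hv',
      costDeriv_coord K hN P hv hE' hv', Matrix.dotProduct_mulVec, dotProduct_comm _ (K.proj (E', v')),
      ← Matrix.mulVec_transpose, ← costDeriv_coord K hN P hv hE' hv', ← ht.1, ← ht.2] at h
    rw [AdjointEquation, dotProduct_add, Matrix.neg_mulVec, dotProduct_neg, ← ht.1, ← ht.2,
      ← costDeriv_coord K hN P hv hE' hv']
    exact h
  constructor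
  · intro h
    ext i
    have h1 := (key _ (K.u_mem i).1 _ (K.u_mem i).2).1 (h _ (K.u_mem i).1 _ (K.u_mem i).2)
    rw [Prod.mk.eta, K.proj_u, single_one_dotProduct, single_one_dotProduct] at h1
    exact h1.symm
  · intro h E' hE' v' hv'
    rw [key E' hE' v' hv', h]

/-- Solutions of the adjoint equation solve the transposed system, backward in time. -/
lemma IsAdjoint.ode {P : ProblemData D} {v : ℝ → VField El} (hv : RegV D (Icc 0 P.T) v)
    {H H' : ℝ → TField El} {w w' : ℝ → VField El}
    (heq : ∀ t ∈ Ioo 0 P.T, ∀ E' ∈ D.Ph, ∀ v' ∈ D.Qh, AdjointEquation D P m v H w t E' v')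
    (rH : RegT D (Icc 0 P.T) H)
    (rw' : RegV D (Icc 0 P.T) w) (rH' : RegT D (Icc 0 P.T) H') (rww : RegV D (Icc 0 P.T) w')
    (hdt : ∀ t ∈ Ioo 0 P.T, dtT H t = H' t ∧ dtV w t = w' t)
    (hder : ∀ t ∈ Icc 0 P.T, HasDerivWithinAt (fun t => K.proj (H t, w t))
      (K.proj (H' t, w' t)) (Icc 0 P.T) t)
    (hcont : ContinuousOn (fun t => K.proj (H' t, w' t)) (Icc 0 P.T)) :
    ∀ t ∈ Icc 0 P.T, massMat K m *ᵥ K.proj (H' t, w' t) =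
      (-(stiffMat K m)ᵀ) *ᵥ K.proj (H t, w t) + costVec K P (v t) := by
  have hc : ContinuousOn (fun t => K.proj (H t, w t)) (Icc 0 P.T) :=
    fun t ht => (hder t ht).continuousWithinAt
  refine ContinuousOn.of_Ioo P.T_pos ?_ ?_ fun t ht => ?_
  · exact (continuous_const.matrix_mulVec continuous_id).comp_continuousOn hcont
  · exact ((continuous_const.matrix_mulVec continuous_id).comp_continuousOn hc).add
      (continuousOn_costVec K P hv)
  · have htI := Ioo_subset_Icc_self ht
    exact (adjointEquation_iff K hm hN P (hv.mem t htI) (rH.mem t htI) (rw'.mem t htI)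
      (rH'.mem t htI) (rww.mem t htI) (hdt t ht)).1 (heq t ht)

omit K hN in
theorem exists_adjoint (P : ProblemData D) {v : ℝ → VField El} (hv : IsC1Curve P.T D.Qh v) :
    ∃ H w, IsAdjoint D P m v H w := by
  obtain ⟨K⟩ := exists_coordinates D m
  obtain ⟨rv, -⟩ := hv.regV P.T_pos
  have hmaps : MapsTo (fun s : ℝ => P.T - s) (Icc 0 P.T) (Icc 0 P.T) := fun s hs =>
    ⟨by linarith [hs.2], by linarith [hs.1]⟩
  -- `y s` stands for the coordinates of the adjoint at time `T - s`
  obtain ⟨y, y', h0, hy', hy, hode⟩ := exists_solution (B := (stiffMat K m)ᵀ)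
    (g := fun s => -costVec K P (v (P.T - s)))
    (fun y => massMat_injective K hm rfl) P.T_pos.le
    ((continuousOn_costVec K P rv).comp (by fun_prop) hmaps).neg 0
  have hc : ∀ t, HasDerivAt (fun t => y (P.T - t)) (-y' (P.T - t)) t := fun t => by
    have := (hy (P.T - t)).scomp t ((hasDerivAt_id t).const_sub P.T)
    rw [neg_one_smul] at this
    exact this
  obtain ⟨H, w, hH, hw, hHT, hwT, hproj⟩ := exists_curve (T := P.T) (t₀ := P.T) K hc
    (hy'.comp (continuous_const.sub continuous_id)).neg D.Ph.zero_mem D.Qh.zero_mem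
    (by rw [sub_self, h0]; exact (map_zero K.proj).symm)
  obtain ⟨rH, rw', H', w', rH', rww, hdt, hder, -⟩ := exists_coord_deriv K P.T_pos hH hw
  refine ⟨H, w, hH, hw, fun e x _ => by rw [hHT]; rfl, fun e x _ => by rw [hwT]; rfl,
    fun t ht => ?_⟩
  have htI := Ioo_subset_Icc_self ht
  refine (adjointEquation_iff K hm rfl P (rv.mem t htI) (rH.mem t htI) (rw'.mem t htI)
    (rH'.mem t htI) (rww.mem t htI) (hdt t ht)).2 ?_
  have hd : K.proj (H' t, w' t) = -y' (P.T - t) := by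
    have h1 := hder t htI
    simp only [hproj] at h1
    exact (uniqueDiffOn_Icc P.T_pos t htI).eq_deriv _ h1 (hc t).hasDerivWithinAt
  rw [hd, hproj, Matrix.mulVec_neg, hode _ (hmaps htI), sub_sub_cancel, Matrix.neg_mulVec,
    neg_add, neg_neg]

omit K hN in
/-- Solutions of the adjoint equation have the same stress and velocity. -/
theorem adjoint_unique {P : ProblemData D} {v : ℝ → VField El} (hv : IsC1Curve P.T D.Qh v)
    {H₁ H₂ : ℝ → TField El} {w₁ w₂ : ℝ → VField El}
    (h₁ : IsAdjoint D P m v H₁ w₁) (h₂ : IsAdjoint D P m v H₂ w₂) {t : ℝ}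
    (ht : t ∈ Icc 0 P.T) : (H₁ t, w₁ t) - (H₂ t, w₂ t) ∈ nullSpace D m := by
  obtain ⟨K⟩ := exists_coordinates D m
  obtain ⟨rv, -⟩ := hv.regV P.T_pos
  obtain ⟨r₁, s₁, H₁', w₁', r₁', s₁', hdt₁, hder₁, hc₁⟩ :=
    exists_coord_deriv K P.T_pos h₁.curve_H h₁.curve_w
  obtain ⟨r₂, s₂, H₂', w₂', r₂', s₂', hdt₂, hder₂, hc₂⟩ :=
    exists_coord_deriv K P.T_pos h₂.curve_H h₂.curve_w
  have o₁ := IsAdjoint.ode K hm rfl rv h₁.equation r₁ s₁ r₁' s₁' hdt₁ hder₁ hc₁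
  have o₂ := IsAdjoint.ode K hm rfl rv h₂.equation r₂ s₂ r₂' s₂' hdt₂ hder₂ hc₂
  have hmem : ∀ t ∈ Icc 0 P.T, (H₁ t, w₁ t) - (H₂ t, w₂ t) ∈ D.Ph.prod D.Qh := fun t ht =>
    ⟨D.Ph.sub_mem (r₁.mem t ht) (r₂.mem t ht), D.Qh.sub_mem (s₁.mem t ht) (s₂.mem t ht)⟩
  have hT : P.T ∈ Icc 0 P.T := ⟨P.T_pos.le, le_rfl⟩
  have hmaps : MapsTo (fun s : ℝ => P.T - s) (Icc 0 P.T) (Icc 0 P.T) := fun s hs =>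
    ⟨by linarith [hs.2], by linarith [hs.1]⟩
  -- reversal of time turns the final condition into an initial condition
  have hz := eq_zero_of_ode (A := massMat K m) (B := (stiffMat K m)ᵀ) (T := P.T)
    (x := fun s => K.proj (H₁ (P.T - s), w₁ (P.T - s)) - K.proj (H₂ (P.T - s), w₂ (P.T - s)))
    (x' := fun s => -(K.proj (H₁' (P.T - s), w₁' (P.T - s))
      - K.proj (H₂' (P.T - s), w₂' (P.T - s))))
    (fun y => massMat_injective K hm rfl) ?_ (fun s hs => ?_) (fun s hs => ?_) (P.T - t) (hmaps ht)
  · refine K.mem_null_of_proj (hmem t ht) ?_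
    rw [map_sub]
    simpa using hz
  · simp only [sub_zero]
    rw [← map_sub]
    refine K.proj_null _ (hmem _ hT) (sub_mem_nullSpace.2 fun e x hx => ⟨?_, ?_⟩)
    · simp only [h₁.final_H e x hx, h₂.final_H e x hx]
    · simp only [h₁.final_w e x hx, h₂.final_w e x hx]
  · have := ((hder₁ _ (hmaps hs)).fun_sub (hder₂ _ (hmaps hs))).scomp s
      (((hasDerivAt_id s).const_sub P.T).hasDerivWithinAt (s := Icc 0 P.T)) hmaps
    rw [neg_one_smul] at this
    exact this
  · rw [Matrix.mulVec_neg, Matrix.mulVec_sub, o₁ _ (hmaps hs), o₂ _ (hmaps hs), Matrix.mulVec_sub,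
      Matrix.neg_mulVec, Matrix.neg_mulVec]
    abel

end adjoint

/-! ### The adjoint fluxes in terms of jumps -/

/-- The adjoint fluxes minus the traces from the element. On acoustic sides `k1 = 0`, so the
tangential part of `w` is not cancelled in the velocity flux; contraction with a stress, which is
isotropic there, removes it. -/
theorem adjoint_flux_differences {El IF BF : Type*} {D : Discretization El IF BF} {m : Medium El}
    (hm : Admissible D.toMesh m) (H : TField El) (w : VField El) (s : Side IF BF) {x : V3}
    (hx : x ∈ D.face (Mesh.faceOf s)) :
    (∀ A : M3, A.IsSymm →
      ddot ((m.interface D.toMesh s x).adjFluxV (m.adjTrace D.toMesh H w s x)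
          - symPart (Matrix.vecMulVec (D.outNormal s x) (w (D.inner s) x)))
        (m.C (D.inner s) x A) =
      ddot ((m.interface D.toMesh s x).adjFluxDiffV (m.adjTrace D.toMesh H w s x))
        (m.C (D.inner s) x A)) ∧
    (m.mu (D.inner s) x ≠ 0 →
      (m.interface D.toMesh s x).adjFluxV (m.adjTrace D.toMesh H w s x)
          - symPart (Matrix.vecMulVec (D.outNormal s x) (w (D.inner s) x)) =
        (m.interface D.toMesh s x).adjFluxDiffV (m.adjTrace D.toMesh H w s x)) ∧
    (m.interface D.toMesh s x).adjFluxS (m.adjTrace D.toMesh H w s x)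
        - m.traction D.toMesh H s x =
      (m.interface D.toMesh s x).adjFluxDiffS (m.adjTrace D.toMesh H w s x) := by
  have hF := hm.regular s hx
  have ht : (m.interface D.toMesh s x).csM = 0 → ∀ (A : M3) (z : V3),
      tang (D.outNormal s x) (m.C (D.inner s) x A *ᵥ D.outNormal s x) z = 0 :=
    fun h A z => tang_C_mulVec h A hF.unit (Or.inl rfl) z
  exact ⟨fun A hA => Interface.ddot_adjFluxV_sub hF (m.adjTrace D.toMesh H w s x)
      (m.C_isSymm _ x hA) fun h => ht h A,
    fun hμ => Interface.adjFluxV_sub hF (m.adjTrace D.toMesh H w s x)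
      ((hm.mu_ne_zero_iff (D.face_subset_inner s hx)).1 hμ),
    Interface.adjFluxS_sub hF (m.adjTrace D.toMesh H w s x) fun h => ht h _⟩

end

end DGAE

namespace DGAE

noncomputable section

/-! ### The cost functional to first order -/

/-- First-order Taylor expansion, uniformly on a compact set. -/
lemma exists_taylor {F : Type*} [NormedAddCommGroup F] [NormedSpace ℝ F] [ProperSpace F]
    {j : F → ℝ} (hj : ContDiff ℝ 1 j) {S : Set F} (hS : IsCompact S) {ε : ℝ} (hε : 0 < ε) :
    ∃ δ > 0, ∀ x ∈ S, ∀ y, ‖y - x‖ ≤ δ → |j y - j x - fderiv ℝ j x (y - x)| ≤ ε * ‖y - x‖ := by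
  obtain ⟨R, hR⟩ := hS.isBounded.subset_closedBall 0
  have huc : UniformContinuousOn (fderiv ℝ j) (Metric.closedBall 0 (R + 1)) :=
    (isCompact_closedBall 0 (R + 1)).uniformContinuousOn_of_continuous
      (hj.continuous_fderiv one_ne_zero).continuousOn
  obtain ⟨δ, hδ, hδ'⟩ := Metric.uniformContinuousOn_iff.1 huc ε hε
  refine ⟨min (δ / 2) 1, by positivity, fun x hx y hy => ?_⟩
  set r := min (δ / 2) 1 with hr
  have hx0 : ‖x‖ ≤ R := by simpa using hR hx
  have hmem : ∀ z ∈ Metric.closedBall x r, z ∈ Metric.closedBall (0 : F) (R + 1) := fun z hz => by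
    rw [mem_closedBall_iff_norm] at hz
    rw [mem_closedBall_zero_iff]
    have h1 : ‖z‖ ≤ ‖z - x‖ + ‖x‖ := by simpa using norm_add_le (z - x) x
    have h2 : r ≤ 1 := min_le_right _ _
    linarith
  have h := (convex_closedBall x r).norm_image_sub_le_of_norm_hasFDerivWithin_le'
    (f := j) (f' := fderiv ℝ j) (φ := fderiv ℝ j x) (C := ε) (x := x) (y := y)
    (fun z _ => (hj.differentiable one_ne_zero z).hasFDerivAt.hasFDerivWithinAt)
    (fun z hz => ?_) (Metric.mem_closedBall_self (by positivity)) (mem_closedBall_iff_norm.2 hy)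
  · exact h
  · rw [← dist_eq_norm]
    refine (hδ' z (hmem z hz) x (hmem x (Metric.mem_closedBall_self (by positivity))) ?_).le
    have h3 : r ≤ δ / 2 := min_le_left _ _
    have := Metric.mem_closedBall.1 hz
    linarith

lemma RegOn.sub {I : Set ℝ} {K : Set V3} {u v : ℝ → V3 → ℝ} (hu : RegOn I K u)
    (hv : RegOn I K v) : RegOn I K fun t x => u t x - v t x where
  smooth t ht x hx := (hu.smooth t ht x hx).sub (hv.smooth t ht x hx)
  cont := hu.cont.sub hv.cont
  cont_pd k := (ContinuousOn.sub (hu.cont_pd k) (hv.cont_pd k)).congr fun _ hz =>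
    pd_sub k (hu.diff hz.1 hz.2) (hv.diff hz.1 hz.2)

lemma RegV.sub {El IF BF : Type*} {D : Discretization El IF BF} {I : Set ℝ}
    {u v : ℝ → VField El} (hu : RegV D I u) (hv : RegV D I v) :
    RegV D I fun t => u t - v t where
  mem t ht := D.Qh.sub_mem (hu.mem t ht) (hv.mem t ht)
  reg e i := (hu.reg e i).sub (hv.reg e i)

section cost

variable {El IF BF : Type*} [Fintype El] {D : Discretization El IF BF} (P : ProblemData D)

/-- The cost of a velocity at a fixed time. -/
def costAt (v : VField El) : ℝ := ∑ e, ∫ x, P.jΩ (v e x) ∂P.obs e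

omit [Fintype El] in
lemma continuousOn_jΩ {I : Set ℝ} {v : ℝ → VField El} (hv : RegV D I v) (e : El) :
    ContinuousOn (fun z : ℝ × V3 => P.jΩ (v z.1 e z.2)) (I ×ˢ closure (D.cell e)) :=
  P.jΩ_smooth.continuous.comp_continuousOn (hv.continuousOn_face subset_rfl)

lemma continuousOn_costAt {I : Set ℝ} (hI : IsCompact I) {v : ℝ → VField El} (hv : RegV D I v) :
    ContinuousOn (fun t => costAt P (v t)) I :=
  continuousOn_finsetSum _ fun e _ => continuousOn_integral_param (D.isCompact_cell e)
    (P.obs_supp e) hI (continuousOn_jΩ P hv e)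

lemma costAt_congr {v v' : VField El} (h : ∀ e, ∀ x ∈ closure (D.cell e), v e x = v' e x) :
    costAt P v = costAt P v' :=
  Finset.sum_congr rfl fun e _ => integral_congr_on (P.obs_supp e) fun x hx => by rw [h e x hx]

/-- First-order expansion of the cost, uniformly in time. -/
lemma exists_costAt_taylor {I : Set ℝ} (hI : IsCompact I) {v : ℝ → VField El} (hv : RegV D I v)
    {ε : ℝ} (hε : 0 < ε) : ∃ δ > 0, ∀ t ∈ I, ∀ u ∈ D.Qh, ∀ η, 0 ≤ η → η ≤ δ →
      (∀ e, ∀ x ∈ closure (D.cell e), ‖u e x - v t e x‖ ≤ η) →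
      |costAt P u - costAt P (v t) - costDeriv P (v t) (u - v t)| ≤ ε * η := by
  set M := ∑ e, (P.obs e).real univ with hM
  have hM0 : 0 ≤ M := Finset.sum_nonneg fun _ _ => measureReal_nonneg
  have hS : IsCompact (⋃ e, (fun z : ℝ × V3 => v z.1 e z.2) '' (I ×ˢ closure (D.cell e))) :=
    isCompact_iUnion fun e => (hI.prod (D.isCompact_cell e)).image_of_continuousOn
      (hv.continuousOn_face subset_rfl)
  obtain ⟨δ, hδ, h⟩ := exists_taylor P.jΩ_smooth hS (div_pos hε (by positivity : 0 < M + 1))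
  refine ⟨δ, hδ, fun t ht u hu η h0 hη hb => ?_⟩
  have hvt := hv.mem t ht
  have c : ∀ {u}, u ∈ D.Qh → ∀ e, Integrable (fun x => P.jΩ (u e x)) (P.obs e) := fun hu e =>
    integrable_of_continuousOn (D.isCompact_cell e) (P.obs_supp e)
      (continuousOn_slice (continuousOn_jΩ P (I := {0}) (.static hu) e) (mem_singleton 0))
  have c' : ∀ e, Integrable (fun x => fderiv ℝ P.jΩ (v t e x) ((u - v t) e x)) (P.obs e) :=
    fun e => integrable_of_continuousOn (D.isCompact_cell e) (P.obs_supp e)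
      (continuousOn_slice (continuousOn_costDeriv_integrand P (I := {0}) (.static hvt)
        (.static (D.Qh.sub_mem hu hvt)) e) (mem_singleton 0))
  rw [costAt, costAt, costDeriv, ← Finset.sum_sub_distrib, ← Finset.sum_sub_distrib]
  have hbound : ∀ e ∈ Finset.univ, |(∫ x, P.jΩ (u e x) ∂P.obs e) - (∫ x, P.jΩ (v t e x) ∂P.obs e)
      - ∫ x, fderiv ℝ P.jΩ (v t e x) ((u - v t) e x) ∂P.obs e| ≤
        ε / (M + 1) * η * (P.obs e).real univ := fun e _ => by
    rw [← integral_sub (c hu e) (c hvt e), ← integral_sub (f := fun x => P.jΩ (u e x) - P.jΩ (v t e x))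
      ((c hu e).sub (c hvt e)) (c' e)]
    refine abs_integral_le_of_forall_abs_le (P.obs_supp e) fun x hx => ?_
    have h1 := h (v t e x) (mem_iUnion.2 ⟨e, (t, x), ⟨ht, hx⟩, rfl⟩) (u e x)
      ((hb e x hx).trans hη)
    refine h1.trans ?_
    gcongr
    exact hb e x hx
  refine (Finset.abs_sum_le_sum_abs _ _).trans ((Finset.sum_le_sum hbound).trans ?_)
  rw [← Finset.mul_sum, ← hM]
  have h2 : M / (M + 1) ≤ 1 := by rw [div_le_one (by positivity)]; linarith
  calc ε / (M + 1) * η * M = ε * η * (M / (M + 1)) := by ring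
    _ ≤ ε * η * 1 := by gcongr
    _ = _ := mul_one _

/-- First-order expansion of the time integral of the cost. -/
lemma exists_integral_costAt_taylor {v : ℝ → VField El} (hv : RegV D (Icc 0 P.T) v)
    {ε : ℝ} (hε : 0 < ε) : ∃ δ > 0, ∀ u, RegV D (Icc 0 P.T) u → ∀ η, 0 ≤ η → η ≤ δ →
      (∀ t ∈ Icc 0 P.T, ∀ e, ∀ x ∈ closure (D.cell e), ‖u t e x - v t e x‖ ≤ η) →
      |(∫ t in (0 : ℝ)..P.T, costAt P (u t)) - (∫ t in (0 : ℝ)..P.T, costAt P (v t))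
        - ∫ t in (0 : ℝ)..P.T, costDeriv P (v t) (u t - v t)| ≤ ε * η := by
  have hT := P.T_pos
  obtain ⟨δ, hδ, h⟩ := exists_costAt_taylor P isCompact_Icc hv (div_pos hε hT)
  refine ⟨δ, hδ, fun u hu η h0 hη hb => ?_⟩
  have hsub : RegV D (Icc 0 P.T) fun t => u t - v t := hu.sub hv
  have i1 := (continuousOn_costAt P isCompact_Icc hu).intervalIntegrable_of_Icc hT.le
    (μ := volume)
  have i2 := (continuousOn_costAt P isCompact_Icc hv).intervalIntegrable_of_Icc hT.le
    (μ := volume)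
  have i3 := (continuousOn_costDeriv P isCompact_Icc hv hsub).intervalIntegrable_of_Icc hT.le
    (μ := volume)
  rw [← intervalIntegral.integral_sub i1 i2, ← intervalIntegral.integral_sub (i1.sub i2) i3]
  have := intervalIntegral.norm_integral_le_of_norm_le_const (a := 0) (b := P.T)
    (f := fun t => costAt P (u t) - costAt P (v t) - costDeriv P (v t) (u t - v t))
    (C := ε / P.T * η) fun t ht => by
      rw [uIoc_of_le hT.le] at ht
      have ht' := Ioc_subset_Icc_self ht
      exact h t ht' (u t) (hu.mem t ht') η h0 hη (hb t ht')
  rw [Real.norm_eq_abs] at this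
  refine this.trans (le_of_eq ?_)
  rw [sub_zero, abs_of_pos hT]
  field_simp

end cost

end

end DGAE

namespace DGAE

noncomputable section

/-! ### Duality of linear systems of ordinary differential equations -/

section duality

variable {n : ℕ} {A B : Matrix (Fin n) (Fin n) ℝ} {T : ℝ}

lemma _root_.HasDerivWithinAt.dotProduct_vec {x y : ℝ → Fin n → ℝ} {x' y' : Fin n → ℝ} {S : Set ℝ}
    {t : ℝ} (hx : HasDerivWithinAt x x' S t) (hy : HasDerivWithinAt y y' S t) :
    HasDerivWithinAt (fun s => x s ⬝ᵥ y s) (x' ⬝ᵥ y t + x t ⬝ᵥ y') S t := by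
  have h := HasDerivWithinAt.fun_sum (u := Finset.univ) (A := fun i s => x s i * y s i)
    fun i _ => (hasDerivWithinAt_pi.1 hx i).mul (hasDerivWithinAt_pi.1 hy i)
  rw [Finset.sum_add_distrib] at h
  exact h

lemma _root_.HasDerivWithinAt.mulVec_const {x : ℝ → Fin n → ℝ} {x' : Fin n → ℝ} {S : Set ℝ}
    {t : ℝ} (A : Matrix (Fin n) (Fin n) ℝ) (hx : HasDerivWithinAt x x' S t) :
    HasDerivWithinAt (fun s => A *ᵥ x s) (A *ᵥ x') S t :=
  (Matrix.mulVecLin A).toContinuousLinearMap.hasFDerivAt.comp_hasDerivWithinAt t hx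

lemma _root_.ContinuousOn.dotProduct_vec {x y : ℝ → Fin n → ℝ} {S : Set ℝ}
    (hx : ContinuousOn x S) (hy : ContinuousOn y S) : ContinuousOn (fun t => x t ⬝ᵥ y t) S :=
  continuousOn_finsetSum _ fun i _ =>
    (continuousOn_pi.1 hx i).mul (continuousOn_pi.1 hy i)

lemma _root_.ContinuousOn.mulVec_const {x : ℝ → Fin n → ℝ} {S : Set ℝ}
    (A : Matrix (Fin n) (Fin n) ℝ) (hx : ContinuousOn x S) : ContinuousOn (fun t => A *ᵥ x t) S :=
  (continuous_const.matrix_mulVec continuous_id).comp_continuousOn hx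

lemma dotProduct_mulVec_comm (hA : Aᵀ = A) (x y : Fin n → ℝ) : x ⬝ᵥ (A *ᵥ y) = (A *ᵥ x) ⬝ᵥ y := by
  rw [Matrix.dotProduct_mulVec, ← Matrix.mulVec_transpose, hA]

/-- Fundamental theorem of calculus on a closed interval. -/
lemma integral_eq_sub_of_hasDerivWithinAt (hT : 0 < T) {f f' : ℝ → ℝ}
    (hf : ∀ t ∈ Icc 0 T, HasDerivWithinAt f (f' t) (Icc 0 T) t) (hc : ContinuousOn f' (Icc 0 T)) :
    ∫ t in (0 : ℝ)..T, f' t = f T - f 0 :=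
  intervalIntegral.integral_eq_sub_of_hasDerivAt_of_le hT.le
    (fun t ht => (hf t ht).continuousWithinAt)
    (fun t ht => (hf t (Ioo_subset_Icc_self ht)).hasDerivAt (Icc_mem_nhds ht.1 ht.2))
    (hc.intervalIntegrable_of_Icc hT.le)

/-- Solutions of the backward equation represent the functional `∫ G ⬝ d` on the solutions of the
forward equation. -/
lemma adjoint_representation (hA : Aᵀ = A) (hT : 0 < T) {h h' d d' G : ℝ → Fin n → ℝ}
    (hh : ∀ t ∈ Icc 0 T, HasDerivWithinAt h (h' t) (Icc 0 T) t)
    (hd : ∀ t ∈ Icc 0 T, HasDerivWithinAt d (d' t) (Icc 0 T) t)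
    (ch : ContinuousOn h' (Icc 0 T)) (cd : ContinuousOn d' (Icc 0 T))
    (hode : ∀ t ∈ Icc 0 T, A *ᵥ h' t = (-Bᵀ) *ᵥ h t + G t) (hT0 : A *ᵥ h T = 0) (h0 : d 0 = 0) :
    ∫ t in (0 : ℝ)..T, (G t ⬝ᵥ d t + h t ⬝ᵥ (A *ᵥ d' t - B *ᵥ d t)) = 0 := by
  have hhc : ContinuousOn h (Icc 0 T) := fun t ht => (hh t ht).continuousWithinAt
  have hdc : ContinuousOn d (Icc 0 T) := fun t ht => (hd t ht).continuousWithinAt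
  have key := integral_eq_sub_of_hasDerivWithinAt hT
    (fun t ht => ((hh t ht).mulVec_const A).dotProduct_vec (hd t ht))
    (((ch.mulVec_const A).dotProduct_vec hdc).add ((hhc.mulVec_const A).dotProduct_vec cd))
  rw [hT0, h0, zero_dotProduct, dotProduct_zero, sub_zero] at key
  refine Eq.trans ?_ key
  apply intervalIntegral.integral_congr
  intro t ht
  rw [uIcc_of_le hT.le] at ht
  simp only
  rw [hode t ht, add_dotProduct, dotProduct_sub, dotProduct_mulVec_comm hA, neg_mulVec,
    neg_dotProduct, Matrix.mulVec_transpose, ← Matrix.dotProduct_mulVec]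
  ring

/-- If the functional in `adjoint_representation` vanishes for all `d` with `d 0 = 0`, then `h`
solves the backward equation. -/
lemma ode_of_forall_integral_eq_zero (hA : Aᵀ = A) (hT : 0 < T) {h h' G : ℝ → Fin n → ℝ}
    (hh : ∀ t ∈ Icc 0 T, HasDerivWithinAt h (h' t) (Icc 0 T) t) (cG : ContinuousOn G (Icc 0 T))
    (H : ∀ d d' : ℝ → Fin n → ℝ, (∀ t, HasDerivAt d (d' t) t) → Continuous d' → d 0 = 0 →
      ∫ t in (0 : ℝ)..T, (G t ⬝ᵥ d t + h t ⬝ᵥ (A *ᵥ d' t - B *ᵥ d t)) = 0) :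
    (∀ t ∈ Icc 0 T, A *ᵥ h' t = (-Bᵀ) *ᵥ h t + G t) ∧ A *ᵥ h T = 0 := by
  have hhc : ContinuousOn h (Icc 0 T) := fun t ht => (hh t ht).continuousWithinAt
  -- `g` is a continuous extension of `G - Bᵀ h`, and `Q` its primitive with `Q T = 0`
  obtain ⟨g, hg, hgeq⟩ : ∃ g : ℝ → Fin n → ℝ, Continuous g ∧
      ∀ t ∈ Icc 0 T, g t = (-Bᵀ) *ᵥ h t + G t :=
    ⟨IccExtend hT.le ((Icc 0 T).domRestrict fun t => (-Bᵀ) *ᵥ h t + G t),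
      (continuousOn_iff_continuous_domRestrict.1 ((hhc.mulVec_const _).add cG)).Icc_extend',
      fun t ht => by rw [IccExtend_of_mem _ _ ht]; rfl⟩
  have prim : ∀ {q : ℝ → Fin n → ℝ}, Continuous q → ∀ t,
      HasDerivAt (fun t => ∫ s in (0 : ℝ)..t, q s) (q t) t := fun hq t =>
    intervalIntegral.integral_hasDerivAt_right (hq.intervalIntegrable _ _)
      (hq.stronglyMeasurableAtFilter _ _) hq.continuousAt
  set Q : ℝ → Fin n → ℝ := fun t => (∫ s in (0 : ℝ)..T, g s) - ∫ s in (0 : ℝ)..t, g s with hQ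
  have hQd : ∀ t, HasDerivAt Q (-g t) t := fun t => (prim hg t).const_sub _
  have hQT : Q T = 0 := sub_self _
  have hQc : Continuous Q := continuous_iff_continuousAt.2 fun t => (hQd t).continuousAt
  -- the direction with derivative `Q + A h` gives `∫ |Q + A h|² = 0`
  have hpc : ContinuousOn (fun t => Q t + A *ᵥ h t) (Icc 0 T) :=
    hQc.continuousOn.add (hhc.mulVec_const A)
  obtain ⟨p, hp, hpeq⟩ : ∃ p : ℝ → Fin n → ℝ, Continuous p ∧
      ∀ t ∈ Icc 0 T, p t = Q t + A *ᵥ h t :=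
    ⟨IccExtend hT.le ((Icc 0 T).domRestrict fun t => Q t + A *ᵥ h t),
      (continuousOn_iff_continuous_domRestrict.1 hpc).Icc_extend',
      fun t ht => by rw [IccExtend_of_mem _ _ ht]; rfl⟩
  set d : ℝ → Fin n → ℝ := fun t => ∫ s in (0 : ℝ)..t, p s with hd
  have hdd := prim hp
  have hd0 : d 0 = 0 := intervalIntegral.integral_same
  have hdc : Continuous d := continuous_iff_continuousAt.2 fun t => (hdd t).continuousAt
  have h1 := H d p hdd hp hd0
  have h2 := integral_eq_sub_of_hasDerivWithinAt hT (f := fun t => Q t ⬝ᵥ d t)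
    (fun t _ => (hQd t).hasDerivWithinAt.dotProduct_vec (hdd t).hasDerivWithinAt)
    ((hg.neg.continuousOn.dotProduct_vec hdc.continuousOn).add
      (hQc.continuousOn.dotProduct_vec hp.continuousOn))
  rw [hQT, hd0, zero_dotProduct, dotProduct_zero, sub_zero] at h2
  have c1 : ContinuousOn (fun t => G t ⬝ᵥ d t + h t ⬝ᵥ (A *ᵥ p t - B *ᵥ d t)) (Icc 0 T) :=
    (cG.dotProduct_vec hdc.continuousOn).add (hhc.dotProduct_vec
      ((hp.continuousOn.mulVec_const A).sub (hdc.continuousOn.mulVec_const B)))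
  have c2 : ContinuousOn (fun t => -g t ⬝ᵥ d t + Q t ⬝ᵥ p t) (Icc 0 T) :=
    (hg.neg.continuousOn.dotProduct_vec hdc.continuousOn).add
      (hQc.continuousOn.dotProduct_vec hp.continuousOn)
  have h3 : ∫ t in (0 : ℝ)..T, p t ⬝ᵥ p t = 0 := by
    have := intervalIntegral.integral_add (c1.intervalIntegrable_of_Icc hT.le)
      (c2.intervalIntegrable_of_Icc hT.le) (μ := volume)
    rw [h1, h2, add_zero] at this
    refine Eq.trans ?_ this
    apply intervalIntegral.integral_congr
    intro t ht
    rw [uIcc_of_le hT.le] at ht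
    have e1 : (Bᵀ *ᵥ h t) ⬝ᵥ d t = h t ⬝ᵥ (B *ᵥ d t) := by
      rw [Matrix.mulVec_transpose, ← Matrix.dotProduct_mulVec]
    simp only
    rw [hgeq t ht, dotProduct_sub, dotProduct_mulVec_comm hA, neg_dotProduct, add_dotProduct,
      neg_mulVec, neg_dotProduct, e1]
    nth_rw 1 [hpeq t ht]
    rw [add_dotProduct]
    ring
  have hp0 : ∀ t ∈ Icc 0 T, Q t + A *ᵥ h t = 0 := fun t ht => by
    rw [← hpeq t ht]
    by_contra hne
    refine absurd h3 (ne_of_gt (intervalIntegral.integral_pos hT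
      (hp.continuousOn.dotProduct_vec hp.continuousOn)
      (fun s _ => Finset.sum_nonneg fun i _ => mul_self_nonneg _) ⟨t, ht, ?_⟩))
    refine lt_of_le_of_ne (Finset.sum_nonneg fun i _ => mul_self_nonneg _) fun h0 => hne ?_
    exact dotProduct_self_eq_zero.1 h0.symm
  refine ⟨fun t ht => ?_, ?_⟩
  · have hz : HasDerivWithinAt (fun t => Q t + A *ᵥ h t) (-g t + A *ᵥ h' t) (Icc 0 T) t :=
      (hQd t).hasDerivWithinAt.add ((hh t ht).mulVec_const A)
    have hz' : HasDerivWithinAt (fun t => Q t + A *ᵥ h t) 0 (Icc 0 T) t :=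
      (hasDerivWithinAt_const t _ (0 : Fin n → ℝ)).congr hp0 (hp0 t ht)
    have := (uniqueDiffOn_Icc hT t ht).eq_deriv _ hz hz'
    rw [← hgeq t ht]
    exact (neg_add_eq_zero.1 this).symm
  · have := hp0 T ⟨hT.le, le_rfl⟩
    rwa [hQT, zero_add] at this

end duality

end

end DGAE

namespace DGAE

noncomputable section

/-! ### Stationarity of the Lagrangian -/

lemma IsC1Curve.add_smul {F : Type*} [AddCommGroup F] [Module ℝ F] {T : ℝ} {S : Submodule ℝ F}
    {u u' : ℝ → F} (h : IsC1Curve T S u) (h' : IsC1Curve T S u') (ε : ℝ) :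
    IsC1Curve T S (u + ε • u') := by
  obtain ⟨N, φ, a, hφ, ha, hu⟩ := h
  obtain ⟨N', φ', a', hφ', ha', hu'⟩ := h'
  refine ⟨N + N', Fin.append φ fun k => ε • φ' k, Fin.append a a', fun k => ?_, fun k => ?_,
    fun t ht => ?_⟩
  · refine Fin.addCases (fun i => ?_) (fun i => ?_) k
    · simpa using hφ i
    · simpa using S.smul_mem ε (hφ' i)
  · refine Fin.addCases (fun i => ?_) (fun i => ?_) k
    · simpa using ha i
    · simpa using ha' i
  · simp [Fin.sum_univ_add, hu t ht, hu' t ht, Finset.smul_sum, smul_comm ε]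

section stationary

variable {El IF BF : Type*} [Fintype El] [Fintype IF] [Fintype BF] {D : Discretization El IF BF}
  {N : Submodule ℝ (TField El × VField El)} (K : Coordinates (D.Ph.prod D.Qh) N)
  {m : Medium El} (hm : Admissible D.toMesh m) (hN : nullSpace D m = N) {P : ProblemData D}

omit [Fintype IF] [Fintype BF] in
/-- Velocities are bounded on the closed elements. -/
lemma RegV.exists_bound {v : ℝ → VField El} {I : Set ℝ} (hI : IsCompact I) (hv : RegV D I v) :
    ∃ C, 0 ≤ C ∧ ∀ t ∈ I, ∀ e, ∀ x ∈ closure (D.cell e), ‖v t e x‖ ≤ C := by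
  have h : ∀ e, ∃ C, ∀ z ∈ I ×ˢ closure (D.cell e), ‖v z.1 e z.2‖ ≤ C := fun e =>
    (hI.prod (D.isCompact_cell e)).exists_bound_of_continuousOn (hv.continuousOn_face subset_rfl)
  choose C hC using h
  refine ⟨∑ e, |C e|, Finset.sum_nonneg fun _ _ => abs_nonneg _, fun t ht e x hx => ?_⟩
  exact (hC e (t, x) ⟨ht, hx⟩).trans ((le_abs_self _).trans
    (Finset.single_le_sum (f := fun e => |C e|) (fun _ _ => abs_nonneg _) (Finset.mem_univ e)))

include hm hN in
/-- The residual along a curve, in coordinates. -/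
lemma stateResidual_curve {E : ℝ → TField El} {v : ℝ → VField El}
    (hE : IsC1Curve P.T D.Ph E) (hv : IsC1Curve P.T D.Qh v)
    {c' : ℝ → Fin K.n → ℝ} (hc' : ∀ t ∈ Icc 0 P.T,
      HasDerivWithinAt (fun t => K.proj (E t, v t)) (c' t) (Icc 0 P.T) t)
    {t : ℝ} (ht : t ∈ Ioo 0 P.T) {H : TField El} {w : VField El} (hH : H ∈ D.Ph)
    (hw : w ∈ D.Qh) :
    stateResidual D m (P.force t) (P.trac t) (dtT E t) (E t) (dtV v t) (v t) H w =
      K.proj (H, w) ⬝ᵥ (massMat K m *ᵥ c' t - stiffMat K m *ᵥ K.proj (E t, v t)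
        - loadVec K m (P.force t) (P.trac t)) := by
  obtain ⟨rE, rv, E', v', rE', rv', hdt, hder, -⟩ := exists_coord_deriv K P.T_pos hE hv
  have htI := Ioo_subset_Icc_self ht
  have hY : RegData D (Icc 0 P.T) P.force P.trac E' E v' v :=
    ⟨P.force_cont, P.trac_cont, rE', rE, rv', rv⟩
  rw [(hdt t ht).1, (hdt t ht).2, stateResidual_coord K hm hN (hY.at htI) hH hw,
    (uniqueDiffOn_Icc P.T_pos t htI).eq_deriv _ (hder t htI) (hc' t htI)]

include hm hN in
/-- The variation of the Lagrangian with respect to the state. -/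
lemma hasDerivAt_lagrangian {E E' H : ℝ → TField El} {v v' w : ℝ → VField El}
    (hE : IsC1Curve P.T D.Ph E) (hv : IsC1Curve P.T D.Qh v)
    (hE' : IsC1Curve P.T D.Ph E') (hv' : IsC1Curve P.T D.Qh v')
    (hH : IsC1Curve P.T D.Ph H) (hw : IsC1Curve P.T D.Qh w)
    {d' : ℝ → Fin K.n → ℝ} (hd' : ∀ t ∈ Icc 0 P.T,
      HasDerivWithinAt (fun t => K.proj (E' t, v' t)) (d' t) (Icc 0 P.T) t)
    (cd' : ContinuousOn d' (Icc 0 P.T)) :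
    HasDerivAt (fun ε : ℝ => lagrangian D P m (E + ε • E') (v + ε • v') H w)
      (∫ t in (0 : ℝ)..P.T, (costVec K P (v t) ⬝ᵥ K.proj (E' t, v' t) + K.proj (H t, w t) ⬝ᵥ
        (massMat K m *ᵥ d' t - stiffMat K m *ᵥ K.proj (E' t, v' t)))) 0 := by
  have hT := P.T_pos
  obtain ⟨rE, rv, E₁, v₁, -, -, -, hder, cder⟩ := exists_coord_deriv K hT hE hv
  obtain ⟨rE', rv', -⟩ := exists_coord_deriv K hT hE' hv'
  obtain ⟨rH, rw, H₁, w₁, -, -, -, hderH, -⟩ := exists_coord_deriv K hT hH hw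
  set A := massMat K m
  set B := stiffMat K m
  set c : ℝ → Fin K.n → ℝ := fun t => K.proj (E t, v t) with hc
  set d : ℝ → Fin K.n → ℝ := fun t => K.proj (E' t, v' t) with hd
  set h : ℝ → Fin K.n → ℝ := fun t => K.proj (H t, w t) with hh
  set c' : ℝ → Fin K.n → ℝ := fun t => K.proj (E₁ t, v₁ t) with hc'
  set F : ℝ → Fin K.n → ℝ := fun t => loadVec K m (P.force t) (P.trac t) with hF
  have cc : ContinuousOn c (Icc 0 P.T) := fun t ht => (hder t ht).continuousWithinAt
  have cdd : ContinuousOn d (Icc 0 P.T) := fun t ht => (hd' t ht).continuousWithinAt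
  have ch : ContinuousOn h (Icc 0 P.T) := fun t ht => (hderH t ht).continuousWithinAt
  have cF : ContinuousOn F (Icc 0 P.T) := continuousOn_loadVec K hm P
  -- the residual is affine in the state
  have i0 : IntervalIntegrable (fun t => h t ⬝ᵥ (A *ᵥ c' t - B *ᵥ c t - F t)) volume 0 P.T :=
    (ch.dotProduct_vec (((cder.mulVec_const A).sub (cc.mulVec_const B)).sub
      cF)).intervalIntegrable_of_Icc hT.le
  have i1 : IntervalIntegrable (fun t => h t ⬝ᵥ (A *ᵥ d' t - B *ᵥ d t)) volume 0 P.T :=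
    (ch.dotProduct_vec ((cd'.mulVec_const A).sub
      (cdd.mulVec_const B))).intervalIntegrable_of_Icc hT.le
  have i2 : IntervalIntegrable (fun t => costVec K P (v t) ⬝ᵥ d t) volume 0 P.T :=
    ((continuousOn_costVec K P rv).dotProduct_vec cdd).intervalIntegrable_of_Icc hT.le
  have hres : ∀ ε : ℝ, (∫ t in (0 : ℝ)..P.T, stateResidual D m (P.force t) (P.trac t)
      (dtT (E + ε • E') t) ((E + ε • E') t) (dtV (v + ε • v') t) ((v + ε • v') t) (H t) (w t)) =
      (∫ t in (0 : ℝ)..P.T, h t ⬝ᵥ (A *ᵥ c' t - B *ᵥ c t - F t)) +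
        ε * ∫ t in (0 : ℝ)..P.T, h t ⬝ᵥ (A *ᵥ d' t - B *ᵥ d t) := fun ε => by
    rw [← intervalIntegral.integral_const_mul, ← intervalIntegral.integral_add i0
      (i1.const_mul ε)]
    refine intervalIntegral.integral_congr_Ioo_of_le hT.le fun t ht => ?_
    have htI := Ioo_subset_Icc_self ht
    have hsum : ∀ s, K.proj ((E + ε • E') s, (v + ε • v') s) = c s + ε • d s := fun s => by
      rw [hc, hd]
      simp only
      rw [← map_smul, ← map_add]
      rfl
    rw [stateResidual_curve K hm hN (c' := fun t => c' t + ε • d' t) (hE.add_smul hE' ε)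
      (hv.add_smul hv' ε) (fun s hs => ?_) ht (rH.mem t htI) (rw.mem t htI), hsum]
    · change h t ⬝ᵥ (A *ᵥ (c' t + ε • d' t) - B *ᵥ (c t + ε • d t) - F t) = _
      simp only [mulVec_add, mulVec_smul, dotProduct_sub, dotProduct_add, dotProduct_smul,
        smul_eq_mul]
      ring
    · simp only [hsum]
      exact (hder s hs).add ((hd' s hs).const_smul ε)
  -- the cost is differentiable
  obtain ⟨C, hC0, hC⟩ := rv'.exists_bound isCompact_Icc
  have hcost : HasDerivAt (fun ε : ℝ => ∫ t in (0 : ℝ)..P.T, costAt P ((v + ε • v') t))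
      (∫ t in (0 : ℝ)..P.T, costVec K P (v t) ⬝ᵥ d t) 0 := by
    rw [hasDerivAt_iff_isLittleO_nhds_zero, Asymptotics.isLittleO_iff]
    intro η hη
    obtain ⟨δ, hδ, hδ'⟩ := exists_integral_costAt_taylor P rv
      (div_pos hη (by positivity : 0 < C + 1))
    have hev : ∀ᶠ ε : ℝ in 𝓝 0, |ε| < δ / (C + 1) := by
      have : Tendsto (fun ε : ℝ => |ε|) (𝓝 0) (𝓝 0) := by
        simpa using (continuous_abs.tendsto (0 : ℝ))
      exact this.eventually (gt_mem_nhds (by positivity))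
    filter_upwards [hev] with ε hε
    have hε' : |ε| * (C + 1) ≤ δ := ((lt_div_iff₀ (by positivity)).1 hε).le
    have h1 := hδ' (v + ε • v') ((IsC1Curve.regV hT (hv.add_smul hv' ε)).1) (|ε| * (C + 1))
      (by positivity) hε' fun t ht e x hx => by
        have : (v + ε • v') t e x - v t e x = ε • v' t e x := by simp
        rw [this, norm_smul, Real.norm_eq_abs]
        exact mul_le_mul_of_nonneg_left ((hC t ht e x hx).trans (by linarith)) (abs_nonneg _)
    have h2 : (∫ t in (0 : ℝ)..P.T, costDeriv P (v t) ((v + ε • v') t - v t)) =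
        ε * ∫ t in (0 : ℝ)..P.T, costVec K P (v t) ⬝ᵥ d t := by
      rw [← intervalIntegral.integral_const_mul]
      apply intervalIntegral.integral_congr
      intro t ht
      rw [uIcc_of_le hT.le] at ht
      have h3 : (v + ε • v') t - v t = 0 + ε • v' t := by
        simp [Pi.add_apply, Pi.smul_apply]
      have h0 : costDeriv P (v t) (0 : VField El) = 0 := by simp [costDeriv]
      simp only
      rw [h3, costDeriv_add_mul P (rv.mem t ht) D.Qh.zero_mem (rv'.mem t ht), h0, zero_add,
        costDeriv_coord K hN P (rv.mem t ht) (rE'.mem t ht) (rv'.mem t ht), dotProduct_comm]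
    rw [h2] at h1
    have h4 : (fun ε : ℝ => ∫ t in (0 : ℝ)..P.T, costAt P ((v + ε • v') t)) 0 =
        ∫ t in (0 : ℝ)..P.T, costAt P (v t) := by simp
    simp only [zero_add, smul_eq_mul, Real.norm_eq_abs, zero_smul, add_zero]
    refine h1.trans (le_of_eq ?_)
    field_simp
  have hL : (fun ε : ℝ => lagrangian D P m (E + ε • E') (v + ε • v') H w) = fun ε =>
      (∫ t in (0 : ℝ)..P.T, costAt P ((v + ε • v') t)) +
      ((D.intVol (fun e x => P.rp (m.cp e x)) + D.intVol (fun e x => P.rs (m.cs e x)) +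
        ∫ t in (0 : ℝ)..P.T, h t ⬝ᵥ (A *ᵥ c' t - B *ᵥ c t - F t)) +
          ε * ∫ t in (0 : ℝ)..P.T, h t ⬝ᵥ (A *ᵥ d' t - B *ᵥ d t)) := by
    funext ε
    rw [lagrangian, hres, cost]
    simp only [costAt]
    ring
  rw [hL, intervalIntegral.integral_add i2 i1]
  refine hcost.add ?_
  have := ((hasDerivAt_id (0 : ℝ)).mul_const
    (∫ t in (0 : ℝ)..P.T, h t ⬝ᵥ (A *ᵥ d' t - B *ᵥ d t))).const_add
    (D.intVol (fun e x => P.rp (m.cp e x)) + D.intVol (fun e x => P.rs (m.cs e x)) +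
        ∫ t in (0 : ℝ)..P.T, h t ⬝ᵥ (A *ᵥ c' t - B *ᵥ c t - F t))
  rw [one_mul] at this
  exact this

include hm in
/-- The Lagrangian is stationary with respect to the state if and only if the multiplier solves the
adjoint equation. -/
theorem isStationary_iff {E H : ℝ → TField El} {v w : ℝ → VField El}
    (hE : IsC1Curve P.T D.Ph E) (hv : IsC1Curve P.T D.Qh v)
    (hH : IsC1Curve P.T D.Ph H) (hw : IsC1Curve P.T D.Qh w) :
    IsStationary D P m E v H w ↔
      (∀ t ∈ Ioo 0 P.T, ∀ E' ∈ D.Ph, ∀ v' ∈ D.Qh, AdjointEquation D P m v H w t E' v') ∧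
      ∀ e, ∀ x ∈ closure (D.cell e), w P.T e x = 0 ∧ m.C e x (H P.T e x) = 0 := by
  have hT := P.T_pos
  have hTI : P.T ∈ Icc 0 P.T := ⟨hT.le, le_rfl⟩
  obtain ⟨K⟩ := exists_coordinates D m
  have rv := (hv.regV hT).1
  obtain ⟨rH, rw, H', w', rH', rw', hdt, hder, hcont⟩ := exists_coord_deriv K hT hH hw
  have hfin : (∀ e, ∀ x ∈ closure (D.cell e), w P.T e x = 0 ∧ m.C e x (H P.T e x) = 0) ↔
      massMat K m *ᵥ K.proj (H P.T, w P.T) = 0 := by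
    have hmem : (H P.T, w P.T) ∈ D.Ph.prod D.Qh := ⟨rH.mem _ hTI, rw.mem _ hTI⟩
    constructor
    · intro h
      rw [K.proj_null _ hmem (mem_nullSpace.2 fun e x hx => (h e x hx).symm), mulVec_zero]
    · intro h e x hx
      exact (mem_nullSpace.1 (K.mem_null_of_proj hmem (massMat_injective K hm rfl h)) e x hx).symm
  rw [hfin]
  constructor
  · intro hst
    have key := ode_of_forall_integral_eq_zero (massMat_transpose K hm) (B := stiffMat K m) hT hder
      (continuousOn_costVec K P rv) fun d d' hd cd' hd0 => by
        obtain ⟨E', v', hE', hv', hE0, hv0, hproj⟩ := exists_curve (T := P.T) K hd cd'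
          D.Ph.zero_mem D.Qh.zero_mem (t₀ := 0) (by rw [hd0]; exact (map_zero K.proj).symm)
        have h1 := hasDerivAt_lagrangian K hm rfl (P := P) hE hv hE' hv' hH hw (d' := d')
          (fun t _ => by simp only [hproj]; exact (hd t).hasDerivWithinAt) cd'.continuousOn
        simp only [hproj] at h1
        exact h1.unique (hst E' v' hE' hv' hE0 hv0)
    refine ⟨fun t ht => ?_, key.2⟩
    have htI := Ioo_subset_Icc_self ht
    exact (adjointEquation_iff K hm rfl P (rv.mem t htI) (rH.mem t htI) (rw.mem t htI)
      (rH'.mem t htI) (rw'.mem t htI) (hdt t ht)).2 (key.1 t htI)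
  · rintro ⟨heq, hfin⟩ E' v' hE' hv' hE0 hv0
    have hode := IsAdjoint.ode K hm rfl rv heq rH rw rH' rw' hdt hder hcont
    obtain ⟨-, -, E₁, v₁, -, -, -, hd, cd⟩ := exists_coord_deriv K hT hE' hv'
    have h1 := hasDerivAt_lagrangian K hm rfl (P := P) hE hv hE' hv' hH hw hd cd
    rwa [adjoint_representation (massMat_transpose K hm) hT hder hd hcont cd hode hfin
      (by rw [hE0, hv0]; exact map_zero K.proj)] at h1

end stationary

end

end DGAE

namespace DGAE

noncomputable section

/-! ### Dependence of the state on the wave speeds -/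

section bounds

variable {Θ Z : Type*} [NormedAddCommGroup Θ] [NormedSpace ℝ Θ] [TopologicalSpace Z] {S : Set Z}

lemma UExp.exists_bound {ι : Type*} [Fintype ι] {f : ι → Θ → Z → ℝ} {f0 : ι → Z → ℝ}
    {f1 : ι → Θ → Z → ℝ} (h : ∀ i, UExp S (f i) (f0 i) (f1 i)) :
    ∃ C, 0 ≤ C ∧ ∀ᶠ θ in 𝓝 0, ∀ i, ∀ z ∈ S, |f i θ z - f0 i z| ≤ C * ‖θ‖ := by
  choose C hC using fun i => (h i).sub_isBigO.bound
  refine ⟨∑ i, |C i|, Finset.sum_nonneg fun _ _ => abs_nonneg _, ?_⟩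
  rw [eventually_all]
  intro i
  filter_upwards [eventually_prod_principal_iff.1 (hC i)] with θ hθ z hz
  have h1 := hθ z hz
  rw [Real.norm_eq_abs, norm_norm] at h1
  refine h1.trans (mul_le_mul_of_nonneg_right ?_ (norm_nonneg _))
  exact (le_abs_self _).trans
    (Finset.single_le_sum (f := fun i => |C i|) (fun _ _ => abs_nonneg _) (Finset.mem_univ i))

lemma UExp.eventually_rem {f : Θ → Z → ℝ} {f0 : Z → ℝ} {f1 : Θ → Z → ℝ} (h : UExp S f f0 f1)
    {ε : ℝ} (hε : 0 < ε) : ∀ᶠ θ in 𝓝 0, ∀ z ∈ S, |f θ z - f0 z - f1 θ z| ≤ ε * ‖θ‖ := by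
  filter_upwards [eventually_prod_principal_iff.1 (h.rem.bound hε)] with θ hθ z hz
  simpa using hθ z hz

omit [NormedSpace ℝ Θ] in
lemma eventually_mul_norm_le (C : ℝ) {δ : ℝ} (hδ : 0 < δ) : ∀ᶠ θ : Θ in 𝓝 0, C * ‖θ‖ ≤ δ := by
  have : Tendsto (fun θ : Θ => C * ‖θ‖) (𝓝 0) (𝓝 0) := by
    have h : Continuous fun θ : Θ => C * ‖θ‖ := by fun_prop
    simpa using h.tendsto (0 : Θ)
  exact (this.eventually (gt_mem_nhds hδ)).mono fun _ h => h.le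

end bounds

section states

variable {El IF BF : Type*} [Fintype El] [Fintype IF] [Fintype BF] {D : Discretization El IF BF}
  {N : ℕ} {m : Medium El} (hm : Admissible D.toMesh m) {φ χ : Fin N → SField El}
  (hd : IsDirection D m φ χ)
include hm hd

/-- The system matrices depend Lipschitz continuously on the wave speeds. -/
lemma exists_matrix_bound {𝒩 : Submodule ℝ (TField El × VField El)}
    (K : Coordinates (D.Ph.prod D.Qh) 𝒩) :
    ∃ C, 0 ≤ C ∧ ∀ᶠ θ in 𝓝 (0 : Fin N → ℝ), ∀ i j,
      |(massMat K (m.perturb φ χ θ) - massMat K m) i j| ≤ C * ‖θ‖ ∧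
      |(stiffMat K (m.perturb φ χ θ) - stiffMat K m) i j| ≤ C * ‖θ‖ := by
  have hmass := fun p : Fin K.n × Fin K.n => uexp_residual hm hd (isCompact_singleton (x := (0 : ℝ)))
    ((DataMem.mass (K.u_mem p.2).1 (K.u_mem p.2).2).reg _) (.static (K.u_mem p.1).1)
    (.static (K.u_mem p.1).2)
  have hstiff := fun p : Fin K.n × Fin K.n =>
    (uexp_residual hm hd (isCompact_singleton (x := (0 : ℝ)))
    ((DataMem.main (K.u_mem p.2).1 (K.u_mem p.2).2).reg _) (.static (K.u_mem p.1).1)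
    (.static (K.u_mem p.1).2)).neg
  obtain ⟨C₁, h₁, H₁⟩ := UExp.exists_bound hmass
  obtain ⟨C₂, h₂, H₂⟩ := UExp.exists_bound hstiff
  refine ⟨max C₁ C₂, h₁.trans (le_max_left _ _), ?_⟩
  filter_upwards [H₁, H₂] with θ hθ₁ hθ₂ i j
  exact ⟨(hθ₁ (i, j) 0 rfl).trans (mul_le_mul_of_nonneg_right (le_max_left _ _) (norm_nonneg _)),
    (hθ₂ (i, j) 0 rfl).trans (mul_le_mul_of_nonneg_right (le_max_right _ _) (norm_nonneg _))⟩

/-- The solution of the state equation depends Lipschitz continuously on the wave speeds. Here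
`massMat *ᵥ … - stiffMat *ᵥ … - loadVec` is the residual of the unperturbed solution in the
perturbed state equation. -/
lemma exists_state_bound (K : Coordinates (D.Ph.prod D.Qh) (nullSpace D m)) {P : ProblemData D}
    {E E' : ℝ → TField El} {v v' : ℝ → VField El} (hs : IsState D P m E v)
    (rE : RegT D (Icc 0 P.T) E) (rv : RegV D (Icc 0 P.T) v)
    (rE' : RegT D (Icc 0 P.T) E') (rv' : RegV D (Icc 0 P.T) v')
    (hdt : ∀ t ∈ Ioo 0 P.T, dtT E t = E' t ∧ dtV v t = v' t)
    (hder : ∀ t ∈ Icc 0 P.T, HasDerivWithinAt (fun t => K.proj (E t, v t))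
      (K.proj (E' t, v' t)) (Icc 0 P.T) t)
    (hcont : ContinuousOn (fun t => K.proj (E' t, v' t)) (Icc 0 P.T)) :
    ∃ C, 0 ≤ C ∧ ∀ᶠ θ in 𝓝 (0 : Fin N → ℝ), ∀ Eθ vθ, IsState D P (m.perturb φ χ θ) Eθ vθ →
      ∃ d', ContinuousOn d' (Icc 0 P.T) ∧ K.proj (Eθ 0, vθ 0) - K.proj (E 0, v 0) = 0 ∧
      ∀ t ∈ Icc 0 P.T,
        HasDerivWithinAt (fun t => K.proj (Eθ t, vθ t) - K.proj (E t, v t)) (d' t) (Icc 0 P.T) t ∧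
        ‖K.proj (Eθ t, vθ t) - K.proj (E t, v t)‖ ≤ C * ‖θ‖ ∧ ‖d' t‖ ≤ C * ‖θ‖ ∧
        massMat K (m.perturb φ χ θ) *ᵥ d' t = stiffMat K (m.perturb φ χ θ) *ᵥ
            (K.proj (Eθ t, vθ t) - K.proj (E t, v t)) +
          -(massMat K (m.perturb φ χ θ) *ᵥ K.proj (E' t, v' t)
            - stiffMat K (m.perturb φ χ θ) *ᵥ K.proj (E t, v t)
            - loadVec K (m.perturb φ χ θ) (P.force t) (P.trac t)) := by
  have hT := P.T_pos
  have h0I : (0 : ℝ) ∈ Icc 0 P.T := ⟨le_rfl, hT.le⟩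
  have hY : RegData D (Icc 0 P.T) P.force P.trac E' E v' v :=
    ⟨P.force_cont, P.trac_cont, rE', rE, rv', rv⟩
  -- the residual of the unperturbed solution
  obtain ⟨C₁, hC₁, hr⟩ := UExp.exists_bound fun i : Fin K.n =>
    uexp_residual hm hd isCompact_Icc hY (.static (K.u_mem i).1) (.static (K.u_mem i).2)
  have hode := hs.ode hm K rfl rE rv rE' rv' hdt hder hcont
  -- the matrices stay uniformly regular
  obtain ⟨C₂, hC₂, hM⟩ := exists_matrix_bound hm hd K
  obtain ⟨κ, hκ, hlow⟩ := exists_lower_bound fun y => massMat_injective K hm rfl (c := y)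
  obtain ⟨b, hb⟩ := Set.finite_range
    (fun p : Fin K.n × Fin K.n => |stiffMat K m p.1 p.2|) |>.bddAbove
  have hb' : ∀ i j, |stiffMat K m i j| ≤ max b 0 := fun i j =>
    (hb (mem_range_self (i, j))).trans (le_max_left _ _)
  obtain ⟨C₃, hC₃, hG⟩ := exists_gronwall_bound K.n (κ := κ / 2) (β := K.n * (max b 0 + 1)) P.T
    (by positivity) (by positivity)
  refine ⟨C₃ * C₁, by positivity, ?_⟩
  filter_upwards [eventually_admissible hm hd, hr, hM,
    eventually_mul_norm_le (Θ := Fin N → ℝ) C₂ one_pos,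
    eventually_mul_norm_le (Θ := Fin N → ℝ) (K.n * C₂) (half_pos hκ)]
    with θ hθ hrθ hMθ hθ₁ hθ₂ Eθ vθ hsθ
  have hN : nullSpace D (m.perturb φ χ θ) = nullSpace D m := nullSpace_eq hm hθ.1 hθ.2
  obtain ⟨rEθ, rvθ, Eθ', vθ', rEθ', rvθ', hdtθ, hderθ, hcontθ⟩ :=
    exists_coord_deriv K hT hsθ.curve_E hsθ.curve_v
  have hodeθ := hsθ.ode hθ.1 K hN rEθ rvθ rEθ' rvθ' hdtθ hderθ hcontθ
  have hder' : ∀ t ∈ Icc 0 P.T, HasDerivWithinAt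
      (fun t => K.proj (Eθ t, vθ t) - K.proj (E t, v t))
      (K.proj (Eθ' t, vθ' t) - K.proj (E' t, v' t)) (Icc 0 P.T) t :=
    fun t ht => (hderθ t ht).sub (hder t ht)
  have hinit : K.proj (Eθ 0, vθ 0) - K.proj (E 0, v 0) = 0 := by
    rw [← map_sub]
    refine K.proj_null _ ((D.Ph.prod D.Qh).sub_mem ⟨rEθ.mem 0 h0I, rvθ.mem 0 h0I⟩
      ⟨rE.mem 0 h0I, rv.mem 0 h0I⟩) (sub_mem_nullSpace.2 fun e x hx => ⟨?_, ?_⟩)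
    · simp only [hsθ.init_E e x hx, hs.init_E e x hx]
    · simp only [hsθ.init_v e x hx, hs.init_v e x hx]
  have heq : ∀ t ∈ Icc 0 P.T,
      massMat K (m.perturb φ χ θ) *ᵥ (K.proj (Eθ' t, vθ' t) - K.proj (E' t, v' t)) =
        stiffMat K (m.perturb φ χ θ) *ᵥ (K.proj (Eθ t, vθ t) - K.proj (E t, v t)) +
          -(massMat K (m.perturb φ χ θ) *ᵥ K.proj (E' t, v' t)
            - stiffMat K (m.perturb φ χ θ) *ᵥ K.proj (E t, v t)
            - loadVec K (m.perturb φ χ θ) (P.force t) (P.trac t)) := fun t ht => by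
    rw [mulVec_sub, mulVec_sub, hodeθ t ht]
    abel
  have hbound := hG (massMat K (m.perturb φ χ θ)) (stiffMat K (m.perturb φ χ θ)) _ _
    (fun t => -(massMat K (m.perturb φ χ θ) *ᵥ K.proj (E' t, v' t)
            - stiffMat K (m.perturb φ χ θ) *ᵥ K.proj (E t, v t)
            - loadVec K (m.perturb φ χ θ) (P.force t) (P.trac t))) (C₁ * ‖θ‖)
    (fun y => ?_) (fun y => ?_) (by positivity) hinit hder' heq (fun t ht => ?_)
  · refine ⟨_, hcontθ.sub hcont, hinit, fun t ht => ⟨hder' t ht, ?_, ?_, heq t ht⟩⟩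
    · rw [mul_assoc]; exact (hbound t ht).1
    · rw [mul_assoc]; exact (hbound t ht).2
  · have h1 := norm_mulVec_le (by positivity) (fun i j => (hMθ i j).1) y
    have h2 : ‖massMat K m *ᵥ y‖ ≤ ‖massMat K (m.perturb φ χ θ) *ᵥ y‖ +
        ‖(massMat K (m.perturb φ χ θ) - massMat K m) *ᵥ y‖ := by
      rw [sub_mulVec]
      have := norm_sub_le (massMat K (m.perturb φ χ θ) *ᵥ y)
        (massMat K (m.perturb φ χ θ) *ᵥ y - massMat K m *ᵥ y)
      rwa [sub_sub_cancel] at this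
    have h3 : K.n * (C₂ * ‖θ‖) * ‖y‖ ≤ κ / 2 * ‖y‖ := by
      refine mul_le_mul_of_nonneg_right ?_ (norm_nonneg _)
      rwa [← mul_assoc]
    have h4 := hlow y
    linarith
  · refine norm_mulVec_le (by positivity) (fun i j => ?_) y
    have h1 := (hMθ i j).2
    have h2 := abs_add_le (stiffMat K m i j)
      ((stiffMat K (m.perturb φ χ θ) - stiffMat K m) i j)
    rw [Matrix.sub_apply, add_sub_cancel] at h2
    rw [Matrix.sub_apply] at h1
    have := hb' i j
    linarith
  · rw [norm_neg]
    refine (pi_norm_le_iff_of_nonneg (by positivity)).2 fun i => ?_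
    have h1 := hrθ i t ht
    rw [stateResidual_coord K hm rfl (hY.at ht) (K.u_mem i).1 (K.u_mem i).2,
      stateResidual_coord K hθ.1 hN (hY.at ht) (K.u_mem i).1 (K.u_mem i).2, hode t ht] at h1
    simpa [K.proj_u, single_dotProduct] using h1

end states

end

end DGAE

namespace DGAE

noncomputable section

/-! ### Differentiability of the reduced cost -/

section reduced

variable {El IF BF : Type*} [Fintype El] [Fintype IF] [Fintype BF] {D : Discretization El IF BF}

/-- The reduced cost, defined with a chosen solution, is the cost of any solution. -/
lemma reducedCost_eq {m : Medium El} (hm : Admissible D.toMesh m) {P : ProblemData D}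
    {E : ℝ → TField El} {v : ℝ → VField El} (h : IsState D P m E v) :
    reducedCost D P m = cost D P m v := by
  have hex : ∃ v : ℝ → VField El, ∃ E : ℝ → TField El, IsState D P m E v := ⟨v, E, h⟩
  rw [reducedCost, dif_pos hex]
  obtain ⟨E', hE'⟩ := hex.choose_spec
  have hcong : ∫ t in (0 : ℝ)..P.T, costAt P (hex.choose t) =
      ∫ t in (0 : ℝ)..P.T, costAt P (v t) := by
    apply intervalIntegral.integral_congr
    intro t ht
    rw [uIcc_of_le P.T_pos.le] at ht
    exact costAt_congr P fun e x hx =>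
      (sub_mem_nullSpace.1 (state_unique hm hE' h ht) e x hx).2
  simp only [costAt] at hcong
  rw [cost, cost, hcong]

variable {N : ℕ} {m : Medium El}

omit [Fintype El] in
lemma Medium.perturb_zero (m : Medium El) (φ χ : Fin N → SField El) : m.perturb φ χ 0 = m := by
  simp [Medium.perturb]

/-- The first variation of the residual with respect to the wave speeds, in the direction `c` of
`cp` and `c'` of `cs`. -/
def residualVar (D : Discretization El IF BF) (m : Medium El) (c c' : SField El)
    (τ : BF → V3 → V3) (Et E : TField El) (v : VField El) (H : TField El) (w : VField El) : ℝ :=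
  D.intVol (fun e x => volVarTest m c c' Et v H e x + volVarMain m c c' E w e x)
    - D.intSides fun s x => (m.interface D.toMesh s x).pairingVar
      (sideVariation D.toMesh m c c' E s x) (m.stateTrace D.toMesh τ E v s x)
      (m.traction D.toMesh H s x) (sideVariation D.toMesh m c c' H s x).tM (w (D.inner s) x)

omit [Fintype IF] [Fintype BF] in
/-- First-order expansion of the terms of the cost that depend on a wave speed directly. -/
lemma uexp_parameterCost {c : SField El} (hc : PiecewiseC1 D.toMesh c) {φ : Fin N → SField El}
    (hφ : ∀ i, PiecewiseC1 D.toMesh (φ i)) {r : ℝ → ℝ} (hr : ContDiff ℝ 1 r) :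
    UExp {(0 : ℝ)} (fun (θ : Fin N → ℝ) _ => D.intVol fun e x => r ((c + ∑ i, θ i • φ i) e x))
      (fun _ => D.intVol fun e x => r (c e x))
      (fun θ _ => D.intVol fun e x => deriv r (c e x) * (∑ i, θ i • φ i) e x) :=
  UExp.sum Finset.univ fun e _ => ((uexp_speed e isCompact_singleton (D.isCompact_cell e)
    subset_rfl hc hφ).comp_contDiff (isCompact_singleton.prod (D.isCompact_cell e)) hr).integral
      (D.isCompact_cell e) (D.vol_supp e) isCompact_singleton

variable (hm : Admissible D.toMesh m) {φ χ : Fin N → SField El} (hd : IsDirection D m φ χ)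
  {P : ProblemData D}
include hm hd

/-- The reduced cost is differentiable with respect to the wave speeds, and its derivative is the
derivative of the Lagrangian at a fixed state and adjoint. -/
theorem hasFDerivAt_reducedCost {E H : ℝ → TField El} {v w : ℝ → VField El}
    (hs : IsState D P m E v) (ha : IsAdjoint D P m v H w) :
    ∃ L : (Fin N → ℝ) →L[ℝ] ℝ,
      HasFDerivAt (fun θ => reducedCost D P (m.perturb φ χ θ)) L 0 ∧ ∀ θ, L θ =
        D.intVol (fun e x => deriv P.rp (m.cp e x) * (∑ i, θ i • φ i) e x)
        + D.intVol (fun e x => deriv P.rs (m.cs e x) * (∑ i, θ i • χ i) e x)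
        + ∫ t in (0 : ℝ)..P.T, residualVar D m (∑ i, θ i • φ i) (∑ i, θ i • χ i) (P.trac t)
            (dtT E t) (E t) (v t) (H t) (w t) := by
  have hT := P.T_pos
  have hTI : P.T ∈ Icc 0 P.T := ⟨hT.le, le_rfl⟩
  obtain ⟨K⟩ := exists_coordinates D m
  obtain ⟨rE, rv, E', v', rE', rv', hdt, hder, hcont⟩ :=
    exists_coord_deriv K hT hs.curve_E hs.curve_v
  obtain ⟨rH, rw, H', w', rH', rw', hdtH, hderH, hcontH⟩ :=
    exists_coord_deriv K hT ha.curve_H ha.curve_w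
  have hY : RegData D (Icc 0 P.T) P.force P.trac E' E v' v :=
    ⟨P.force_cont, P.trac_cont, rE', rE, rv', rv⟩
  have hR := uexp_residual hm hd isCompact_Icc hY rH rw
  have hSp := uexp_parameterCost hm.smooth_cp hd.smooth_p P.rp_smooth
  have hSs := uexp_parameterCost hm.smooth_cs hd.smooth_s P.rs_smooth
  have hode := hs.ode hm K rfl rE rv rE' rv' hdt hder hcont
  have hodeH := IsAdjoint.ode K hm rfl rv ha.equation rH rw rH' rw' hdtH hderH hcontH
  set R1 : (Fin N → ℝ) → ℝ → ℝ := fun θ t => residualVar D m (∑ i, θ i • φ i) (∑ i, θ i • χ i)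
    (P.trac t) (E' t) (E t) (v t) (H t) (w t) with hR1
  have hR0 : ∀ t ∈ Icc 0 P.T, stateResidual D m (P.force t) (P.trac t) (E' t) (E t) (v' t) (v t)
      (H t) (w t) = 0 := fun t ht => by
    rw [stateResidual_coord K hm rfl (hY.at ht) (rH.mem t ht) (rw.mem t ht), hode t ht]
    simp
  have iR1 : ∀ θ, IntervalIntegrable (R1 θ) volume 0 P.T := fun θ =>
    (hR.cont1 θ).intervalIntegrable_of_Icc hT.le
  let L : (Fin N → ℝ) →ₗ[ℝ] ℝ :=
    { toFun := fun θ => D.intVol (fun e x => deriv P.rp (m.cp e x) * (∑ i, θ i • φ i) e x)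
        + D.intVol (fun e x => deriv P.rs (m.cs e x) * (∑ i, θ i • χ i) e x)
        + ∫ t in (0 : ℝ)..P.T, R1 θ t
      map_add' := fun θ θ' => by
        have h1 := hSp.map_add θ θ' 0 rfl
        have h2 := hSs.map_add θ θ' 0 rfl
        have h3 : ∫ t in (0 : ℝ)..P.T, R1 (θ + θ') t =
            (∫ t in (0 : ℝ)..P.T, R1 θ t) + ∫ t in (0 : ℝ)..P.T, R1 θ' t := by
          rw [← intervalIntegral.integral_add (iR1 θ) (iR1 θ')]
          apply intervalIntegral.integral_congr
          intro t ht
          rw [uIcc_of_le hT.le] at ht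
          exact hR.map_add θ θ' t ht
        rw [h1, h2, h3]
        ring
      map_smul' := fun c θ => by
        have h1 := hSp.map_smul c θ 0 rfl
        have h2 := hSs.map_smul c θ 0 rfl
        have h3 : ∫ t in (0 : ℝ)..P.T, R1 (c • θ) t = c * ∫ t in (0 : ℝ)..P.T, R1 θ t := by
          rw [← intervalIntegral.integral_const_mul]
          apply intervalIntegral.integral_congr
          intro t ht
          rw [uIcc_of_le hT.le] at ht
          exact hR.map_smul c θ t ht
        rw [h1, h2, h3, RingHom.id_apply, smul_eq_mul]
        ring }
  refine ⟨L.toContinuousLinearMap, ?_, fun θ => ?_⟩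
  swap
  · have : ∫ t in (0 : ℝ)..P.T, residualVar D m (∑ i, θ i • φ i) (∑ i, θ i • χ i) (P.trac t)
        (dtT E t) (E t) (v t) (H t) (w t) = ∫ t in (0 : ℝ)..P.T, R1 θ t :=
      intervalIntegral.integral_congr_Ioo_of_le hT.le fun t ht => by
        simp only [hR1, (hdt t ht).1]
    rw [this]
    rfl
  -- bounds for the representatives and the adjoint
  choose M hM0 hM using fun i => (RegV.static (D := D) (I := {(0 : ℝ)}) (K.u_mem i).2).exists_bound
    isCompact_singleton
  obtain ⟨Mh, hMh⟩ := isCompact_Icc.exists_bound_of_continuousOn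
    (fun t ht => (hderH t ht).continuousWithinAt : ContinuousOn (fun t => K.proj (H t, w t))
      (Icc 0 P.T))
  have hMh0 : 0 ≤ Mh := (norm_nonneg _).trans (hMh _ hTI)
  obtain ⟨C₁, hC₁, hstate⟩ := exists_state_bound hm hd K hs rE rv rE' rv' hdt hder hcont
  obtain ⟨C₂, hC₂, hmat⟩ := exists_matrix_bound hm hd K
  set C' := (∑ i, M i) * C₁ with hC'
  have hC'0 : 0 ≤ C' := mul_nonneg (Finset.sum_nonneg fun i _ => hM0 i) hC₁
  rw [hasFDerivAt_iff_isLittleO_nhds_zero, Asymptotics.isLittleO_iff]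
  intro η hη
  obtain ⟨δ, hδ, hcost⟩ := exists_integral_costAt_taylor P rv
    (by positivity : 0 < η / 4 / (C' + 1))
  filter_upwards [eventually_admissible hm hd, hstate, hmat,
    hR.eventually_rem (by positivity : 0 < η / 8 / P.T),
    hSp.eventually_rem (by positivity : 0 < η / 4), hSs.eventually_rem (by positivity : 0 < η / 4),
    eventually_mul_norm_le (Θ := Fin N → ℝ) C' hδ,
    eventually_mul_norm_le (Θ := Fin N → ℝ) (2 * (K.n * Mh * (K.n * C₂ * C₁)))
      (by positivity : 0 < η / 8 / P.T)] with θ hθ hst hma hRθ hSpθ hSsθ hδθ hqθ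
  obtain ⟨Eθ, vθ, hsθ⟩ := exists_state hθ.1 P
  obtain ⟨rEθ, -⟩ := hsθ.curve_E.regT hT
  obtain ⟨rvθ, -⟩ := hsθ.curve_v.regV hT
  have hN : nullSpace D (m.perturb φ χ θ) = nullSpace D m := nullSpace_eq hm hθ.1 hθ.2
  obtain ⟨d', hd'c, hd0, hdd⟩ := hst Eθ vθ hsθ
  set d : ℝ → Fin K.n → ℝ := fun t => K.proj (Eθ t, vθ t) - K.proj (E t, v t) with hdef
  set Aθ := massMat K (m.perturb φ χ θ) with hAθ
  set Bθ := stiffMat K (m.perturb φ χ θ) with hBθ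
  have hdproj : ∀ t, d t = K.proj (Eθ t - E t, vθ t - v t) := fun t => by
    rw [hdef]; simp only; rw [← map_sub]; rfl
  have cd : ContinuousOn d (Icc 0 P.T) := fun t ht => (hdd t ht).1.continuousWithinAt
  have ch : ContinuousOn (fun t => K.proj (H t, w t)) (Icc 0 P.T) :=
    fun t ht => (hderH t ht).continuousWithinAt
  -- the cost of the velocity
  have hvb : ∀ t ∈ Icc 0 P.T, ∀ e, ∀ x ∈ closure (D.cell e), ‖vθ t e x - v t e x‖ ≤ C' * ‖θ‖ :=
      fun t ht e x hx => by
    have hmem : (Eθ t - E t, vθ t - v t) ∈ D.Ph.prod D.Qh :=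
      ⟨D.Ph.sub_mem (rEθ.mem t ht) (rE.mem t ht), D.Qh.sub_mem (rvθ.mem t ht) (rv.mem t ht)⟩
    have h1 := (sub_mem_nullSpace.1 (K.sub_mem _ hmem) e x hx).2
    rw [← hdproj] at h1
    have h2 : (∑ i, d t i • K.u i).2 e x = ∑ i, d t i • (K.u i).2 e x := by
      simp [Prod.snd_sum, Finset.sum_apply]
    have h3 : vθ t e x - v t e x = ∑ i, d t i • (K.u i).2 e x := h1.trans h2
    rw [h3, hC', mul_assoc, Finset.sum_mul]
    refine (norm_sum_le _ _).trans (Finset.sum_le_sum fun i _ => ?_)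
    rw [norm_smul, mul_comm]
    exact mul_le_mul (hM i 0 rfl e x hx) ((norm_le_pi_norm _ i).trans (hdd t ht).2.1)
      (norm_nonneg _) (hM0 i)
  have hT1 := hcost vθ rvθ (C' * ‖θ‖) (by positivity) hδθ hvb
  -- the adjoint representation of its derivative
  have cG := continuousOn_costVec K P rv
  have hcd : ∫ t in (0 : ℝ)..P.T, costDeriv P (v t) (vθ t - v t) =
      ∫ t in (0 : ℝ)..P.T, costVec K P (v t) ⬝ᵥ d t := by
    apply intervalIntegral.integral_congr
    intro t ht
    rw [uIcc_of_le hT.le] at ht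
    simp only
    rw [costDeriv_coord K rfl P (E' := Eθ t - E t) (rv.mem t ht)
      (D.Ph.sub_mem (rEθ.mem t ht) (rE.mem t ht)) (D.Qh.sub_mem (rvθ.mem t ht) (rv.mem t ht)),
      hdproj, dotProduct_comm]
  have hrep := adjoint_representation (massMat_transpose K hm) hT hderH (fun t ht => (hdd t ht).1)
    hcontH hd'c hodeH (by
      rw [K.proj_null _ ⟨rH.mem _ hTI, rw.mem _ hTI⟩ (mem_nullSpace.2 fun e x hx => ?_),
        mulVec_zero]
      simp only
      rw [ha.final_H e x hx, ha.final_w e x hx]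
      simp [Medium.C]) hd0
  have i1 : IntervalIntegrable (fun t => costVec K P (v t) ⬝ᵥ d t) volume 0 P.T :=
    (cG.dotProduct_vec cd).intervalIntegrable_of_Icc hT.le
  have i2 : IntervalIntegrable (fun t => K.proj (H t, w t) ⬝ᵥ
      (massMat K m *ᵥ d' t - stiffMat K m *ᵥ d t)) volume 0 P.T :=
    (ch.dotProduct_vec ((hd'c.mulVec_const _).sub
      (cd.mulVec_const _))).intervalIntegrable_of_Icc hT.le
  rw [intervalIntegral.integral_add i1 i2] at hrep
  have hT2 : |(∫ t in (0 : ℝ)..P.T, K.proj (H t, w t) ⬝ᵥ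
      (massMat K m *ᵥ d' t - stiffMat K m *ᵥ d t)) + ∫ t in (0 : ℝ)..P.T, R1 θ t| ≤
        η / 4 * ‖θ‖ := by
    rw [← intervalIntegral.integral_add i2 (iR1 θ)]
    have := intervalIntegral.norm_integral_le_of_norm_le_const (a := 0) (b := P.T)
      (f := fun t => K.proj (H t, w t) ⬝ᵥ
        (massMat K m *ᵥ d' t - stiffMat K m *ᵥ d t) + R1 θ t)
      (C := η / 4 / P.T * ‖θ‖) fun t ht => by
        rw [uIoc_of_le hT.le] at ht
        have ht' := Ioc_subset_Icc_self ht
        obtain ⟨-, hb1, hb2, heq⟩ := hdd t ht'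
        have e1 := hRθ t ht'
        rw [hR0 t ht', sub_zero, stateResidual_coord K hθ.1 hN (hY.at ht') (rH.mem t ht')
          (rw.mem t ht')] at e1
        change |_ - R1 θ t| ≤ _ at e1
        set h := K.proj (H t, w t)
        set ρ := Aθ *ᵥ K.proj (E' t, v' t) - Bθ *ᵥ K.proj (E t, v t)
            - loadVec K (m.perturb φ χ θ) (P.force t) (P.trac t)
        -- the equation of the perturbed state turns the unperturbed system into the residual `ρ`
        -- up to terms of second order
        have e2 : h ⬝ᵥ (massMat K m *ᵥ d' t - stiffMat K m *ᵥ d t) + R1 θ t =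
            -(h ⬝ᵥ ρ - R1 θ t) - h ⬝ᵥ ((Aθ - massMat K m) *ᵥ d' t)
              + h ⬝ᵥ ((Bθ - stiffMat K m) *ᵥ d t) := by
          rw [sub_mulVec, sub_mulVec, heq]
          simp only [dotProduct_sub, dotProduct_add, dotProduct_neg]
          ring
        have hquad : ∀ (X : Matrix (Fin K.n) (Fin K.n) ℝ) (y : Fin K.n → ℝ),
            (∀ i j, |X i j| ≤ C₂ * ‖θ‖) → ‖y‖ ≤ C₁ * ‖θ‖ →
            |h ⬝ᵥ (X *ᵥ y)| ≤ K.n * Mh * (K.n * C₂ * C₁) * ‖θ‖ * ‖θ‖ := fun X y hX hy => by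
          have h1 := norm_mulVec_le (by positivity) hX y
          have h2 : ‖X *ᵥ y‖ ≤ K.n * (C₂ * ‖θ‖) * (C₁ * ‖θ‖) :=
            h1.trans (mul_le_mul_of_nonneg_left hy (by positivity))
          refine (abs_dotProduct_le _ _).trans ?_
          calc (K.n : ℝ) * ‖h‖ * ‖X *ᵥ y‖ ≤ K.n * Mh * (K.n * (C₂ * ‖θ‖) * (C₁ * ‖θ‖)) :=
                mul_le_mul (mul_le_mul_of_nonneg_left (hMh t ht') (by positivity)) h2
                  (norm_nonneg _) (by positivity)
            _ = _ := by ring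
        have e3 := hquad _ _ (fun i j => (hma i j).1) hb2
        have e4 := hquad _ _ (fun i j => (hma i j).2) hb1
        have e5 := mul_le_mul_of_nonneg_right hqθ (norm_nonneg θ)
        rw [Real.norm_eq_abs, e2]
        have e6 : η / 4 / P.T * ‖θ‖ = η / 8 / P.T * ‖θ‖ + η / 8 / P.T * ‖θ‖ := by ring
        rw [e6]
        rw [abs_le] at e1 e3 e4 ⊢
        constructor <;> linarith [e1.1, e1.2, e3.1, e3.2, e4.1, e4.2]
    rw [Real.norm_eq_abs] at this
    refine this.trans (le_of_eq ?_)
    rw [sub_zero, abs_of_pos hT]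
    field_simp
  have hT3 := hSpθ 0 rfl
  have hT4 := hSsθ 0 rfl
  have hT1' : η / 4 / (C' + 1) * (C' * ‖θ‖) ≤ η / 4 * ‖θ‖ := by
    have h1 : C' / (C' + 1) ≤ 1 := by rw [div_le_one (by positivity)]; linarith
    calc η / 4 / (C' + 1) * (C' * ‖θ‖) = η / 4 * ‖θ‖ * (C' / (C' + 1)) := by ring
      _ ≤ η / 4 * ‖θ‖ * 1 := by gcongr
      _ = _ := mul_one _
  rw [zero_add, m.perturb_zero, reducedCost_eq hθ.1 hsθ, reducedCost_eq hm hs]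
  have hLθ : L.toContinuousLinearMap θ =
      D.intVol (fun e x => deriv P.rp (m.cp e x) * (∑ i, θ i • φ i) e x)
        + D.intVol (fun e x => deriv P.rs (m.cs e x) * (∑ i, θ i • χ i) e x)
        + ∫ t in (0 : ℝ)..P.T, R1 θ t := rfl
  have hc1 : cost D P (m.perturb φ χ θ) vθ = (∫ t in (0 : ℝ)..P.T, costAt P (vθ t))
    + D.intVol (fun e x => P.rp ((m.cp + ∑ i, θ i • φ i) e x))
    + D.intVol (fun e x => P.rs ((m.cs + ∑ i, θ i • χ i) e x)) := rfl
  have hc2 : cost D P m v = (∫ t in (0 : ℝ)..P.T, costAt P (v t))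
    + D.intVol (fun e x => P.rp (m.cp e x)) + D.intVol (fun e x => P.rs (m.cs e x)) := rfl
  rw [hLθ, hc1, hc2, Real.norm_eq_abs]
  rw [hcd] at hT1
  -- the four remainders: of the cost of the velocity, of the adjoint representation, and of the
  -- two terms that depend on the wave speeds directly
  have hη : η * ‖θ‖ = η / 4 * ‖θ‖ + η / 4 * ‖θ‖ + η / 4 * ‖θ‖ + η / 4 * ‖θ‖ := by ring
  rw [hη]
  rw [abs_le] at hT1 hT2 hT3 hT4 ⊢
  constructor <;> linarith [hT1.1, hT1.2, hT2.1, hT2.2, hT3.1, hT3.2, hT4.1, hT4.2]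

end reduced

end

end DGAE

namespace DGAE

noncomputable section

/-! ### The gradient terms -/

section continuity

lemma ContInterface.gp {Z : Type*} [TopologicalSpace Z] {S : Set Z} {F : Z → Interface}
    (hF : ContInterface S F) {q p : Z → Trace} (hq : ContTrace S q) (hp : ContTrace S p)
    {A : Z → M3} (hA : ContinuousOn A S) :
    ContinuousOn (fun z => (F z).gp (q z) (p z) (A z)) S := by
  have hqS := hF.n.dot (hq.tM.add hq.tP)
  have hpS := hF.n.dot (hp.tM.add hp.tP)
  have hqV := (hq.vM.dot hF.n).add (hq.vP.dot hF.n.neg)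
  have hpV := (hp.vM.dot hF.n).add (hp.vP.dot hF.n.neg)
  have htr : ContinuousOn (fun z => (A z).trace) S :=
    (continuous_id.matrix_trace).comp_continuousOn hA
  have c2 : ContinuousOn (fun _ : Z => (2 : ℝ)) S := continuousOn_const
  have hk := (hF.k0.pow 2).mul hF.ρM
  exact ((((hk.mul hqS).mul hpS).neg.add
    (((hk.mul ((hF.ρP.mul hF.cpP).pow 2)).mul hqV).mul hpV)).add
    (((hk.mul hF.ρP).mul hF.cpP).mul ((hqS.mul hpV).sub (hqV.mul hpS)))).add
    (((((c2.mul hF.k0).mul hF.ρM).mul hF.cpM).mul htr).mul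
      (hpS.sub ((hF.ρP.mul hF.cpP).mul hpV))) |>.add
    ((((c2.mul hF.ρM).mul hF.cpM).mul htr).mul (hp.vM.dot hF.n))

lemma ContInterface.gs {Z : Type*} [TopologicalSpace Z] {S : Set Z} {F : Z → Interface}
    (hF : ContInterface S F) (hn : ∀ z ∈ S, (F z).n ⬝ᵥ (F z).n = 1) {q p : Z → Trace}
    (hq : ContTrace S q) (hp : ContTrace S p) {A : Z → M3} (hA : ContinuousOn A S) :
    ContinuousOn (fun z => (F z).gs (q z) (p z) (A z)) S := by
  refine ContinuousOn.congr ?_ fun z hz => Interface.gs_eq (hn z hz) _ _ _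
  have hqS := hq.tM.add hq.tP
  have hqD := hq.vM.sub hq.vP
  have hpz := (hp.tM.add hp.tP).sub ((hF.ρP.mul hF.csP).smul (hp.vM.sub hp.vP))
  have hpz' := (hp.tM.add hp.tP).sub ((hF.ρP.mul hF.cpP).smul (hp.vM.sub hp.vP))
  have htr : ContinuousOn (fun z => (A z).trace) S :=
    (continuous_id.matrix_trace).comp_continuousOn hA
  have hAn : ContinuousOn (fun z => A z *ᵥ (F z).n) S :=
    (continuous_fst.matrix_mulVec continuous_snd).comp_continuousOn (hA.prodMk hF.n)
  have hnn := (hF.n.dot hAn).sub htr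
  have c4 : ContinuousOn (fun _ : Z => (4 : ℝ)) S := continuousOn_const
  have hk := (hF.k1.pow 2).mul hF.ρM
  exact (((((hk.mul (hF.n.tang hqS hpz)).neg.sub
    (((hk.mul hF.ρP).mul hF.csP).mul (hF.n.tang hqD hpz))).add
    (((((c4.mul hF.k0).mul hF.ρM).mul hF.csM).mul hnn).mul (hF.n.dot hpz'))).add
    ((((c4.mul hF.k1).mul hF.ρM).mul hF.csM).mul (hF.n.tang hAn hpz))).add
    (((c4.mul hF.ρM).mul hF.csM).mul ((hF.n.tang hAn hp.vM).add (hnn.mul (hF.n.dot hp.vM)))))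

variable {El IF BF : Type*} [Fintype El] {D : Discretization El IF BF} {m : Medium El}
  (hm : Admissible D.toMesh m) {P : ProblemData D} {E H : ℝ → TField El} {v w : ℝ → VField El}
  (rE : RegT D (Icc 0 P.T) E) (rv : RegV D (Icc 0 P.T) v) (rH : RegT D (Icc 0 P.T) H)
  (rw : RegV D (Icc 0 P.T) w)
include hm rE rv rH rw

lemma continuousOn_sideTermPS (s : Side IF BF) :
    ContinuousOn (fun z : ℝ × V3 => sideTermP P m E v H w z.1 s z.2)
      (Icc 0 P.T ×ˢ D.face (Mesh.faceOf s)) ∧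
    ContinuousOn (fun z : ℝ × V3 => sideTermS P m E v H w z.1 s z.2)
      (Icc 0 P.T ×ˢ D.face (Mesh.faceOf s)) := by
  have hF := contInterface hm isCompact_Icc (I := Icc 0 P.T) s
  have hq := contTrace hm isCompact_Icc rE rv P.trac_cont s
  have hp := contTrace hm isCompact_Icc rH rw (τ := fun _ => 0) (fun _ => continuousOn_const) s
  have hA : ContinuousOn (fun z : ℝ × V3 => E z.1 (D.inner s) z.2)
      (Icc 0 P.T ×ˢ D.face (Mesh.faceOf s)) :=
    continuousOn_pi.2 fun i => continuousOn_pi.2 fun j =>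
      rE.continuousOn_face (D.face_subset_inner s) i j
  constructor
  · simp only [sideTermP, adjTrace_eq]
    exact hF.gp hq hp hA
  · simp only [sideTermS, adjTrace_eq]
    exact hF.gs (fun z hz => (hm.regular s hz.2).unit) hq hp hA

omit [Fintype El] rv rH in
lemma continuousOn_volVarMain {c c' : SField El} (hc : PiecewiseC1 D.toMesh c)
    (hc' : PiecewiseC1 D.toMesh c') (e : El) :
    ContinuousOn (fun z : ℝ × V3 => volVarMain m c c' (E z.1) (w z.1) e z.2)
      (Icc 0 P.T ×ˢ closure (D.cell e)) := by
  -- the first-order terms of an expansion are continuous; here with the single direction `c`, `c'`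
  have h := (uexp_volTerm (N := 1) (φ := fun _ => c) (χ := fun _ => c') hm.isC1 (fun _ => hc)
    (fun _ => hc') e (isCompact_Icc (a := 0) (b := P.T)) (f := fun _ => 0) continuousOn_const
    (.static D.Ph.zero_mem) rE (.static D.Ph.zero_mem) (.static D.Qh.zero_mem)
    (.static D.Qh.zero_mem) rw).cont1 1
  refine h.congr fun z _ => ?_
  simp [volVarTest, Medium.Cp, Medium.Cs, ddot_zero_right]

end continuity

section identification

variable {El IF BF : Type*} {D : Discretization El IF BF} {m : Medium El}

lemma sideVariation_swap (M : Mesh El IF BF) (m : Medium El) (c c' : SField El) (E : TField El)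
    (f : IF) (x : V3) : sideVariation M m c c' E (Sum.inl (f, false)) x =
      (sideVariation M m c c' E (Sum.inl (f, true)) x).swap := by
  simp only [sideVariation, Interface.Variation.swap, varOuter, Mesh.outer, Mesh.inner,
    Mesh.outNormal, neg_neg]

variable (hm : Admissible D.toMesh m) {c c' : SField El}
  (hvan : ∀ e, ∀ x ∈ closure (D.cell e), m.cs e x = 0 → c' e x = 0)
include hvan

lemma isInterior_sideVariation (E : TField El) (f : IF) {x : V3}
    (hx : x ∈ D.face (Sum.inl f)) :
    (sideVariation D.toMesh m c c' E (Sum.inl (f, true)) x).IsInterior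
      (m.interface D.toMesh (Sum.inl (f, true)) x) (E (D.left f) x) (E (D.right f) x) where
  tM := rfl
  tP := rfl
  sM := hvan _ x (D.face_subset_inner (Sum.inl (f, true)) hx)
  sP := hvan _ x (D.face_subset_outer (Sum.inl (f, true)) hx)

include hm in
lemma isBoundary_sideVariation (E : TField El) (b : BF) {x : V3}
    (hx : x ∈ D.face (Sum.inr b)) :
    (sideVariation D.toMesh m c c' E (Sum.inr b) x).IsBoundary
      (m.interface D.toMesh (Sum.inr b) x) (E (D.own b) x) where
  tM := rfl
  elastic h := if_pos ((hm.mu_ne_zero_iff (D.face_subset_inner (Sum.inr b) hx)).2 h)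
  acoustic h := if_neg (not_not.2 (not_not.1
    (mt (hm.mu_ne_zero_iff (D.face_subset_inner (Sum.inr b) hx)).1 (not_not.2 h))))
  pP := rfl
  sP := rfl
  sM := hvan _ x (D.face_subset_inner (Sum.inr b) hx)

include hm

/-- The flux part of the variation of the residual at fixed test stress, on both sides of an
interior face. -/
lemma pairingVar_interior (P : ProblemData D) (E H : ℝ → TField El) (v w : ℝ → VField El) (t : ℝ)
    (f : IF) {x : V3} (hx : x ∈ D.face (Sum.inl f)) :
    (∑ b, (m.interface D.toMesh (Sum.inl (f, b)) x).pairingVar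
      (sideVariation D.toMesh m c c' (E t) (Sum.inl (f, b)) x)
      (m.stateTrace D.toMesh (P.trac t) (E t) (v t) (Sum.inl (f, b)) x)
      (m.traction D.toMesh (H t) (Sum.inl (f, b)) x) 0 (w t (D.inner (Sum.inl (f, b))) x)) =
    -∑ b, (sideTermP P m E v H w t (Sum.inl (f, b)) x * c (D.inner (Sum.inl (f, b))) x +
      sideTermS P m E v H w t (Sum.inl (f, b)) x * c' (D.inner (Sum.inl (f, b))) x) := by
  have h := Interface.pairingVar_add_swap (hm.regular (Sum.inl (f, true)) hx)
    (isInterior_sideVariation (m := m) (c := c) hvan (E t) f hx)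
    (acousticTangential hm f hx (P.trac t) (E t) (v t)) (acousticTangential hm f hx 0 (H t) (w t))
  rw [← interface_swap, ← sideVariation_swap, ← stateTrace_swap, ← stateTrace_swap] at h
  have hp : (m.stateTrace D.toMesh 0 (H t) (w t) (Sum.inl (f, true)) x).tP =
      m.traction D.toMesh (H t) (Sum.inl (f, false)) x := rfl
  rw [hp] at h
  simp only [Fintype.sum_bool, sideTermP, sideTermS, adjTrace_eq]
  exact h

lemma pairingVar_boundary_face (P : ProblemData D) (E H : ℝ → TField El) (v w : ℝ → VField El)
    (t : ℝ) (b : BF) {x : V3} (hx : x ∈ D.face (Sum.inr b)) :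
    (m.interface D.toMesh (Sum.inr b) x).pairingVar
      (sideVariation D.toMesh m c c' (E t) (Sum.inr b) x)
      (m.stateTrace D.toMesh (P.trac t) (E t) (v t) (Sum.inr b) x)
      (m.traction D.toMesh (H t) (Sum.inr b) x) 0 (w t (D.inner (Sum.inr b)) x) =
    -(sideTermP P m E v H w t (Sum.inr b) x * c (D.inner (Sum.inr b)) x +
      sideTermS P m E v H w t (Sum.inr b) x * c' (D.inner (Sum.inr b)) x) := by
  have h := Interface.pairingVar_boundary (q := m.stateTrace D.toMesh (P.trac t) (E t) (v t)
      (Sum.inr b) x) (hm.regular (Sum.inr b) hx) (sameParameters D.toMesh m b x)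
    (isBoundary_sideVariation hm (c := c) hvan (E t) b hx) rfl (freeTrace hm b hx (H t) (w t))
  simp only [sideTermP, sideTermS, adjTrace_eq]
  exact h

end identification

section gradient

variable {El IF BF : Type*} [Fintype El] [Fintype IF] [Fintype BF] {D : Discretization El IF BF}
  {m : Medium El} (hm : Admissible D.toMesh m) {P : ProblemData D} {E H : ℝ → TField El}
  {v w : ℝ → VField El} {c c' : SField El} (hc : PiecewiseC1 D.toMesh c)
  (hc' : PiecewiseC1 D.toMesh c')
  (hvan : ∀ e, ∀ x ∈ closure (D.cell e), m.cs e x = 0 → c' e x = 0)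
include hm hc hc'

/-- The face terms of the gradient in the directions `c`, `c'`. -/
def gradSide (P : ProblemData D) (m : Medium El) (E : ℝ → TField El) (v : ℝ → VField El)
    (H : ℝ → TField El) (w : ℝ → VField El) (c c' : SField El) (t : ℝ) (s : Side IF BF)
    (x : V3) : ℝ :=
  sideTermP P m E v H w t s x * c (D.inner s) x + sideTermS P m E v H w t s x * c' (D.inner s) x

omit [Fintype IF] [Fintype BF] in
lemma continuousOn_gradSide (rE : RegT D (Icc 0 P.T) E) (rv : RegV D (Icc 0 P.T) v)
    (rH : RegT D (Icc 0 P.T) H) (rw : RegV D (Icc 0 P.T) w) (s : Side IF BF) :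
    ContinuousOn (fun z : ℝ × V3 => gradSide P m E v H w c c' z.1 s z.2)
      (Icc 0 P.T ×ˢ D.face (Mesh.faceOf s)) := by
  obtain ⟨h1, h2⟩ := continuousOn_sideTermPS hm rE rv rH rw s
  exact (h1.mul (continuousOn_comp_snd ((hc.continuousOn _).mono (D.face_subset_inner s)))).add
    (h2.mul (continuousOn_comp_snd ((hc'.continuousOn _).mono (D.face_subset_inner s))))

include hvan in
/-- If the variation of the adjoint stress is a test stress, then the variation of the residual
consists of the element and face terms of the gradient: the part in which the test stress varies
vanishes by the state equation. -/
lemma residualVar_eq (hs : IsState D P m E v) (hH : IsC1Curve P.T D.Ph H)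
    (hw : IsC1Curve P.T D.Qh w) {t : ℝ} (ht : t ∈ Ioo 0 P.T)
    (htest : IsTestStress D m fun e x => m.Cp c e x (H t e x) + m.Cs c' e x (H t e x)) :
    residualVar D m c c' (P.trac t) (dtT E t) (E t) (v t) (H t) (w t) =
      D.intVol (volVarMain m c c' (E t) (w t)) + D.intSides (gradSide P m E v H w c c' t) := by
  have hT := P.T_pos
  have htI := Ioo_subset_Icc_self ht
  obtain ⟨rE, E', rE', -, hdtE⟩ := hs.curve_E.regT hT
  obtain ⟨rv, v', rv', -, hdtv⟩ := hs.curve_v.regV hT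
  obtain ⟨rH, -⟩ := hH.regT hT
  obtain ⟨rw, -⟩ := hw.regV hT
  obtain ⟨A, hA, hAvol, hAsurf⟩ := htest
  have hY : DataMem D (P.force t) (P.trac t) (dtT E t) (E t) (dtV v t) (v t) := by
    rw [hdtE t ht, hdtv t ht]
    exact RegData.at (⟨P.force_cont, P.trac_cont, rE', rE, rv', rv⟩ :
      RegData D (Icc 0 P.T) P.force P.trac E' E v' v) htI
  -- the state equation with test functions `(A, 0)`
  have hres := hs.equation t ht A hA 0 D.Qh.zero_mem
  rw [stateResidual_eq hm hY hA D.Qh.zero_mem] at hres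
  set V := volTerm m (P.force t) (dtT E t) (E t) (dtV v t) (v t) A 0 with hV
  set S := sideTerm D.toMesh m (P.trac t) (E t) (v t) A 0 with hS
  have cV : ∀ e, ContinuousOn (V e) (closure (D.cell e)) :=
    continuousOn_volTerm_static hm hY hA D.Qh.zero_mem
  have cS : ∀ s, ContinuousOn (S s) (D.face (Mesh.faceOf s)) :=
    continuousOn_sideTerm_static hm hY hA D.Qh.zero_mem
  have cM : ∀ e, ContinuousOn (volVarMain m c c' (E t) (w t) e) (closure (D.cell e)) := fun e =>
    continuousOn_slice (continuousOn_volVarMain hm rE rw hc hc' e) htI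
  have cG : ∀ s, ContinuousOn (gradSide P m E v H w c c' t s) (D.face (Mesh.faceOf s)) := fun s =>
    continuousOn_slice (continuousOn_gradSide hm hc hc' rE rv rH rw s) htI
  -- the volume terms
  have hvol : D.intVol (fun e x => volVarTest m c c' (dtT E t) (v t) (H t) e x
      + volVarMain m c c' (E t) (w t) e x) = D.intVol V + D.intVol (volVarMain m c c' (E t) (w t)) := by
    rw [← one_mul (D.intVol (volVarMain m c c' (E t) (w t))), ← intVol_add_mul D cV cM]
    refine Finset.sum_congr rfl fun e _ => integral_congr_ae ?_
    filter_upwards [hAvol e] with x hx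
    simp only [hV, volTerm, volVarTest, hx, Pi.zero_apply, dotProduct_zero, mul_zero, add_zero,
      sub_zero, one_mul]
  -- the flux terms
  set X : Side IF BF → V3 → ℝ := fun s x => (m.interface D.toMesh s x).pairingVar
      (sideVariation D.toMesh m c c' (E t) s x) (m.stateTrace D.toMesh (P.trac t) (E t) (v t) s x)
      (m.traction D.toMesh (H t) s x) (sideVariation D.toMesh m c c' (H t) s x).tM
      (w t (D.inner s) x) with hX
  set X₀ : Side IF BF → V3 → ℝ := fun s x => (m.interface D.toMesh s x).pairingVar
      (sideVariation D.toMesh m c c' (E t) s x) (m.stateTrace D.toMesh (P.trac t) (E t) (v t) s x)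
      (m.traction D.toMesh (H t) s x) 0 (w t (D.inner s) x) with hX₀
  -- the variation of the test stress enters linearly, and only through the term `S` of the state
  -- equation
  have hXS : ∀ s, ∀ᵐ x ∂D.surfOf s, X₀ s x = X s x - S s x := fun s => by
    filter_upwards [hAsurf s] with x hx
    simp only [hX, hX₀, hS, sideTerm]
    rw [Interface.pairingVar_eq _ _ _ _ (sideVariation D.toMesh m c c' (H t) s x).tM]
    have : m.traction D.toMesh A s x = (sideVariation D.toMesh m c c' (H t) s x).tM := by
      rw [Medium.traction, hx, Cp_add_Cs_mulVec]
      rfl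
    rw [this]
    simp
  have cX : ∀ s, ContinuousOn (X s) (D.face (Mesh.faceOf s)) := fun s => by
    have h := (uexp_side (N := 1) (φ := fun _ => c) (χ := fun _ => c') hm
      ⟨fun _ => hc, fun _ => hc', fun _ => hvan⟩ s (isCompact_Icc (a := 0) (b := P.T)) rE rH rv rw
      P.trac_cont).cont1 1
    simpa using continuousOn_slice h htI
  have iX := fun s => integrable_of_continuousOn (D.isCompact_face s) (D.surfOf_supp s) (cX s)
  have iS := fun s => integrable_of_continuousOn (D.isCompact_face s) (D.surfOf_supp s) (cS s)
  have iG := fun s => integrable_of_continuousOn (D.isCompact_face s) (D.surfOf_supp s) (cG s)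
  have iX₀ : ∀ s, Integrable (X₀ s) (D.surfOf s) := fun s =>
    ((iX s).sub (iS s)).congr ((hXS s).mono fun x hx => hx.symm)
  have hX₀eq : D.intSides X₀ = D.intSides X - D.intSides S := by
    simp only [Discretization.intSides, ← Finset.sum_sub_distrib]
    refine Finset.sum_congr rfl fun s _ => ?_
    rw [← integral_sub (iX s) (iS s)]
    exact integral_congr_ae (hXS s)
  have hX₀G : D.intSides X₀ = -D.intSides (gradSide P m E v H w c c' t) := by
    rw [intSides_eq_faces, intSides_eq_faces, neg_add, ← Finset.sum_neg_distrib,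
      ← Finset.sum_neg_distrib]
    congr 1
    · refine Finset.sum_congr rfl fun f _ => ?_
      have j : ∀ b, Integrable (X₀ (Sum.inl (f, b))) (D.surf (Sum.inl f)) := fun b => iX₀ _
      have j' : ∀ b, Integrable (gradSide P m E v H w c c' t (Sum.inl (f, b)))
        (D.surf (Sum.inl f)) := fun b => iG (Sum.inl (f, b))
      rw [← integral_add (j true) (j false), ← integral_add (j' true) (j' false), ← integral_neg]
      refine integral_congr_on (D.surfOf_supp (Sum.inl (f, true))) fun x hx => ?_
      have := pairingVar_interior hm (c := c) hvan P E H v w t f hx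
      rw [Fintype.sum_bool, Fintype.sum_bool] at this
      exact this
    · refine Finset.sum_congr rfl fun b _ => ?_
      rw [← integral_neg]
      exact integral_congr_on (D.surfOf_supp (Sum.inr b)) fun x hx =>
        pairingVar_boundary_face hm hvan P E H v w t b hx
  rw [residualVar, hvol]
  change D.intVol V + D.intVol (volVarMain m c c' (E t) (w t)) - D.intSides X = _
  linarith

/-- Time integration of the element and face terms of the gradient. -/
lemma integral_gradient_terms (rE : RegT D (Icc 0 P.T) E) (rv : RegV D (Icc 0 P.T) v)
    (rH : RegT D (Icc 0 P.T) H) (rw : RegV D (Icc 0 P.T) w) :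
    ∫ t in (0 : ℝ)..P.T, (D.intVol (volVarMain m c c' (E t) (w t)) +
        D.intSides (gradSide P m E v H w c c' t)) =
      (∫ t in (0 : ℝ)..P.T, D.intVol (volVarMain m c c' (E t) (w t))) +
        ∑ s, ∫ t in (0 : ℝ)..P.T, ∫ x, gradSide P m E v H w c c' t s x ∂D.surfOf s := by
  have hT := P.T_pos
  have h1 : ContinuousOn (fun t => D.intVol (volVarMain m c c' (E t) (w t))) (Icc 0 P.T) :=
    continuousOn_finsetSum _ fun e _ => continuousOn_integral_param (D.isCompact_cell e)
      (D.vol_supp e) isCompact_Icc (continuousOn_volVarMain hm rE rw hc hc' e)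
  have h2 : ∀ s, ContinuousOn (fun t => ∫ x, gradSide P m E v H w c c' t s x ∂D.surfOf s)
      (Icc 0 P.T) := fun s => continuousOn_integral_param (D.isCompact_face s)
      (D.surfOf_supp s) isCompact_Icc (continuousOn_gradSide hm hc hc' rE rv rH rw s)
  simp only [Discretization.intSides]
  rw [intervalIntegral.integral_add (h1.intervalIntegrable_of_Icc hT.le)
    ((continuousOn_finsetSum _ fun s _ => h2 s).intervalIntegrable_of_Icc hT.le),
    ← intervalIntegral.integral_finsetSum fun s _ => (h2 s).intervalIntegrable_of_Icc hT.le]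

end gradient

end

end DGAE

namespace DGAE

noncomputable section

/-! ### Gradients with respect to one wave speed -/

section gradients

variable {El IF BF : Type*} {D : Discretization El IF BF} {m : Medium El}

lemma IsTestStress.zero : IsTestStress D m fun _ _ => 0 :=
  ⟨0, D.Ph.zero_mem, fun e => .of_forall fun x => by simp [Medium.C],
    fun s => .of_forall fun x => by simp [Medium.C]⟩

lemma IsTestStress.add_smul {A B : TField El} (hA : IsTestStress D m A) (hB : IsTestStress D m B)
    (a : ℝ) : IsTestStress D m fun e x => A e x + a • B e x := by
  obtain ⟨K, hK, hKv, hKs⟩ := hA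
  obtain ⟨K', hK', hKv', hKs'⟩ := hB
  refine ⟨K + a • K', D.Ph.add_mem hK (D.Ph.smul_mem a hK'), fun e => ?_, fun s => ?_⟩
  · filter_upwards [hKv e, hKv' e] with x h h'
    rw [← h, ← h']
    exact m.C_add_smul e x _ _ a
  · filter_upwards [hKs s, hKs' s] with x h h'
    rw [← h, ← h']
    exact m.C_add_smul _ x _ _ a

lemma IsTestStress.sum {ι : Type*} (s : Finset ι) (a : ι → ℝ) {A : ι → TField El}
    (hA : ∀ i ∈ s, IsTestStress D m (A i)) :
    IsTestStress D m fun e x => ∑ i ∈ s, a i • A i e x := by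
  classical
  induction s using Finset.induction_on with
  | empty => simpa using IsTestStress.zero
  | insert i s hi ih =>
    have h := (ih fun j hj => hA j (Finset.mem_insert_of_mem hj)).add_smul
      (hA i (Finset.mem_insert_self i s)) (a i)
    simp only [Finset.sum_insert hi, add_comm (a i • A i _ _)]
    exact h

variable {N : ℕ}

lemma Medium.Cp_sum (m : Medium El) (φ : Fin N → SField El) (θ : Fin N → ℝ) (e : El) (x : V3)
    (A : M3) : m.Cp (∑ i, θ i • φ i) e x A = ∑ i, θ i • m.Cp (φ i) e x A := by
  simp only [Medium.Cp, sum_dir_apply, smul_smul, ← Finset.sum_smul]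
  congr 1
  rw [Finset.mul_sum, Finset.sum_mul]
  exact Finset.sum_congr rfl fun i _ => by ring

lemma Medium.Cs_sum (m : Medium El) (χ : Fin N → SField El) (θ : Fin N → ℝ) (e : El) (x : V3)
    (A : M3) : m.Cs (∑ i, θ i • χ i) e x A = ∑ i, θ i • m.Cs (χ i) e x A := by
  simp only [Medium.Cs, sum_dir_apply, smul_smul, ← Finset.sum_smul]
  congr 1
  rw [Finset.mul_sum]
  exact Finset.sum_congr rfl fun i _ => by ring

lemma elementTermP_zero (m : Medium El) (E : TField El) (w : VField El) :
    elementTermP m E w 0 = 0 := by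
  funext e x
  simp [elementTermP, grad, dotProduct]

lemma elementTermS_zero (m : Medium El) (E : TField El) (w : VField El) :
    elementTermS m E w 0 = 0 := by
  funext e x
  simp [elementTermS, divTensor, dotProduct]

variable [Fintype El] [Fintype IF] [Fintype BF] (hm : Admissible D.toMesh m) {P : ProblemData D}
  {E H : ℝ → TField El} {v w : ℝ → VField El} (hs : IsState D P m E v) (ha : IsAdjoint D P m v H w)
include hm hs ha

/-- The derivative of the reduced cost in terms of the gradient terms, for simultaneous
perturbations of both wave speeds. -/
lemma hasFDerivAt_reducedCost_gradient {φ χ : Fin N → SField El} (hd : IsDirection D m φ χ)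
    (htest : ∀ i, ∀ t ∈ Ioo 0 P.T,
      IsTestStress D m fun e x => m.Cp (φ i) e x (H t e x) + m.Cs (χ i) e x (H t e x)) :
    ∃ L : (Fin N → ℝ) →L[ℝ] ℝ,
      HasFDerivAt (fun θ => reducedCost D P (m.perturb φ χ θ)) L 0 ∧ ∀ θ, L θ =
        D.intVol (fun e x => deriv P.rp (m.cp e x) * (∑ i, θ i • φ i) e x)
        + D.intVol (fun e x => deriv P.rs (m.cs e x) * (∑ i, θ i • χ i) e x)
        + ((∫ t in (0 : ℝ)..P.T,
            D.intVol (volVarMain m (∑ i, θ i • φ i) (∑ i, θ i • χ i) (E t) (w t))) +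
          ∑ s, ∫ t in (0 : ℝ)..P.T, ∫ x,
            gradSide P m E v H w (∑ i, θ i • φ i) (∑ i, θ i • χ i) t s x ∂D.surfOf s) := by
  have hT := P.T_pos
  obtain ⟨L, hL, hL'⟩ := hasFDerivAt_reducedCost hm hd hs ha
  refine ⟨L, hL, fun θ => ?_⟩
  have hc := PiecewiseC1.sum hd.smooth_p θ
  have hc' := PiecewiseC1.sum hd.smooth_s θ
  have hvan : ∀ e, ∀ x ∈ closure (D.cell e), m.cs e x = 0 → (∑ i, θ i • χ i) e x = 0 :=
    fun e x hx h0 => by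
      rw [sum_dir_apply]
      exact Finset.sum_eq_zero fun i _ => by rw [hd.vanish i e x hx h0, mul_zero]
  rw [hL', ← integral_gradient_terms hm hc hc' (hs.curve_E.regT hT).1 (hs.curve_v.regV hT).1
    (ha.curve_H.regT hT).1 (ha.curve_w.regV hT).1]
  congr 1
  refine intervalIntegral.integral_congr_Ioo_of_le hT.le fun t ht => ?_
  refine residualVar_eq hm hc hc' hvan hs ha.curve_H ha.curve_w ht ?_
  have h := IsTestStress.sum Finset.univ θ fun i _ => htest i t ht
  simp only [smul_add, Finset.sum_add_distrib, ← Medium.Cp_sum, ← Medium.Cs_sum] at h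
  exact h

theorem hasFDerivAt_reducedCost_cp {φ : Fin N → SField El}
    (hφ : ∀ i, PiecewiseC1 D.toMesh (φ i))
    (htest : ∀ i, ∀ t ∈ Ioo 0 P.T, IsTestStress D m fun e x => m.Cp (φ i) e x (H t e x)) :
    ∃ L : (Fin N → ℝ) →L[ℝ] ℝ,
      HasFDerivAt (fun θ => reducedCost D P (m.perturbCp φ θ)) L 0 ∧
      ∀ θ, L θ = gradientP D P m E v H w (∑ i, θ i • φ i) := by
  obtain ⟨L, hL, hL'⟩ := hasFDerivAt_reducedCost_gradient hm hs ha (φ := φ) (χ := fun _ => 0)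
    ⟨hφ, fun _ _ _ _ => contDiffAt_const, fun _ _ _ _ _ => rfl⟩ fun i t ht => by
      simpa [Medium.Cs] using htest i t ht
  refine ⟨L, ?_, fun θ => ?_⟩
  · have : ∀ θ, m.perturb φ (fun _ => 0) θ = m.perturbCp φ θ := fun θ => by
      simp [Medium.perturb, Medium.perturbCp]
    simpa only [this] using hL
  · rw [hL', gradientP]
    have h0 : volVarMain m (∑ i, θ i • φ i) 0 = fun A u => elementTermP m A u (∑ i, θ i • φ i) := by
      funext A u e x
      simp [volVarMain, elementTermS_zero]
    simp only [smul_zero, Finset.sum_const_zero, h0, gradSide, Pi.zero_apply, mul_zero, add_zero]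
    simp only [Discretization.intVol, integral_zero, Finset.sum_const_zero, add_zero]
    ring

theorem hasFDerivAt_reducedCost_cs {χ : Fin N → SField El}
    (hχ : ∀ i, PiecewiseC1 D.toMesh (χ i))
    (hvan : ∀ i e, ∀ x ∈ closure (D.cell e), m.cs e x = 0 → χ i e x = 0)
    (htest : ∀ i, ∀ t ∈ Ioo 0 P.T, IsTestStress D m fun e x => m.Cs (χ i) e x (H t e x)) :
    ∃ L : (Fin N → ℝ) →L[ℝ] ℝ,
      HasFDerivAt (fun θ => reducedCost D P (m.perturbCs χ θ)) L 0 ∧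
      ∀ θ, L θ = gradientS D P m E v H w (∑ i, θ i • χ i) := by
  obtain ⟨L, hL, hL'⟩ := hasFDerivAt_reducedCost_gradient hm hs ha (φ := fun _ => 0) (χ := χ)
    ⟨fun _ _ _ _ => contDiffAt_const, hχ, hvan⟩ fun i t ht => by
      simpa [Medium.Cp] using htest i t ht
  refine ⟨L, ?_, fun θ => ?_⟩
  · have : ∀ θ, m.perturb (fun _ => 0) χ θ = m.perturbCs χ θ := fun θ => by
      simp [Medium.perturb, Medium.perturbCs]
    simpa only [this] using hL
  · rw [hL', gradientS]
    have h0 : volVarMain m 0 (∑ i, θ i • χ i) = fun A u => elementTermS m A u (∑ i, θ i • χ i) := by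
      funext A u e x
      simp [volVarMain, elementTermP_zero]
    simp only [smul_zero, Finset.sum_const_zero, h0, gradSide, Pi.zero_apply, mul_zero, zero_add]
    simp only [Discretization.intVol, integral_zero, Finset.sum_const_zero, zero_add]
    ring

end gradients

/-! ### Acoustic media with continuous parameters -/

section acoustic

variable {El IF BF : Type*} {D : Discretization El IF BF} {m : Medium El}

/-- In an acoustic medium with continuous parameters, the gradient terms of the two sides of an
interior face add up to the face term of the acoustic wave equation. -/
lemma sideTermP_add [Fintype El] (hm : Admissible D.toMesh m)
    (h0 : ∀ e, ∀ x ∈ closure (D.cell e), m.cs e x = 0)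
    (hρ : ContinuousAcross D.toMesh m.ρ) (hcp : ContinuousAcross D.toMesh m.cp)
    (P : ProblemData D) (E H : ℝ → TField El) (v w : ℝ → VField El) (t : ℝ) (f : IF) {x : V3}
    (hx : x ∈ D.face (Sum.inl f)) :
    sideTermP P m E v H w t (Sum.inl (f, true)) x
      + sideTermP P m E v H w t (Sum.inl (f, false)) x =
    acousticTerm D.toMesh m (E t) (v t) (H t) (w t) f x := by
  have hl := D.face_subset_inner (Sum.inl (f, true)) hx
  have hr := D.face_subset_outer (Sum.inl (f, true)) hx
  have hC : ∀ e, x ∈ closure (D.cell e) → ∀ (A : M3) (n : V3),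
      m.C e x A *ᵥ n = (m.ρ e x * m.cp e x ^ 2 * A.trace) • n := fun e he A n => by
    simp [Medium.C, Medium.lam, Medium.mu, h0 e x he, Matrix.smul_mulVec]
  have hsame : (m.interface D.toMesh (Sum.inl (f, true)) x).SameParameters :=
    ⟨(hρ f x hx).symm, (hcp f x hx).symm, (h0 _ x hr).trans (h0 _ x hl).symm⟩
  have hρ' : m.ρ (D.outer (Sum.inl (f, true))) x = m.ρ (D.inner (Sum.inl (f, true))) x :=
    hsame.ρ
  have hcp' : m.cp (D.outer (Sum.inl (f, true))) x = m.cp (D.inner (Sum.inl (f, true))) x :=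
    hsame.cp
  have hP : ∀ (τ : BF → V3 → V3) (A : TField El) (u : VField El),
      (m.stateTrace D.toMesh τ A u (Sum.inl (f, true)) x).tP =
        (m.ρ (D.left f) x * m.cp (D.left f) x ^ 2 * (A (D.right f) x).trace) •
          (-D.outNormal (Sum.inl (f, true)) x) := fun τ A u => by
    have h := hC _ hr (A (D.right f) x) (-D.outNormal (Sum.inl (f, true)) x)
    rw [hρ', hcp'] at h
    exact h
  have h := Interface.gp_add_swap (hm.regular (Sum.inl (f, true)) hx) hsame
    (EM := E t (D.left f) x) (EP := E t (D.right f) x) (HM := H t (D.left f) x)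
    (HP := H t (D.right f) x)
    (q := m.stateTrace D.toMesh (P.trac t) (E t) (v t) (Sum.inl (f, true)) x)
    (p := m.stateTrace D.toMesh 0 (H t) (w t) (Sum.inl (f, true)) x)
    (hC _ hl _ _) (hP _ _ _) (hC _ hl _ _) (hP _ _ _)
  rw [← interface_swap, ← stateTrace_swap, ← stateTrace_swap] at h
  simp only [sideTermP, adjTrace_eq]
  exact h

/-- The gradient with respect to `cp` in an acoustic medium with continuous parameters. -/
lemma gradientP_acoustic [Fintype El] [Fintype IF] [Fintype BF] (hm : Admissible D.toMesh m)
    (h0 : ∀ e, ∀ x ∈ closure (D.cell e), m.cs e x = 0)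
    (hρ : ContinuousAcross D.toMesh m.ρ) (hcp : ContinuousAcross D.toMesh m.cp)
    {P : ProblemData D} {E H : ℝ → TField El} {v w : ℝ → VField El}
    (rE : RegT D (Icc 0 P.T) E) (rv : RegV D (Icc 0 P.T) v) (rH : RegT D (Icc 0 P.T) H)
    (rw : RegV D (Icc 0 P.T) w) {c : SField El} (hc : PiecewiseC1 D.toMesh c)
    (hc' : ContinuousAcross D.toMesh c) :
    gradientP D P m E v H w c = D.intVol (fun e x => deriv P.rp (m.cp e x) * c e x)
      + (∫ t in (0 : ℝ)..P.T, D.intVol (elementTermP m (E t) (w t) c))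
      + (∑ f, ∫ t in (0 : ℝ)..P.T, ∫ x,
          acousticTerm D.toMesh m (E t) (v t) (H t) (w t) f x * c (D.left f) x
            ∂D.surf (Sum.inl f))
      + ∑ b, ∫ t in (0 : ℝ)..P.T, ∫ x,
          sideTermP P m E v H w t (Sum.inr b) x * c (D.own b) x ∂D.surf (Sum.inr b) := by
  have hT := P.T_pos
  have cs : ∀ s, ContinuousOn (fun z : ℝ × V3 => sideTermP P m E v H w z.1 s z.2 *
      c (D.inner s) z.2) (Icc 0 P.T ×ˢ D.face (Mesh.faceOf s)) := fun s =>
    (continuousOn_sideTermPS hm rE rv rH rw s).1.mul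
      (continuousOn_comp_snd ((hc.continuousOn _).mono (D.face_subset_inner s)))
  have ct : ∀ s, IntervalIntegrable (fun t => ∫ x, sideTermP P m E v H w t s x *
      c (D.inner s) x ∂D.surfOf s) volume 0 P.T := fun s =>
    (continuousOn_integral_param (D.isCompact_face s) (D.surfOf_supp s) isCompact_Icc
      (cs s)).intervalIntegrable_of_Icc hT.le
  rw [gradientP, add_assoc _ (∑ f, _)]
  congr 1
  rw [Fintype.sum_sum_type, Fintype.sum_prod_type]
  congr 1
  refine Finset.sum_congr rfl fun f _ => ?_
  rw [Fintype.sum_bool, ← intervalIntegral.integral_add (ct _) (ct _)]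
  apply intervalIntegral.integral_congr
  intro t ht
  rw [uIcc_of_le hT.le] at ht
  have j : ∀ b, Integrable (fun x => sideTermP P m E v H w t (Sum.inl (f, b)) x *
      c (D.inner (Sum.inl (f, b))) x) (D.surf (Sum.inl f)) := fun b =>
    integrable_of_continuousOn (D.isCompact_face (Sum.inl (f, b)))
      (D.surfOf_supp (Sum.inl (f, b))) (continuousOn_slice (cs (Sum.inl (f, b))) ht)
  refine (integral_add (j true) (j false)).symm.trans ?_
  refine integral_congr_on (D.surfOf_supp (Sum.inl (f, true))) fun x hx => ?_
  have h := sideTermP_add hm h0 hρ hcp P E H v w t f hx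
  have h1 : c (D.inner (Sum.inl (f, false))) x = c (D.left f) x := (hc' f x hx).symm
  have h2 : c (D.inner (Sum.inl (f, true))) x = c (D.left f) x := rfl
  rw [h1, h2, ← add_mul, h]

end acoustic

end

end DGAE

theorem mainTheorem4 {El IF BF : Type*} [Fintype El] [Fintype IF] [Fintype BF]
    (D : Discretization El IF BF) (P : ProblemData D) (m : Medium El)
    (hm : Admissible D.toMesh m) :
    -- the state equation is solvable, and velocity and stress are unique
    (∃ E v, IsState D P m E v) ∧
    (∀ E v E' v', IsState D P m E v → IsState D P m E' v' → ∀ t ∈ Set.Icc 0 P.T, ∀ e,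
      ∀ x ∈ closure (D.cell e), v t e x = v' t e x ∧ m.C e x (E t e x) = m.C e x (E' t e x)) ∧
    -- the discrete adjoint is the backward dG scheme with the adjoint fluxes
    (∀ E v H w, IsC1Curve P.T D.Ph E → IsC1Curve P.T D.Qh v → IsC1Curve P.T D.Ph H →
      IsC1Curve P.T D.Qh w →
      (IsStationary D P m E v H w ↔
        (∀ t ∈ Set.Ioo 0 P.T, ∀ E' ∈ D.Ph, ∀ v' ∈ D.Qh, AdjointEquation D P m v H w t E' v') ∧
        ∀ e, ∀ x ∈ closure (D.cell e), w P.T e x = 0 ∧ m.C e x (H P.T e x) = 0)) ∧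
    (∀ v, IsC1Curve P.T D.Qh v → ∃ H w, IsAdjoint D P m v H w) ∧
    (∀ v H w H' w', IsC1Curve P.T D.Qh v → IsAdjoint D P m v H w → IsAdjoint D P m v H' w' →
      ∀ t ∈ Set.Icc 0 P.T, ∀ e, ∀ x ∈ closure (D.cell e),
        w t e x = w' t e x ∧ m.C e x (H t e x) = m.C e x (H' t e x)) ∧
    -- the adjoint fluxes in terms of jumps
    (∀ H ∈ D.Ph, ∀ w ∈ D.Qh, ∀ s, ∀ x ∈ D.face (Mesh.faceOf s),
      (∀ A : M3, A.IsSymm →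
        ddot ((m.interface D.toMesh s x).adjFluxV (m.adjTrace D.toMesh H w s x)
            - symPart (Matrix.vecMulVec (D.outNormal s x) (w (D.inner s) x)))
          (m.C (D.inner s) x A) =
        ddot ((m.interface D.toMesh s x).adjFluxDiffV (m.adjTrace D.toMesh H w s x))
          (m.C (D.inner s) x A)) ∧
      (m.mu (D.inner s) x ≠ 0 →
        (m.interface D.toMesh s x).adjFluxV (m.adjTrace D.toMesh H w s x)
            - symPart (Matrix.vecMulVec (D.outNormal s x) (w (D.inner s) x)) =
          (m.interface D.toMesh s x).adjFluxDiffV (m.adjTrace D.toMesh H w s x)) ∧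
      (m.interface D.toMesh s x).adjFluxS (m.adjTrace D.toMesh H w s x)
          - m.traction D.toMesh H s x =
        (m.interface D.toMesh s x).adjFluxDiffS (m.adjTrace D.toMesh H w s x)) ∧
    -- the gradients
    ∀ E v H w, IsState D P m E v → IsAdjoint D P m v H w →
      (∀ (N : ℕ) (φ : Fin N → SField El), (∀ i, PiecewiseC1 D.toMesh (φ i)) →
        (∀ i, ∀ t ∈ Set.Ioo 0 P.T, IsTestStress D m (fun e x => m.Cp (φ i) e x (H t e x))) →
        ∃ L : (Fin N → ℝ) →L[ℝ] ℝ,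
          HasFDerivAt (fun θ => reducedCost D P (m.perturbCp φ θ)) L 0 ∧
          ∀ θ, L θ = gradientP D P m E v H w (∑ i, θ i • φ i)) ∧
      (∀ (N : ℕ) (φ : Fin N → SField El), (∀ i, PiecewiseC1 D.toMesh (φ i)) →
        (∀ i e, ∀ x ∈ closure (D.cell e), m.cs e x = 0 → φ i e x = 0) →
        (∀ i, ∀ t ∈ Set.Ioo 0 P.T, IsTestStress D m (fun e x => m.Cs (φ i) e x (H t e x))) →
        ∃ L : (Fin N → ℝ) →L[ℝ] ℝ,
          HasFDerivAt (fun θ => reducedCost D P (m.perturbCs φ θ)) L 0 ∧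
          ∀ θ, L θ = gradientS D P m E v H w (∑ i, θ i • φ i)) ∧
      -- an acoustic medium with continuous parameters
      ((∀ e, ∀ x ∈ closure (D.cell e), m.cs e x = 0) →
        ContinuousAcross D.toMesh m.ρ → ContinuousAcross D.toMesh m.cp →
        (∀ t ∈ Set.Icc 0 P.T, ∀ f, ∀ x ∈ D.face (Sum.inl f),
          sideTermP P m E v H w t (Sum.inl (f, true)) x
            + sideTermP P m E v H w t (Sum.inl (f, false)) x =
          acousticTerm D.toMesh m (E t) (v t) (H t) (w t) f x) ∧
        ∀ c, PiecewiseC1 D.toMesh c → ContinuousAcross D.toMesh c →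
          gradientP D P m E v H w c =
            D.intVol (fun e x => deriv P.rp (m.cp e x) * c e x)
            + (∫ t in (0 : ℝ)..P.T, D.intVol (elementTermP m (E t) (w t) c))
            + (∑ f, ∫ t in (0 : ℝ)..P.T, ∫ x,
                acousticTerm D.toMesh m (E t) (v t) (H t) (w t) f x * c (D.left f) x
                  ∂D.surf (Sum.inl f))
            + ∑ b, ∫ t in (0 : ℝ)..P.T, ∫ x,
                sideTermP P m E v H w t (Sum.inr b) x * c (D.own b) x
                  ∂D.surf (Sum.inr b)) := by
  have hT := P.T_pos
  refine ⟨exists_state hm P, ?_, ?_, fun v hv => exists_adjoint hm P hv, ?_, ?_, ?_⟩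
  · intro E v E' v' h h' t ht e x hx
    exact (sub_mem_nullSpace.1 (state_unique hm h h' ht) e x hx).symm
  · intro E v H w hE hv hH hw
    exact isStationary_iff hm hE hv hH hw
  · intro v H w H' w' hv h h' t ht e x hx
    exact (sub_mem_nullSpace.1 (adjoint_unique hm hv h h' ht) e x hx).symm
  · intro H _ w _ s x hx
    exact adjoint_flux_differences hm H w s hx
  · intro E v H w hs ha
    refine ⟨fun N φ hφ htest => hasFDerivAt_reducedCost_cp hm hs ha hφ htest,
      fun N φ hφ hvan htest => hasFDerivAt_reducedCost_cs hm hs ha hφ hvan htest,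
      fun h0 hρ hcp => ⟨fun t _ f x hx => sideTermP_add hm h0 hρ hcp P E H v w t f hx,
        fun c hc hc' => ?_⟩⟩
    exact gradientP_acoustic hm h0 hρ hcp (hs.curve_E.regT hT).1 (hs.curve_v.regV hT).1
      (ha.curve_H.regT hT).1 (ha.curve_w.regV hT).1 hc hc'
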